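/- **Orbital stability of the plane wave with $k=0$ for the Schrödinger–Wave system.** Let $d\ge 1$, $n\ge 3$, $\gamma,c>0$, $\mathbb T^d=(\mathbb R/2\pi\mathbb Z)^d$ with Lebesgue measure, and write $\langle f\rangle=\int_{\mathbb T^d}f\,dx$. Let $\sigma_1:\mathbb T^d\to[0,\infty)$ be $C^\infty$ and even, i.e. $\sigma_1(-x)=\sigma_1(x)$ (in particular $\sigma_1$ may be radially symmetric), with $\langle\sigma_1\rangle\ne0$; let $\sigma_2:\mathbb R^n\to[0,\infty)$ be $C^\infty$, radially symmetric, compactly supported, with $\widehat\sigma_2(\xi)=\int_{\mathbb R^n}\sigma_2(z)e^{-i\xi\cdot z}\,dz\neq0$ for every $\xi\in\mathbb R^n$. Let $\dot H^1(\mathbb R^n)=\{\varphi\in L^{2n/(n-2)}(\mathbb R^n):\nabla\varphi\in L^2\}$, with norm $\|\nabla\varphi\|_{L^2}$, and let $\Gamma\in\dot H^1(\mathbb R^n)$ be the solution of $-\Delta\Gamma=\sigma_2$. Set $\kappa=\int_{\mathbb R^n}\sigma_2\Gamma\,dz$. Consider the system $$i\partial_tu+\tfrac12\Delta_xu=\gamma\Phi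 u,\qquad \tfrac1{c^2}\partial_{tt}^2\Psi-\Delta_z\Psi=-\gamma\,\sigma_2(z)\,(\sigma_1\star|u|^2)(t,x),\qquad \Phi(t,x)=\iint_{\mathbb T^d\times\mathbb R^n}\sigma_1(x-y)\sigma_2(z)\Psi(t,y,z)\,dz\,dy,$$ for $u$ complex valued on $\mathbb T^d$ and $\Psi$ real valued on $\mathbb T^d\times\mathbb R^n$, and set $\Pi=-\frac1{2c^2}\partial_t\Psi$. A solution with Cauchy data $(u_0,\Psi_0,\Pi_0)$ in $E=H^1(\mathbb T^d;\mathbb C)\times L^2(\mathbb T^d;\dot H^1(\mathbb R^n))\times L^2(\mathbb T^d\times\mathbb R^n)$ is a triple $(u,\Psi,\Pi)\in C^0([0,\infty);E)$ taking the value $(u_0,\Psi_0,\Pi_0)$ at $t=0$ and such that, for all $t\ge 0$, the Schrödinger equation holds in the dual of $H^1(\mathbb T^d)$, and $\partial_t\Psi=-2c^2\Pi$, $\partial_t\Pi=-\frac12\Delta_z\Psi+\frac\gamma2\sigma_2\,(\sigma_1\star|u|^2)$ hold in the sense of distributions on $\mathbb T^d\times\mathbb R^n$. Let $\omega\in\mathbb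 R$ satisfy the dispersion relation (for $k=0$) $\omega-\gamma^2\kappa\langle\sigma_1\rangle^2=0$, and assume the smallness condition $4\gamma^2\kappa\|\sigma_1\|_{L^1(\mathbb T^d)}^2<1$. Then $t\mapsto(e^{i\omega t}\mathbf 1(x),-\gamma\Gamma(z)\langle\sigma_1\rangle,0)$ is a solution, and it is orbitally stable with respect to phase rotations: for every $\varepsilon>0$ there is $\delta>0$ such that, for all $(v^{\mathrm{Init}},\phi^{\mathrm{Init}},\tau^{\mathrm{Init}})\in E$ with $$\|v^{\mathrm{Init}}-\mathbf 1\|_{H^1}+\|\phi^{\mathrm{Init}}+\gamma\Gamma\langle\sigma_1\rangle\|_{L^2_x\dot H^1_z}+\|\tau^{\mathrm{Init}}\|_{L^2}<\delta,$$ there is a unique solution $(v,\phi,\tau)$ with Cauchy data $(v^{\mathrm{Init}},\phi^{\mathrm{Init}},\tau^{\mathrm{Init}})$, and it satisfies $$\sup_{t\ge0}\ \Big(\inf_{\theta\in[0,2\pi)}\|v(t)-e^{i\theta}\mathbf 1\|_{H^1}+\|\phi(t)+\gamma\Gamma\langle\sigma_1\rangle\|_{L^2_x\dot H^1_z}+\|\tau(t)\|_{L^2}\Big)<\varepsilon.$$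 -/

import Mathlib

open MeasureTheory Set
open scoped Real ENNReal ContDiff

noncomputable section

namespace SchrodingerWave

/-! ### The torus `𝕋^d = (ℝ / 2πℤ)^d` -/

instance instFactTwoPiPos : Fact ((0 : ℝ) < 2 * π) := ⟨Real.two_pi_pos⟩

/-- The torus `(ℝ / 2πℤ)^d`; its `volume` is the Lebesgue measure, of total mass `(2π)^d`. -/
abbrev Torus (d : ℕ) : Type := Fin d → AddCircle (2 * π)

/-- The projection `ℝ^d → 𝕋^d`. -/
def Torus.proj {d : ℕ} (y : Fin d → ℝ) : Torus d := fun i => (y i : AddCircle (2 * π))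

/-- `f` is `C^∞` on the torus: its `2π`-periodic lift to `ℝ^d` is `C^∞`. -/
def Torus.Smooth {d : ℕ} {F : Type*} [NormedAddCommGroup F] [NormedSpace ℝ F]
    (f : Torus d → F) : Prop :=
  ContDiff ℝ ∞ (fun y : Fin d → ℝ => f (Torus.proj y))

/-- The partial derivative `∂_j f` of a function on the torus. -/
def Torus.partialDeriv {d : ℕ} {F : Type*} [NormedAddCommGroup F] [NormedSpace ℝ F]
    (j : Fin d) (f : Torus d → F) (x : Torus d) : F :=
  deriv (fun s : ℝ => f (x + Pi.single j (s : AddCircle (2 * π)))) 0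

section TorusFacts

variable {d : ℕ} {F : Type*} [NormedAddCommGroup F] [NormedSpace ℝ F]

theorem Torus.isOpenQuotientMap_proj : IsOpenQuotientMap (Torus.proj (d := d)) :=
  IsOpenQuotientMap.piMap (fun _ => QuotientAddGroup.isOpenQuotientMap_mk)

theorem Torus.proj_add_single (y : Fin d → ℝ) (j : Fin d) (s : ℝ) :
    Torus.proj y + Pi.single j (s : AddCircle (2 * π))
      = Torus.proj (y + s • (Pi.single j (1 : ℝ) : Fin d → ℝ)) := by
  funext i
  by_cases h : i = j
  · subst h; simp [Torus.proj]
  · simp [Torus.proj, h]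

theorem Torus.Smooth.continuous {f : Torus d → F} (hf : Torus.Smooth f) : Continuous f :=
  Torus.isOpenQuotientMap_proj.continuous_comp_iff.1 (ContDiff.continuous hf)

theorem Torus.Smooth.hasDerivAt_lift {f : Torus d → F} (hf : Torus.Smooth f)
    (j : Fin d) (y : Fin d → ℝ) (s : ℝ) :
    HasDerivAt (fun s : ℝ => f (Torus.proj y + Pi.single j (s : AddCircle (2 * π))))
      (fderiv ℝ (fun y : Fin d → ℝ => f (Torus.proj y)) (y + s • Pi.single j (1 : ℝ))
        (Pi.single j (1 : ℝ))) s := by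
  have h1 : HasFDerivAt (fun y : Fin d → ℝ => f (Torus.proj y))
      (fderiv ℝ (fun y : Fin d → ℝ => f (Torus.proj y)) (y + s • Pi.single j (1 : ℝ)))
      (y + s • Pi.single j (1 : ℝ)) :=
    ((ContDiff.differentiable hf (by simp)) _).hasFDerivAt
  have h2 : HasDerivAt (fun s : ℝ => y + s • (Pi.single j (1 : ℝ) : Fin d → ℝ))
      (Pi.single j (1 : ℝ)) s := by
    simpa using ((hasDerivAt_id s).smul_const (Pi.single j (1 : ℝ) : Fin d → ℝ)).const_add y
  have h3 := h1.comp_hasDerivAt s h2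
  refine h3.congr_of_eventuallyEq (Filter.Eventually.of_forall fun r => ?_)
  simp only [Function.comp, Torus.proj_add_single]

theorem Torus.Smooth.partialDeriv_proj {f : Torus d → F} (hf : Torus.Smooth f)
    (j : Fin d) (y : Fin d → ℝ) :
    Torus.partialDeriv j f (Torus.proj y)
      = fderiv ℝ (fun y : Fin d → ℝ => f (Torus.proj y)) y (Pi.single j (1 : ℝ)) := by
  have := (hf.hasDerivAt_lift j y 0).deriv
  simpa [Torus.partialDeriv] using this

theorem Torus.Smooth.hasDerivAt {f : Torus d → F} (hf : Torus.Smooth f)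
    (j : Fin d) (x : Torus d) (s : ℝ) :
    HasDerivAt (fun s : ℝ => f (x + Pi.single j (s : AddCircle (2 * π))))
      (Torus.partialDeriv j f (x + Pi.single j (s : AddCircle (2 * π)))) s := by
  obtain ⟨y, rfl⟩ := Torus.isOpenQuotientMap_proj.surjective x
  rw [Torus.proj_add_single, hf.partialDeriv_proj]
  exact hf.hasDerivAt_lift j y s

theorem Torus.Smooth.continuous_partialDeriv {f : Torus d → F} (hf : Torus.Smooth f)
    (j : Fin d) : Continuous (Torus.partialDeriv j f) := by
  refine Torus.isOpenQuotientMap_proj.continuous_comp_iff.1 ?_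
  have : (Torus.partialDeriv j f ∘ Torus.proj) = fun y =>
      fderiv ℝ (fun y : Fin d → ℝ => f (Torus.proj y)) y (Pi.single j (1 : ℝ)) :=
    funext fun y => hf.partialDeriv_proj j y
  rw [this]
  exact (ContDiff.continuous_fderiv hf (by simp)).clm_apply continuous_const

theorem Torus.memLp_of_continuous {f : Torus d → ℂ} (hf : Continuous f)
    (p : ℝ≥0∞) : MemLp f p (volume : Measure (Torus d)) := by
  obtain ⟨C, hC⟩ := (isCompact_range hf).isBounded.exists_norm_le
  exact MemLp.of_bound hf.aestronglyMeasurable C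
    (Filter.Eventually.of_forall fun x => hC _ (mem_range_self x))

/-- The integral over the torus of a partial derivative vanishes. -/
theorem Torus.Smooth.integral_partialDeriv {f : Torus d → ℂ} (hf : Torus.Smooth f)
    (j : Fin d) : ∫ x, Torus.partialDeriv j f x = 0 := by
  have hc := hf.continuous_partialDeriv j
  obtain ⟨C, hC⟩ := (isCompact_range hc).isBounded.exists_norm_le
  have hF : ∀ s : ℝ, Continuous fun x : Torus d => f (x + Pi.single j (s : AddCircle (2 * π))) :=
    fun s => hf.continuous.comp (continuous_add_const _)
  have hF' : ∀ s : ℝ, Continuous fun x : Torus d =>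
      Torus.partialDeriv j f (x + Pi.single j (s : AddCircle (2 * π))) :=
    fun s => hc.comp (continuous_add_const _)
  have hconst : ∀ s : ℝ, ∫ x : Torus d, f (x + Pi.single j (s : AddCircle (2 * π)))
      = ∫ x, f x := fun s => integral_add_right_eq_self f _
  have h0 : ∫ x : Torus d, Torus.partialDeriv j f (x + Pi.single j ((0 : ℝ) : AddCircle (2 * π)))
      = ∫ x, Torus.partialDeriv j f x := integral_add_right_eq_self _ _
  have hb : ∀ᵐ x : Torus d, ∀ s ∈ (univ : Set ℝ),
      ‖Torus.partialDeriv j f (x + Pi.single j (s : AddCircle (2 * π)))‖ ≤ C :=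
    Filter.Eventually.of_forall fun x s _ => hC _ (mem_range_self _)
  have hd : ∀ᵐ x : Torus d, ∀ s ∈ (univ : Set ℝ),
      HasDerivAt (fun s : ℝ => f (x + Pi.single j (s : AddCircle (2 * π))))
        (Torus.partialDeriv j f (x + Pi.single j (s : AddCircle (2 * π)))) s :=
    Filter.Eventually.of_forall fun x s _ => hf.hasDerivAt j x s
  have key := (hasDerivAt_integral_of_dominated_loc_of_deriv_le
    (μ := (volume : Measure (Torus d))) (x₀ := (0 : ℝ)) Filter.univ_mem
    (Filter.Eventually.of_forall fun s => (hF s).aestronglyMeasurable)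
    ((Torus.memLp_of_continuous (hF 0) 1).integrable le_rfl)
    (hF' 0).aestronglyMeasurable hb (integrable_const C) hd).2
  simp only [hconst] at key
  rw [h0] at key
  exact key.unique (hasDerivAt_const (0 : ℝ) _)

end TorusFacts

/-! ### The Sobolev space `H¹(𝕋^d; ℂ)` -/

/-- `g` is the weak gradient of `u` on the torus. -/
def Torus.IsWeakGradient {d : ℕ} (u : Torus d → ℂ) (g : Torus d → EuclideanSpace ℂ (Fin d)) :
    Prop :=
  ∀ η : Torus d → ℂ, Torus.Smooth η → ∀ j : Fin d,
    ∫ x, u x * Torus.partialDeriv j η x = -∫ x, g x j * η x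

theorem integrable_coord_mul {d : ℕ}
    (g : Lp (EuclideanSpace ℂ (Fin d)) 2 (volume : Measure (Torus d))) (j : Fin d)
    {η : Torus d → ℂ} (hη : Continuous η) : Integrable (fun x => g x j * η x) := by
  have h1 : MemLp (fun x => g x j) 2 (volume : Measure (Torus d)) := by
    refine (Lp.memLp g).of_le ?_ (Filter.Eventually.of_forall fun x => ?_)
    · exact (EuclideanSpace.proj (𝕜 := ℂ) j).continuous.comp_aestronglyMeasurable (Lp.memLp g).1
    · exact PiLp.norm_apply_le _ _
  exact h1.integrable_mul (Torus.memLp_of_continuous hη 2)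

theorem integrable_mul_continuous {d : ℕ} (u : Lp ℂ 2 (volume : Measure (Torus d)))
    {η : Torus d → ℂ} (hη : Continuous η) : Integrable (fun x => u x * η x) :=
  (Lp.memLp u).integrable_mul (Torus.memLp_of_continuous hη 2)

/-- `H¹(𝕋^d; ℂ)`, the space of the `u ∈ L²` with a weak gradient in `L²`, realized as the
graph of the weak gradient: an element is a pair `(u, ∇u)`, its norm is
`(‖u‖_{L²}² + ‖∇u‖_{L²}²)^{1/2}`. -/
def H1.graph (d : ℕ) : Submodule ℂ (WithLp 2 (Lp ℂ 2 (volume : Measure (Torus d)) ×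
    Lp (EuclideanSpace ℂ (Fin d)) 2 (volume : Measure (Torus d)))) where
  carrier := {w | Torus.IsWeakGradient w.fst w.snd}
  zero_mem' := by
    intro η _ j
    have h1 : (fun x => ((0 : Lp ℂ 2 (volume : Measure (Torus d))) x) *
        Torus.partialDeriv j η x) =ᵐ[volume] fun _ => (0 : ℂ) := by
      filter_upwards [Lp.coeFn_zero ℂ 2 (volume : Measure (Torus d))] with x _
      simp
    have h2 : (fun x => ((0 : Lp (EuclideanSpace ℂ (Fin d)) 2
        (volume : Measure (Torus d))) x) j * η x) =ᵐ[volume] fun _ => (0 : ℂ) := by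
      filter_upwards [Lp.coeFn_zero (EuclideanSpace ℂ (Fin d)) 2
        (volume : Measure (Torus d))] with x _
      simp
    simp only [WithLp.zero_fst, WithLp.zero_snd]
    rw [integral_congr_ae h1, integral_congr_ae h2]
    simp
  add_mem' := by
    intro a b ha hb η hη j
    have hc := hη.continuous_partialDeriv j
    have h1 : (fun x => (a.fst + b.fst : Lp ℂ 2 (volume : Measure (Torus d))) x *
        Torus.partialDeriv j η x) =ᵐ[volume]
        fun x => a.fst x * Torus.partialDeriv j η x + b.fst x * Torus.partialDeriv j η x := by
      filter_upwards [Lp.coeFn_add a.fst b.fst] with x hx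
      rw [hx, Pi.add_apply, add_mul]
    have h2 : (fun x => (a.snd + b.snd : Lp (EuclideanSpace ℂ (Fin d)) 2
        (volume : Measure (Torus d))) x j * η x) =ᵐ[volume]
        fun x => a.snd x j * η x + b.snd x j * η x := by
      filter_upwards [Lp.coeFn_add a.snd b.snd] with x hx
      rw [hx, Pi.add_apply, PiLp.add_apply, add_mul]
    simp only [WithLp.add_fst, WithLp.add_snd]
    rw [integral_congr_ae h1, integral_congr_ae h2,
      integral_add (integrable_mul_continuous _ hc) (integrable_mul_continuous _ hc),
      integral_add (integrable_coord_mul _ j hη.continuous)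
        (integrable_coord_mul _ j hη.continuous), ha η hη j, hb η hη j]
    ring
  smul_mem' := by
    intro c a ha η hη j
    have h1 : (fun x => (c • a.fst : Lp ℂ 2 (volume : Measure (Torus d))) x *
        Torus.partialDeriv j η x) =ᵐ[volume]
        fun x => c * (a.fst x * Torus.partialDeriv j η x) := by
      filter_upwards [Lp.coeFn_smul c a.fst] with x hx
      rw [hx, Pi.smul_apply, smul_eq_mul, mul_assoc]
    have h2 : (fun x => (c • a.snd : Lp (EuclideanSpace ℂ (Fin d)) 2
        (volume : Measure (Torus d))) x j * η x) =ᵐ[volume]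
        fun x => c * (a.snd x j * η x) := by
      filter_upwards [Lp.coeFn_smul c a.snd] with x hx
      rw [hx, Pi.smul_apply, PiLp.smul_apply, smul_eq_mul, mul_assoc]
    simp only [WithLp.smul_fst, WithLp.smul_snd]
    rw [integral_congr_ae h1, integral_congr_ae h2, integral_const_mul, integral_const_mul,
      ha η hη j, mul_neg]

/-- The Hilbert space `H¹(𝕋^d; ℂ)`. -/
abbrev H1 (d : ℕ) : Type := H1.graph d

/-- The function underlying an element of `H¹(𝕋^d)`, as an element of `L²`. -/
def H1.fn {d : ℕ} (u : H1 d) : Lp ℂ 2 (volume : Measure (Torus d)) := u.1.fst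

/-- The weak gradient of an element of `H¹(𝕋^d)`. -/
def H1.grad {d : ℕ} (u : H1 d) :
    Lp (EuclideanSpace ℂ (Fin d)) 2 (volume : Measure (Torus d)) := u.1.snd

/-- The constant function `a · 𝟏` as an element of `H¹(𝕋^d)`. -/
def H1.const (d : ℕ) (a : ℂ) : H1 d :=
  ⟨WithLp.toLp 2 (Lp.const 2 volume a, 0), by
    intro η hη j
    have h1 : (fun x => (Lp.const 2 (volume : Measure (Torus d)) a) x *
        Torus.partialDeriv j η x) =ᵐ[volume] fun x => a * Torus.partialDeriv j η x := by
      filter_upwards [Lp.coeFn_const 2 (volume : Measure (Torus d)) a] with x hx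
      rw [hx, Function.const_apply]
    have h2 : (fun x => ((0 : Lp (EuclideanSpace ℂ (Fin d)) 2
        (volume : Measure (Torus d))) x) j * η x) =ᵐ[volume] fun _ => (0 : ℂ) := by
      filter_upwards [Lp.coeFn_zero (EuclideanSpace ℂ (Fin d)) 2
        (volume : Measure (Torus d))] with x _
      simp
    simp only [WithLp.toLp_fst, WithLp.toLp_snd]
    rw [integral_congr_ae h1, integral_congr_ae h2, integral_const_mul,
      hη.integral_partialDeriv j]
    simp⟩

/-! ### The homogeneous Sobolev space `Ḣ¹(ℝ^n)`, `n ≥ 3` -/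

/-- Euclidean space `ℝ^n`. -/
abbrev Space (n : ℕ) : Type := EuclideanSpace ℝ (Fin n)

/-- The critical Sobolev exponent `2n / (n - 2)`. -/
def sobolevExponent (n : ℕ) : ℝ≥0∞ := ENNReal.ofReal (2 * n / (n - 2))

/-- `G` is the weak gradient of `φ` on `ℝ^n`. -/
def Space.IsWeakGradient {n : ℕ} (φ : Space n → ℝ) (G : Space n → Space n) : Prop :=
  ∀ η : Space n → ℝ, ContDiff ℝ ∞ η → HasCompactSupport η → ∀ j : Fin n,
    ∫ z, φ z * fderiv ℝ η z (EuclideanSpace.single j 1) = -∫ z, G z j * η z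

section SpaceFacts

variable {n : ℕ}

theorem one_lt_sobolevExponent [hn : Fact (3 ≤ n)] : 1 < sobolevExponent n := by
  have h3 : (3 : ℝ) ≤ n := by exact_mod_cast hn.out
  rw [sobolevExponent, ← ENNReal.ofReal_one, ENNReal.ofReal_lt_ofReal_iff_of_nonneg zero_le_one,
    lt_div_iff₀ (by linarith)]
  linarith

theorem sobolevExponent_ne_top : sobolevExponent n ≠ ⊤ := ENNReal.ofReal_ne_top

theorem integrable_mul_test {p : ℝ≥0∞} (hp : 1 ≤ p) {φ : Space n → ℝ} (hφ : MemLp φ p)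
    {η : Space n → ℝ} (hη : Continuous η) (hs : HasCompactSupport η) :
    Integrable (fun z => φ z * η z) :=
  (hφ.locallyIntegrable hp).integrable_smul_right_of_hasCompactSupport hη hs

theorem memLp_coord (G : Lp (Space n) 2 (volume : Measure (Space n))) (j : Fin n) :
    MemLp (fun z => G z j) 2 (volume : Measure (Space n)) := by
  refine (Lp.memLp G).of_le ?_ (Filter.Eventually.of_forall fun x => ?_)
  · exact (EuclideanSpace.proj (𝕜 := ℝ) j).continuous.comp_aestronglyMeasurable (Lp.memLp G).1
  · exact PiLp.norm_apply_le _ _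

theorem continuous_fderiv_test {η : Space n → ℝ} (hη : ContDiff ℝ ∞ η) (v : Space n) :
    Continuous (fun z => fderiv ℝ η z v) :=
  (hη.continuous_fderiv (by simp)).clm_apply continuous_const

theorem hasCompactSupport_fderiv_test {η : Space n → ℝ} (hs : HasCompactSupport η)
    (v : Space n) : HasCompactSupport (fun z => fderiv ℝ η z v) :=
  hs.fderiv_apply ℝ v

/-- A function of `L^p(ℝ^n)`, `1 < p < ∞`, whose weak gradient vanishes is zero. -/
theorem ae_eq_zero_of_weakGradient_zero [hn : Fact (3 ≤ n)] {p : ℝ≥0∞} (hp : 1 < p)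
    (hp' : p ≠ ⊤) {φ : Space n → ℝ} (hφ : MemLp φ p)
    (h : ∀ η : Space n → ℝ, ContDiff ℝ ∞ η → HasCompactSupport η → ∀ j : Fin n,
      ∫ z, φ z * fderiv ℝ η z (EuclideanSpace.single j 1) = 0) :
    φ =ᵐ[volume] 0 := by
  have hloc : LocallyIntegrable φ volume := hφ.locallyIntegrable hp.le
  refine ae_eq_zero_of_integral_contDiff_smul_eq_zero hloc fun η hη hs => ?_
  -- translates of the test function
  have htr : ∀ x : Space n, ContDiff ℝ ∞ (fun z => η (z - x)) ∧
      HasCompactSupport (fun z => η (z - x)) := fun x =>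
    ⟨hη.comp (contDiff_id.sub contDiff_const),
      hs.comp_homeomorph (Homeomorph.subRight x)⟩
  set I : Space n → ℝ := fun x => ∫ z, φ z * η (z - x) with hI
  -- the integral against a translate does not depend on the translate
  have hconst : ∀ x, I x = I 0 := by
    set g : Space n → ℝ := fun y => η (-y) with hg
    have hgc : ContDiff ℝ 1 g := (hη.of_le (by simp)).comp contDiff_neg
    have hgs : HasCompactSupport g := hs.comp_homeomorph (Homeomorph.neg _)
    have hconv : convolution φ g (ContinuousLinearMap.mul ℝ ℝ) volume = I := by
      funext x
      simp [convolution, hI, hg]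
    have hder : ∀ x, HasFDerivAt I (0 : Space n →L[ℝ] ℝ) x := by
      intro x
      have h1 := hgs.hasFDerivAt_convolution_right (ContinuousLinearMap.mul ℝ ℝ) hloc hgc x
      rw [hconv] at h1
      have h2 : convolution φ (fderiv ℝ g)
          (ContinuousLinearMap.precompR (Space n) (ContinuousLinearMap.mul ℝ ℝ)) volume x = 0 := by
        have hint := (hgs.fderiv ℝ).convolutionExists_right
          (ContinuousLinearMap.precompR (Space n) (ContinuousLinearMap.mul ℝ ℝ)) hloc
          (hgc.continuous_fderiv one_ne_zero) x
        refine ContinuousLinearMap.coe_injective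
          ((EuclideanSpace.basisFun (Fin n) ℝ).toBasis.ext fun j => ?_)
        have h3 : ∀ t, fderiv ℝ g (x - t) (EuclideanSpace.single j 1)
            = -fderiv ℝ (fun z => η (z - x)) t (EuclideanSpace.single j 1) := by
          intro t
          have hηd : HasFDerivAt η (fderiv ℝ η (t - x)) (-(x - t)) := by
            rw [neg_sub]
            exact (hη.differentiable (by simp) _).hasFDerivAt
          have hgd : HasFDerivAt g (-fderiv ℝ η (t - x)) (x - t) := by
            have := hηd.comp (x - t) (hasFDerivAt_id (x - t)).neg
            convert! this using 1
            ext v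
            simp
          rw [fderiv_comp_sub, hgd.fderiv, neg_apply]
        have h4 := h _ (htr x).1 (htr x).2 j
        simp only [convolution, ContinuousLinearMap.coe_coe, OrthonormalBasis.coe_toBasis,
          EuclideanSpace.basisFun_apply, ContinuousLinearMap.toLinearMap_zero, LinearMap.zero_apply]
        rw [ContinuousLinearMap.integral_apply hint]
        simp only [ContinuousLinearMap.precompR, ContinuousLinearMap.compL_apply,
          ContinuousLinearMap.comp_apply, ContinuousLinearMap.mul_apply', h3,
          mul_neg, integral_neg, h4, neg_zero]
      rwa [h2] at h1
    intro x
    exact is_const_of_fderiv_eq_zero (𝕜 := ℝ) (fun x => (hder x).differentiableAt)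
      (fun x => (hder x).fderiv) x 0
  -- and it tends to zero as the translate goes to infinity
  have hsmall : ∀ ε : ℝ≥0∞, ε ≠ 0 → ‖I 0‖ₑ ≤ ε * eLpNorm η p.conjExponent volume := by
    intro ε hε
    obtain ⟨ψ, hψs, hψ, hψc, hψL⟩ := hφ.exists_hasCompactSupport_eLpNorm_sub_le hp' hε
    obtain ⟨R₁, hR₁⟩ := hψs.isCompact.isBounded.exists_norm_le
    obtain ⟨R₂, hR₂⟩ := hs.isCompact.isBounded.exists_norm_le
    have hn0 : 0 < n := by have := hn.out; omega
    set x : Space n := EuclideanSpace.single ⟨0, hn0⟩ (|R₁| + |R₂| + 1) with hx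
    have hxn : ‖x‖ = |R₁| + |R₂| + 1 := by
      rw [hx, PiLp.norm_single, Real.norm_of_nonneg (by positivity)]
    have hprod : ∀ z, ψ z * η (z - x) = 0 := by
      intro z
      by_contra hne
      have h1 := hR₁ z (subset_tsupport _ (left_ne_zero_of_mul hne))
      have h2 := hR₂ (z - x) (subset_tsupport _ (right_ne_zero_of_mul hne))
      have h3 : ‖x‖ ≤ ‖z‖ + ‖z - x‖ := by
        have := norm_sub_le z (z - x)
        rwa [sub_sub_cancel] at this
      linarith [le_abs_self R₁, le_abs_self R₂]
    have hIx : I 0 = ∫ z, ((φ - ψ) • fun z => η (z - x)) z := by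
      rw [← hconst x]
      refine integral_congr_ae (Filter.Eventually.of_forall fun z => ?_)
      simp [sub_mul, hprod z]
    have := ENNReal.HolderConjugate.conjExponent hp.le
    have hηx : AEStronglyMeasurable (fun z => η (z - x)) volume :=
      (htr x).1.continuous.aestronglyMeasurable
    calc ‖I 0‖ₑ ≤ eLpNorm ((φ - ψ) • fun z => η (z - x)) 1 volume := by
          rw [hIx, eLpNorm_one_eq_lintegral_enorm]
          exact enorm_integral_le_lintegral_enorm _
      _ ≤ eLpNorm (φ - ψ) p volume * eLpNorm (fun z => η (z - x)) p.conjExponent volume :=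
          eLpNorm_smul_le_mul_eLpNorm hηx (hφ.1.sub hψL.1)
      _ = eLpNorm (φ - ψ) p volume * eLpNorm η p.conjExponent volume := by
          congr 1
          exact eLpNorm_comp_measurePreserving hη.continuous.aestronglyMeasurable
            (measurePreserving_sub_right volume x)
      _ ≤ ε * eLpNorm η p.conjExponent volume := by gcongr
  have hfin : eLpNorm η p.conjExponent volume ≠ ⊤ :=
    (hη.continuous.memLp_of_hasCompactSupport hs).2.ne
  have hzero : I 0 = 0 := by
    by_contra hne
    have hpos : 0 < ‖I 0‖ := norm_pos_iff.2 hne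
    set N := (eLpNorm η p.conjExponent volume).toReal with hN
    have hN0 : 0 ≤ N := ENNReal.toReal_nonneg
    have hδ : 0 < ‖I 0‖ / (2 * (N + 1)) := by positivity
    have h1 := hsmall (ENNReal.ofReal (‖I 0‖ / (2 * (N + 1)))) (by simpa using hδ)
    rw [← ofReal_norm, ← ENNReal.ofReal_toReal hfin, ← ENNReal.ofReal_mul hδ.le,
      ENNReal.ofReal_le_ofReal_iff (by positivity), div_mul_eq_mul_div,
      le_div_iff₀ (by positivity)] at h1
    nlinarith
  simpa [hI, mul_comm] using hzero

end SpaceFacts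

/-- The pairs `(φ, ∇φ)` with `φ ∈ L^{2n/(n-2)}(ℝ^n)` and weak gradient `∇φ ∈ L²(ℝ^n)`. -/
def HDot1.graph (n : ℕ) [Fact (3 ≤ n)] :
    Submodule ℝ (Lp ℝ (sobolevExponent n) (volume : Measure (Space n)) ×
      Lp (Space n) 2 (volume : Measure (Space n))) where
  carrier := {w | Space.IsWeakGradient w.1 w.2}
  zero_mem' := by
    intro η _ _ j
    have h1 : (fun z => ((0 : Lp ℝ (sobolevExponent n) (volume : Measure (Space n))) z) *
        fderiv ℝ η z (EuclideanSpace.single j 1)) =ᵐ[volume] fun _ => (0 : ℝ) := by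
      filter_upwards [Lp.coeFn_zero ℝ (sobolevExponent n) (volume : Measure (Space n))] with z _
      simp
    have h2 : (fun z => ((0 : Lp (Space n) 2 (volume : Measure (Space n))) z) j * η z)
        =ᵐ[volume] fun _ => (0 : ℝ) := by
      filter_upwards [Lp.coeFn_zero (Space n) 2 (volume : Measure (Space n))] with z _
      simp
    simp only [Prod.fst_zero, Prod.snd_zero]
    rw [integral_congr_ae h1, integral_congr_ae h2]
    simp
  add_mem' := by
    intro a b ha hb η hη hs j
    have hc := continuous_fderiv_test hη (EuclideanSpace.single j 1)
    have hcs := hasCompactSupport_fderiv_test hs (EuclideanSpace.single j 1)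
    have hp : 1 ≤ sobolevExponent n := one_lt_sobolevExponent.le
    have h1 : (fun z => (a.1 + b.1 : Lp ℝ (sobolevExponent n) (volume : Measure (Space n))) z *
        fderiv ℝ η z (EuclideanSpace.single j 1)) =ᵐ[volume]
        fun z => a.1 z * fderiv ℝ η z (EuclideanSpace.single j 1)
          + b.1 z * fderiv ℝ η z (EuclideanSpace.single j 1) := by
      filter_upwards [Lp.coeFn_add a.1 b.1] with z hz
      rw [hz, Pi.add_apply, add_mul]
    have h2 : (fun z => (a.2 + b.2 : Lp (Space n) 2 (volume : Measure (Space n))) z j * η z)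
        =ᵐ[volume] fun z => a.2 z j * η z + b.2 z j * η z := by
      filter_upwards [Lp.coeFn_add a.2 b.2] with z hz
      rw [hz, Pi.add_apply, PiLp.add_apply, add_mul]
    simp only [Prod.fst_add, Prod.snd_add]
    rw [integral_congr_ae h1, integral_congr_ae h2,
      integral_add (integrable_mul_test hp (Lp.memLp a.1) hc hcs)
        (integrable_mul_test hp (Lp.memLp b.1) hc hcs),
      integral_add (integrable_mul_test one_le_two (memLp_coord a.2 j) hη.continuous hs)
        (integrable_mul_test one_le_two (memLp_coord b.2 j) hη.continuous hs),
      ha η hη hs j, hb η hη hs j]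
    ring
  smul_mem' := by
    intro c a ha η hη hs j
    have h1 : (fun z => (c • a.1 : Lp ℝ (sobolevExponent n) (volume : Measure (Space n))) z *
        fderiv ℝ η z (EuclideanSpace.single j 1)) =ᵐ[volume]
        fun z => c * (a.1 z * fderiv ℝ η z (EuclideanSpace.single j 1)) := by
      filter_upwards [Lp.coeFn_smul c a.1] with z hz
      rw [hz, Pi.smul_apply, smul_eq_mul, mul_assoc]
    have h2 : (fun z => (c • a.2 : Lp (Space n) 2 (volume : Measure (Space n))) z j * η z)
        =ᵐ[volume] fun z => c * (a.2 z j * η z) := by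
      filter_upwards [Lp.coeFn_smul c a.2] with z hz
      rw [hz, Pi.smul_apply, PiLp.smul_apply, smul_eq_mul, mul_assoc]
    simp only [Prod.smul_fst, Prod.smul_snd]
    rw [integral_congr_ae h1, integral_congr_ae h2, integral_const_mul, integral_const_mul,
      ha η hη hs j, mul_neg]

/-- The homogeneous Sobolev space `Ḣ¹(ℝ^n) = {φ ∈ L^{2n/(n-2)} : ∇φ ∈ L²}`, `n ≥ 3`, with norm
`‖∇φ‖_{L²}`; an element carries the function and its weak gradient. -/
def HDot1 (n : ℕ) [Fact (3 ≤ n)] : Type := HDot1.graph n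

namespace HDot1

variable {n : ℕ} [Fact (3 ≤ n)]

instance : AddCommGroup (HDot1 n) := inferInstanceAs (AddCommGroup (HDot1.graph n))

instance : Module ℝ (HDot1 n) := inferInstanceAs (Module ℝ (HDot1.graph n))

/-- The function underlying an element of `Ḣ¹(ℝ^n)`. -/
def fn (φ : HDot1 n) : Lp ℝ (sobolevExponent n) (volume : Measure (Space n)) := φ.1.1

/-- The weak gradient, as a linear map `Ḣ¹(ℝ^n) → L²(ℝ^n; ℝ^n)`. -/
def grad : HDot1 n →ₗ[ℝ] Lp (Space n) 2 (volume : Measure (Space n)) :=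
  (LinearMap.snd ℝ _ _).comp (HDot1.graph n).subtype

theorem grad_injective : Function.Injective (grad : HDot1 n →ₗ[ℝ] _) := by
  rw [← LinearMap.ker_eq_bot, LinearMap.ker_eq_bot']
  intro φ hφ
  have hφ2 : φ.1.2 = 0 := hφ
  have hφ1 : φ.1.1 = 0 := by
    rw [Lp.eq_zero_iff_ae_eq_zero]
    refine ae_eq_zero_of_weakGradient_zero one_lt_sobolevExponent sobolevExponent_ne_top
      (Lp.memLp φ.1.1) fun η hη hs j => ?_
    rw [φ.2 η hη hs j, hφ2]
    have h2 : (fun z => ((0 : Lp (Space n) 2 (volume : Measure (Space n))) z) j * η z)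
        =ᵐ[volume] fun _ => (0 : ℝ) := by
      filter_upwards [Lp.coeFn_zero (Space n) 2 (volume : Measure (Space n))] with z _
      simp
    rw [integral_congr_ae h2]
    simp
  exact Subtype.ext (Prod.ext hφ1 hφ2)

instance : NormedAddCommGroup (HDot1 n) :=
  NormedAddCommGroup.induced (HDot1 n) (Lp (Space n) 2 (volume : Measure (Space n)))
    grad grad_injective

instance : NormedSpace ℝ (HDot1 n) :=
  NormedSpace.induced ℝ (HDot1 n) (Lp (Space n) 2 (volume : Measure (Space n))) grad

theorem norm_eq (φ : HDot1 n) : ‖φ‖ = ‖grad φ‖ := rfl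

end HDot1

/-! ### The Schrödinger–wave system -/

/-- `L²(𝕋^d; Ḣ¹(ℝ^n))`, as a Bochner space; its norm is `‖∇_z Ψ‖_{L²(𝕋^d × ℝ^n)}`. -/
abbrev Field (d n : ℕ) [Fact (3 ≤ n)] : Type := Lp (HDot1 n) 2 (volume : Measure (Torus d))

/-- `L²(𝕋^d; L²(ℝ^n)) = L²(𝕋^d × ℝ^n)`, as a Bochner space. -/
abbrev Momentum (d n : ℕ) : Type :=
  Lp (Lp ℝ 2 (volume : Measure (Space n))) 2 (volume : Measure (Torus d))

/-- The energy space `H¹(𝕋^d; ℂ) × L²(𝕋^d; Ḣ¹(ℝ^n)) × L²(𝕋^d × ℝ^n)` of the `(u, Ψ, Π)`. -/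
abbrev EnergySpace (d n : ℕ) [Fact (3 ≤ n)] : Type := H1 d × Field d n × Momentum d n

/-- `⟨f⟩ = ∫_{𝕋^d} f dx` (not normalized). -/
def average {d : ℕ} (f : Torus d → ℝ) : ℝ := ∫ x, f x

/-- `Γ ∈ Ḣ¹(ℝ^n)` is the (weak) solution of `-Δ Γ = σ`. -/
def IsInverseLaplacian {n : ℕ} [Fact (3 ≤ n)] (σ : Space n → ℝ) (Γ : HDot1 n) : Prop :=
  ∀ η : Space n → ℝ, ContDiff ℝ ∞ η → HasCompactSupport η →
    ∫ z, inner ℝ (Γ.grad z) (gradient η z) = ∫ z, σ z * η z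

/-- `κ = ∫ σ₂ Γ dz`, where `-Δ Γ = σ₂`. -/
def kappa {n : ℕ} [Fact (3 ≤ n)] (σ₂ : Space n → ℝ) (Γ : HDot1 n) : ℝ := ∫ z, σ₂ z * Γ.fn z

section System

variable {d n : ℕ} [Fact (3 ≤ n)]

/-- `(σ₁ ⋆ |u|²)(x) = ∫ σ₁(x - y) |u(y)|² dy`. -/
def density (σ₁ : Torus d → ℝ) (u : H1 d) (x : Torus d) : ℝ :=
  ∫ y, σ₁ (x - y) * ‖u.fn y‖ ^ 2

/-- `Φ(x) = ∬ σ₁(x - y) σ₂(z) Ψ(y, z) dz dy`. -/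
def potential (σ₁ : Torus d → ℝ) (σ₂ : Space n → ℝ) (Ψ : Field d n) (x : Torus d) : ℝ :=
  ∫ y, σ₁ (x - y) * ∫ z, σ₂ z * (Ψ y).fn z

/-- `X = (u, Ψ, Π) : [0, ∞) → EnergySpace` is a solution, with initial value `X₀`, of
`i ∂ₜu + ½ Δₓu = γ Φ u` and `(1/c²) ∂ₜₜΨ - Δ_z Ψ = -γ σ₂ (σ₁ ⋆ |u|²)`, written as a first
order system with `Π = -(1/(2c²)) ∂ₜΨ`:
* `X` is continuous in time with values in the energy space;
* the equation for `u` holds in the dual of `H¹(𝕋^d)`, for every `t ≥ 0`;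
* the equations `∂ₜΨ = -2c² Π` and `∂ₜΠ = -½ Δ_z Ψ + (γ/2) σ₂ (σ₁ ⋆ |u|²)` hold in the sense of
  distributions on `𝕋^d × ℝ^n` (tested against the products `a(x) b(z)`), for every `t ≥ 0`.
Only the values `X t` with `t ≥ 0` matter. -/
structure IsSolution (γ c : ℝ) (σ₁ : Torus d → ℝ) (σ₂ : Space n → ℝ)
    (X : ℝ → EnergySpace d n) (X₀ : EnergySpace d n) : Prop where
  initial : X 0 = X₀
  continuousOn : ContinuousOn X (Ici 0)
  schrodinger : ∀ w : H1 d, ∀ t : ℝ, 0 ≤ t →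
    HasDerivWithinAt (fun s => inner ℂ w.fn (X s).1.fn)
      (-Complex.I * ((1 / 2) * inner ℂ w.grad (X t).1.grad
        + γ * ∫ x, starRingEnd ℂ (w.fn x) * (potential σ₁ σ₂ (X t).2.1 x * (X t).1.fn x)))
      (Ici 0) t
  field : ∀ a : Torus d → ℝ, Torus.Smooth a →
    ∀ b : Space n → ℝ, ContDiff ℝ ∞ b → HasCompactSupport b → ∀ t : ℝ, 0 ≤ t →
    HasDerivWithinAt (fun s => ∫ x, a x * ∫ z, ((X s).2.1 x).fn z * b z)
      (-2 * c ^ 2 * ∫ x, a x * ∫ z, (X t).2.2 x z * b z) (Ici 0) t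
  momentum : ∀ a : Torus d → ℝ, Torus.Smooth a →
    ∀ b : Space n → ℝ, ContDiff ℝ ∞ b → HasCompactSupport b → ∀ t : ℝ, 0 ≤ t →
    HasDerivWithinAt (fun s => ∫ x, a x * ∫ z, (X s).2.2 x z * b z)
      (1 / 2 * (∫ x, a x * ∫ z, inner ℝ (((X t).2.1 x).grad z) (gradient b z))
        + γ / 2 * ∫ x, a x * (density σ₁ (X t).1 x * ∫ z, σ₂ z * b z)) (Ici 0) t

/-- The field `Ψ_*(x, z) = -γ ⟨σ₁⟩ Γ(z)`, constant in `x`. -/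
def equilibriumField (γ : ℝ) (σ₁ : Torus d → ℝ) (Γ : HDot1 n) : Field d n :=
  Lp.const 2 volume (-(γ * average σ₁) • Γ)

/-- The plane wave with `k = 0`: `t ↦ (e^{i freq t} 𝟏, -γ ⟨σ₁⟩ Γ, 0)`. -/
def planeWave (γ freq : ℝ) (σ₁ : Torus d → ℝ) (Γ : HDot1 n) (t : ℝ) : EnergySpace d n :=
  (H1.const d (Complex.exp (Complex.I * freq * t)), equilibriumField γ σ₁ Γ, 0)

/-- The distance of `(v, φ, τ)` to the orbit `{(e^{iθ} 𝟏, -γ ⟨σ₁⟩ Γ, 0) : θ ∈ ℝ}`. -/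
def orbitDist (γ : ℝ) (σ₁ : Torus d → ℝ) (Γ : HDot1 n) (X : EnergySpace d n) : ℝ :=
  (⨅ θ : Ico (0 : ℝ) (2 * π), ‖X.1 - H1.const d (Complex.exp (Complex.I * (θ : ℝ)))‖)
    + ‖X.2.1 - equilibriumField γ σ₁ Γ‖ + ‖X.2.2‖

end System

end SchrodingerWave

end

/-!
Orbital stability of the plane wave `(e^{iωt} 𝟏, -γ ⟨σ₁⟩ Γ, 0)` is obtained from the two conserved
quantities of the system, the mass `‖u‖²` and the energy
`½ ‖∇u‖² + ½ (‖2cΠ‖² + ‖∇Ψ‖²) + γ ∫ Φ |u|²`.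

**Coercivity.** Put `ρ = σ₁ ⋆ |u|²`. Since `-Δ Γ = σ₂`, the solution `Γ` is the Riesz representative
of `φ ↦ ∫ σ₂ φ` in `Ḣ¹`, and `κ = ‖∇Γ‖²`. As `σ₁` is even, `∫ Φ |u|²` is the inner product of `Ψ` with
`ρ ⊗ Γ`, so that completing the square turns the field part of the energy into
`½ ‖Ψ + γ ρ ⊗ Γ‖² - ½ γ² κ ‖ρ‖²`. The mean of `ρ` is a function of the mass; subtracting its
contribution gives a conserved quantity, the `excess`, which equals (`excess_eq`)
`½ (‖∇u‖² + ‖2cΠ‖² + ‖Ψ + γ ρ ⊗ Γ‖² - γ² κ ‖ρ - mean ρ‖²)`.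
Write `u = α + v` with `α` the mean of `u`. To first order `ρ - mean ρ` is `2 σ₁ ⋆ Re (ᾱ v)`, whose norm
is at most `2 ⟨σ₁⟩ |α| ‖v‖` by Young's inequality (`norm_rho_const_le`), and `‖v‖ ≤ ‖∇u‖` by the Poincaré
inequality, whose constant is `1` on this torus. Near the plane wave `|α|` is close to `1`, hence under
the condition `4 γ² κ ⟨σ₁⟩² < 1` the negative term is absorbed by `‖∇u‖²`. This is
`exists_sq_le_excess`; consequently the conserved quantities control the distance to the orbit
(`exists_deviation_le`, `exists_orbitDist_le`).

**The Cauchy problem.** The norm of `Ḣ¹` comes from an inner product, and the space is complete with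
test functions dense in it. This rests on the Sobolev inequality and on `weak_identity_extend`, which
extends a weak identity from test functions to the energy space by cutoffs, whose gradients are bounded
in `L^n`, and mollification. The linear part of the system generates a group of isometries on the energy space. The
free Schrödinger group is diagonal in the Fourier basis of `H¹(𝕋^d)`. The wave generator
`(p, v) ↦ (T* v, -T p)`, for `T` the identification of functions in `L² ∩ Ḣ¹`, is a skew-adjoint
relation, and it generates a group by bounded approximation (`IsSkewAdjointGraph.exists_flow`).
The nonlinearity is quadratic and bounded on the energy space, because `σ₁` and `σ₂` are smoothing. Hence
the system truncated by the radial retraction onto a ball is a Lipschitz differential equation in the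
frame moving with the linear flow, and has global solutions (`exists_isTruncatedSolution`).
Conversely, a solution in the sense of the statement satisfies the mild form of the equations
(`isSolution_iff`, `IsWeakSolution.hasDerivWithinAt`), which gives uniqueness (`IsWeakSolution.eqOn`).

**Conservation laws and conclusion.** A solution is in general not differentiable in the energy space.
The mass and the energy are nevertheless differentiated (`mass_eq`, `energy_eq`): the linear flow
preserves the quadratic part, and in the interaction term the derivatives fall on smooth factors, as
`Φ u` lies in `H¹`. For data near the plane wave, conservation and coercivity improve any bound on the
deviation by which the truncation is not active. By continuity the deviation stays small for all
times (`IsTruncatedSolution.deviation_lt`), so the truncated solution is a global solution, close to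
the orbit.
-/

noncomputable section

namespace SchrodingerWave

open Filter Topology

/-! ### Isometric flows -/

/-- A strongly continuous one-parameter group of linear isometries. -/
structure IsometricFlow (𝕜 H : Type*) [RCLike 𝕜] [NormedAddCommGroup H] [NormedSpace 𝕜 H] where
  /-- The isometry at time `t`. -/
  toFun : ℝ → H →L[𝕜] H
  map_zero' : ∀ x, toFun 0 x = x
  map_add' : ∀ s t x, toFun (s + t) x = toFun s (toFun t x)
  norm_map' : ∀ t x, ‖toFun t x‖ = ‖x‖
  continuous' : ∀ x, Continuous fun t => toFun t x

namespace IsometricFlow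

section Basic

variable {𝕜 H : Type*} [RCLike 𝕜] [NormedAddCommGroup H] [NormedSpace 𝕜 H]

instance : CoeFun (IsometricFlow 𝕜 H) (fun _ => ℝ → H →L[𝕜] H) := ⟨toFun⟩

variable (S : IsometricFlow 𝕜 H)

@[simp] theorem map_zero (x : H) : S 0 x = x := S.map_zero' x

theorem map_add (s t : ℝ) (x : H) : S (s + t) x = S s (S t x) := S.map_add' s t x

@[simp] theorem norm_map (t : ℝ) (x : H) : ‖S t x‖ = ‖x‖ := S.norm_map' t x

@[simp] theorem neg_apply_apply (t : ℝ) (x : H) : S (-t) (S t x) = x := by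
  rw [← S.map_add, neg_add_cancel, S.map_zero]

@[simp] theorem apply_neg_apply (t : ℝ) (x : H) : S t (S (-t) x) = x := by
  rw [← S.map_add, add_neg_cancel, S.map_zero]

/-- A flow of isometries is jointly continuous. -/
theorem continuous_comp {X : Type*} [TopologicalSpace X] {τ : X → ℝ} {f : X → H}
    (hτ : Continuous τ) (hf : Continuous f) : Continuous fun s => S (τ s) (f s) := by
  rw [continuous_iff_continuousAt]
  intro a
  have h1 : Tendsto (fun s => S (τ s) (f a)) (𝓝 a) (𝓝 (S (τ a) (f a))) :=
    ((S.continuous' (f a)).comp hτ).tendsto a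
  have h2 : Tendsto (fun s => S (τ s) (f s - f a)) (𝓝 a) (𝓝 0) := by
    rw [tendsto_zero_iff_norm_tendsto_zero]
    simp only [norm_map]
    have := (hf.sub (continuous_const (y := f a))).norm.tendsto a
    simpa using this
  have := h1.add h2
  simpa [ContinuousAt] using this

theorem continuousOn_comp {X : Type*} [TopologicalSpace X] {τ : X → ℝ} {f : X → H} {s : Set X}
    (hτ : Continuous τ) (hf : ContinuousOn f s) : ContinuousOn (fun x => S (τ x) (f x)) s := by
  rw [continuousOn_iff_continuous_domRestrict] at *
  exact S.continuous_comp (hτ.comp continuous_subtype_val) hf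

end Basic

section Inner

variable {𝕜 H : Type*} [RCLike 𝕜] [NormedAddCommGroup H] [InnerProductSpace 𝕜 H]
  (S : IsometricFlow 𝕜 H)

theorem inner_map_map (t : ℝ) (x y : H) : inner 𝕜 (S t x) (S t y) = inner 𝕜 x y :=
  LinearIsometry.inner_map_map (⟨(S t : H →ₗ[𝕜] H), S.norm_map t⟩ : H →ₗᵢ[𝕜] H) x y

theorem inner_map_eq (t : ℝ) (x y : H) : inner 𝕜 x (S t y) = inner 𝕜 (S (-t) x) y := by
  rw [← S.inner_map_map t (S (-t) x) y, apply_neg_apply]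

end Inner

section Skew

variable {H : Type*} [NormedAddCommGroup H] [InnerProductSpace ℝ H] [CompleteSpace H]

/-- The flow generated by a bounded skew-symmetric operator. -/
def ofSkew (B : H →L[ℝ] H) (hB : ∀ x, inner ℝ x (B x) = 0) : IsometricFlow ℝ H where
  toFun t := NormedSpace.exp (t • B)
  map_zero' x := by simp
  map_add' s t x := by
    let _ : NormedAlgebra ℚ (H →L[ℝ] H) := NormedAlgebra.restrictScalars ℚ ℝ _
    rw [add_smul, NormedSpace.exp_add_of_commute
      (((Commute.refl B).smul_left s).smul_right t)]
    rfl
  norm_map' t x := by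
    have hd : ∀ s : ℝ, HasDerivAt (fun u : ℝ => NormedSpace.exp (u • B) x)
        (B (NormedSpace.exp (s • B) x)) s := fun s => by
      have := (hasDerivAt_exp_smul_const' B s).clm_apply (hasDerivAt_const s x)
      simpa using this
    have h2 : ∀ s : ℝ, HasDerivAt (fun u : ℝ => ‖NormedSpace.exp (u • B) x‖ ^ 2) 0 s := fun s => by
      have := (hd s).norm_sq
      rwa [hB, mul_zero] at this
    have h3 := is_const_of_deriv_eq_zero (fun s => (h2 s).differentiableAt)
      (fun s => (h2 s).deriv) t 0
    simpa using h3
  continuous' x := by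
    refine continuous_iff_continuousAt.2 fun s => ?_
    exact ((hasDerivAt_exp_smul_const' B s).clm_apply (hasDerivAt_const s x)).continuousAt

theorem hasDerivAt_ofSkew (B : H →L[ℝ] H) (hB : ∀ x, inner ℝ x (B x) = 0) (x : H) (t : ℝ) :
    HasDerivAt (fun s => ofSkew B hB s x) (ofSkew B hB t (B x)) t := by
  have := (hasDerivAt_exp_smul_const B t).clm_apply (hasDerivAt_const t x)
  rw [ContinuousLinearMap.map_zero, add_zero] at this
  exact this

theorem commute_ofSkew {B J : H →L[ℝ] H} (hB : ∀ x, inner ℝ x (B x) = 0) (h : Commute J B)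
    (t : ℝ) (x : H) : J (ofSkew B hB t x) = ofSkew B hB t (J x) := by
  have := (h.smul_right t).exp_right
  exact congrArg (fun K : H →L[ℝ] H => K x) this

/-- Two commuting bounded generators that are close at `x` generate flows that are close at `x`. -/
theorem norm_ofSkew_sub_le {B C : H →L[ℝ] H} (hB : ∀ x, inner ℝ x (B x) = 0)
    (hC : ∀ x, inner ℝ x (C x) = 0) (h : Commute B C) (x : H) (t : ℝ) :
    ‖ofSkew B hB t x - ofSkew C hC t x‖ ≤ ‖B x - C x‖ * |t| := by
  have hder : ∀ s ∈ (univ : Set ℝ), HasDerivWithinAt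
      (fun u => ofSkew C hC (-u) (ofSkew B hB u x))
      (ofSkew C hC (-s) (ofSkew B hB s (B x - C x))) univ s := by
    intro s _
    have h1 : HasDerivAt (fun u : ℝ => NormedSpace.exp ((-u) • C))
        (-(NormedSpace.exp ((-s) • C) * C)) s := by
      have := (hasDerivAt_exp_smul_const C (-s)).scomp s (hasDerivAt_neg s)
      simpa [Function.comp_def] using this
    have h2 := h1.clm_apply (hasDerivAt_ofSkew B hB x s)
    have e : ofSkew C hC (-s) (ofSkew B hB s (B x - C x))
        = (-(NormedSpace.exp ((-s) • C) * C)) (ofSkew B hB s x)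
          + NormedSpace.exp ((-s) • C) (ofSkew B hB s (B x)) := by
      have h3 : C (ofSkew B hB s x) = ofSkew B hB s (C x) := commute_ofSkew hB h.symm s x
      have h4 : (-(NormedSpace.exp ((-s) • C) * C)) (ofSkew B hB s x)
        = -(ofSkew C hC (-s) (C (ofSkew B hB s x))) := rfl
      have h5 : NormedSpace.exp ((-s) • C) (ofSkew B hB s (B x))
        = ofSkew C hC (-s) (ofSkew B hB s (B x)) := rfl
      rw [h4, h5, h3, map_sub, map_sub]
      abel
    rw [e]
    exact h2.hasDerivWithinAt
  have := convex_univ.norm_image_sub_le_of_norm_hasDerivWithin_le (𝕜 := ℝ) hder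
    (C := ‖B x - C x‖) (fun s _ => by rw [norm_map, norm_map]) (mem_univ 0) (mem_univ t)
  have e : ofSkew C hC (-t) (ofSkew B hB t x) - x
      = ofSkew C hC (-t) (ofSkew B hB t x - ofSkew C hC t x) := by
    rw [map_sub, neg_apply_apply]
  simp only [neg_zero, map_zero] at this
  rwa [e, norm_map, sub_zero, Real.norm_eq_abs] at this

/-- A sequence of isometric flows that is Cauchy, locally uniformly in time, on a dense set,
converges to an isometric flow, locally uniformly in time. -/
theorem exists_limit (U : ℕ → IsometricFlow ℝ H) {D : Set H} (hD : Dense D)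
    (hU : ∀ x ∈ D, ∀ T : ℝ, ∀ ε > 0, ∃ N, ∀ n ≥ N, ∀ m ≥ N, ∀ t, |t| ≤ T →
      ‖U n t x - U m t x‖ ≤ ε) :
    ∃ S : IsometricFlow ℝ H, ∀ x, ∀ T : ℝ, ∀ ε > 0, ∃ N, ∀ n ≥ N, ∀ t, |t| ≤ T →
      ‖U n t x - S t x‖ ≤ ε := by
  have hall : ∀ x, ∀ T : ℝ, ∀ ε > 0, ∃ N, ∀ n ≥ N, ∀ m ≥ N, ∀ t, |t| ≤ T →
      ‖U n t x - U m t x‖ ≤ ε := by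
    intro x T ε hε
    obtain ⟨y, hy, hxy⟩ := Metric.mem_closure_iff.1 (hD x) (ε / 3) (by positivity)
    obtain ⟨N, hN⟩ := hU y hy T (ε / 3) (by positivity)
    refine ⟨N, fun n hn m hm t ht => ?_⟩
    have e : U n t x - U m t x = U n t (x - y) + (U n t y - U m t y) - U m t (x - y) := by
      simp only [map_sub]; abel
    rw [dist_eq_norm] at hxy
    calc ‖U n t x - U m t x‖ ≤ ‖U n t (x - y)‖ + ‖U n t y - U m t y‖ + ‖U m t (x - y)‖ := by
          rw [e]; exact (norm_sub_le _ _).trans (add_le_add_left (norm_add_le _ _) _)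
      _ ≤ ε := by
          have := hN n hn m hm t ht
          simp only [norm_map]; linarith
  have hlim : ∀ t x, ∃ z, Tendsto (fun n => U n t x) atTop (𝓝 z) := by
    intro t x
    refine cauchySeq_tendsto_of_complete (Metric.cauchySeq_iff'.2 fun ε hε => ?_)
    obtain ⟨N, hN⟩ := hall x |t| (ε / 2) (by positivity)
    refine ⟨N, fun n hn => ?_⟩
    rw [dist_eq_norm]
    linarith [hN n hn N le_rfl t le_rfl]
  choose S hS using hlim
  have hunif : ∀ x, ∀ T : ℝ, ∀ ε > 0, ∃ N, ∀ n ≥ N, ∀ t, |t| ≤ T → ‖U n t x - S t x‖ ≤ ε := by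
    intro x T ε hε
    obtain ⟨N, hN⟩ := hall x T ε hε
    refine ⟨N, fun n hn t ht => ?_⟩
    refine le_of_tendsto ((tendsto_const_nhds.sub (hS t x)).norm) ?_
    filter_upwards [eventually_ge_atTop N] with m hm using hN n hn m hm t ht
  have hnorm : ∀ t x, ‖S t x‖ = ‖x‖ := fun t x => by
    refine tendsto_nhds_unique (hS t x).norm ?_
    simp
  let Sl : ℝ → H →L[ℝ] H := fun t =>
    LinearMap.mkContinuous
      { toFun := S t
        map_add' := fun x y => tendsto_nhds_unique (hS t (x + y)) (by
          simpa using (hS t x).add (hS t y))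
        map_smul' := fun a x => tendsto_nhds_unique (hS t (a • x)) (by
          simpa using (hS t x).const_smul a) } 1 (fun x => by
            simpa using (hnorm t x).le)
  refine ⟨⟨Sl, fun x => ?_, fun s t x => ?_, hnorm, fun x => ?_⟩, hunif⟩
  · exact tendsto_nhds_unique (hS 0 x) (by simp)
  · refine tendsto_nhds_unique (hS (s + t) x) ?_
    have h1 : Tendsto (fun n => U n s (U n t x - S t x)) atTop (𝓝 0) := by
      rw [tendsto_zero_iff_norm_tendsto_zero]
      simp only [norm_map]
      have := ((hS t x).sub_const (S t x)).norm
      simpa using this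
    have h2 := h1.add (hS s (S t x))
    simp only [map_sub, sub_add_cancel, zero_add] at h2
    simp only [map_add]
    exact h2
  · change Continuous fun t => S t x
    refine Metric.continuous_iff.2 fun t ε hε => ?_
    obtain ⟨N, hN⟩ := hunif x (|t| + 1) (ε / 4) (by positivity)
    obtain ⟨δ, hδ, h⟩ := Metric.continuous_iff.1 ((U N).continuous' x) t (ε / 4) (by positivity)
    refine ⟨min δ 1, by positivity, fun s hs => ?_⟩
    have hs1 : |s| ≤ |t| + 1 := by
      have h1 : |s - t| < 1 := by
        rw [← Real.dist_eq]; exact hs.trans_le (min_le_right _ _)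
      have h2 := abs_sub_abs_le_abs_sub s t
      linarith
    have h1 := hN N le_rfl s hs1
    have h2 := hN N le_rfl t (by linarith)
    have h3 := h s (hs.trans_le (min_le_left _ _))
    rw [dist_eq_norm] at h3 ⊢
    have e : S s x - S t x = -(U N s x - S s x) + (U N s x - U N t x) + (U N t x - S t x) := by
      abel
    rw [e]
    calc _ ≤ ‖-(U N s x - S s x)‖ + ‖U N s x - U N t x‖ + ‖U N t x - S t x‖ := norm_add₃_le
      _ < ε := by rw [norm_neg]; linarith

end Skew

end IsometricFlow

/-! ### The flow generated by a skew-adjoint operator -/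

section HilleYosida

variable {H : Type*} [NormedAddCommGroup H] [InnerProductSpace ℝ H]

/-- A densely defined skew-adjoint operator, given by its graph: it is skew-symmetric and
`1 - h A` is onto for every real `h ≠ 0`. -/
structure IsSkewAdjointGraph (A : Submodule ℝ (H × H)) : Prop where
  inner_eq_zero : ∀ p ∈ A, inner ℝ p.1 p.2 = 0
  exists_sub_smul_eq : ∀ h : ℝ, h ≠ 0 → ∀ z, ∃ p ∈ A, p.1 - h • p.2 = z
  dense_domain : Dense {x | ∃ y, (x, y) ∈ A}

namespace IsSkewAdjointGraph

variable {A : Submodule ℝ (H × H)}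

theorem inner_add_inner_eq_zero (hA : IsSkewAdjointGraph A) {p q : H × H} (hp : p ∈ A)
    (hq : q ∈ A) : inner ℝ p.1 q.2 + inner ℝ p.2 q.1 = 0 := by
  have h := hA.inner_eq_zero _ (A.add_mem hp hq)
  simp only [Prod.fst_add, Prod.snd_add, inner_add_left, inner_add_right,
    hA.inner_eq_zero p hp, hA.inner_eq_zero q hq] at h
  rw [real_inner_comm q.1 p.2]
  linarith

/-- The a priori estimate `‖x‖ ≤ ‖x - h y‖` for `(x, y)` in the relation: `x` and `y` are
orthogonal. -/
theorem norm_fst_le (hA : IsSkewAdjointGraph A) {p : H × H} (hp : p ∈ A) (h : ℝ) :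
    ‖p.1‖ ≤ ‖p.1 - h • p.2‖ := by
  refine abs_le_of_sq_le_sq' ?_ (norm_nonneg _) |>.2
  rw [norm_sub_sq_real, inner_smul_right, hA.inner_eq_zero p hp]
  nlinarith [sq_nonneg ‖h • p.2‖]

theorem fst_eq_of_sub_smul_eq (hA : IsSkewAdjointGraph A) {p q : H × H} (hp : p ∈ A) (hq : q ∈ A)
    {h : ℝ} (hpq : p.1 - h • p.2 = q.1 - h • q.2) : p.1 = q.1 := by
  have := hA.norm_fst_le (A.sub_mem hp hq) h
  have e : (p - q).1 - h • (p - q).2 = 0 := by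
    simp only [Prod.fst_sub, Prod.snd_sub, smul_sub]
    rw [sub_sub_sub_comm, hpq, sub_self]
  rw [e, norm_zero] at this
  exact sub_eq_zero.1 (norm_le_zero_iff.1 this)

/-- The resolvent `(1 - h A)⁻¹`. -/
def resolvent (hA : IsSkewAdjointGraph A) (h : ℝ) (hh : h ≠ 0) : H →L[ℝ] H :=
  LinearMap.mkContinuous
    { toFun := fun z => (hA.exists_sub_smul_eq h hh z).choose.1
      map_add' := fun x y => by
        have hx := (hA.exists_sub_smul_eq h hh x).choose_spec
        have hy := (hA.exists_sub_smul_eq h hh y).choose_spec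
        have hxy := (hA.exists_sub_smul_eq h hh (x + y)).choose_spec
        refine (hA.fst_eq_of_sub_smul_eq hxy.1 (A.add_mem hx.1 hy.1) (h := h) ?_)
        rw [hxy.2, Prod.fst_add, Prod.snd_add, smul_add, add_sub_add_comm, hx.2, hy.2]
      map_smul' := fun a x => by
        have hx := (hA.exists_sub_smul_eq h hh x).choose_spec
        have hax := (hA.exists_sub_smul_eq h hh (a • x)).choose_spec
        refine (hA.fst_eq_of_sub_smul_eq hax.1 (A.smul_mem a hx.1) (h := h) ?_)
        rw [hax.2, Prod.smul_fst, Prod.smul_snd, smul_comm h a, ← smul_sub, hx.2] } 1 fun z => by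
    have hz := (hA.exists_sub_smul_eq h hh z).choose_spec
    have := hA.norm_fst_le hz.1 h
    rw [hz.2] at this
    simpa using this

theorem norm_resolvent_le (hA : IsSkewAdjointGraph A) {h : ℝ} (hh : h ≠ 0) (z : H) :
    ‖hA.resolvent h hh z‖ ≤ ‖z‖ := by
  have hz := (hA.exists_sub_smul_eq h hh z).choose_spec
  have := hA.norm_fst_le hz.1 h
  rwa [hz.2] at this

/-- With `x = (1 - h A)⁻¹ z`, the pair `(x, A x)` belongs to the relation. -/
theorem resolvent_mem (hA : IsSkewAdjointGraph A) {h : ℝ} (hh : h ≠ 0) (z : H) :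
    (hA.resolvent h hh z, h⁻¹ • (hA.resolvent h hh z - z)) ∈ A := by
  have hz := (hA.exists_sub_smul_eq h hh z).choose_spec
  have e : hA.resolvent h hh z = (hA.exists_sub_smul_eq h hh z).choose.1 := rfl
  convert hz.1 using 1
  refine Prod.ext e ?_
  simp only [e]
  rw [inv_smul_eq_iff₀ hh, sub_eq_iff_eq_add, ← sub_eq_iff_eq_add', hz.2]

theorem resolvent_sub_smul (hA : IsSkewAdjointGraph A) {h : ℝ} (hh : h ≠ 0) {x y : H}
    (hxy : (x, y) ∈ A) : hA.resolvent h hh (x - h • y) = x := by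
  refine hA.fst_eq_of_sub_smul_eq (hA.resolvent_mem hh _) hxy (h := h) ?_
  rw [smul_inv_smul₀ hh, sub_sub_cancel]

theorem resolvent_fst (hA : IsSkewAdjointGraph A) {h : ℝ} (hh : h ≠ 0) {x y : H}
    (hxy : (x, y) ∈ A) : hA.resolvent h hh x = x + h • hA.resolvent h hh y := by
  have := hA.resolvent_sub_smul hh hxy
  rw [map_sub, map_smul, sub_eq_iff_eq_add] at this
  exact this

theorem resolvent_map_mem (hA : IsSkewAdjointGraph A) {h : ℝ} (hh : h ≠ 0) {x y : H}
    (hxy : (x, y) ∈ A) : (hA.resolvent h hh x, hA.resolvent h hh y) ∈ A := by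
  have := hA.resolvent_mem hh x
  have e : h⁻¹ • (hA.resolvent h hh x - x) = hA.resolvent h hh y := by
    rw [hA.resolvent_fst hh hxy, add_sub_cancel_left, inv_smul_smul₀ hh]
  rwa [e] at this

theorem resolvent_comm (hA : IsSkewAdjointGraph A) {h k : ℝ} (hh : h ≠ 0) (hk : k ≠ 0) :
    Commute (hA.resolvent h hh) (hA.resolvent k hk) := by
  refine ContinuousLinearMap.ext fun z => ?_
  have h1 := hA.resolvent_map_mem hh (hA.resolvent_mem hk z)
  have h2 := hA.resolvent_sub_smul hk h1
  rw [map_smul, smul_inv_smul₀ hk, ← map_sub, sub_sub_cancel] at h2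
  exact h2.symm

/-- The adjoint of `(1 - h A)⁻¹` is `(1 + h A)⁻¹`. -/
theorem inner_resolvent (hA : IsSkewAdjointGraph A) {h : ℝ} (hh : h ≠ 0) (z w : H) :
    inner ℝ (hA.resolvent h hh z) w = inner ℝ z (hA.resolvent (-h) (neg_ne_zero.2 hh) w) := by
  have := hA.inner_add_inner_eq_zero (hA.resolvent_mem hh z)
    (hA.resolvent_mem (neg_ne_zero.2 hh) w)
  simp only [inner_smul_left, inner_smul_right, inner_sub_left, inner_sub_right, inv_neg,
    RCLike.conj_to_real, neg_mul] at this
  field_simp at this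
  linarith

/-- `(1 - h A)⁻¹` tends to the identity strongly as `h → 0`: this is clear on the dense domain, and
the resolvents are contractions. -/
theorem tendsto_resolvent (hA : IsSkewAdjointGraph A) {h : ℕ → ℝ} (hh : ∀ n, h n ≠ 0)
    (hlim : Tendsto h atTop (𝓝 0)) (z : H) :
    Tendsto (fun n => hA.resolvent (h n) (hh n) z) atTop (𝓝 z) := by
  rw [Metric.tendsto_atTop]
  intro ε hε
  obtain ⟨x, ⟨y, hxy⟩, hx⟩ := Metric.mem_closure_iff.1 (hA.dense_domain z) (ε / 3) (by positivity)
  have h0 : Tendsto (fun n => |h n| * ‖y‖) atTop (𝓝 0) := by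
    have := hlim.abs.mul_const ‖y‖
    simpa using this
  obtain ⟨N, hN⟩ := eventually_atTop.1 (h0.eventually_lt_const (show (0 : ℝ) < ε / 3 by positivity))
  refine ⟨N, fun n hn => ?_⟩
  have e : hA.resolvent (h n) (hh n) z - z = hA.resolvent (h n) (hh n) (z - x)
      + h n • hA.resolvent (h n) (hh n) y + (x - z) := by
    rw [map_sub, hA.resolvent_fst (hh n) hxy]; abel
  rw [dist_eq_norm] at hx ⊢
  have h1 := hA.norm_resolvent_le (hh n) (z - x)
  have h2 : ‖h n • hA.resolvent (h n) (hh n) y‖ ≤ |h n| * ‖y‖ := by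
    rw [norm_smul, Real.norm_eq_abs]
    gcongr
    exact hA.norm_resolvent_le (hh n) y
  have h3 := hN n hn
  rw [e]
  calc _ ≤ _ + _ + _ := norm_add₃_le
    _ < ε := by rw [norm_sub_rev x z]; linarith

/-- The bounded skew-symmetric approximation `A (1 - h² A²)⁻¹` of `A`. -/
def approx (hA : IsSkewAdjointGraph A) (h : ℝ) (hh : h ≠ 0) : H →L[ℝ] H :=
  (2 * h)⁻¹ • (hA.resolvent h hh - hA.resolvent (-h) (neg_ne_zero.2 hh))

theorem inner_approx (hA : IsSkewAdjointGraph A) {h : ℝ} (hh : h ≠ 0) (z : H) :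
    inner ℝ z (hA.approx h hh z) = 0 := by
  have := hA.inner_resolvent hh z z
  simp only [approx, smul_apply, sub_apply,
    inner_smul_right, inner_sub_right]
  rw [← this, real_inner_comm, sub_self, mul_zero]

/-- On the domain of `A`, the approximation of `A` is the resolvent applied to `A x`. -/
theorem approx_fst (hA : IsSkewAdjointGraph A) {h : ℝ} (hh : h ≠ 0) {x y : H}
    (hxy : (x, y) ∈ A) : hA.approx h hh x = (2 : ℝ)⁻¹ •
      (hA.resolvent h hh y + hA.resolvent (-h) (neg_ne_zero.2 hh) y) := by
  simp only [approx, smul_apply, sub_apply,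
    hA.resolvent_fst _ hxy]
  rw [neg_smul, add_sub_add_left_eq_sub, sub_neg_eq_add, ← smul_add, smul_smul]
  congr 1
  field_simp

theorem commute_resolvent_approx (hA : IsSkewAdjointGraph A) {h k : ℝ} (hh : h ≠ 0) (hk : k ≠ 0) :
    Commute (hA.resolvent h hh) (hA.approx k hk) :=
  ((hA.resolvent_comm hh hk).sub_right (hA.resolvent_comm hh (neg_ne_zero.2 hk))).smul_right _

theorem commute_approx (hA : IsSkewAdjointGraph A) {h k : ℝ} (hh : h ≠ 0) (hk : k ≠ 0) :
    Commute (hA.approx h hh) (hA.approx k hk) :=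
  ((hA.commute_resolvent_approx hh hk).sub_left
    (hA.commute_resolvent_approx (neg_ne_zero.2 hh) hk)).smul_left _

/-- A skew-adjoint operator generates an isometric flow, which preserves its graph. -/
theorem exists_flow [CompleteSpace H] (hA : IsSkewAdjointGraph A) :
    ∃ S : IsometricFlow ℝ H, ∀ x y, (x, y) ∈ A → ∀ t,
      HasDerivAt (fun s => S s x) (S t y) t ∧ (S t x, S t y) ∈ A := by
  set h : ℕ → ℝ := fun n => 1 / ((n : ℝ) + 1) with h_def
  have hh : ∀ n, h n ≠ 0 := fun n => by positivity
  have hlim : Tendsto h atTop (𝓝 0) := tendsto_one_div_add_atTop_nhds_zero_nat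
  set B : ℕ → H →L[ℝ] H := fun n => hA.approx (h n) (hh n)
  have hB : ∀ n x, inner ℝ x (B n x) = 0 := fun n x => hA.inner_approx (hh n) x
  have hBlim : ∀ x y, (x, y) ∈ A → Tendsto (fun n => B n x) atTop (𝓝 y) := by
    intro x y hxy
    have h1 := hA.tendsto_resolvent hh hlim y
    have h2 := hA.tendsto_resolvent (fun n => neg_ne_zero.2 (hh n)) (by simpa using hlim.neg) y
    have h3 := (h1.add h2).const_smul (2 : ℝ)⁻¹
    have e : (2 : ℝ)⁻¹ • (y + y) = y := by rw [← two_smul ℝ y, inv_smul_smul₀ two_ne_zero]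
    rw [e] at h3
    exact h3.congr fun n => (hA.approx_fst (hh n) hxy).symm
  set U : ℕ → IsometricFlow ℝ H := fun n => IsometricFlow.ofSkew (B n) (hB n)
  obtain ⟨S, hS⟩ := IsometricFlow.exists_limit U hA.dense_domain (by
    rintro x ⟨y, hxy⟩ T ε hε
    have hc := (hBlim x y hxy).cauchySeq
    obtain ⟨N, hN⟩ := Metric.cauchySeq_iff.1 hc (ε / (|T| + 1)) (by positivity)
    refine ⟨N, fun n hn m hm t ht => ?_⟩
    have h1 := IsometricFlow.norm_ofSkew_sub_le (hB n) (hB m)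
      (hA.commute_approx (hh n) (hh m)) x t
    have h2 := (hN n hn m hm).le
    rw [dist_eq_norm] at h2
    calc _ ≤ _ := h1
      _ ≤ ε / (|T| + 1) * (|T| + 1) := by
        gcongr
        linarith [le_abs_self T]
      _ = ε := by field_simp)
  have hSlim : ∀ t x, Tendsto (fun n => U n t x) atTop (𝓝 (S t x)) := by
    intro t x
    rw [Metric.tendsto_atTop]
    intro ε hε
    obtain ⟨N, hN⟩ := hS x |t| (ε / 2) (by positivity)
    refine ⟨N, fun n hn => ?_⟩
    rw [dist_eq_norm]
    linarith [hN n hn t le_rfl]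
  have hcomm : ∀ t x, hA.resolvent 1 one_ne_zero (S t x) = S t (hA.resolvent 1 one_ne_zero x) := by
    intro t x
    refine tendsto_nhds_unique (((hA.resolvent 1 one_ne_zero).continuous.tendsto _).comp
      (hSlim t x)) ?_
    refine (hSlim t _).congr fun n => ?_
    exact (IsometricFlow.commute_ofSkew (hB n)
      (hA.commute_resolvent_approx one_ne_zero (hh n)) t x).symm
  refine ⟨S, fun x y hxy t => ⟨?_, ?_⟩⟩
  · refine hasDerivAt_of_tendstoUniformlyOn (l := atTop) (s := Metric.ball 0 (|t| + 1))
      (f := fun n s => U n s x) (f' := fun n s => U n s (B n x)) (g' := fun s => S s y)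
      Metric.isOpen_ball ?_
      (Eventually.of_forall fun n s _ => IsometricFlow.hasDerivAt_ofSkew (B n) (hB n) x s)
      (fun s _ => hSlim s x) (by simp)
    rw [Metric.tendstoUniformlyOn_iff]
    intro ε hε
    obtain ⟨N, hN⟩ := hS y (|t| + 1) (ε / 3) (by positivity)
    obtain ⟨N', hN'⟩ := Metric.tendsto_atTop.1 (hBlim x y hxy) (ε / 3) (by positivity)
    filter_upwards [eventually_ge_atTop (max N N')] with n hn s hs
    have h1 := hN n (le_of_max_le_left hn) s (by simpa using (mem_ball_zero_iff.1 hs).le)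
    have h2 := hN' n (le_of_max_le_right hn)
    rw [dist_eq_norm, norm_sub_rev]
    rw [dist_eq_norm] at h2
    have e : U n s (B n x) - S s y = U n s (B n x - y) + (U n s y - S s y) := by
      rw [map_sub]; abel
    rw [e]
    have h3 : ‖U n s (B n x - y)‖ = ‖B n x - y‖ := IsometricFlow.norm_map _ _ _
    calc _ ≤ _ + _ := norm_add_le _ _
      _ < ε := by linarith
  · have h1 := hA.resolvent_sub_smul one_ne_zero hxy
    have h2 := hA.resolvent_mem one_ne_zero (S t (x - (1 : ℝ) • y))
    rw [hcomm, h1] at h2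
    convert h2 using 2
    rw [inv_one, one_smul, one_smul, map_sub, sub_sub_cancel]

end IsSkewAdjointGraph
end HilleYosida

/-! ### Weak and mild solutions -/

section Mild

variable {𝕜 H : Type*} [RCLike 𝕜] [NormedAddCommGroup H] [InnerProductSpace 𝕜 H]
  [NormedSpace ℝ H] [IsScalarTower ℝ 𝕜 H]

/-- A product rule for `⟪a, y⟫` at a point where `a` vanishes: `y` need only be continuous. -/
theorem hasDerivWithinAt_inner_of_eq_zero {a y : ℝ → H} {a' : H} {s : Set ℝ} {t : ℝ}
    (ha : HasDerivWithinAt a a' s t) (h0 : a t = 0) (hy : ContinuousWithinAt y s t) :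
    HasDerivWithinAt (fun r => inner 𝕜 (a r) (y r)) (inner 𝕜 a' (y t)) s t := by
  rw [hasDerivWithinAt_iff_tendsto_slope] at *
  have h2 : Tendsto y (𝓝[s \ {t}] t) (𝓝 (y t)) := hy.mono_left (nhdsWithin_mono _ sdiff_subset)
  refine (ha.inner h2).congr fun r => ?_
  simp only [slope, vsub_eq_sub, h0, sub_zero, inner_zero_left]
  rw [← algebraMap_smul 𝕜 ((r - t)⁻¹) (a r), inner_smul_left, RCLike.real_smul_eq_coe_mul]
  simp

theorem hasDerivWithinAt_inner_const {y : ℝ → H} {y' : H} {s : Set ℝ} {t : ℝ} (p : H)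
    (hy : HasDerivWithinAt y y' s t) :
    HasDerivWithinAt (fun r => inner 𝕜 p (y r)) (inner 𝕜 p y') s t :=
  (((innerSL 𝕜 p).restrictScalars ℝ).hasFDerivAt (x := y t)).comp_hasDerivWithinAt t hy

/-- A weak solution of `y' = A y + f`, tested against the vectors of a set that is dense and stable
under the flow `S` of `A`, is a mild solution: `s ↦ S (-s) (y s)` has the derivative
`S (-s) (f s)`. -/
theorem hasDerivWithinAt_of_weak [CompleteSpace H] (S : IsometricFlow 𝕜 H) (T : Set (H × H))
    (hT : ∀ p ∈ T, ∀ t, HasDerivAt (fun s => S s p.1) (S t p.2) t ∧ (S t p.1, S t p.2) ∈ T)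
    (hdense : ∀ x, (∀ p ∈ T, inner 𝕜 p.1 x = 0) → x = 0)
    {y f : ℝ → H} (hy : Continuous y) (hf : Continuous f)
    (hw : ∀ p ∈ T, ∀ t, 0 ≤ t → HasDerivWithinAt (fun s => inner 𝕜 p.1 (y s))
      (-inner 𝕜 p.2 (y t) + inner 𝕜 p.1 (f t)) (Ici 0) t) {t : ℝ} (ht : 0 ≤ t) :
    HasDerivWithinAt (fun s => S (-s) (y s)) (S (-t) (f t)) (Ici 0) t := by
  have hg : Continuous fun s => S (-s) (f s) := S.continuous_comp continuous_neg hf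
  have hz : Continuous fun s => S (-s) (y s) := S.continuous_comp continuous_neg hy
  set G : ℝ → H := fun s => S (-0) (y 0) + ∫ r in (0 : ℝ)..s, S (-r) (f r) with hG
  have hGd : ∀ s, HasDerivAt G (S (-s) (f s)) s := fun s =>
    (intervalIntegral.integral_hasDerivAt_right (hg.intervalIntegrable _ _)
      (hg.stronglyMeasurableAtFilter _ _) hg.continuousAt).const_add _
  have hp : ∀ p ∈ T, ∀ s, 0 ≤ s → HasDerivWithinAt (fun r => inner 𝕜 p.1 (S (-r) (y r)))
      (inner 𝕜 p.1 (S (-s) (f s))) (Ici 0) s := by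
    intro p hp s hs
    obtain ⟨hd, hmem⟩ := hT p hp s
    have h1 := hasDerivWithinAt_inner_of_eq_zero (𝕜 := 𝕜)
      ((hd.sub_const (S s p.1)).hasDerivWithinAt (s := Ici 0)) (sub_self _)
      hy.continuousWithinAt
    have h2 := h1.add (hw _ hmem s hs)
    have e : (fun r => inner 𝕜 p.1 (S (-r) (y r))) =
        (fun r => inner 𝕜 (S r p.1 - S s p.1) (y r)) + fun r => inner 𝕜 (S s p.1) (y r) := by
      funext r
      rw [S.inner_map_eq, neg_neg, Pi.add_apply, inner_sub_left, sub_add_cancel]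
    rw [e, S.inner_map_eq, neg_neg]
    dsimp only at h2
    rw [add_neg_cancel_left] at h2
    exact h2
  have key : ∀ s, 0 ≤ s → S (-s) (y s) = G s := by
    intro s hs
    refine sub_eq_zero.1 (hdense _ fun p hpT => ?_)
    have h1 := constant_of_has_deriv_right_zero (a := 0) (b := s)
      (f := fun r => inner 𝕜 p.1 (S (-r) (y r) - G r))
      ((continuous_const.inner (hz.sub
        (continuous_iff_continuousAt.2 fun r => (hGd r).continuousAt))).continuousOn)
      (fun r hr => by
        have h2 := ((hp p hpT r hr.1).sub (hasDerivWithinAt_inner_const (𝕜 := 𝕜) p.1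
          (hGd r).hasDerivWithinAt)).mono (Ici_subset_Ici.2 hr.1)
        simp only [inner_sub_right]
        rw [sub_self] at h2
        exact h2)
      s ⟨hs, le_rfl⟩
    rw [h1]
    simp [hG]
  exact (hGd t).hasDerivWithinAt.congr (fun s hs => key s hs) (key t ht)

/-- A mild solution is a weak solution. -/
theorem hasDerivAt_inner_of_mild (S : IsometricFlow 𝕜 H) {p q : H}
    (hp : ∀ t, HasDerivAt (fun s => S s p) (S t q) t) {z : ℝ → H} {f : H} {t : ℝ}
    (hz : HasDerivAt z (S (-t) f) t) :
    HasDerivAt (fun s => inner 𝕜 p (S s (z s))) (-inner 𝕜 q (S t (z t)) + inner 𝕜 p f) t := by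
  rw [← hasDerivWithinAt_univ] at *
  have hd : HasDerivAt (fun s => S (-s) p - S (-t) p) (-(S (-t) q)) t := by
    have := (hp (-t)).scomp t (hasDerivAt_neg t)
    simpa [Function.comp_def] using this.sub_const (S (-t) p)
  have h1 := hasDerivWithinAt_inner_of_eq_zero (𝕜 := 𝕜) (hd.hasDerivWithinAt (s := univ))
    (sub_self _) hz.continuousWithinAt
  have h2 := h1.add (hasDerivWithinAt_inner_const (𝕜 := 𝕜) (S (-t) p) hz)
  have e : (fun s => inner 𝕜 p (S s (z s))) =
      (fun s => inner 𝕜 (S (-s) p - S (-t) p) (z s)) + fun s => inner 𝕜 (S (-t) p) (z s) := by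
    funext r
    rw [S.inner_map_eq, Pi.add_apply, inner_sub_left, sub_add_cancel]
  rw [e]
  convert h2 using 1
  rw [S.inner_map_map, S.inner_map_eq, inner_neg_left]

end Mild

/-- Differentiation of `s ↦ D s (w s) - D t (w s)` at `t`, for time-dependent linear forms `D s`
whose weak derivative `D' s` is locally bounded, along a curve `w` that is merely continuous. -/
theorem hasDerivAt_sub_of_weak {N : Type*} [NormedAddCommGroup N] [NormedSpace ℝ N]
    {D : ℝ → N →ₗ[ℝ] ℝ} {D' : ℝ → N → ℝ} (hD : ∀ w s, HasDerivAt (fun r => D r w) (D' s w) s)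
    {t C : ℝ} (hC : ∀ᶠ s in 𝓝 t, ∀ w, |D' s w| ≤ C * ‖w‖) {w : ℝ → N} (hw : ContinuousAt w t) :
    HasDerivAt (fun s => D s (w s) - D t (w s)) (D' t (w t)) t := by
  have h1 : HasDerivAt (fun s => D s (w t) - D t (w t)) (D' t (w t)) t :=
    (hD (w t) t).sub_const _
  have h2 : HasDerivAt (fun s => D s (w s - w t) - D t (w s - w t)) 0 t := by
    rw [hasDerivAt_iff_isLittleO]
    simp only [sub_self, map_zero, sub_zero, smul_zero]
    rw [Asymptotics.isLittleO_iff]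
    intro ε hε
    obtain ⟨r, hr, hball⟩ := Metric.eventually_nhds_iff_ball.1 hC
    have h3 : Tendsto (fun s => C * ‖w s - w t‖) (𝓝 t) (𝓝 0) := by
      have := ((hw.tendsto.sub_const (w t)).norm).const_mul C
      simpa using this
    filter_upwards [h3.eventually_le_const hε, Metric.ball_mem_nhds t hr] with s hs hst
    have h4 := (convex_ball t r).norm_image_sub_le_of_norm_hasDerivWithin_le (𝕜 := ℝ)
      (f := fun s' => D s' (w s - w t)) (f' := fun s' => D' s' (w s - w t))
      (fun s' _ => (hD _ s').hasDerivWithinAt) (fun s' hs' => hball s' hs' (w s - w t))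
      (Metric.mem_ball_self hr) hst
    exact h4.trans (by gcongr)
  have h3 := h1.add h2
  rw [add_zero] at h3
  refine h3.congr_of_eventuallyEq (Eventually.of_forall fun s => ?_)
  simp only [map_sub, Pi.add_apply]
  ring

/-! ### Global solutions of ordinary differential equations -/

section ODE

variable {E : Type*} [NormedAddCommGroup E] [NormedSpace ℝ E]

/-- A bounded, globally Lipschitz, time-dependent vector field has global integral curves. -/
theorem exists_global_integralCurve [CompleteSpace E] (f : ℝ → E → E) {K : NNReal}
    (hLip : ∀ t, LipschitzWith K (f t)) (hcont : ∀ x, Continuous fun t => f t x) {M : NNReal}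
    (hM : ∀ t x, ‖f t x‖ ≤ M) (x₀ : E) :
    ∃ z : ℝ → E, z 0 = x₀ ∧ ∀ t, HasDerivAt z (f t (z t)) t := by
  have hloc : ∀ n : ℕ, ∃ z : ℝ → E, z 0 = x₀ ∧ ∀ t ∈ Ioo (-((n : ℝ) + 1)) ((n : ℝ) + 1),
      HasDerivAt z (f t (z t)) t := by
    intro n
    have h0 : (0 : ℝ) ∈ Icc (-((n : ℝ) + 1)) ((n : ℝ) + 1) := ⟨by linarith [n.cast_nonneg (α := ℝ)],
      by positivity⟩
    have hPL : IsPicardLindelof f (⟨0, h0⟩ : Icc (-((n : ℝ) + 1)) ((n : ℝ) + 1)) x₀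
        (M * (n + 1)) 0 M K :=
      { lipschitzOnWith := fun t _ => (hLip t).lipschitzOnWith
        continuousOn := fun x _ => (hcont x).continuousOn
        norm_le := fun t _ x _ => hM t x
        mul_max_le := by simp }
    obtain ⟨z, hz0, hz⟩ := hPL.exists_eq_forall_mem_Icc_hasDerivWithinAt₀
    exact ⟨z, hz0, fun t ht => (hz t (Ioo_subset_Icc_self ht)).hasDerivAt (Icc_mem_nhds ht.1 ht.2)⟩
  choose z hz0 hz using hloc
  have hagree : ∀ n m : ℕ, n ≤ m → EqOn (z n) (z m) (Ioo (-((n : ℝ) + 1)) ((n : ℝ) + 1)) := by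
    intro n m hnm
    have hnm' : (n : ℝ) ≤ m := by exact_mod_cast hnm
    refine ODE_solution_unique_of_mem_Ioo (v := f) (s := fun _ => univ) (K := K)
      (fun t _ => (hLip t).lipschitzOnWith) (t₀ := 0)
      ⟨by linarith [n.cast_nonneg (α := ℝ)], by positivity⟩
      (fun t ht => ⟨hz n t ht, mem_univ _⟩)
      (fun t ht => ⟨hz m t ⟨by linarith [ht.1], by linarith [ht.2]⟩, mem_univ _⟩) ?_
    rw [hz0, hz0]
  refine ⟨fun t => z ⌈|t|⌉₊ t, by simp [hz0], fun t => ?_⟩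
  set n : ℕ := ⌈|t|⌉₊ + 1 with hn
  have ht : |t| < n := by
    have := Nat.le_ceil |t|
    rw [hn]; push_cast; linarith
  have heq : ∀ s : ℝ, |s| < n → z ⌈|s|⌉₊ s = z n s := by
    intro s hs
    have h1 : ⌈|s|⌉₊ ≤ n := Nat.ceil_le.2 hs.le
    refine hagree _ _ h1 ?_
    have := Nat.le_ceil |s|
    rw [mem_Ioo, ← abs_lt]; linarith
  beta_reduce
  rw [heq t ht]
  refine (hz n t ?_).congr_of_eventuallyEq ?_
  · rw [mem_Ioo, ← abs_lt]; linarith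
  · have : Tendsto (fun s : ℝ => |s|) (𝓝 t) (𝓝 |t|) := continuous_abs.tendsto t
    filter_upwards [this.eventually_lt_const ht] with s hs using heq s hs

/-- The radial retraction of a normed space onto the closed ball of radius `R`. -/
def radialRetraction (R : ℝ) (x : E) : E := min 1 (R / ‖x‖) • x

theorem radialRetraction_of_norm_le {R : ℝ} {x : E} (hx : ‖x‖ ≤ R) : radialRetraction R x = x := by
  rcases eq_or_ne x 0 with rfl | h0
  · simp [radialRetraction]
  · rw [radialRetraction, min_eq_left, one_smul]
    rwa [one_le_div (norm_pos_iff.2 h0)]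

theorem norm_radialRetraction_le {R : ℝ} (hR : 0 ≤ R) (x : E) : ‖radialRetraction R x‖ ≤ R := by
  rcases eq_or_ne x 0 with rfl | h0
  · simpa [radialRetraction] using hR
  · have hx := norm_pos_iff.2 h0
    rw [radialRetraction, norm_smul, Real.norm_of_nonneg (le_min zero_le_one (by positivity))]
    calc _ ≤ R / ‖x‖ * ‖x‖ := by gcongr; exact min_le_right _ _
      _ = R := by field_simp

theorem norm_radialRetraction_sub_le {R : ℝ} (hR : 0 < R) (x y : E) :
    ‖radialRetraction R x - radialRetraction R y‖ ≤ 2 * ‖x - y‖ := by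
  wlog hxy : ‖x‖ ≤ ‖y‖ generalizing x y
  · rw [norm_sub_rev, norm_sub_rev x y]
    exact this y x (le_of_not_ge hxy)
  rcases le_or_gt ‖y‖ R with hy | hy
  · rw [radialRetraction_of_norm_le hy, radialRetraction_of_norm_le (hxy.trans hy)]
    linarith [norm_nonneg (x - y)]
  have hy0 : 0 < ‖y‖ := hR.trans hy
  have hsub : ‖y‖ - ‖x‖ ≤ ‖x - y‖ := by rw [norm_sub_rev]; exact norm_sub_norm_le _ _
  have hyr : radialRetraction R y = (R / ‖y‖) • y := by
    rw [radialRetraction, min_eq_right]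
    exact (div_le_one hy0).2 hy.le
  -- compare both retractions through `(R / ‖y‖) • x`
  have hyx : ‖(R / ‖y‖) • x - (R / ‖y‖) • y‖ ≤ ‖x - y‖ := by
    rw [← smul_sub, norm_smul, Real.norm_of_nonneg (by positivity)]
    exact mul_le_of_le_one_left (norm_nonneg _) ((div_le_one hy0).2 hy.le)
  have hxx : ‖radialRetraction R x - (R / ‖y‖) • x‖ ≤ ‖x - y‖ := by
    rcases le_or_gt ‖x‖ R with hx | hx
    · rw [radialRetraction_of_norm_le hx]
      have e : x - (R / ‖y‖) • x = (1 - R / ‖y‖) • x := by rw [sub_smul, one_smul]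
      rw [e, norm_smul, Real.norm_of_nonneg (sub_nonneg.2 ((div_le_one hy0).2 hy.le))]
      have : (1 - R / ‖y‖) * ‖x‖ ≤ ‖y‖ - ‖x‖ := by
        rw [one_sub_div hy0.ne', div_mul_eq_mul_div, div_le_iff₀ hy0]
        nlinarith [norm_nonneg x]
      linarith
    · have hx0 : 0 < ‖x‖ := hR.trans hx
      have hxr : radialRetraction R x = (R / ‖x‖) • x := by
        rw [radialRetraction, min_eq_right]
        exact (div_le_one hx0).2 hx.le
      have hnn : 0 ≤ R / ‖x‖ - R / ‖y‖ := sub_nonneg.2 (by gcongr)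
      rw [hxr, ← sub_smul, norm_smul, Real.norm_of_nonneg hnn]
      have : (R / ‖x‖ - R / ‖y‖) * ‖x‖ = R / ‖y‖ * (‖y‖ - ‖x‖) := by field_simp
      rw [this]
      calc _ ≤ 1 * (‖y‖ - ‖x‖) := by
            gcongr
            exact (div_le_one hy0).2 hy.le
        _ ≤ _ := by linarith
  calc _ = ‖(radialRetraction R x - (R / ‖y‖) • x) + ((R / ‖y‖) • x - (R / ‖y‖) • y)‖ := by
        rw [hyr, sub_add_sub_cancel]
    _ ≤ _ := (norm_add_le _ _).trans (by linarith)

end ODE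

/-- The continuity method: a continuous function that starts below `r`, and is below `r` at every
time up to which it is at most `r`, stays below `r`. -/
theorem lt_of_continuity {f : ℝ → ℝ} (hf : ContinuousOn f (Ici 0)) {r : ℝ} (h0 : f 0 < r)
    (h : ∀ T, 0 ≤ T → (∀ t ∈ Icc 0 T, f t ≤ r) → f T < r) {t : ℝ} (ht : 0 ≤ t) : f t < r := by
  by_contra! hcon
  have hcont : ContinuousOn f (Icc 0 t) := hf.mono Icc_subset_Ici_self
  set s : Set ℝ := Icc 0 t ∩ f ⁻¹' Ici r with hs
  have hclosed : IsClosed s := hcont.preimage_isClosed_of_isClosed isClosed_Icc isClosed_Ici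
  have hne : s.Nonempty := ⟨t, ⟨ht, le_rfl⟩, hcon⟩
  have hbdd : BddBelow s := ⟨0, fun x hx => hx.1.1⟩
  -- the first time at which `f` reaches `r`
  set T := sInf s with hT
  have hTs : T ∈ s := hclosed.csInf_mem hne hbdd
  refine absurd (h T hTs.1.1 fun τ hτ => ?_) (not_lt.2 hTs.2)
  rcases hτ.2.lt_or_eq with hlt | rfl
  · by_contra! hgt
    exact absurd (csInf_le hbdd (show τ ∈ s from ⟨⟨hτ.1, hτ.2.trans hTs.1.2⟩, hgt.le⟩))
      (not_le.2 hlt)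
  · -- otherwise `f` takes the value `r` strictly before `T`
    by_contra! hgt
    obtain ⟨τ', hτ', hr⟩ := intermediate_value_Icc hTs.1.1
      (hcont.mono (Icc_subset_Icc le_rfl hTs.1.2)) ⟨h0.le, hgt.le⟩
    have h1 : T ≤ τ' := csInf_le hbdd ⟨⟨hτ'.1, hτ'.2.trans hTs.1.2⟩, hr.ge⟩
    have h2 : τ' = T := le_antisymm hτ'.2 h1
    rw [h2] at hr
    linarith

/-! ### Correlations and test functions on `ℝ^n` -/

section Correlation

variable {n : ℕ} {p q : ℝ≥0∞} {f k ρ : Space n → ℝ}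

theorem memLp_comp_sub (hk : MemLp k q) (w : Space n) : MemLp (fun z => k (z - w)) q :=
  hk.comp_measurePreserving (measurePreserving_sub_right volume w)

/-- The correlation `w ↦ ∫ f(z) k(z - w) dz` of conjugate `L^p` functions is continuous. -/
theorem continuous_correlation [Fact (1 ≤ p)] [Fact (1 ≤ q)] [p.HolderConjugate q] (hq : q ≠ ⊤)
    (hf : MemLp f p) (hk : MemLp k q) : Continuous fun w => ∫ z, f z * k (z - w) := by
  let g : Space n → C(Space n, Space n) := fun w => ⟨fun z => z - w, by fun_prop⟩
  have hg : Continuous g :=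
    ContinuousMap.continuous_of_continuous_uncurry _ (by
      change Continuous fun x : Space n × Space n => x.2 - x.1
      fun_prop)
  have hgm : ∀ w, MeasurePreserving (g w) (volume : Measure (Space n)) volume :=
    fun w => measurePreserving_sub_right volume w
  have h1 : Continuous fun w => Lp.compMeasurePreserving (g w) (hgm w) (hk.toLp k) :=
    (continuous_const (y := hk.toLp k)).compMeasurePreservingLp hg hgm hq
  have h2 := ((ContinuousLinearMap.mul ℝ ℝ).lpPairing (volume : Measure (Space n)) p q
    (hf.toLp f)).continuous.comp h1
  refine h2.congr fun w => ?_
  simp only [Function.comp_apply, ContinuousLinearMap.lpPairing_eq_integral]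
  refine integral_congr_ae ?_
  have h3 := (hgm w).quasiMeasurePreserving.ae_eq_comp hk.coeFn_toLp
  filter_upwards [hf.coeFn_toLp, Lp.coeFn_compMeasurePreserving (hk.toLp k) (hgm w), h3]
    with z h4 h5 h6
  rw [h4, h5, h6]
  rfl

theorem norm_integral_mul_le [p.HolderConjugate q] (hf : MemLp f p) (hk : MemLp k q) :
    ∫ z, ‖f z * k z‖ ≤ (eLpNorm f p).toReal * (eLpNorm k q).toReal := by
  have h1 : eLpNorm (fun z => f z * k z) 1 volume ≤ (1 : NNReal) * eLpNorm f p * eLpNorm k q :=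
    eLpNorm_le_eLpNorm_mul_eLpNorm_of_nnnorm hf.1 hk.1 (fun a b => a * b) 1
      (Eventually.of_forall fun z => by simp)
  have hint : Integrable (fun z => f z * k z) := hf.integrable_mul hk
  rw [integral_norm_eq_lintegral_enorm hint.1, ← eLpNorm_one_eq_lintegral_enorm,
    ← ENNReal.toReal_mul]
  refine ENNReal.toReal_mono (ENNReal.mul_ne_top hf.2.ne hk.2.ne) ?_
  simpa using h1

/-- Integrating `f` against a mollification of `k` amounts to averaging their correlation. -/
theorem integral_mul_mollify [p.HolderConjugate q] (hf : MemLp f p) (hk : MemLp k q)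
    (hρ : Integrable ρ) :
    Integrable (fun z => f z * ∫ w, k (z - w) * ρ w) ∧
    ∫ z, f z * ∫ w, k (z - w) * ρ w = ∫ w, ρ w * ∫ z, f z * k (z - w) := by
  have hmeas : AEStronglyMeasurable (fun x : Space n × Space n => f x.1 * (k (x.1 - x.2) * ρ x.2))
      ((volume : Measure (Space n)).prod volume) := by
    refine hf.1.comp_fst.mul (AEStronglyMeasurable.mul ?_ hρ.1.comp_snd)
    exact hk.1.comp_quasiMeasurePreserving
      (quasiMeasurePreserving_sub (volume : Measure (Space n)) volume)
  have hint : Integrable (fun x : Space n × Space n => f x.1 * (k (x.1 - x.2) * ρ x.2))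
      ((volume : Measure (Space n)).prod volume) := by
    rw [integrable_prod_iff' hmeas]
    refine ⟨Eventually.of_forall fun w => ?_, ?_⟩
    · have := (hf.integrable_mul (memLp_comp_sub hk w)).mul_const (ρ w)
      exact this.congr (Eventually.of_forall fun z => mul_assoc _ _ _)
    · refine (hρ.norm.const_mul ((eLpNorm f p).toReal * (eLpNorm k q).toReal)).mono'
        hmeas.norm.prod_swap.integral_prod_right' (Eventually.of_forall fun w => ?_)
      have h1 := norm_integral_mul_le hf (memLp_comp_sub hk w)
      have h0 : eLpNorm (fun z => k (z - w)) q volume = eLpNorm k q volume :=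
        eLpNorm_comp_measurePreserving hk.1 (measurePreserving_sub_right volume w)
      rw [h0] at h1
      have h2 : ∫ z, ‖f z * (k (z - w) * ρ w)‖ = (∫ z, ‖f z * k (z - w)‖) * ‖ρ w‖ := by
        rw [← integral_mul_const]
        refine integral_congr_ae (Eventually.of_forall fun z => ?_)
        simp only [← mul_assoc, norm_mul]
      rw [h2, Real.norm_of_nonneg (by positivity)]
      gcongr
  have e : ∀ z, ∫ w, f z * (k (z - w) * ρ w) = f z * ∫ w, k (z - w) * ρ w :=
    fun z => integral_const_mul _ _
  refine ⟨?_, ?_⟩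
  · simpa only [e] using hint.integral_prod_left
  · have := integral_integral_swap (f := fun z w => f z * (k (z - w) * ρ w)) hint
    simp only [e] at this
    rw [this]
    refine integral_congr_ae (Eventually.of_forall fun w => ?_)
    simp only [← mul_assoc, integral_mul_const]
    ring

end Correlation

section TestFunctions

variable {n : ℕ}

/-- Compactly supported smooth functions on `ℝ^n`. -/
def IsTest (η : Space n → ℝ) : Prop := ContDiff ℝ ∞ η ∧ HasCompactSupport η

theorem IsTest.add {η θ : Space n → ℝ} (h : IsTest η) (h' : IsTest θ) :
    IsTest fun z => η z + θ z := ⟨h.1.add h'.1, h.2.add h'.2⟩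

theorem IsTest.const_mul {η : Space n → ℝ} (h : IsTest η) (a : ℝ) :
    IsTest fun z => a * η z := ⟨contDiff_const.mul h.1, h.2.mul_left⟩

theorem IsTest.differentiable {η : Space n → ℝ} (h : IsTest η) : Differentiable ℝ η :=
  h.1.differentiable (by simp)

theorem IsTest.memLp {η : Space n → ℝ} (h : IsTest η) (p : ℝ≥0∞) : MemLp η p :=
  h.1.continuous.memLp_of_hasCompactSupport h.2

theorem IsTest.fderiv_apply {η : Space n → ℝ} (h : IsTest η) (v : Space n) :
    IsTest fun z => fderiv ℝ η z v :=
  ⟨(h.1.fderiv_right (m := ∞) (by simp)).clm_apply contDiff_const,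
    hasCompactSupport_fderiv_test h.2 v⟩

theorem gradient_apply {η : Space n → ℝ} (z : Space n) (j : Fin n) :
    gradient η z j = fderiv ℝ η z (EuclideanSpace.single j 1) := by
  have h : inner ℝ (EuclideanSpace.single j (1 : ℝ)) (gradient η z) = gradient η z j := by
    rw [EuclideanSpace.inner_single_left]; simp
  rw [← h, real_inner_comm, gradient, InnerProductSpace.toDual_symm_apply]

theorem inner_gradient (v : Space n) {η : Space n → ℝ} (z : Space n) :
    inner ℝ v (gradient η z) = ∑ j, v j * fderiv ℝ η z (EuclideanSpace.single j 1) := by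
  rw [PiLp.inner_apply]
  refine Finset.sum_congr rfl fun j _ => ?_
  rw [gradient_apply]
  simp [mul_comm]

theorem norm_gradient {η : Space n → ℝ} (z : Space n) : ‖gradient η z‖ = ‖fderiv ℝ η z‖ := by
  simp [gradient]

theorem IsTest.continuous_gradient {η : Space n → ℝ} (h : IsTest η) :
    Continuous fun z => gradient η z :=
  (InnerProductSpace.toDual ℝ (Space n)).symm.continuous.comp (h.1.continuous_fderiv (by simp))

theorem IsTest.memLp_gradient {η : Space n → ℝ} (h : IsTest η) (p : ℝ≥0∞) :
    MemLp (fun z => gradient η z) p := by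
  refine h.continuous_gradient.memLp_of_hasCompactSupport ?_
  exact (h.2.fderiv (𝕜 := ℝ)).comp_left
    (g := (InnerProductSpace.toDual ℝ (Space n)).symm) (map_zero _)

theorem IsTest.isWeakGradient {η : Space n → ℝ} (h : IsTest η) :
    Space.IsWeakGradient η (gradient η) := by
  intro θ hθ hθs j
  have hT : IsTest θ := ⟨hθ, hθs⟩
  have := integral_mul_fderiv_eq_neg_fderiv_mul_of_integrable
    (μ := (volume : Measure (Space n))) (f := η) (g := θ) (v := EuclideanSpace.single j (1 : ℝ))
    (((h.fderiv_apply _).memLp 2).integrable_mul (hT.memLp 2))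
    ((h.memLp 2).integrable_mul ((hT.fderiv_apply _).memLp 2))
    ((h.memLp 2).integrable_mul (hT.memLp 2)) (fun z _ => h.differentiable z)
    (fun z _ => hT.differentiable z)
  rw [this]
  simp only [gradient_apply]

end TestFunctions

/-! ### Extension of weak identities from test functions to the energy space -/

section Extension

variable {n : ℕ}

/-- The mollification `φ ⋆ ρ` of a function with a weak gradient is smooth, and its gradient is the
mollification of the weak gradient. -/
theorem fderiv_mollify {p : ℝ≥0∞} (hp : 1 ≤ p) {φ : Space n → ℝ} (hφ : MemLp φ p)
    {Gφ : Space n → Space n} (hw : Space.IsWeakGradient φ Gφ) {ρ : Space n → ℝ} (hρ : IsTest ρ) :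
    ContDiff ℝ ∞ (fun z => ∫ w, φ (z - w) * ρ w) ∧
    ∀ z j, fderiv ℝ (fun z => ∫ w, φ (z - w) * ρ w) z (EuclideanSpace.single j 1)
      = ∫ w, Gφ (z - w) j * ρ w := by
  have hloc : LocallyIntegrable φ volume := hφ.locallyIntegrable hp
  have e : (fun z => ∫ w, φ (z - w) * ρ w) =
      convolution ρ φ (ContinuousLinearMap.mul ℝ ℝ) volume := by
    funext z
    simp [convolution, mul_comm]
  refine ⟨e ▸ hρ.2.contDiff_convolution_left _ hρ.1 hloc, fun z j => ?_⟩
  have hd := hρ.2.hasFDerivAt_convolution_left (ContinuousLinearMap.mul ℝ ℝ)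
    (hρ.1.of_le (by simp)) hloc z
  have hint := (hρ.2.fderiv (𝕜 := ℝ)).convolutionExists_left
    (ContinuousLinearMap.precompL (Space n) (ContinuousLinearMap.mul ℝ ℝ))
    (hρ.1.continuous_fderiv (by simp)) hloc z
  rw [e, hd.fderiv]
  have h1 : (convolution (fderiv ℝ ρ) φ (ContinuousLinearMap.precompL (Space n)
      (ContinuousLinearMap.mul ℝ ℝ)) volume z) (EuclideanSpace.single j 1)
      = ∫ t, φ (z - t) * fderiv ℝ ρ t (EuclideanSpace.single j 1) := by
    simp only [convolution]
    rw [ContinuousLinearMap.integral_apply hint]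
    refine integral_congr_ae (Eventually.of_forall fun t => ?_)
    simp [ContinuousLinearMap.precompL_apply, mul_comm]
  rw [h1]
  have hT : IsTest fun t => ρ (z - t) :=
    ⟨hρ.1.comp (contDiff_const.sub contDiff_id), hρ.2.comp_homeomorph (Homeomorph.subLeft z)⟩
  have h2 := hw _ hT.1 hT.2 j
  have h3 : ∀ t, fderiv ℝ (fun t => ρ (z - t)) t (EuclideanSpace.single j 1)
      = -fderiv ℝ ρ (z - t) (EuclideanSpace.single j 1) := by
    intro t
    have h4 : HasFDerivAt (fun t => ρ (z - t)) _ t :=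
      (hρ.differentiable (z - t)).hasFDerivAt.comp t ((hasFDerivAt_id t).const_sub z)
    rw [h4.fderiv]
    simp
  simp only [h3, mul_neg, integral_neg, neg_inj] at h2
  rw [← integral_sub_left_eq_self _ _ z,
    ← integral_sub_left_eq_self (fun w => Gφ (z - w) j * ρ w) _ z]
  simpa only [sub_sub_cancel] using h2

theorem sum_integral_add_integral {α ι : Type*} [MeasurableSpace α] {μ : Measure α} [Fintype ι]
    {f g : ι → α → ℝ} (hf : ∀ j, Integrable (f j) μ) (hg : ∀ j, Integrable (g j) μ) :
    Integrable (fun x => ∑ j, (f j x + g j x)) μ ∧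
    ∑ j, ((∫ x, f j x ∂μ) + ∫ x, g j x ∂μ) = ∫ x, ∑ j, (f j x + g j x) ∂μ := by
  refine ⟨integrable_finsetSum _ fun j _ => (hf j).add (hg j), ?_⟩
  refine Eq.trans ?_ (integral_finsetSum _ fun j _ => (hf j).add (hg j)).symm
  exact Finset.sum_congr rfl fun j _ => (integral_add (hf j) (hg j)).symm

/-- The localized form of the extension: a weak identity for test functions extends to `χ φ`, for
a cutoff function `χ`. -/
theorem weak_identity_cutoff {r r' s s' : ℝ≥0∞} [Fact (1 ≤ r)] [Fact (1 ≤ r')]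
    [Fact (1 ≤ s)] [Fact (1 ≤ s')] [r'.HolderConjugate r] [s'.HolderConjugate s]
    (hr : r ≠ ⊤) (hs : s ≠ ⊤) {g φ : Space n → ℝ} {G Gφ : Space n → Space n}
    (hΛ : ∀ η : Space n → ℝ, IsTest η → (∫ z, g z * η z) + (∫ z, inner ℝ (G z) (gradient η z)) = 0)
    (hg : MemLp g r') (hφr : MemLp φ r) (hφs : MemLp φ s) (hG : ∀ j, MemLp (fun z => G z j) 2)
    (hGφ : ∀ j, MemLp (fun z => Gφ z j) 2) (hw : Space.IsWeakGradient φ Gφ)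
    {χ : Space n → ℝ} (hχ : IsTest χ)
    (hGχ : ∀ j, MemLp (fun z => G z j * fderiv ℝ χ z (EuclideanSpace.single j 1)) s') :
    (∫ z, (g z * χ z) * φ z) + ∑ j, ((∫ z, (G z j * χ z) * Gφ z j)
      + ∫ z, (G z j * fderiv ℝ χ z (EuclideanSpace.single j 1)) * φ z) = 0 := by
  have hgχ : MemLp (fun z => g z * χ z) r' := (hχ.memLp ⊤).mul' hg (r := r')
  have hGχ' : ∀ j, MemLp (fun z => G z j * χ z) 2 := fun j => (hχ.memLp ⊤).mul' (hG j)
  set I : Space n → ℝ := fun w => (∫ z, (g z * χ z) * φ (z - w))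
    + ∑ j, ((∫ z, (G z j * χ z) * Gφ (z - w) j)
      + ∫ z, (G z j * fderiv ℝ χ z (EuclideanSpace.single j 1)) * φ (z - w)) with hI
  have c0 := continuous_correlation hr hgχ hφr
  have c1 := fun j => continuous_correlation (p := 2) (by simp) (hGχ' j) (hGφ j)
  have c2 := fun j => continuous_correlation hs (hGχ j) hφs
  have hIc : Continuous I :=
    c0.add (continuous_finsetSum _ fun j _ => (c1 j).add (c2 j))
  suffices h : I = 0 by
    have := congrFun h 0
    simpa [hI] using this
  have hae : I =ᵐ[volume] 0 := by
    refine ae_eq_zero_of_integral_contDiff_smul_eq_zero hIc.locallyIntegrable fun ρ hρ1 hρ2 => ?_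
    have hρ : IsTest ρ := ⟨hρ1, hρ2⟩
    have hρi : Integrable ρ := memLp_one_iff_integrable.1 (hρ.memLp 1)
    obtain ⟨hm, hmd⟩ := fderiv_mollify Fact.out hφs hw hρ
    set m : Space n → ℝ := fun z => ∫ w, φ (z - w) * ρ w with hm_def
    obtain ⟨i0, e0⟩ := integral_mul_mollify hgχ hφr hρi
    have i1 := fun j => (integral_mul_mollify (p := 2) (hGχ' j) (hGφ j) hρi).1
    have e1 := fun j => (integral_mul_mollify (p := 2) (hGχ' j) (hGφ j) hρi).2
    have i2 := fun j => (integral_mul_mollify (hGχ j) hφs hρi).1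
    have e2 := fun j => (integral_mul_mollify (hGχ j) hφs hρi).2
    have hη : IsTest fun z => χ z * m z := ⟨hχ.1.mul hm, hχ.2.mul_right⟩
    have key := hΛ _ hη
    have hd : ∀ z j, fderiv ℝ (fun z => χ z * m z) z (EuclideanSpace.single j 1)
        = χ z * (∫ w, Gφ (z - w) j * ρ w) + fderiv ℝ χ z (EuclideanSpace.single j 1) * m z := by
      intro z j
      have h1 : DifferentiableAt ℝ m z := hm.differentiable (by simp) z
      rw [fderiv_fun_mul hχ.differentiable.differentiableAt h1]
      simp only [add_apply, smul_apply, smul_eq_mul, hmd]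
      ring
    have k1 : ∫ z, g z * (χ z * m z) = ∫ w, ρ w * ∫ z, (g z * χ z) * φ (z - w) := by
      rw [← e0]
      simp only [mul_assoc, hm_def]
    have k2 : ∫ z, inner ℝ (G z) (gradient (fun z => χ z * m z) z)
        = ∑ j, ((∫ w, ρ w * ∫ z, (G z j * χ z) * Gφ (z - w) j)
          + ∫ w, ρ w * ∫ z, (G z j * fderiv ℝ χ z (EuclideanSpace.single j 1)) * φ (z - w)) := by
      simp only [← e1, ← e2]
      rw [(sum_integral_add_integral i1 i2).2]
      refine integral_congr_ae (Eventually.of_forall fun z => ?_)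
      simp only [inner_gradient, hd]
      refine Finset.sum_congr rfl fun j _ => ?_
      simp only [hm_def]
      ring
    have cont_int : ∀ c : Space n → ℝ, Continuous c → Integrable fun w => ρ w * c w := fun c hc =>
      (hρ.1.continuous.mul hc).integrable_of_hasCompactSupport hρ.2.mul_right
    have k3 : ∫ w, ρ w * I w = (∫ w, ρ w * ∫ z, (g z * χ z) * φ (z - w))
        + ∑ j, ((∫ w, ρ w * ∫ z, (G z j * χ z) * Gφ (z - w) j)
          + ∫ w, ρ w * ∫ z, (G z j * fderiv ℝ χ z (EuclideanSpace.single j 1)) * φ (z - w)) := by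
      have h12 := sum_integral_add_integral (fun j => cont_int _ (c1 j))
        (fun j => cont_int _ (c2 j))
      rw [h12.2, ← integral_add (cont_int _ c0) h12.1]
      refine integral_congr_ae (Eventually.of_forall fun w => ?_)
      simp only [hI, Finset.mul_sum, mul_add]
    simp only [smul_eq_mul]
    rw [k3, ← k1, ← k2, key]
  exact (hIc.ae_eq_iff_eq volume continuous_const).1 hae

end Extension

/-! ### Sobolev exponents and cutoff functions -/

section Exponents

variable {n : ℕ} [hn : Fact (3 ≤ n)]

/-- The exponent `2n / (n + 2)`, conjugate to the critical Sobolev exponent. -/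
def dualSobolevExponent (n : ℕ) : ℝ≥0∞ := ENNReal.ofReal (2 * n / (n + 2))

theorem three_le_cast : (3 : ℝ) ≤ n := by exact_mod_cast hn.out

theorem inv_sobolevExponent :
    (sobolevExponent n)⁻¹ = ENNReal.ofReal (1 / 2 - 1 / n) := by
  have h := three_le_cast (n := n)
  have h2 : (0 : ℝ) < n - 2 := by linarith
  rw [sobolevExponent, ← ENNReal.ofReal_inv_of_pos (by positivity)]
  congr 1
  field_simp

theorem inv_dualSobolevExponent :
    (dualSobolevExponent n)⁻¹ = ENNReal.ofReal (1 / 2 + 1 / n) := by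
  have h := three_le_cast (n := n)
  rw [dualSobolevExponent, ← ENNReal.ofReal_inv_of_pos (by positivity)]
  congr 1
  field_simp

theorem inv_cast_eq : ((n : ℝ≥0∞))⁻¹ = ENNReal.ofReal (1 / n) := by
  have h := three_le_cast (n := n)
  rw [← ENNReal.ofReal_natCast, ← ENNReal.ofReal_inv_of_pos (by linarith), one_div]

theorem inv_two_eq : (2 : ℝ≥0∞)⁻¹ = ENNReal.ofReal (1 / 2) := by
  rw [one_div, ENNReal.ofReal_inv_of_pos two_pos]
  simp

instance : Fact (1 ≤ sobolevExponent n) := ⟨one_lt_sobolevExponent.le⟩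

instance : (dualSobolevExponent n).HolderConjugate (sobolevExponent n) := by
  have h := three_le_cast (n := n)
  have h3 : (1 : ℝ) / n ≤ 1 / 3 := one_div_le_one_div_of_le (by norm_num) h
  refine ⟨?_⟩
  rw [inv_sobolevExponent, inv_dualSobolevExponent, ← ENNReal.ofReal_add (by positivity)
    (by linarith), inv_one, ← ENNReal.ofReal_one]
  congr 1
  ring

instance : Fact (1 ≤ dualSobolevExponent n) :=
  ⟨ENNReal.HolderConjugate.one_le _ (sobolevExponent n)⟩

instance : ENNReal.HolderTriple n 2 (dualSobolevExponent n) := by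
  refine ⟨?_⟩
  rw [inv_dualSobolevExponent, inv_cast_eq, inv_two_eq, ← ENNReal.ofReal_add (by positivity)
    (by positivity), add_comm]

/-- The exponent `n / (n - 1)`, conjugate to `n`. -/
def dimConjExponent (n : ℕ) : ℝ≥0∞ := (ENNReal.ofReal (1 - 1 / n))⁻¹

instance : ENNReal.HolderTriple (sobolevExponent n) 2 (dimConjExponent n) := by
  have h := three_le_cast (n := n)
  have h3 : (1 : ℝ) / n ≤ 1 / 3 := one_div_le_one_div_of_le (by norm_num) h
  refine ⟨?_⟩
  rw [inv_sobolevExponent, inv_two_eq, dimConjExponent, inv_inv,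
    ← ENNReal.ofReal_add (by linarith) (by positivity)]
  congr 1
  ring

instance : (dimConjExponent n).HolderConjugate n := by
  have h := three_le_cast (n := n)
  have h3 : (1 : ℝ) / n ≤ 1 / 3 := one_div_le_one_div_of_le (by norm_num) h
  refine ⟨?_⟩
  rw [inv_cast_eq, dimConjExponent, inv_inv,
    ← ENNReal.ofReal_add (by linarith) (by positivity), inv_one, ← ENNReal.ofReal_one]
  congr 1
  ring

theorem dimConjExponent_ne_top : dimConjExponent n ≠ ⊤ := by
  have h := three_le_cast (n := n)
  have h3 : (1 : ℝ) / n ≤ 1 / 3 := one_div_le_one_div_of_le (by norm_num) h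
  rw [dimConjExponent, ENNReal.inv_ne_top]
  exact (ENNReal.ofReal_pos.2 (by linarith)).ne'

end Exponents

section Extension

variable {n : ℕ}

/-- Cutoff functions, equal to `1` on larger and larger balls, whose gradients are bounded in `L^n`:
this is the scale-invariant norm. -/
theorem exists_cutoff (n : ℕ) [Fact (3 ≤ n)] : ∃ C : ℝ≥0∞, C ≠ ⊤ ∧ ∀ k : ℕ, ∃ χ : Space n → ℝ,
    IsTest χ ∧ (∀ z, |χ z| ≤ 1) ∧ (∀ z, ‖z‖ ≤ k → χ z = 1) ∧
    (∀ z, ‖z‖ < k → fderiv ℝ χ z = 0) ∧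
    ∀ j, eLpNorm (fun z => fderiv ℝ χ z (EuclideanSpace.single j 1)) n ≤ C := by
  have hn0 : (0 : ℝ) < n := by linarith [three_le_cast (n := n)]
  have hn1 : n ≠ 0 := by rintro rfl; simp at hn0
  let b : ContDiffBump (0 : Space n) := ⟨1, 2, one_pos, one_lt_two⟩
  have hb : IsTest b := ⟨b.contDiff, b.hasCompactSupport⟩
  obtain ⟨M, hM⟩ : ∃ M, ∀ z, ‖fderiv ℝ b z‖ ≤ M :=
    (hb.1.continuous_fderiv (by simp)).bounded_above_of_compact_support (hb.2.fderiv (𝕜 := ℝ))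
  have hM0 : 0 ≤ M := (norm_nonneg _).trans (hM 0)
  have hsupp : ∀ z : Space n, 2 < ‖z‖ → fderiv ℝ b z = 0 := by
    intro z hz
    refine image_eq_zero_of_notMem_tsupport fun h => ?_
    have h1 := tsupport_fderiv_subset ℝ h
    rw [b.tsupport_eq, mem_closedBall_zero_iff] at h1
    exact absurd h1 (not_le.2 hz)
  refine ⟨ENNReal.ofReal (2 * M) * (volume (Metric.ball (0 : Space n) 1)) ^ (1 / (n : ℝ)),
    ENNReal.mul_ne_top ENNReal.ofReal_ne_top
      (ENNReal.rpow_ne_top_of_nonneg (by positivity) measure_ball_lt_top.ne), fun k => ?_⟩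
  set R : ℝ := k + 1 with hR
  have hR0 : 0 < R := by positivity
  have hd : ∀ z, fderiv ℝ (fun z => b (R⁻¹ • z)) z = R⁻¹ • fderiv ℝ b (R⁻¹ • z) := by
    intro z
    rw [fderiv_comp_smul]
  have hone : ∀ z : Space n, ‖z‖ ≤ k → b (R⁻¹ • z) = 1 := by
    intro z hz
    refine b.one_of_mem_closedBall ?_
    rw [mem_closedBall_zero_iff, norm_smul, norm_inv, Real.norm_of_nonneg hR0.le,
      inv_mul_le_iff₀ hR0]
    change ‖z‖ ≤ R * 1
    linarith
  refine ⟨fun z => b (R⁻¹ • z), ⟨hb.1.comp (contDiff_const_smul _),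
    hb.2.comp_smul (inv_ne_zero hR0.ne')⟩, fun z => ?_, hone, fun z hz => ?_, fun j => ?_⟩
  · rw [abs_of_nonneg b.nonneg]
    exact b.le_one
  · have : (fun z => b (R⁻¹ • z)) =ᶠ[𝓝 z] fun _ => (1 : ℝ) := by
      filter_upwards [(continuous_norm.tendsto z).eventually_lt_const hz] with w hw
        using hone w hw.le
    rw [this.fderiv_eq]
    simp
  · have hle : ∀ z, ‖fderiv ℝ (fun z => b (R⁻¹ • z)) z (EuclideanSpace.single j 1)‖
        ≤ ‖(Metric.closedBall (0 : Space n) (2 * R)).indicator (fun _ => M / R) z‖ := by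
      intro z
      rw [hd]
      by_cases hz : z ∈ Metric.closedBall (0 : Space n) (2 * R)
      · rw [indicator_of_mem hz, Real.norm_of_nonneg (div_nonneg hM0 hR0.le)]
        refine (ContinuousLinearMap.le_opNorm _ _).trans ?_
        rw [norm_smul, norm_inv, Real.norm_of_nonneg hR0.le, PiLp.norm_single, norm_one, mul_one,
          div_eq_inv_mul]
        gcongr
        exact hM _
      · rw [mem_closedBall_zero_iff, not_le] at hz
        rw [hsupp, smul_zero]
        · simp
        · rw [norm_smul, norm_inv, Real.norm_of_nonneg hR0.le, lt_inv_mul_iff₀ hR0]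
          linarith
    refine (eLpNorm_mono hle).trans ?_
    rw [eLpNorm_indicator_const Metric.isClosed_closedBall.measurableSet
      (Nat.cast_ne_zero.2 hn1) (ENNReal.natCast_ne_top n),
      Measure.addHaar_closedBall _ _ (by positivity), ENNReal.toReal_natCast,
      finrank_euclideanSpace,
      Fintype.card_fin, ENNReal.mul_rpow_of_nonneg _ _ (by positivity),
      ENNReal.ofReal_rpow_of_nonneg (by positivity) (by positivity), ← mul_assoc]
    gcongr
    rw [one_div, Real.pow_rpow_inv_natCast (by positivity) hn1,
      Real.enorm_of_nonneg (by positivity), ← ENNReal.ofReal_mul (by positivity)]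
    refine le_of_eq ?_
    congr 1
    field_simp

/-- A weak identity `∫ g η + ∫ G · ∇η = 0` for all test functions `η` extends to the functions
`φ ∈ L^{2n/(n-2)}` with weak gradient in `L²` for which `∫ g φ` makes sense. -/
theorem weak_identity_extend [Fact (3 ≤ n)] {r r' : ℝ≥0∞} [Fact (1 ≤ r)] [Fact (1 ≤ r')]
    [r'.HolderConjugate r] (hr : r ≠ ⊤) {g φ : Space n → ℝ} {G Gφ : Space n → Space n}
    (hΛ : ∀ η : Space n → ℝ, IsTest η →
      (∫ z, g z * η z) + (∫ z, inner ℝ (G z) (gradient η z)) = 0)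
    (hg : MemLp g r') (hφr : MemLp φ r) (hφs : MemLp φ (sobolevExponent n))
    (hG : ∀ j, MemLp (fun z => G z j) 2)
    (hGφ : ∀ j, MemLp (fun z => Gφ z j) 2) (hw : Space.IsWeakGradient φ Gφ) :
    (∫ z, g z * φ z) + ∫ z, inner ℝ (G z) (Gφ z) = 0 := by
  obtain ⟨C, hC, hcut⟩ := exists_cutoff n
  choose χ hχ hχ1 hχone hχfd hχC using hcut
  have hfd : ∀ k j, MemLp (fun z => fderiv ℝ (χ k) z (EuclideanSpace.single j 1)) n :=
    fun k j => ((hχ k).fderiv_apply _).memLp _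
  have key := fun k => weak_identity_cutoff (s' := dualSobolevExponent n) hr sobolevExponent_ne_top
    hΛ hg hφr hφs hG hGφ hw (hχ k) (fun j => (hfd k j).mul' (hG j))
  have hlim1 : ∀ z, Tendsto (fun k => χ k z) atTop (𝓝 1) := by
    intro z
    refine tendsto_const_nhds.congr' ?_
    filter_upwards [eventually_ge_atTop ⌈‖z‖⌉₊] with k hk
    exact (hχone k z (Nat.ceil_le.1 hk)).symm
  have dom : ∀ {u v : Space n → ℝ}, Integrable (fun z => u z * v z) →
      Tendsto (fun k => ∫ z, (u z * χ k z) * v z) atTop (𝓝 (∫ z, u z * v z)) := by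
    intro u v huv
    have e : ∀ k z, (u z * χ k z) * v z = χ k z * (u z * v z) := fun k z => by ring
    simp only [e]
    refine tendsto_integral_of_dominated_convergence (fun z => ‖u z * v z‖)
      (fun k => (hχ k).1.continuous.aestronglyMeasurable.mul huv.1) huv.norm
      (fun k => Eventually.of_forall fun z => ?_) (Eventually.of_forall fun z => ?_)
    · rw [norm_mul]
      exact mul_le_of_le_one_left (norm_nonneg _) (hχ1 k z)
    · simpa using (hlim1 z).mul_const (u z * v z)
  have h3 : ∀ j, Tendsto (fun k => ∫ z,
      (G z j * fderiv ℝ (χ k) z (EuclideanSpace.single j 1)) * φ z) atTop (𝓝 0) := by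
    intro j
    have hh : MemLp (fun z => G z j * φ z) (dimConjExponent n) :=
      by
      simpa only [mul_comm] using (MemLp.mul' (r := dimConjExponent n) (hG j) hφs)
    rw [Metric.tendsto_atTop]
    intro ε hε
    obtain ⟨ψ, hψs, hψ, -, hψL⟩ := hh.exists_hasCompactSupport_eLpNorm_sub_le
      dimConjExponent_ne_top (ε := ENNReal.ofReal (ε / (2 * (C.toReal + 1))))
      (ENNReal.ofReal_pos.2 (by positivity)).ne'
    obtain ⟨R, hR⟩ := hψs.isCompact.isBounded.exists_norm_le
    refine ⟨⌈|R|⌉₊ + 1, fun k hk => ?_⟩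
    have hRk : R < k := by
      have h1 := Nat.le_ceil |R|
      have h2 : ((⌈|R|⌉₊ + 1 : ℕ) : ℝ) ≤ k := by exact_mod_cast hk
      push_cast at h2
      linarith [le_abs_self R]
    have hvan : ∀ z, ψ z * fderiv ℝ (χ k) z (EuclideanSpace.single j 1) = 0 := by
      intro z
      by_cases hz : z ∈ tsupport ψ
      · rw [hχfd k z ((hR z hz).trans_lt hRk)]; simp
      · rw [image_eq_zero_of_notMem_tsupport hz, zero_mul]
    have e : ∀ z, (G z j * fderiv ℝ (χ k) z (EuclideanSpace.single j 1)) * φ z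
        = (G z j * φ z - ψ z) * fderiv ℝ (χ k) z (EuclideanSpace.single j 1) := by
      intro z
      rw [sub_mul, hvan]; ring
    simp only [e, dist_zero_right]
    refine (norm_integral_le_integral_norm _).trans_lt ?_
    refine (norm_integral_mul_le (p := dimConjExponent n) (q := n)
      (hh.sub hψL) (hfd k j)).trans_lt ?_
    have b1 : (eLpNorm (fun z => G z j * φ z - ψ z) (dimConjExponent n)).toReal
        ≤ ε / (2 * (C.toReal + 1)) := ENNReal.toReal_le_of_le_ofReal (by positivity) hψ
    have b2 := ENNReal.toReal_mono hC (hχC k j)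
    calc _ ≤ ε / (2 * (C.toReal + 1)) * C.toReal := by
          gcongr
          exact b1
      _ < ε := by
          rw [div_mul_eq_mul_div, div_lt_iff₀ (by positivity)]
          nlinarith [ENNReal.toReal_nonneg (a := C)]
  have hgi : Integrable (fun z => g z * φ z) := hg.integrable_mul hφr
  have hGi : ∀ j, Integrable (fun z => G z j * Gφ z j) := fun j => (hG j).integrable_mul (hGφ j)
  have hlim := (dom hgi).add (tendsto_finsetSum Finset.univ fun j _ => (dom (hGi j)).add (h3 j))
  have hval := tendsto_nhds_unique hlim (tendsto_const_nhds.congr fun k => (key k).symm)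
  rw [← hval]
  congr 1
  simp only [add_zero]
  rw [← integral_finsetSum _ fun j _ => hGi j]
  refine integral_congr_ae (Eventually.of_forall fun z => ?_)
  simp only [PiLp.inner_apply]
  refine Finset.sum_congr rfl fun j _ => ?_
  simp [mul_comm]

end Extension

/-! ### The Hilbert space `Ḣ¹(ℝ^n)` -/

theorem inner_toLp_eq_integral_mul {n : ℕ} (G : Lp ℝ 2 (volume : Measure (Space n)))
    {θ : Space n → ℝ}
    (h : MemLp θ 2) : inner ℝ (h.toLp θ) G = ∫ z, G z * θ z := by
  rw [L2.inner_def]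
  refine integral_congr_ae ?_
  filter_upwards [h.coeFn_toLp] with z hz
  rw [hz]; simp

theorem integral_coord_mul {n : ℕ} (G : Lp (Space n) 2 (volume : Measure (Space n))) (j : Fin n)
    {θ : Space n → ℝ} (h : IsTest θ) :
    ∫ z, G z j * θ z = inner ℝ ((((h.memLp 2).toLp θ : Lp ℝ 2 (volume : Measure (Space n))))) 
      ((EuclideanSpace.proj (𝕜 := ℝ) j).compLp G) := by
  rw [inner_toLp_eq_integral_mul]
  refine integral_congr_ae ?_
  filter_upwards [(EuclideanSpace.proj (𝕜 := ℝ) j : Space n →L[ℝ] ℝ).coeFn_compLp G] with z hz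
  rw [hz]; rfl

section HDotHilbert

variable {n : ℕ} [hn : Fact (3 ≤ n)]

namespace HDot1

instance : InnerProductSpace ℝ (HDot1 n) where
  inner φ ψ := inner ℝ (grad φ) (grad ψ)
  norm_sq_eq_re_inner φ := by
    rw [norm_eq]; exact norm_sq_eq_re_inner (𝕜 := ℝ) (grad φ)
  conj_inner_symm φ ψ := inner_conj_symm (𝕜 := ℝ) (grad φ) (grad ψ)
  add_left φ ψ χ := by rw [map_add, inner_add_left]
  smul_left φ ψ a := by rw [map_smul, inner_smul_left]

theorem inner_eq (φ ψ : HDot1 n) : inner ℝ φ ψ = inner ℝ (grad φ) (grad ψ) := rfl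

/-- The gradient, an isometric embedding of `Ḣ¹` into `L²`. -/
def gradₗᵢ : HDot1 n →ₗᵢ[ℝ] Lp (Space n) 2 (volume : Measure (Space n)) where
  toLinearMap := grad
  norm_map' φ := (norm_eq φ).symm

/-- A test function as an element of `Ḣ¹`. -/
def ofTest {η : Space n → ℝ} (h : IsTest η) : HDot1 n :=
  ⟨((h.memLp _).toLp η, (h.memLp_gradient 2).toLp _), by
    intro θ hθ hθs j
    have e1 : (fun z => (h.memLp (sobolevExponent n)).toLp η z
        * fderiv ℝ θ z (EuclideanSpace.single j 1)) =ᵐ[volume]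
        fun z => η z * fderiv ℝ θ z (EuclideanSpace.single j 1) := by
      filter_upwards [(h.memLp (sobolevExponent n)).coeFn_toLp] with z hz
      rw [hz]
    have e2 : (fun z => (h.memLp_gradient 2).toLp _ z j * θ z) =ᵐ[volume]
        fun z => gradient η z j * θ z := by
      filter_upwards [(h.memLp_gradient 2).coeFn_toLp] with z hz
      rw [hz]
    rw [integral_congr_ae e1, integral_congr_ae e2]
    exact h.isWeakGradient θ hθ hθs j⟩

theorem fn_ofTest {η : Space n → ℝ} (h : IsTest η) : (ofTest h).fn = (h.memLp _).toLp η := rfl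

theorem grad_ofTest {η : Space n → ℝ} (h : IsTest η) :
    grad (ofTest h) = (h.memLp_gradient 2).toLp _ := rfl

theorem inner_grad_ofTest (G : Lp (Space n) 2 (volume : Measure (Space n))) {η : Space n → ℝ}
    (h : IsTest η) : inner ℝ G (grad (ofTest h)) = ∫ z, inner ℝ (G z) (gradient η z) := by
  rw [grad_ofTest, L2.inner_def]
  refine integral_congr_ae ?_
  filter_upwards [(h.memLp_gradient 2).coeFn_toLp] with z hz
  rw [hz]

/-- The functions of `Ḣ¹` that are test functions. -/
def testSubmodule (n : ℕ) [Fact (3 ≤ n)] : Submodule ℝ (HDot1 n) where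
  carrier := {φ | ∃ (η : Space n → ℝ) (h : IsTest η), φ = ofTest h}
  zero_mem' := by
    have h0 : IsTest (fun _ : Space n => (0 : ℝ)) := ⟨contDiff_const, HasCompactSupport.zero⟩
    refine ⟨fun _ => 0, h0, Subtype.ext (Prod.ext ?_ ?_)⟩
    · exact (MemLp.toLp_zero (h0.memLp _)).symm
    · refine Lp.ext ?_
      filter_upwards [(h0.memLp_gradient 2).coeFn_toLp, Lp.coeFn_zero (Space n) 2 volume]
        with z h1 h2
      refine h2.trans (Eq.symm (h1.trans ?_))
      simp [gradient]
  add_mem' := by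
    rintro _ _ ⟨η, h, rfl⟩ ⟨θ, h', rfl⟩
    refine ⟨fun z => η z + θ z, h.add h', Subtype.ext (Prod.ext ?_ ?_)⟩
    · exact (MemLp.toLp_add (h.memLp _) (h'.memLp _)).symm
    · refine ((MemLp.toLp_add (h.memLp_gradient 2) (h'.memLp_gradient 2)).symm).trans ?_
      refine MemLp.toLp_congr _ ((h.add h').memLp_gradient 2) (Eventually.of_forall fun z => ?_)
      change gradient η z + gradient θ z = gradient (fun z => η z + θ z) z
      simp only [gradient]
      rw [fderiv_fun_add h.differentiable.differentiableAt
        h'.differentiable.differentiableAt, map_add]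
  smul_mem' := by
    rintro a _ ⟨η, h, rfl⟩
    refine ⟨fun z => a * η z, h.const_mul a, Subtype.ext (Prod.ext ?_ ?_)⟩
    · exact (MemLp.toLp_const_smul a (h.memLp _)).symm
    · refine ((MemLp.toLp_const_smul a (h.memLp_gradient 2)).symm).trans ?_
      refine MemLp.toLp_congr _ ((h.const_mul a).memLp_gradient 2)
        (Eventually.of_forall fun z => ?_)
      change a • gradient η z = gradient (fun z => a * η z) z
      simp only [gradient]
      rw [fderiv_const_mul h.differentiable.differentiableAt, map_smul]

/-- The Sobolev inequality for test functions. -/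
theorem exists_norm_fn_le_of_test : ∃ C : ℝ, 0 ≤ C ∧ ∀ φ ∈ testSubmodule n,
    ‖φ.fn‖ ≤ C * ‖grad φ‖ := by
  have h3 := three_le_cast (n := n)
  refine ⟨SNormLESNormFDerivOfEqConst ℝ (volume : Measure (Space n)) 2, by positivity, ?_⟩
  rintro _ ⟨η, h, rfl⟩
  have hs : sobolevExponent n = ((2 * n / (n - 2) : ℝ).toNNReal : ℝ≥0∞) := rfl
  have hle := eLpNorm_le_eLpNorm_fderiv_of_eq (volume : Measure (Space n)) (p := 2)
    (p' := (2 * n / (n - 2) : ℝ).toNNReal) (h.1.of_le (by simp)) h.2 one_le_two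
    (by rw [finrank_euclideanSpace_fin]; linarith [hn.out]) (by
      rw [finrank_euclideanSpace_fin, Real.coe_toNNReal _ (by
        have : (0 : ℝ) < n - 2 := by linarith
        positivity)]
      have : (n : ℝ) - 2 ≠ 0 := by linarith
      push_cast
      field_simp)
  rw [← hs] at hle
  rw [fn_ofTest, grad_ofTest, Lp.norm_toLp, Lp.norm_toLp]
  have e : eLpNorm (fun z => gradient η z) 2 (volume : Measure (Space n))
      = eLpNorm (fderiv ℝ η) 2 volume :=
    eLpNorm_congr_norm_ae (Eventually.of_forall fun z => norm_gradient z)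
  rw [e]
  have hfin : eLpNorm (fderiv ℝ η) 2 (volume : Measure (Space n)) ≠ ⊤ := by
    rw [← e]; exact (h.memLp_gradient 2).2.ne
  have := ENNReal.toReal_mono (ENNReal.mul_ne_top ENNReal.coe_ne_top hfin) hle
  rwa [ENNReal.toReal_mul, ENNReal.coe_toReal] at this

/-- Pairing with a fixed function of the dual exponent, as a continuous functional. -/
def pairLp (n : ℕ) [Fact (3 ≤ n)] {θ : Space n → ℝ} (h : MemLp θ (dualSobolevExponent n)) :
    Lp ℝ (sobolevExponent n) (volume : Measure (Space n)) →L[ℝ] ℝ :=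
  haveI : (sobolevExponent n).HolderConjugate (dualSobolevExponent n) :=
    ENNReal.HolderConjugate.symm
  (ContinuousLinearMap.lpPairing volume (sobolevExponent n) (dualSobolevExponent n)
    (ContinuousLinearMap.mul ℝ ℝ)).flip (h.toLp θ)

theorem pairLp_apply {θ : Space n → ℝ} (h : MemLp θ (dualSobolevExponent n))
    (f : Lp ℝ (sobolevExponent n) (volume : Measure (Space n))) :
    pairLp n h f = ∫ z, f z * θ z := by
  rw [pairLp, ContinuousLinearMap.flip_apply, ContinuousLinearMap.lpPairing_eq_integral]
  refine integral_congr_ae ?_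
  filter_upwards [h.coeFn_toLp] with z hz
  rw [ContinuousLinearMap.mul_apply', hz]

/-- A limit in `L²` of gradients of test functions is the gradient of a function of `Ḣ¹`. -/
theorem exists_of_mem_closure {C : ℝ} (hC0 : 0 ≤ C)
    (hC : ∀ φ ∈ testSubmodule n, ‖φ.fn‖ ≤ C * ‖grad φ‖)
    {G : Lp (Space n) 2 (volume : Measure (Space n))}
    (hG : G ∈ closure (grad '' (testSubmodule n : Set (HDot1 n)))) :
    ∃ φ : HDot1 n, grad φ = G ∧ ‖φ.fn‖ ≤ C * ‖grad φ‖ := by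
  obtain ⟨g, hg, hlim⟩ := mem_closure_iff_seq_limit.1 hG
  choose φ hφ hφg using hg
  have hgrad : Tendsto (fun k => grad (φ k)) atTop (𝓝 G) := by simpa only [hφg] using hlim
  have hcauchy : CauchySeq fun k => (φ k).fn := by
    rw [Metric.cauchySeq_iff']
    intro ε hε
    obtain ⟨N, hN⟩ := Metric.cauchySeq_iff'.1 hgrad.cauchySeq (ε / (C + 1)) (by positivity)
    refine ⟨N, fun k hk => ?_⟩
    have h1 := hC _ ((testSubmodule n).sub_mem (hφ k) (hφ N))
    have h2 := hN k hk
    rw [dist_eq_norm, ← map_sub] at h2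
    rw [dist_eq_norm]
    calc ‖(φ k).fn - (φ N).fn‖ = ‖(φ k - φ N).fn‖ := rfl
      _ ≤ C * ‖grad (φ k - φ N)‖ := h1
      _ ≤ C * (ε / (C + 1)) := by gcongr
      _ < ε := by
        rw [mul_div_assoc', div_lt_iff₀ (by positivity)]
        nlinarith
  obtain ⟨f, hf⟩ := cauchySeq_tendsto_of_complete hcauchy
  refine ⟨⟨(f, G), ?_⟩, rfl, ?_⟩
  · intro θ hθ hθs j
    have hT : IsTest θ := ⟨hθ, hθs⟩
    have hθ1 : MemLp (fun z => fderiv ℝ θ z (EuclideanSpace.single j 1)) (dualSobolevExponent n) :=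
      (hT.fderiv_apply _).memLp _
    have l1 : Tendsto (fun k => ∫ z, (φ k).fn z * fderiv ℝ θ z (EuclideanSpace.single j 1)) atTop
        (𝓝 (∫ z, f z * fderiv ℝ θ z (EuclideanSpace.single j 1))) := by
      simp only [← pairLp_apply hθ1]
      exact ((pairLp n hθ1).continuous.tendsto _).comp hf
    have l2 : Tendsto (fun k => -∫ z, grad (φ k) z j * θ z) atTop (𝓝 (-∫ z, G z j * θ z)) := by
      simp only [integral_coord_mul _ j hT]
      refine (Tendsto.inner tendsto_const_nhds ?_).neg
      exact (((EuclideanSpace.proj (𝕜 := ℝ) j).compLpL 2 volume).continuous.tendsto _).comp hgrad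
    exact tendsto_nhds_unique l1 (l2.congr fun k => ((φ k).2 θ hθ hθs j).symm)
  · exact le_of_tendsto_of_tendsto hf.norm (hgrad.norm.const_mul C)
      (Eventually.of_forall fun k => hC _ (hφ k))

/-- Gradients of test functions are dense among the gradients: a field orthogonal to them all
has vanishing weak divergence. -/
theorem grad_mem_closure (φ : HDot1 n) :
    grad φ ∈ closure (grad '' (testSubmodule n : Set (HDot1 n))) := by
  have e : grad '' (testSubmodule n : Set (HDot1 n))
      = ((testSubmodule n).map grad : Submodule ℝ _) := rfl
  rw [e, ← Submodule.topologicalClosure_coe, SetLike.mem_coe,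
    ← Submodule.orthogonal_orthogonal_eq_closure, Submodule.mem_orthogonal]
  intro G hG
  rw [Submodule.mem_orthogonal] at hG
  have hΛ : ∀ η : Space n → ℝ, IsTest η →
      (∫ z, (0 : ℝ) * η z) + (∫ z, inner ℝ (G z) (gradient η z)) = 0 := by
    intro η h
    rw [← inner_grad_ofTest G h, real_inner_comm, hG _ ⟨_, ⟨η, h, rfl⟩, rfl⟩]
    simp
  have := weak_identity_extend (r := sobolevExponent n) (r' := dualSobolevExponent n)
    sobolevExponent_ne_top hΛ (MemLp.zero' (p := dualSobolevExponent n)) (Lp.memLp φ.fn)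
    (Lp.memLp φ.fn) (memLp_coord G) (memLp_coord (grad φ)) φ.2
  rw [L2.inner_def]
  simpa using this

/-- The Sobolev inequality on `Ḣ¹`, extended by density from test functions. -/
theorem exists_norm_fn_le (n : ℕ) [Fact (3 ≤ n)] : ∃ C : ℝ, 0 ≤ C ∧ ∀ φ : HDot1 n,
    ‖φ.fn‖ ≤ C * ‖φ‖ := by
  obtain ⟨C, hC0, hC⟩ := exists_norm_fn_le_of_test (n := n)
  refine ⟨C, hC0, fun φ => ?_⟩
  obtain ⟨ψ, h1, h2⟩ := exists_of_mem_closure hC0 hC (grad_mem_closure φ)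
  rwa [grad_injective h1] at h2

/-- Cauchy sequences of gradients converge in `L²`, and by the Sobolev inequality the functions
converge along with them. -/
instance : CompleteSpace (HDot1 n) := by
  have hc : IsClosed (range (gradₗᵢ : HDot1 n →ₗᵢ[ℝ] _)) := by
    obtain ⟨C, hC0, hC⟩ := exists_norm_fn_le_of_test (n := n)
    have : range (gradₗᵢ : HDot1 n →ₗᵢ[ℝ] _)
        = closure (grad '' (testSubmodule n : Set (HDot1 n))) := by
      refine Subset.antisymm ?_ fun G hG => ?_
      · rintro _ ⟨φ, rfl⟩
        exact grad_mem_closure φ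
      · obtain ⟨φ, h, -⟩ := exists_of_mem_closure hC0 hC hG
        exact ⟨φ, h⟩
    rw [this]
    exact isClosed_closure
  have h2 := hc.isComplete
  rw [← image_univ, LinearIsometry.isComplete_image_iff] at h2
  exact completeSpace_iff_isComplete_univ.2 h2

theorem dense_testSubmodule : Dense (testSubmodule n : Set (HDot1 n)) := by
  intro φ
  have h := grad_mem_closure φ
  have hi : IsInducing (gradₗᵢ : HDot1 n →ₗᵢ[ℝ] _) :=
    gradₗᵢ.isometry.isUniformInducing.isInducing
  rw [hi.closure_eq_preimage_closure_image]
  exact h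

/-- The function, as a continuous linear map into `L^{2n/(n-2)}`. -/
def fnL : HDot1 n →L[ℝ] Lp ℝ (sobolevExponent n) (volume : Measure (Space n)) :=
  LinearMap.mkContinuousOfExistsBound
    ((LinearMap.fst ℝ _ _).comp (HDot1.graph n).subtype : HDot1 n →ₗ[ℝ] _)
    ((exists_norm_fn_le n).imp fun _ h => h.2)

/-- The Riesz representative in `Ḣ¹` of the functional `φ ↦ ∫ φ θ`; it solves `-Δ N = θ`. -/
def riesz {θ : Space n → ℝ} (h : IsTest θ) : HDot1 n :=
  (InnerProductSpace.toDual ℝ (HDot1 n)).symm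
    ((pairLp n (h.memLp (dualSobolevExponent n))).comp fnL)

theorem inner_riesz {θ : Space n → ℝ} (h : IsTest θ) (φ : HDot1 n) :
    inner ℝ (riesz h) φ = ∫ z, φ.fn z * θ z := by
  rw [riesz, InnerProductSpace.toDual_symm_apply, ContinuousLinearMap.comp_apply, pairLp_apply]
  rfl

theorem inner_ofTest {θ : Space n → ℝ} (h : IsTest θ) (φ : HDot1 n) :
    inner ℝ (ofTest h) φ = ∫ z, inner ℝ (grad φ z) (gradient θ z) := by
  rw [real_inner_comm, inner_eq, inner_grad_ofTest]

/-- The solution of `-Δ Γ = σ` is the Riesz representative of `φ ↦ ∫ σ φ`. -/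
theorem eq_riesz_of_isInverseLaplacian {σ : Space n → ℝ} (hσ : IsTest σ) {Γ : HDot1 n}
    (hΓ : IsInverseLaplacian σ Γ) : Γ = riesz hσ := by
  refine ext_inner_right ℝ fun φ => ?_
  have hΛ : ∀ η : Space n → ℝ, IsTest η →
      (∫ z, (-σ z) * η z) + (∫ z, inner ℝ (grad Γ z) (gradient η z)) = 0 := by
    intro η h
    rw [hΓ η h.1 h.2]
    simp only [neg_mul, integral_neg]
    ring
  have := weak_identity_extend (r := sobolevExponent n) (r' := dualSobolevExponent n)
    sobolevExponent_ne_top hΛ (hσ.memLp (dualSobolevExponent n)).neg (Lp.memLp φ.fn)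
    (Lp.memLp φ.fn) (memLp_coord (grad Γ)) (memLp_coord (grad φ)) φ.2
  simp only [neg_mul, integral_neg] at this
  rw [inner_riesz, inner_eq, L2.inner_def]
  simp only [mul_comm (φ.fn _)]
  linarith

/-- `κ = ∫ σ₂ Γ = ‖∇Γ‖²`. -/
theorem kappa_eq {σ : Space n → ℝ} (hσ : IsTest σ) {Γ : HDot1 n}
    (hΓ : IsInverseLaplacian σ Γ) : kappa σ Γ = ‖Γ‖ ^ 2 := by
  rw [← real_inner_self_eq_norm_sq, kappa]
  nth_rw 2 [eq_riesz_of_isInverseLaplacian hσ hΓ]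
  rw [inner_riesz]
  simp only [mul_comm (Γ.fn _)]

/-- A function of `L² ∩ Ḣ¹` with `p - Δp = 0` vanishes. -/
theorem eq_zero_of_sub_laplacian_eq_zero {p : Lp ℝ 2 (volume : Measure (Space n))} {F : HDot1 n}
    (h1 : ∀ b : Space n → ℝ, IsTest b → ∫ z, p z * b z = ∫ z, F.fn z * b z)
    (h2 : ∀ b : Space n → ℝ, IsTest b →
      (∫ z, p z * b z) + (∫ z, inner ℝ (grad F z) (gradient b z)) = 0) : p = 0 ∧ F = 0 := by
  have hp := (Lp.memLp p).locallyIntegrable one_le_two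
  have hF := (Lp.memLp F.fn).locallyIntegrable one_lt_sobolevExponent.le
  have hae : p =ᵐ[volume] F.fn := by
    refine ae_eq_of_integral_contDiff_smul_eq hp hF fun b hb hbs => ?_
    simpa only [smul_eq_mul, mul_comm (b _)] using h1 b ⟨hb, hbs⟩
  have hF2 : MemLp F.fn 2 := (memLp_congr_ae hae).1 (Lp.memLp p)
  have := weak_identity_extend (r := 2) (r' := 2) (by simp) h2 (Lp.memLp p) hF2
    (Lp.memLp F.fn) (memLp_coord (grad F)) (memLp_coord (grad F)) F.2
  have e1 : ∫ z, p z * F.fn z = ‖p‖ ^ 2 := by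
    rw [← real_inner_self_eq_norm_sq, L2.inner_def]
    refine integral_congr_ae ?_
    filter_upwards [hae] with z hz
    simp [hz, sq]
  have e2 : ∫ z, inner ℝ (grad F z) (grad F z) = ‖F‖ ^ 2 := by
    rw [← real_inner_self_eq_norm_sq, inner_eq, L2.inner_def]
  rw [e1, e2] at this
  constructor
  · have : ‖p‖ ^ 2 = 0 := by nlinarith [sq_nonneg ‖p‖, sq_nonneg ‖F‖]
    simpa using this
  · have : ‖F‖ ^ 2 = 0 := by nlinarith [sq_nonneg ‖p‖, sq_nonneg ‖F‖]
    simpa using this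

end HDot1

end HDotHilbert

/-! ### Diagonal unitary groups -/

theorem hilbertBasis_ext {ι H : Type*} [NormedAddCommGroup H] [InnerProductSpace ℂ H]
    (b : HilbertBasis ι ℂ H) {x y : H}
    (h : ∀ k, inner ℂ (b k) x = inner ℂ (b k) y) : x = y := by
  refine b.repr.injective (lp.ext (funext fun k => ?_))
  rw [b.repr_apply_apply, b.repr_apply_apply, h]

section Rotate

variable {ι H : Type*} [NormedAddCommGroup H] [InnerProductSpace ℂ H] [CompleteSpace H]

/-- The Hilbert basis `e^{i θ_k} b_k`. -/
def rotateBasis (b : HilbertBasis ι ℂ H) (θ : ι → ℝ) : HilbertBasis ι ℂ H :=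
  HilbertBasis.mkOfOrthogonalEqBot (v := fun k => Complex.exp (Complex.I * θ k) • b k)
    (by
      classical
      rw [orthonormal_iff_ite]
      intro i j
      rw [inner_smul_left, inner_smul_right, orthonormal_iff_ite.1 b.orthonormal i j]
      split_ifs with h
      · subst h
        rw [mul_one, ← Complex.exp_conj, ← Complex.exp_add]
        simp
      · simp)
    (by
      rw [Submodule.eq_bot_iff]
      intro x hx
      rw [Submodule.mem_orthogonal] at hx
      have h0 : ∀ k, b.repr x k = 0 := by
        intro k
        have := hx _ (Submodule.subset_span ⟨k, rfl⟩)
        rw [inner_smul_left, mul_eq_zero] at this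
        rw [b.repr_apply_apply]
        refine this.resolve_left ?_
        simp [Complex.exp_ne_zero]
      have : b.repr x = 0 := lp.ext (funext h0)
      simpa using this)

theorem rotateBasis_apply (b : HilbertBasis ι ℂ H) (θ : ι → ℝ) (k : ι) :
    rotateBasis b θ k = Complex.exp (Complex.I * θ k) • b k := by
  rw [rotateBasis, HilbertBasis.coe_mkOfOrthogonalEqBot]

/-- The isometry with `b_k ↦ e^{i θ_k} b_k`. -/
def rotateMap (b : HilbertBasis ι ℂ H) (θ : ι → ℝ) : H ≃ₗᵢ[ℂ] H :=
  b.repr.trans (rotateBasis b θ).repr.symm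

theorem inner_rotateMap (b : HilbertBasis ι ℂ H) (θ : ι → ℝ) (k : ι) (x : H) :
    inner ℂ (b k) (rotateMap b θ x) = Complex.exp (Complex.I * θ k) * inner ℂ (b k) x := by
  have h : inner ℂ (rotateBasis b θ k) (rotateMap b θ x) = inner ℂ (b k) x := by
    rw [← HilbertBasis.repr_apply_apply, rotateMap, LinearIsometryEquiv.trans_apply,
      LinearIsometryEquiv.apply_symm_apply, b.repr_apply_apply]
  rw [← h, rotateBasis_apply, inner_smul_left, ← mul_assoc, ← Complex.exp_conj, ← Complex.exp_add]
  simp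

/-- The unitary group with `b_k ↦ e^{i t θ_k} b_k`. -/
def IsometricFlow.diagonal (b : HilbertBasis ι ℂ H) (θ : ι → ℝ) : IsometricFlow ℂ H where
  toFun t := (rotateMap b fun k => t * θ k : H →L[ℂ] H)
  map_zero' x := by
    refine hilbertBasis_ext b fun k => ?_
    refine (inner_rotateMap b _ k x).trans ?_
    simp
  map_add' s t x := by
    refine hilbertBasis_ext b fun k => ?_
    refine (inner_rotateMap b _ k x).trans (Eq.symm ?_)
    refine (inner_rotateMap b _ k _).trans ?_
    refine (congrArg _ (inner_rotateMap b _ k x)).trans ?_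
    rw [← mul_assoc, ← Complex.exp_add]
    congr 2
    push_cast
    ring
  norm_map' t x := (rotateMap b _).norm_map x
  continuous' x := by
    rw [continuous_iff_continuousAt]
    intro s
    set T : ℝ → H := fun t => rotateMap b (fun k => t * θ k) x with hT
    change ContinuousAt T s
    have hn : ∀ t, ‖T t‖ = ‖x‖ := fun t => (rotateMap b _).norm_map x
    have hw : Continuous fun t => inner ℂ (T s) (T t) := by
      have e : ∀ t, inner ℂ (T s) (T t) = ∑' k, inner ℂ (T s) (b k)
          * (Complex.exp (Complex.I * ((t * θ k : ℝ) : ℂ)) * inner ℂ (b k) x) := by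
        intro t
        rw [← b.tsum_inner_mul_inner]
        refine tsum_congr fun k => ?_
        rw [hT, inner_rotateMap]
      simp only [e]
      refine continuous_tsum (fun k => by fun_prop)
        (b.summable_inner_mul_inner (T s) x).norm fun k t => ?_
      rw [norm_mul, norm_mul, norm_mul, Complex.norm_exp]
      simp
    have hsq : ∀ t, ‖T t - T s‖ ^ 2
        = 2 * ‖x‖ ^ 2 - 2 * RCLike.re (inner ℂ (T s) (T t)) := by
      intro t
      rw [@norm_sub_sq ℂ, hn, hn, inner_re_symm]
      ring
    rw [ContinuousAt, tendsto_iff_norm_sub_tendsto_zero]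
    have h2 : Tendsto (fun t => ‖T t - T s‖ ^ 2) (𝓝 s) (𝓝 0) := by
      simp only [hsq]
      have := ((RCLike.continuous_re.comp hw).tendsto s).const_mul 2 |>.const_sub (2 * ‖x‖ ^ 2)
      have e0 : 2 * ‖x‖ ^ 2 - 2 * RCLike.re (inner ℂ (T s) (T s)) = 0 := by
        rw [← norm_sq_eq_re_inner, hn]; ring
      simp only [Function.comp_apply, e0] at this
      exact this
    have h3 := h2.sqrt
    simpa [Real.sqrt_sq (norm_nonneg _)] using h3

theorem IsometricFlow.inner_diagonal (b : HilbertBasis ι ℂ H) (θ : ι → ℝ) (k : ι) (t : ℝ) (x : H) :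
    inner ℂ (b k) (diagonal b θ t x) = Complex.exp (Complex.I * (t * θ k : ℝ)) * inner ℂ (b k) x :=
  inner_rotateMap b _ k x

theorem IsometricFlow.diagonal_basis (b : HilbertBasis ι ℂ H) (θ : ι → ℝ) (k : ι) (t : ℝ) :
    diagonal b θ t (b k) = Complex.exp (Complex.I * (t * θ k : ℝ)) • b k := by
  classical
  refine hilbertBasis_ext b fun j => ?_
  rw [inner_diagonal, inner_smul_right, orthonormal_iff_ite.1 b.orthonormal j k]
  split_ifs with h
  · rw [h]
  · simp

theorem IsometricFlow.hasDerivAt_diagonal_basis (b : HilbertBasis ι ℂ H) (θ : ι → ℝ) (k : ι)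
    (t : ℝ) : HasDerivAt (fun s => diagonal b θ s (b k))
      (diagonal b θ t ((Complex.I * θ k) • b k)) t := by
  simp only [map_smul, diagonal_basis]
  have h : HasDerivAt (fun s : ℝ => Complex.exp (Complex.I * (s * θ k : ℝ)))
      (Complex.exp (Complex.I * (t * θ k : ℝ)) * (Complex.I * θ k)) t := by
    refine HasDerivAt.cexp ?_
    have := ((hasDerivAt_id t).mul_const (θ k)).ofReal_comp.const_mul Complex.I
    simpa using this
  have h2 := h.smul_const (b k)
  rwa [mul_comm, mul_smul] at h2

end Rotate

/-! ### Characters of the torus -/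

section Characters

variable {d : ℕ}

namespace Torus

/-- The character `x ↦ e^{i k · x}` of the torus. -/
def char (k : Fin d → ℤ) : C(Torus d, ℂ) where
  toFun x := ∏ i, fourier (k i) (x i)
  continuous_toFun := by fun_prop

theorem char_def (k : Fin d → ℤ) (x : Torus d) : char k x = ∏ i, fourier (k i) (x i) := rfl

theorem char_neg (k : Fin d → ℤ) (x : Torus d) : char (-k) x = starRingEnd ℂ (char k x) := by
  simp only [char_def, Pi.neg_apply, fourier_neg, map_prod]

theorem char_add (k l : Fin d → ℤ) (x : Torus d) : char (k + l) x = char k x * char l x := by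
  simp only [char_def, Pi.add_apply, fourier_add, ← Finset.prod_mul_distrib]

theorem char_zero (x : Torus d) : char (0 : Fin d → ℤ) x = 1 := by
  simp [char_def]

theorem char_apply_add (k : Fin d → ℤ) (x y : Torus d) :
    char k (x + y) = char k x * char k y := by
  simp only [char_def, ← Finset.prod_mul_distrib]
  refine Finset.prod_congr rfl fun i _ => ?_
  rw [Pi.add_apply, fourier_apply, smul_add, AddCircle.toCircle_add, Circle.coe_mul]
  rfl

theorem fourier_coe (m : ℤ) (s : ℝ) :
    fourier m (s : AddCircle (2 * π)) = Complex.exp (Complex.I * m * s) := by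
  rw [fourier_coe_apply]
  congr 1
  push_cast
  have : (π : ℂ) ≠ 0 := by exact_mod_cast Real.pi_ne_zero
  field_simp

theorem char_single (k : Fin d → ℤ) (j : Fin d) (s : ℝ) :
    char k (Pi.single j (s : AddCircle (2 * π))) = Complex.exp (Complex.I * k j * s) := by
  rw [char_def, Finset.prod_eq_single j]
  · rw [Pi.single_eq_same, fourier_coe]
  · intro i _ hi
    rw [Pi.single_eq_of_ne hi, fourier_eval_zero]
  · simp

theorem smooth_char (k : Fin d → ℤ) : Smooth (char k : Torus d → ℂ) := by
  have : (fun y : Fin d → ℝ => char k (proj y))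
      = fun y => ∏ i, Complex.exp (Complex.I * k i * (y i : ℂ)) := by
    funext y
    rw [char_def]
    exact Finset.prod_congr rfl fun i _ => fourier_coe _ _
  rw [Smooth, this]
  refine contDiff_prod fun i _ => ContDiff.cexp (contDiff_const.mul ?_)
  exact Complex.ofRealCLM.contDiff.comp (contDiff_apply ℝ ℝ i)

theorem partialDeriv_char (k : Fin d → ℤ) (j : Fin d) (x : Torus d) :
    partialDeriv j (char k : Torus d → ℂ) x = Complex.I * k j * char k x := by
  have e : (fun s : ℝ => char k (x + Pi.single j (s : AddCircle (2 * π))))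
      = fun s : ℝ => char k x * Complex.exp (Complex.I * k j * s) := by
    funext s
    rw [char_apply_add, char_single]
  rw [partialDeriv, e]
  have h : HasDerivAt (fun s : ℝ => char k x * Complex.exp (Complex.I * k j * s))
      (char k x * (Complex.exp (Complex.I * k j * (0 : ℝ)) * (Complex.I * k j))) 0 := by
    refine (HasDerivAt.cexp ?_).const_mul _
    have := (hasDerivAt_id (0 : ℝ)).ofReal_comp.const_mul (Complex.I * k j)
    simpa using this
  rw [h.deriv]
  simp
  ring

theorem smooth_mul {f g : Torus d → ℂ} (hf : Smooth f) (hg : Smooth g) :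
    Smooth fun x => f x * g x := ContDiff.mul hf hg

theorem partialDeriv_mul {f g : Torus d → ℂ} (hf : Smooth f) (hg : Smooth g) (j : Fin d)
    (x : Torus d) : partialDeriv j (fun x => f x * g x) x
      = partialDeriv j f x * g x + f x * partialDeriv j g x := by
  have h := ((hf.hasDerivAt j x 0).fun_mul (hg.hasDerivAt j x 0)).deriv
  simpa [partialDeriv] using h

/-- Integration by parts on the torus. -/
theorem integral_mul_partialDeriv {f g : Torus d → ℂ} (hf : Smooth f) (hg : Smooth g)
    (j : Fin d) : ∫ x, f x * partialDeriv j g x = -∫ x, partialDeriv j f x * g x := by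
  have h := (smooth_mul hf hg).integral_partialDeriv j
  simp only [partialDeriv_mul hf hg] at h
  rw [integral_add] at h
  · linear_combination h
  · exact (memLp_of_continuous ((hf.continuous_partialDeriv j).mul hg.continuous) 1).integrable
      le_rfl
  · exact (memLp_of_continuous (hf.continuous.mul (hg.continuous_partialDeriv j)) 1).integrable
      le_rfl

/-- The volume of the torus. -/
def vol (d : ℕ) : ℝ := (volume : Measure (Torus d)).real univ

theorem vol_pos : 0 < vol d := by
  rw [vol, measureReal_def, ENNReal.toReal_pos_iff]
  refine ⟨?_, measure_lt_top _ _⟩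
  exact isOpen_univ.measure_pos _ univ_nonempty

/-- Orthogonality of the characters. -/
theorem integral_char [DecidableEq (Fin d → ℤ)] (k : Fin d → ℤ) :
    ∫ x : Torus d, char k x = if k = 0 then (vol d : ℂ) else 0 := by
  split_ifs with h
  · subst h
    simp [char_zero, vol]
  · obtain ⟨j, hj⟩ := Function.ne_iff.1 h
    have h1 := (smooth_char k).integral_partialDeriv j
    simp only [partialDeriv_char, integral_const_mul] at h1
    rw [mul_eq_zero] at h1
    refine h1.resolve_left ?_
    have : (k j : ℂ) ≠ 0 := by exact_mod_cast hj
    exact mul_ne_zero Complex.I_ne_zero this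

/-- The characters span a dense subspace of the continuous functions (Stone–Weierstrass). -/
theorem span_char_closure_eq_top :
    (Submodule.span ℂ (range (char (d := d)))).topologicalClosure = ⊤ := by
  let A : StarSubalgebra ℂ C(Torus d, ℂ) :=
    { toSubalgebra := Algebra.adjoin ℂ (range char)
      star_mem' := by
        change Algebra.adjoin ℂ (range char) ≤ star (Algebra.adjoin ℂ (range char))
        refine Algebra.adjoin_le ?_
        rintro _ ⟨k, rfl⟩
        refine Algebra.subset_adjoin ⟨-k, ?_⟩
        ext1 x
        simp only [char_neg, starRingEnd_apply, ContinuousMap.star_apply] }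
  have hA : A.toSubalgebra.toSubmodule = Submodule.span ℂ (range char) := by
    apply Algebra.adjoin_eq_span_of_subset
    refine .trans (fun x ↦ Submonoid.closure_induction (fun _ ↦ id) ⟨0, ?_⟩ ?_)
      Submodule.subset_span
    · ext z
      simp [char_zero]
    · rintro _ _ _ _ ⟨m, rfl⟩ ⟨n, rfl⟩
      refine ⟨m + n, ?_⟩
      ext z
      simp [char_add]
  have hsep : A.SeparatesPoints := by
    intro x y hxy
    obtain ⟨i, hi⟩ := Function.ne_iff.1 hxy
    have e : ∀ z : Torus d, char (Pi.single i 1) z = fourier 1 (z i) := by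
      intro z
      rw [char_def, Finset.prod_eq_single i]
      · rw [Pi.single_eq_same]
      · intro j _ hj
        rw [Pi.single_eq_of_ne hj, fourier_zero]
      · simp
    refine ⟨_, ⟨char (Pi.single i 1), Algebra.subset_adjoin ⟨Pi.single i 1, rfl⟩, rfl⟩, ?_⟩
    change char (Pi.single i 1) x ≠ char (Pi.single i 1) y
    rw [e, e, fourier_one, fourier_one]
    exact fun h => hi (AddCircle.injective_toCircle Real.two_pi_pos.ne' (Circle.coe_injective h))
  rw [← hA]
  exact congr_arg (Subalgebra.toSubmodule <| StarSubalgebra.toSubalgebra ·)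
    (ContinuousMap.starSubalgebra_topologicalClosure_eq_top_of_separatesPoints A hsep)

/-- The character `e^{i k · x}` as an element of `L²`. -/
def charL2 (k : Fin d → ℤ) : Lp ℂ 2 (volume : Measure (Torus d)) :=
  ContinuousMap.toLp 2 volume ℂ (char k)

theorem coeFn_charL2 (k : Fin d → ℤ) : charL2 k =ᵐ[volume] char k :=
  ContinuousMap.coeFn_toLp _ _

theorem inner_charL2 (k : Fin d → ℤ) (u : Lp ℂ 2 (volume : Measure (Torus d))) :
    inner ℂ (charL2 k) u = ∫ x, u x * char (-k) x := by
  rw [L2.inner_def]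
  refine integral_congr_ae ?_
  filter_upwards [coeFn_charL2 k] with x hx
  rw [hx, char_neg]
  simp

theorem inner_charL2_charL2 [DecidableEq (Fin d → ℤ)] (k l : Fin d → ℤ) :
    inner ℂ (charL2 k) (charL2 l) = if k = l then (vol d : ℂ) else 0 := by
  rw [inner_charL2]
  have : ∫ x, charL2 l x * char (-k) x = ∫ x, char (l - k) x := by
    refine integral_congr_ae ?_
    filter_upwards [coeFn_charL2 l] with x hx
    rw [hx, sub_eq_add_neg, char_add]
  rw [this, integral_char]
  simp only [sub_eq_zero, eq_comm]

/-- The characters are total in `L²`: their span is dense in the continuous functions, which are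
dense in `L²`. -/
theorem eq_zero_of_inner_charL2 {u : Lp ℂ 2 (volume : Measure (Torus d))}
    (h : ∀ k, inner ℂ (charL2 k) u = 0) : u = 0 := by
  have hd : Dense (Submodule.span ℂ (range (charL2 (d := d))) :
      Set (Lp ℂ 2 (volume : Measure (Torus d)))) := by
    have h1 : Dense (Submodule.span ℂ (range (char (d := d))) : Set C(Torus d, ℂ)) :=
      Submodule.dense_iff_topologicalClosure_eq_top.2 span_char_closure_eq_top
    have h2 := (ContinuousMap.toLp_denseRange ℂ (volume : Measure (Torus d)) ℂ (p := 2)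
      (by simp)).dense_image (ContinuousMap.toLp 2 volume ℂ).continuous h1
    have h3 : (ContinuousMap.toLp 2 volume ℂ '' (Submodule.span ℂ (range (char (d := d))) :
          Set C(Torus d, ℂ)))
        = (Submodule.span ℂ (range (charL2 (d := d))) :
      Set (Lp ℂ 2 (volume : Measure (Torus d)))) := by
      have : range (charL2 (d := d)) =
          (ContinuousMap.toLp 2 volume ℂ : C(Torus d, ℂ) →L[ℂ] Lp ℂ 2 (volume : Measure (Torus d)))
            '' range char := by
        rw [← range_comp]; rfl
      rw [this, ← ContinuousLinearMap.coe_coe, Submodule.span_image]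
      rfl
    rwa [h3] at h2
  have : ∀ w ∈ Submodule.span ℂ (range (charL2 (d := d))), inner ℂ w u = 0 := by
    intro w hw
    induction hw using Submodule.span_induction with
    | mem x hx => obtain ⟨k, rfl⟩ := hx; exact h k
    | zero => simp
    | add x y _ _ hx hy => rw [inner_add_left, hx, hy, add_zero]
    | smul a x _ hx => rw [inner_smul_left, hx, mul_zero]
  exact hd.eq_zero_of_inner_right ℂ fun v hv => this v hv

/-- `|k|²`. -/
def freqSq (k : Fin d → ℤ) : ℝ := ∑ j, (k j : ℝ) ^ 2

theorem freqSq_nonneg (k : Fin d → ℤ) : 0 ≤ freqSq k := Finset.sum_nonneg fun _ _ => sq_nonneg _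

theorem one_le_freqSq {k : Fin d → ℤ} (hk : k ≠ 0) : 1 ≤ freqSq k := by
  obtain ⟨j, hj⟩ := Function.ne_iff.1 hk
  have h1 : (1 : ℝ) ≤ (k j : ℝ) ^ 2 := by
    have : (1 : ℤ) ≤ k j ^ 2 := by
      have := sq_pos_of_ne_zero (a := k j) hj
      omega
    exact_mod_cast this
  exact h1.trans (Finset.single_le_sum (f := fun j => (k j : ℝ) ^ 2)
    (fun j _ => sq_nonneg _) (Finset.mem_univ j))

end Torus

end Characters

/-! ### The Hilbert space `H¹(𝕋^d)` -/

section H1Hilbert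

variable {d : ℕ}

open Torus

theorem Torus.integral_mul_eq_inner (u : Lp ℂ 2 (volume : Measure (Torus d))) {θ : Torus d → ℂ}
    (hθ : Continuous θ) : ∫ x, u x * θ x
      = inner ℂ ((memLp_of_continuous (Complex.continuous_conj.comp hθ) 2).toLp _) u := by
  rw [L2.inner_def]
  refine integral_congr_ae ?_
  filter_upwards [(memLp_of_continuous (Complex.continuous_conj.comp hθ) 2).coeFn_toLp] with x hx
  rw [hx]
  simp

theorem Torus.integral_coord_mul_eq_inner
    (g : Lp (EuclideanSpace ℂ (Fin d)) 2 (volume : Measure (Torus d))) (j : Fin d)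
    {θ : Torus d → ℂ} (hθ : Continuous θ) : ∫ x, g x j * θ x
      = inner ℂ ((memLp_of_continuous (Complex.continuous_conj.comp hθ) 2).toLp _)
        ((EuclideanSpace.proj (𝕜 := ℂ) j).compLpL 2 volume g) := by
  rw [← integral_mul_eq_inner _ hθ]
  refine integral_congr_ae ?_
  filter_upwards [(EuclideanSpace.proj (𝕜 := ℂ) j :
    EuclideanSpace ℂ (Fin d) →L[ℂ] ℂ).coeFn_compLpL (p := 2) g] with x hx
  rw [hx]
  rfl

/-- The graph of the weak gradient is an intersection of kernels of continuous functionals. -/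
theorem H1.isClosed_graph (d : ℕ) : IsClosed (H1.graph d : Set (WithLp 2
    (Lp ℂ 2 (volume : Measure (Torus d)) ×
      Lp (EuclideanSpace ℂ (Fin d)) 2 (volume : Measure (Torus d))))) := by
  have e : (H1.graph d : Set (WithLp 2 (Lp ℂ 2 (volume : Measure (Torus d)) ×
      Lp (EuclideanSpace ℂ (Fin d)) 2 (volume : Measure (Torus d)))))
      = ⋂ (η : Torus d → ℂ) (_ : Smooth η) (j : Fin d),
        {w | ∫ x, w.fst x * partialDeriv j η x = -∫ x, w.snd x j * η x} := by
    ext w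
    simp only [mem_iInter]
    rfl
  rw [e]
  refine isClosed_iInter fun η => isClosed_iInter fun hη => isClosed_iInter fun j => ?_
  simp only [integral_mul_eq_inner _ (hη.continuous_partialDeriv j),
    integral_coord_mul_eq_inner _ j hη.continuous]
  refine isClosed_eq ?_ ?_
  · exact continuous_const.inner (WithLp.prod_continuous_ofLp 2 _ _).fst
  · exact (continuous_const.inner ((ContinuousLinearMap.continuous _).comp
      (WithLp.prod_continuous_ofLp 2 _ _).snd)).neg

instance : CompleteSpace (H1 d) := (H1.isClosed_graph d).completeSpace_coe

namespace H1

/-- The inclusion of `H¹` in `L²`. -/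
def fnL : H1 d →L[ℂ] Lp ℂ 2 (volume : Measure (Torus d)) :=
  (WithLp.fstL 2 ℂ _ _).comp (H1.graph d).subtypeL

/-- The gradient on `H¹`. -/
def gradL : H1 d →L[ℂ] Lp (EuclideanSpace ℂ (Fin d)) 2 (volume : Measure (Torus d)) :=
  (WithLp.sndL 2 ℂ _ _).comp (H1.graph d).subtypeL

theorem inner_eq (u v : H1 d) : inner ℂ u v = inner ℂ u.fn v.fn + inner ℂ u.grad v.grad :=
  WithLp.prod_inner_apply _ _

theorem norm_sq_eq (u : H1 d) : ‖u‖ ^ 2 = ‖u.fn‖ ^ 2 + ‖u.grad‖ ^ 2 :=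
  WithLp.prod_norm_sq_eq_of_L2 _

theorem norm_fn_le (u : H1 d) : ‖u.fn‖ ≤ ‖u‖ := by
  have := norm_sq_eq u
  refine le_of_sq_le_sq ?_ (norm_nonneg _)
  nlinarith [sq_nonneg ‖u.grad‖]

theorem norm_grad_le (u : H1 d) : ‖u.grad‖ ≤ ‖u‖ := by
  have := norm_sq_eq u
  refine le_of_sq_le_sq ?_ (norm_nonneg _)
  nlinarith [sq_nonneg ‖u.fn‖]

theorem ext {u v : H1 d} (h : u.fn = v.fn) (h' : u.grad = v.grad) : u = v :=
  Subtype.ext (WithLp.ofLp_injective 2 (Prod.ext h h'))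

/-- A function of `L²` with a weak gradient in `L²`, as an element of `H¹`. -/
def ofMemLp {f : Torus d → ℂ} {g : Torus d → EuclideanSpace ℂ (Fin d)} (hf : MemLp f 2)
    (hg : MemLp g 2) (h : IsWeakGradient f g) : H1 d :=
  ⟨WithLp.toLp 2 (hf.toLp f, hg.toLp g), by
    intro η hη j
    refine Eq.trans (integral_congr_ae ?_) ((h η hη j).trans (congrArg _ (integral_congr_ae ?_)))
    · filter_upwards [hf.coeFn_toLp] with x hx
      exact congrArg (· * _) hx
    · filter_upwards [hg.coeFn_toLp] with x hx
      exact congrArg (fun v : EuclideanSpace ℂ (Fin d) => v j * η x) hx.symm⟩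

/-- The character `e^{i k · x}` as an element of `H¹`. -/
def char (k : Fin d → ℤ) : H1 d :=
  ofMemLp (f := Torus.char k) (g := fun x => WithLp.toLp 2 fun j => partialDeriv j (Torus.char k) x)
    (memLp_of_continuous (smooth_char k).continuous 2)
    (MemLp.of_eval_piLp
      fun j => memLp_of_continuous ((smooth_char k).continuous_partialDeriv j) 2)
    (fun _ hη j => integral_mul_partialDeriv (smooth_char k) hη j : IsWeakGradient _ _)

theorem fn_char (k : Fin d → ℤ) : (char k).fn = charL2 k := rfl

theorem coeFn_grad_char (k : Fin d → ℤ) : (char k).grad =ᵐ[volume]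
    fun x => WithLp.toLp 2 fun j => partialDeriv j (Torus.char k) x :=
  MemLp.coeFn_toLp (MemLp.of_eval_piLp
    fun j => memLp_of_continuous ((smooth_char k).continuous_partialDeriv j) 2)

/-- The Fourier coefficients of `∇u`: the identity defining the weak gradient, tested against a
character. -/
theorem inner_grad_char (k : Fin d → ℤ) (u : H1 d) :
    inner ℂ (char k).grad u.grad = freqSq k * inner ℂ (charL2 k) u.fn := by
  have hint : ∀ j, Integrable fun x => u.grad x j * Torus.char (-k) x :=
    fun j => integrable_coord_mul _ j (smooth_char (-k)).continuous
  have h1 : inner ℂ (char k).grad u.grad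
      = ∫ x, ∑ j, (-(Complex.I * k j)) * (u.grad x j * Torus.char (-k) x) := by
    rw [L2.inner_def]
    refine integral_congr_ae ?_
    filter_upwards [coeFn_grad_char k] with x hx
    rw [hx, PiLp.inner_apply]
    refine Finset.sum_congr rfl fun j _ => ?_
    simp only [partialDeriv_char, RCLike.inner_apply, map_mul, Complex.conj_I,
      map_intCast, char_neg]
    ring
  rw [h1, integral_finsetSum _ fun j _ => (hint j).const_mul _, inner_charL2, freqSq]
  push_cast
  rw [Finset.sum_mul]
  refine Finset.sum_congr rfl fun j _ => ?_
  have h2 := u.2 _ (smooth_char (-k)) j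
  change ∫ x, u.fn x * partialDeriv j (Torus.char (-k)) x
    = -∫ x, u.grad x j * Torus.char (-k) x at h2
  have h3 : ∫ x, u.fn x * partialDeriv j (Torus.char (-k)) x
      = -(Complex.I * k j) * ∫ x, u.fn x * Torus.char (-k) x := by
    rw [← integral_const_mul]
    refine integral_congr_ae (Eventually.of_forall fun x => ?_)
    simp only [partialDeriv_char, Pi.neg_apply, Int.cast_neg]
    ring
  rw [h3] at h2
  rw [integral_const_mul]
  linear_combination -(Complex.I * k j) * h2
    - ((k j : ℂ) ^ 2 * ∫ x, u.fn x * Torus.char (-k) x) * Complex.I_sq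

theorem inner_char (k : Fin d → ℤ) (u : H1 d) :
    inner ℂ (char k) u = ((1 + freqSq k : ℝ) : ℂ) * inner ℂ (charL2 k) u.fn := by
  rw [inner_eq, inner_grad_char, fn_char]
  push_cast
  ring

/-- The weak gradient is determined by the function. -/
theorem grad_eq_zero {u : H1 d} (h : u.fn = 0) : u.grad = 0 := by
  have hc : ∀ j, (EuclideanSpace.proj (𝕜 := ℂ) j).compLpL 2 volume u.grad = 0 := by
    intro j
    refine eq_zero_of_inner_charL2 fun k => ?_
    have h2 := u.2 _ (smooth_char (-k)) j
    change ∫ x, u.fn x * partialDeriv j (Torus.char (-k)) x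
      = -∫ x, u.grad x j * Torus.char (-k) x at h2
    rw [integral_mul_eq_inner _ ((smooth_char (-k)).continuous_partialDeriv j), h, inner_zero_right,
      zero_eq_neg] at h2
    rw [inner_charL2, ← h2]
    refine integral_congr_ae ?_
    filter_upwards [(EuclideanSpace.proj (𝕜 := ℂ) j :
      EuclideanSpace ℂ (Fin d) →L[ℂ] ℂ).coeFn_compLpL (p := 2) u.grad] with x hx
    rw [hx]
    rfl
  rw [Lp.eq_zero_iff_ae_eq_zero]
  have hae : ∀ᵐ x : Torus d, ∀ j, u.grad x j = 0 := by
    rw [ae_all_iff]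
    intro j
    filter_upwards [(EuclideanSpace.proj (𝕜 := ℂ) j :
      EuclideanSpace ℂ (Fin d) →L[ℂ] ℂ).coeFn_compLpL (p := 2) u.grad,
      (Lp.eq_zero_iff_ae_eq_zero).1 (hc j)] with x h1 h2
    rw [h1] at h2
    exact h2
  filter_upwards [hae] with x hx
  exact PiLp.ext hx

theorem inner_smul_left' (a : ℂ) (u v : H1 d) :
    inner ℂ (a • u) v = starRingEnd ℂ a * inner ℂ u v := _root_.inner_smul_left u v a

theorem inner_smul_right' (a : ℂ) (u v : H1 d) :
    inner ℂ u (a • v) = a * inner ℂ u v := _root_.inner_smul_right u v a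

/-- The normalization of the `k`-th character in `H¹`. -/
def charNorm (k : Fin d → ℤ) : ℝ := Real.sqrt (vol d * (1 + freqSq k))

theorem charNorm_sq (k : Fin d → ℤ) : charNorm k ^ 2 = vol d * (1 + freqSq k) :=
  Real.sq_sqrt (mul_nonneg vol_pos.le (by linarith [freqSq_nonneg k]))

theorem charNorm_pos (k : Fin d → ℤ) : 0 < charNorm k :=
  Real.sqrt_pos.2 (mul_pos vol_pos (by linarith [freqSq_nonneg k]))

/-- The normalized characters, a Hilbert basis of `H¹`. -/
def basis (d : ℕ) : HilbertBasis (Fin d → ℤ) ℂ (H1 d) :=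
  HilbertBasis.mkOfOrthogonalEqBot (v := fun k => ((charNorm k)⁻¹ : ℂ) • char k)
    (by
      classical
      rw [orthonormal_iff_ite]
      intro k l
      rw [inner_smul_left', inner_smul_right', inner_char, fn_char, inner_charL2_charL2]
      split_ifs with h
      · subst h
        have h0 : (charNorm k : ℂ) ≠ 0 := by exact_mod_cast (charNorm_pos k).ne'
        have h1 : (charNorm k : ℂ) ^ 2 = vol d * (1 + freqSq k) := by exact_mod_cast charNorm_sq k
        rw [map_inv₀, Complex.conj_ofReal]
        field_simp
        rw [h1]
        push_cast
        ring
      · simp)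
    (by
      rw [Submodule.eq_bot_iff]
      intro u hu
      rw [Submodule.mem_orthogonal] at hu
      have h0 : u.fn = 0 := by
        refine eq_zero_of_inner_charL2 fun k => ?_
        have : inner ℂ (((charNorm k)⁻¹ : ℂ) • char k) u = 0 :=
          hu _ (Submodule.subset_span ⟨k, rfl⟩)
        rw [inner_smul_left', inner_char, mul_eq_zero, mul_eq_zero] at this
        have hc : (charNorm k : ℂ) ≠ 0 := by exact_mod_cast (charNorm_pos k).ne'
        have hf : ((1 + freqSq k : ℝ) : ℂ) ≠ 0 := by
          exact_mod_cast (by linarith [freqSq_nonneg k] : (0 : ℝ) < 1 + freqSq k).ne'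
        rcases this with h | h | h
        · simp [hc] at h
        · exact absurd h hf
        · exact h
      exact ext h0 (grad_eq_zero h0))

theorem basis_apply (k : Fin d → ℤ) : basis d k = ((charNorm k)⁻¹ : ℂ) • char k := by
  rw [basis, HilbertBasis.coe_mkOfOrthogonalEqBot]

/-- The normalized characters, a Hilbert basis of `L²`. -/
def basisL2 (d : ℕ) : HilbertBasis (Fin d → ℤ) ℂ (Lp ℂ 2 (volume : Measure (Torus d))) :=
  HilbertBasis.mkOfOrthogonalEqBot (v := fun k => ((Real.sqrt (vol d))⁻¹ : ℂ) • charL2 k)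
    (by
      classical
      rw [orthonormal_iff_ite]
      intro k l
      rw [inner_smul_left, inner_smul_right, inner_charL2_charL2]
      split_ifs with h
      · have h0 : (Real.sqrt (vol d) : ℂ) ≠ 0 := by exact_mod_cast (Real.sqrt_pos.2 vol_pos).ne'
        have h1 : (Real.sqrt (vol d) : ℂ) ^ 2 = vol d := by
          exact_mod_cast Real.sq_sqrt vol_pos.le
        rw [map_inv₀, Complex.conj_ofReal]
        field_simp
        rw [h1]
      · simp)
    (by
      rw [Submodule.eq_bot_iff]
      intro u hu
      rw [Submodule.mem_orthogonal] at hu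
      refine eq_zero_of_inner_charL2 fun k => ?_
      have : inner ℂ (((Real.sqrt (vol d))⁻¹ : ℂ) • charL2 k) u = 0 :=
        hu _ (Submodule.subset_span ⟨k, rfl⟩)
      rw [inner_smul_left, mul_eq_zero] at this
      refine this.resolve_left ?_
      simp [(Real.sqrt_pos.2 (vol_pos (d := d))).ne'])

theorem basisL2_apply (k : Fin d → ℤ) :
    basisL2 d k = ((Real.sqrt (vol d))⁻¹ : ℂ) • charL2 k := by
  rw [basisL2, HilbertBasis.coe_mkOfOrthogonalEqBot]

theorem _root_.SchrodingerWave.hasSum_norm_inner_sq {ι H : Type*} [NormedAddCommGroup H]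
    [InnerProductSpace ℂ H] (b : HilbertBasis ι ℂ H) (x : H) :
    HasSum (fun k => ‖inner ℂ (b k) x‖ ^ 2) (‖x‖ ^ 2) := by
  have h := (b.hasSum_inner_mul_inner x x).mapL Complex.reCLM
  have e : Complex.reCLM (inner ℂ x x) = ‖x‖ ^ 2 := by
    rw [inner_self_eq_norm_sq_to_K]
    norm_cast
  rw [e] at h
  refine h.congr_fun fun k => ?_
  rw [← inner_conj_symm (b k) x, RCLike.norm_conj, Complex.mul_conj']
  norm_cast

/-- Parseval's identity in `L²`. -/
theorem hasSum_norm_fn_sq (u : Lp ℂ 2 (volume : Measure (Torus d))) :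
    HasSum (fun k => ‖inner ℂ (charL2 k) u‖ ^ 2 / vol d) (‖u‖ ^ 2) := by
  refine (hasSum_norm_inner_sq (basisL2 d) u).congr_fun fun k => ?_
  rw [basisL2_apply, inner_smul_left, norm_mul, mul_pow]
  simp [Real.sq_sqrt (vol_pos (d := d)).le, abs_of_nonneg]
  ring

/-- Parseval's identity in `H¹`. -/
theorem hasSum_norm_sq (u : H1 d) :
    HasSum (fun k => (1 + freqSq k) * (‖inner ℂ (charL2 k) u.fn‖ ^ 2 / vol d)) (‖u‖ ^ 2) := by
  refine (hasSum_norm_inner_sq (basis d) u).congr_fun fun k => ?_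
  have h0 : (0 : ℝ) < 1 + freqSq k := by linarith [freqSq_nonneg k]
  have h1 := charNorm_sq k
  have hv := vol_pos (d := d)
  rw [basis_apply, inner_smul_left', inner_char, norm_mul, norm_mul, mul_pow, mul_pow,
    Complex.norm_real, Real.norm_of_nonneg h0.le, map_inv₀, Complex.conj_ofReal, norm_inv,
    Complex.norm_real, Real.norm_of_nonneg (charNorm_pos k).le, inv_pow, h1]
  field_simp

/-- The Poincaré–Wirtinger inequality on the torus of side `2π`. -/
theorem norm_fn_le_norm_grad {u : H1 d} (h : inner ℂ (charL2 0) u.fn = 0) :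
    ‖u.fn‖ ≤ ‖u.grad‖ := by
  have h1 : 2 * ‖u.fn‖ ^ 2 ≤ ‖u‖ ^ 2 := by
    refine hasSum_le (fun k => ?_) ((hasSum_norm_fn_sq u.fn).mul_left 2) (hasSum_norm_sq u)
    by_cases hk : k = 0
    · subst hk; simp [h]
    · have := one_le_freqSq hk
      have := vol_pos (d := d)
      gcongr
      linarith
  rw [norm_sq_eq] at h1
  exact le_of_sq_le_sq (by linarith) (norm_nonneg _)

/-- The free Schrödinger group `e^{i t Δ / 2}` on `H¹`. -/
def freeFlow (d : ℕ) : IsometricFlow ℂ (H1 d) :=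
  IsometricFlow.diagonal (basis d) fun k => -(freqSq k / 2)

end H1

end H1Hilbert

/-! ### Abstract wave operators -/

section AbstractWave

/-- For a skew relation the density of the domain follows from the range condition and from
single-valuedness: writing `z` orthogonal to the domain as `x - y` with `(x, y)` in the relation
gives `‖x‖² = ⟪x, x - y⟫ = 0`. -/
theorem IsSkewAdjointGraph.of_range {H : Type*} [NormedAddCommGroup H] [InnerProductSpace ℝ H]
    [CompleteSpace H] {A : Submodule ℝ (H × H)} (h1 : ∀ p ∈ A, inner ℝ p.1 p.2 = 0)
    (h2 : ∀ h : ℝ, h ≠ 0 → ∀ z, ∃ p ∈ A, p.1 - h • p.2 = z)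
    (h3 : ∀ y, ((0 : H), y) ∈ A → y = 0) : IsSkewAdjointGraph A := by
  refine ⟨h1, h2, ?_⟩
  have e : {x | ∃ y, (x, y) ∈ A} = (A.map (LinearMap.fst ℝ H H) : Set H) := by
    ext x
    simp
  rw [e, Submodule.dense_iff_topologicalClosure_eq_top, Submodule.topologicalClosure_eq_top_iff,
    Submodule.eq_bot_iff]
  intro z hz
  obtain ⟨⟨x, y⟩, hxy, hz2⟩ := h2 1 one_ne_zero z
  have h0 : inner ℝ x z = 0 := (Submodule.mem_orthogonal _ _).1 hz x ⟨(x, y), hxy, rfl⟩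
  have h4 : inner ℝ x y = 0 := h1 _ hxy
  simp only [one_smul] at hz2
  rw [← hz2, inner_sub_right, h4, sub_zero, inner_self_eq_zero] at h0
  subst h0
  rw [← hz2, h3 y hxy, sub_zero]

variable {P F : Type*} [NormedAddCommGroup P] [InnerProductSpace ℝ P]
  [NormedAddCommGroup F] [InnerProductSpace ℝ F]

/-- The relation `{((p, v), (T* v, -T p))}`, for the operator `T` with graph `G`: the generator of
the abstract wave equation `p' = T* v`, `v' = -T p`. -/
def waveGraph (G : Submodule ℝ (WithLp 2 (P × F))) :
    Submodule ℝ (WithLp 2 (P × F) × WithLp 2 (P × F)) where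
  carrier := {q | WithLp.toLp 2 (q.1.fst, -q.2.snd) ∈ G ∧ WithLp.toLp 2 (-q.2.fst, q.1.snd) ∈ Gᗮ}
  zero_mem' := by
    simp only [mem_ofPred_eq, Prod.fst_zero, Prod.snd_zero, WithLp.zero_fst, WithLp.zero_snd,
      neg_zero]
    exact ⟨G.zero_mem, Gᗮ.zero_mem⟩
  add_mem' := by
    rintro a b ⟨h1, h2⟩ ⟨h3, h4⟩
    constructor
    · convert G.add_mem h1 h3 using 1
      exact WithLp.ofLp_injective 2 (Prod.ext rfl (neg_add _ _))
    · convert Gᗮ.add_mem h2 h4 using 1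
      exact WithLp.ofLp_injective 2 (Prod.ext (neg_add _ _) rfl)
  smul_mem' := by
    rintro r a ⟨h1, h2⟩
    constructor
    · convert G.smul_mem r h1 using 1
      exact WithLp.ofLp_injective 2 (Prod.ext rfl (smul_neg _ _).symm)
    · convert Gᗮ.smul_mem r h2 using 1
      exact WithLp.ofLp_injective 2 (Prod.ext (smul_neg _ _).symm rfl)

theorem mem_waveGraph {G : Submodule ℝ (WithLp 2 (P × F))} {p l : P} {v f : F} :
    (WithLp.toLp 2 (p, v), WithLp.toLp 2 (l, f)) ∈ waveGraph G ↔
      WithLp.toLp 2 (p, -f) ∈ G ∧ WithLp.toLp 2 (-l, v) ∈ Gᗮ := Iff.rfl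

theorem toLp_inner_toLp (a b : P) (c d : F) :
    inner ℝ (WithLp.toLp 2 (a, c)) (WithLp.toLp 2 (b, d)) = inner ℝ a b + inner ℝ c d :=
  WithLp.prod_inner_apply _ _

variable [CompleteSpace P] [CompleteSpace F]

/-- The abstract wave operator is skew-adjoint. The range condition is the orthogonal decomposition
`G ⊕ Gᗮ` of the product space, applied to the graph of `T` rescaled. -/
theorem isSkewAdjointGraph_waveGraph {G : Submodule ℝ (WithLp 2 (P × F))}
    (hG : IsClosed (G : Set (WithLp 2 (P × F))))
    (h1 : ∀ f, WithLp.toLp 2 ((0 : P), f) ∈ G → f = 0)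
    (h2 : ∀ p, WithLp.toLp 2 (p, (0 : F)) ∈ Gᗮ → p = 0) : IsSkewAdjointGraph (waveGraph G) := by
  refine .of_range ?_ ?_ ?_
  · rintro ⟨x, y⟩ ⟨hx, hy⟩
    have h := (Submodule.mem_orthogonal _ _).1 hy _ hx
    rw [toLp_inner_toLp, inner_neg_right, inner_neg_left] at h
    rw [WithLp.prod_inner_apply]
    change inner ℝ x.fst y.fst + inner ℝ x.snd y.snd = 0
    rw [real_inner_comm y.snd x.snd]
    linarith
  · intro h hh z
    -- rescale the second component of the graph so that the equation is an orthogonal splitting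
    let L : WithLp 2 (P × F) →L[ℝ] WithLp 2 (P × F) :=
      (WithLp.prodContinuousLinearEquiv 2 ℝ P F).symm.toContinuousLinearMap.comp
        ((WithLp.fstL 2 ℝ P F).prod (h⁻¹ • WithLp.sndL 2 ℝ P F))
    have hL : ∀ w, L w = WithLp.toLp 2 (w.fst, h⁻¹ • w.snd) := fun w => rfl
    have hcl : IsClosed (G.comap (L : WithLp 2 (P × F) →ₗ[ℝ] WithLp 2 (P × F)) :
        Set (WithLp 2 (P × F))) := hG.preimage L.continuous
    have : CompleteSpace (G.comap (L : WithLp 2 (P × F) →ₗ[ℝ] WithLp 2 (P × F))) :=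
      hcl.completeSpace_coe
    obtain ⟨g, hg, g', hg', hz⟩ := Submodule.exists_add_mem_mem_orthogonal
      (K := G.comap (L : WithLp 2 (P × F) →ₗ[ℝ] WithLp 2 (P × F))) z
    refine ⟨(WithLp.toLp 2 (g.fst, g'.snd), WithLp.toLp 2 (-(h⁻¹ • g'.fst), -(h⁻¹ • g.snd))),
      mem_waveGraph.2 ⟨?_, ?_⟩, ?_⟩
    · rw [neg_neg]
      exact hg
    · rw [neg_neg, Submodule.mem_orthogonal]
      intro w hw
      have hw' : WithLp.toLp 2 (w.fst, h • w.snd) ∈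
          G.comap (L : WithLp 2 (P × F) →ₗ[ℝ] WithLp 2 (P × F)) := by
        rw [Submodule.mem_comap, ContinuousLinearMap.coe_coe, hL]
        change WithLp.toLp 2 (w.fst, h⁻¹ • h • w.snd) ∈ G
        rw [inv_smul_smul₀ hh]
        exact hw
      have h3 := (Submodule.mem_orthogonal _ _).1 hg' _ hw'
      have h4 : inner ℝ w.fst g'.fst + h * inner ℝ w.snd g'.snd = 0 := by
        rw [← real_inner_smul_left]
        exact h3
      rw [WithLp.prod_inner_apply]
      change inner ℝ w.fst (h⁻¹ • g'.fst) + inner ℝ w.snd g'.snd = 0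
      rw [real_inner_smul_right]
      field_simp
      rw [h4, mul_zero]
    · rw [hz]
      refine WithLp.ofLp_injective 2 (Prod.ext ?_ ?_)
      · change g.fst - h • (-(h⁻¹ • g'.fst)) = g.fst + g'.fst
        rw [smul_neg, smul_inv_smul₀ hh, sub_neg_eq_add]
      · change g'.snd - h • (-(h⁻¹ • g.snd)) = g.snd + g'.snd
        rw [smul_neg, smul_inv_smul₀ hh, sub_neg_eq_add, add_comm]
  · rintro y ⟨hx, hy⟩
    have e1 : y.snd = 0 := by
      have := h1 (-y.snd) hx
      simpa using this
    have e2 : y.fst = 0 := by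
      have := h2 (-y.fst) hy
      simpa using this
    exact WithLp.ofLp_injective 2 (Prod.ext e2 e1)

/-- A linear identity that holds on two families of test pairs holds on the whole wave relation. The
first family must be total in `G`; the second one must have `G` as its orthogonal complement. -/
theorem inner_add_inner_eq_zero_of_waveGraph {ι : Type*} {G : Submodule ℝ (WithLp 2 (P × F))}
    (hG : IsClosed (G : Set (WithLp 2 (P × F)))) {p : ι → P} {f v : ι → F}
    (hp : ∀ i, WithLp.toLp 2 (p i, f i) ∈ G)
    (hp' : ∀ w ∈ G, (∀ i, inner ℝ (WithLp.toLp 2 (p i, f i)) w = 0) → w = 0)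
    (hv : ∀ w, (∀ i, inner ℝ (WithLp.toLp 2 (-p i, v i)) w = 0) → w ∈ G)
    {α β : WithLp 2 (P × F)}
    (h1 : ∀ i, inner ℝ (p i) α.fst - inner ℝ (f i) β.snd = 0)
    (h2 : ∀ i, inner ℝ (v i) α.snd + inner ℝ (p i) β.fst = 0)
    {q : WithLp 2 (P × F) × WithLp 2 (P × F)} (hq : q ∈ waveGraph G) :
    inner ℝ q.1 α + inner ℝ q.2 β = 0 := by
  obtain ⟨hq1, hq2⟩ := hq
  have k1 : WithLp.toLp 2 (-β.fst, α.snd) ∈ G := by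
    refine hv _ fun i => ?_
    rw [toLp_inner_toLp, inner_neg_neg]
    linarith [h2 i]
  have k2 : WithLp.toLp 2 (α.fst, -β.snd) ∈ Gᗮ := by
    have : CompleteSpace G := hG.completeSpace_coe
    obtain ⟨g, hg, g', hg', hz⟩ := Submodule.exists_add_mem_mem_orthogonal (K := G)
      (WithLp.toLp 2 (α.fst, -β.snd))
    have : g = 0 := by
      refine hp' g hg fun i => ?_
      have e : g = WithLp.toLp 2 (α.fst, -β.snd) - g' := by rw [hz, add_sub_cancel_right]
      rw [e, inner_sub_right, (Submodule.mem_orthogonal _ _).1 hg' _ (hp i), sub_zero,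
        toLp_inner_toLp, inner_neg_right]
      linarith [h1 i]
    rw [hz, this, zero_add]
    exact hg'
  have e1 := (Submodule.mem_orthogonal _ _).1 k2 _ hq1
  have e2 := (Submodule.mem_orthogonal _ _).1 hq2 _ k1
  rw [toLp_inner_toLp, inner_neg_neg] at e1
  rw [toLp_inner_toLp, inner_neg_neg] at e2
  rw [WithLp.prod_inner_apply, WithLp.prod_inner_apply]
  change (inner ℝ q.1.fst α.fst + inner ℝ q.1.snd α.snd)
    + (inner ℝ q.2.fst β.fst + inner ℝ q.2.snd β.snd) = 0
  rw [real_inner_comm α.snd q.1.snd, real_inner_comm β.fst q.2.fst] at *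
  linarith

/-- Time rescaling of a flow. -/
def IsometricFlow.rescale {H : Type*} [NormedAddCommGroup H] [NormedSpace ℝ H]
    (S : IsometricFlow ℝ H) (c : ℝ) : IsometricFlow ℝ H where
  toFun t := S (c * t)
  map_zero' x := by simp
  map_add' s t x := by rw [mul_add, S.map_add]
  norm_map' t x := S.norm_map _ x
  continuous' x := S.continuous_comp (continuous_const.mul continuous_id) continuous_const

theorem IsometricFlow.hasDerivAt_rescale {H : Type*} [NormedAddCommGroup H] [NormedSpace ℝ H]
    (S : IsometricFlow ℝ H) (c : ℝ) {x y : H}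
    (h : ∀ t, HasDerivAt (fun s => S s x) (S t y) t) (t : ℝ) :
    HasDerivAt (fun s => S.rescale c s x) (S.rescale c t (c • y)) t := by
  have h2 : HasDerivAt (fun s : ℝ => c * s) c t := by
    simpa using (hasDerivAt_id t).const_mul c
  have := (h (c * t)).scomp t h2
  rw [map_smul]
  exact this

end AbstractWave

/-! ### Vector-valued functions on the torus -/

section Lifting

variable {d : ℕ} {H : Type*} [NormedAddCommGroup H] [InnerProductSpace ℝ H]

open Torus

theorem Torus.memLp_of_continuous_real {f : Torus d → ℝ} (hf : Continuous f)
    (p : ℝ≥0∞) : MemLp f p (volume : Measure (Torus d)) := by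
  obtain ⟨C, hC⟩ := (isCompact_range hf).isBounded.exists_norm_le
  exact MemLp.of_bound hf.aestronglyMeasurable C
    (Eventually.of_forall fun x => hC _ (mem_range_self x))

/-- A real function of `L²(𝕋^d)` orthogonal to the smooth functions vanishes. -/
theorem Torus.eq_zero_of_integral_smooth_mul {r : Lp ℝ 2 (volume : Measure (Torus d))}
    (h : ∀ a : Torus d → ℝ, Smooth a → ∫ x, a x * r x = 0) : r =ᵐ[volume] 0 := by
  set u : Lp ℂ 2 (volume : Measure (Torus d)) := Complex.ofRealCLM.compLp r with hu
  have hur : u =ᵐ[volume] fun x => (r x : ℂ) := Complex.ofRealCLM.coeFn_compLp r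
  have hint : ∀ {a : Torus d → ℝ}, Smooth a → Integrable fun x => a x * r x := fun ha =>
    (memLp_of_continuous_real ha.continuous 2).integrable_mul (Lp.memLp r)
  have hu0 : u = 0 := by
    refine eq_zero_of_inner_charL2 fun k => ?_
    have hre : Smooth fun x => (char (-k) x).re :=
      Complex.reCLM.contDiff.comp (smooth_char (-k) : ContDiff ℝ ∞ _)
    have him : Smooth fun x => (char (-k) x).im :=
      Complex.imCLM.contDiff.comp (smooth_char (-k) : ContDiff ℝ ∞ _)
    have e : ∫ x, u x * char (-k) x
        = ∫ x, (((char (-k) x).re * r x : ℝ) : ℂ) + ((char (-k) x).im * r x : ℝ) * Complex.I := by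
      refine integral_congr_ae ?_
      filter_upwards [hur] with x hx
      rw [hx]
      nth_rw 1 [← Complex.re_add_im (char (-k) x)]
      push_cast
      ring
    rw [inner_charL2, e, integral_add (hint hre).ofReal ((hint him).ofReal.mul_const _),
      integral_mul_const]
    have e1 : ∫ x, (((char (-k) x).re * r x : ℝ) : ℂ) = 0 := by
      rw [integral_complex_ofReal, h _ hre, Complex.ofReal_zero]
    have e2 : ∫ x, (((char (-k) x).im * r x : ℝ) : ℂ) = 0 := by
      rw [integral_complex_ofReal, h _ him, Complex.ofReal_zero]
    rw [e1, e2]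
    simp
  filter_upwards [hur, Lp.eq_zero_iff_ae_eq_zero.1 hu0] with x h1 h2
  have h3 : u x = 0 := h2
  rw [h1] at h3
  exact_mod_cast h3

/-- The function `x ↦ r(x) h`. -/
def tensor (r : Lp ℝ 2 (volume : Measure (Torus d))) (h : H) :
    Lp H 2 (volume : Measure (Torus d)) := (ContinuousLinearMap.toSpanSingleton ℝ h).compLp r

theorem coeFn_tensor (r : Lp ℝ 2 (volume : Measure (Torus d))) (h : H) :
    tensor r h =ᵐ[volume] fun x => r x • h :=
  (ContinuousLinearMap.toSpanSingleton ℝ h).coeFn_compLp r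

theorem inner_tensor (r : Lp ℝ 2 (volume : Measure (Torus d))) (h : H)
    (f : Lp H 2 (volume : Measure (Torus d))) :
    inner ℝ (tensor r h) f = ∫ x, r x * inner ℝ h (f x) := by
  rw [L2.inner_def]
  refine integral_congr_ae ?_
  filter_upwards [coeFn_tensor r h] with x hx
  rw [hx, real_inner_smul_left]

theorem norm_tensor (r : Lp ℝ 2 (volume : Measure (Torus d))) (h : H) :
    ‖tensor r h‖ = ‖r‖ * ‖h‖ := by
  have h1 : ‖tensor r h‖ ^ 2 = (‖r‖ * ‖h‖) ^ 2 := by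
    rw [← real_inner_self_eq_norm_sq, inner_tensor, mul_pow, ← real_inner_self_eq_norm_sq r,
      L2.inner_def, ← integral_mul_const]
    refine integral_congr_ae ?_
    filter_upwards [coeFn_tensor r h] with x hx
    rw [hx, real_inner_smul_right, real_inner_self_eq_norm_sq]
    simp
    ring
  exact (sq_eq_sq₀ (norm_nonneg _) (by positivity)).1 h1

/-- A smooth function of the torus, as an element of `L²`. -/
def smoothL2 {a : Torus d → ℝ} (ha : Smooth a) : Lp ℝ 2 (volume : Measure (Torus d)) :=
  (memLp_of_continuous_real ha.continuous 2).toLp a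

theorem coeFn_smoothL2 {a : Torus d → ℝ} (ha : Smooth a) : smoothL2 ha =ᵐ[volume] a :=
  MemLp.coeFn_toLp _

theorem inner_tensor_smoothL2 {a : Torus d → ℝ} (ha : Smooth a) (h : H)
    (f : Lp H 2 (volume : Measure (Torus d))) :
    inner ℝ (tensor (smoothL2 ha) h) f = ∫ x, a x * inner ℝ h (f x) := by
  rw [inner_tensor]
  refine integral_congr_ae ?_
  filter_upwards [coeFn_smoothL2 ha] with x hx
  rw [hx]

/-- The function `x ↦ ⟨h, f(x)⟩`. -/
def pairL (h : H) : Lp H 2 (volume : Measure (Torus d)) →L[ℝ] Lp ℝ 2 (volume : Measure (Torus d)) :=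
  (innerSL ℝ h).compLpL 2 volume

theorem coeFn_pairL (h : H) (f : Lp H 2 (volume : Measure (Torus d))) :
    pairL h f =ᵐ[volume] fun x => inner ℝ h (f x) :=
  (innerSL ℝ h).coeFn_compLpL f

theorem pairL_add (h h' : H) (f : Lp H 2 (volume : Measure (Torus d))) :
    pairL (h + h') f = pairL h f + pairL h' f := by
  simp only [pairL, map_add]
  rw [ContinuousLinearMap.add_compLpL]
  rfl

theorem pairL_smul (r : ℝ) (h : H) (f : Lp H 2 (volume : Measure (Torus d))) :
    pairL (r • h) f = r • pairL h f := by
  simp only [pairL]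
  rw [map_smul, ContinuousLinearMap.smul_compLpL]
  rfl

theorem norm_pairL_le (h : H) (f : Lp H 2 (volume : Measure (Torus d))) :
    ‖pairL h f‖ ≤ ‖f‖ * ‖h‖ := by
  have := (innerSL ℝ h).norm_compLp_le f
  rw [innerSL_apply_norm ℝ h] at this
  exact this.trans_eq (mul_comm _ _)

theorem integral_mul_pairL (a : Torus d → ℝ) (h : H) (f : Lp H 2 (volume : Measure (Torus d))) :
    ∫ x, a x * pairL h f x = ∫ x, a x * inner ℝ h (f x) := by
  refine integral_congr_ae ?_
  filter_upwards [coeFn_pairL h f] with x hx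
  rw [hx]

theorem pairL_eq_zero {h : H} {f : Lp H 2 (volume : Measure (Torus d))}
    (hf : ∀ a : Torus d → ℝ, Smooth a → ∫ x, a x * inner ℝ h (f x) = 0) : pairL h f = 0 := by
  rw [Lp.eq_zero_iff_ae_eq_zero]
  refine eq_zero_of_integral_smooth_mul fun a ha => ?_
  rw [integral_mul_pairL, hf a ha]

/-- Tensor products of smooth functions of `x` with a total family of vectors are total. -/
theorem eq_zero_of_integral_smooth_mul_inner [CompleteSpace H] {B : Set H}
    (hB : ∀ h : H, (∀ b ∈ B, inner ℝ b h = 0) → h = 0) {f : Lp H 2 (volume : Measure (Torus d))}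
    (hf : ∀ a : Torus d → ℝ, Smooth a → ∀ b ∈ B, ∫ x, a x * inner ℝ b (f x) = 0) : f = 0 := by
  have hspan : (Submodule.span ℝ B).topologicalClosure = ⊤ := by
    rw [Submodule.topologicalClosure_eq_top_iff, Submodule.eq_bot_iff]
    intro h hh
    exact hB h fun b hb => (Submodule.mem_orthogonal _ _).1 hh b (Submodule.subset_span hb)
  -- the scalar function `⟨h, f⟩` depends continuously on `h`
  let K : H →L[ℝ] Lp ℝ 2 (volume : Measure (Torus d)) :=
    LinearMap.mkContinuous
      { toFun := fun h => pairL h f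
        map_add' := fun h h' => pairL_add h h' f
        map_smul' := fun r h => pairL_smul r h f } ‖f‖ fun h => norm_pairL_le h f
  have hK : ∀ h, K h = 0 := by
    intro h
    have hker : (Submodule.span ℝ B).topologicalClosure ≤ K.ker := by
      refine Submodule.topologicalClosure_minimal _ ?_ K.isClosed_ker
      rw [Submodule.span_le]
      intro b hb
      exact pairL_eq_zero fun a ha => hf a ha b hb
    rw [hspan] at hker
    exact hker Submodule.mem_top
  rw [Lp.eq_zero_iff_ae_eq_zero]
  refine ae_eq_zero_of_forall_dual_of_isSeparable ℝ
    (Lp.stronglyMeasurable f).isSeparable_range (fun c => ?_)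
    (Eventually.of_forall fun x => mem_range_self x)
  set h := (InnerProductSpace.toDual ℝ H).symm c with hh
  filter_upwards [coeFn_pairL h f, Lp.eq_zero_iff_ae_eq_zero.1 (hK h)] with x h1 h2
  have h3 : pairL h f x = 0 := h2
  rw [h1, hh, InnerProductSpace.toDual_symm_apply] at h3
  exact h3

theorem integrable_smooth_smul {a : Torus d → ℝ} (ha : Smooth a)
    (f : Lp H 2 (volume : Measure (Torus d))) : Integrable fun x => a x • f x := by
  rw [← memLp_one_iff_integrable]
  exact MemLp.smul (p := 2) (q := 2) (r := 1) (Lp.memLp f)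
    (memLp_of_continuous_real ha.continuous 2)

theorem inner_integral_smooth_smul [CompleteSpace H] {a : Torus d → ℝ} (ha : Smooth a)
    (f : Lp H 2 (volume : Measure (Torus d))) (h : H) :
    inner ℝ h (∫ x, a x • f x) = ∫ x, a x * inner ℝ h (f x) := by
  rw [← integral_inner (integrable_smooth_smul ha f)]
  simp only [real_inner_smul_right]

end Lifting

/-! ### The wave operator on `L²(𝕋^d × ℝ^n) × L²(𝕋^d; Ḣ¹(ℝ^n))` -/

/-- A test function as an element of `L²`. -/
def testL2 {n : ℕ} {b : Space n → ℝ} (hb : IsTest b) : Lp ℝ 2 (volume : Measure (Space n)) :=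
  (hb.memLp 2).toLp b

theorem inner_testL2 {n : ℕ} {b : Space n → ℝ} (hb : IsTest b)
    (p : Lp ℝ 2 (volume : Measure (Space n))) :
    inner ℝ (testL2 hb) p = ∫ z, p z * b z := inner_toLp_eq_integral_mul p (hb.memLp 2)

theorem eq_zero_of_inner_testL2 {n : ℕ} {p : Lp ℝ 2 (volume : Measure (Space n))}
    (h : ∀ (b : Space n → ℝ) (hb : IsTest b), inner ℝ (testL2 hb) p = 0) : p = 0 := by
  rw [Lp.eq_zero_iff_ae_eq_zero]
  refine ae_eq_zero_of_integral_contDiff_smul_eq_zero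
    ((Lp.memLp p).locallyIntegrable one_le_two) fun b hb hbs => ?_
  have hT : IsTest b := ⟨hb, hbs⟩
  have h1 := h b hT
  rw [inner_testL2] at h1
  simpa only [smul_eq_mul, mul_comm (b _)] using h1

section Wave

variable {d n : ℕ} [Fact (3 ≤ n)]

/-- The Riesz representatives of test functions are total in `Ḣ¹`: an element orthogonal to all of
them vanishes as a distribution. -/
theorem eq_zero_of_inner_riesz {φ : HDot1 n}
    (h : ∀ (b : Space n → ℝ) (hb : IsTest b), inner ℝ (HDot1.riesz hb) φ = 0) : φ = 0 := by
  refine HDot1.dense_testSubmodule.eq_zero_of_inner_right ℝ fun v hv => ?_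
  obtain ⟨b, hb, rfl⟩ := hv
  have hi : ∀ j, Integrable fun z =>
      HDot1.grad φ z j * fderiv ℝ b z (EuclideanSpace.single j 1) := fun j =>
    (memLp_coord _ j).integrable_mul ((hb.fderiv_apply _).memLp 2)
  rw [HDot1.inner_ofTest]
  simp only [inner_gradient]
  rw [integral_finsetSum _ fun j _ => hi j]
  refine Finset.sum_eq_zero fun j _ => ?_
  have ht := hb.fderiv_apply (EuclideanSpace.single j (1 : ℝ))
  have h1 := φ.2 _ ht.1 ht.2 j
  have h2 := h _ (ht.fderiv_apply (EuclideanSpace.single j (1 : ℝ)))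
  rw [HDot1.inner_riesz] at h2
  change ∫ z, φ.fn z * _ = -∫ z, HDot1.grad φ z j * _ at h1
  linarith

/-- The space of momenta and fields with the wave energy norm. -/
abbrev WaveSpace (d n : ℕ) [Fact (3 ≤ n)] : Type := WithLp 2 (Momentum d n × Field d n)

/-- The pairs `(p, F)` with `p = F` almost everywhere: the graph of the identification of the
functions of `L²(𝕋^d × ℝ^n)` that belong to `L²(𝕋^d; Ḣ¹)`. -/
def agreeGraph (d n : ℕ) [Fact (3 ≤ n)] : Submodule ℝ (WaveSpace d n) :=
  ⨅ (b : Space n → ℝ) (hb : IsTest b),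
    ((pairL (testL2 hb)).comp (WithLp.fstL 2 ℝ (Momentum d n) (Field d n))
      - (pairL (HDot1.riesz hb)).comp (WithLp.sndL 2 ℝ (Momentum d n) (Field d n))).ker

theorem mem_agreeGraph {w : WaveSpace d n} : w ∈ agreeGraph d n ↔
    ∀ (b : Space n → ℝ) (hb : IsTest b),
      pairL (testL2 hb) w.fst = pairL (HDot1.riesz hb) w.snd := by
  simp only [agreeGraph, Submodule.mem_iInf, LinearMap.mem_ker]
  refine forall_congr' fun b => forall_congr' fun hb => ?_
  exact sub_eq_zero

theorem isClosed_agreeGraph : IsClosed (agreeGraph d n : Set (WaveSpace d n)) := by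
  simp only [agreeGraph, Submodule.coe_iInf]
  exact isClosed_iInter fun b => isClosed_iInter fun hb => ContinuousLinearMap.isClosed_ker _

/-- The tensor products of test functions are a core for the identification of momenta with
fields: the orthogonality relation is `p - Δ_z p = 0`, weakly in `z`, for the averages of `p`. -/
theorem eq_zero_of_agreeGraph {w : WaveSpace d n} (hw : w ∈ agreeGraph d n)
    (h : ∀ (a : Torus d → ℝ) (ha : Torus.Smooth a) (b : Space n → ℝ) (hb : IsTest b),
      inner ℝ (WithLp.toLp 2 (tensor (smoothL2 ha) (testL2 hb),
        tensor (smoothL2 ha) (HDot1.ofTest hb)) : WaveSpace d n) w = 0) : w = 0 := by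
  rw [mem_agreeGraph] at hw
  have key : ∀ a : Torus d → ℝ, Torus.Smooth a →
      (∫ x, a x • w.fst x) = 0 ∧ (∫ x, a x • w.snd x) = 0 := by
    intro a ha
    refine HDot1.eq_zero_of_sub_laplacian_eq_zero (fun b hb => ?_) fun b hb => ?_
    · rw [← inner_testL2 hb, ← HDot1.inner_riesz hb, inner_integral_smooth_smul ha,
        inner_integral_smooth_smul ha, ← integral_mul_pairL, ← integral_mul_pairL, hw b hb]
    · rw [← inner_testL2 hb, ← HDot1.inner_ofTest hb, inner_integral_smooth_smul ha,
        inner_integral_smooth_smul ha, ← inner_tensor_smoothL2 ha, ← inner_tensor_smoothL2 ha]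
      exact h a ha b hb
  have h1 : w.fst = 0 := by
    refine eq_zero_of_integral_smooth_mul_inner (B := univ)
      (fun h hh => inner_self_eq_zero (𝕜 := ℝ) |>.1 (hh h (mem_univ h))) fun a ha b _ => ?_
    rw [← inner_integral_smooth_smul ha, (key a ha).1, inner_zero_right]
  have h2 : w.snd = 0 := by
    refine eq_zero_of_integral_smooth_mul_inner (B := univ)
      (fun h hh => inner_self_eq_zero (𝕜 := ℝ) |>.1 (hh h (mem_univ h))) fun a ha b _ => ?_
    rw [← inner_integral_smooth_smul ha, (key a ha).2, inner_zero_right]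
  exact WithLp.ofLp_injective 2 (Prod.ext h1 h2)

theorem pairL_tensor {H : Type*} [NormedAddCommGroup H] [InnerProductSpace ℝ H]
    (r : Lp ℝ 2 (volume : Measure (Torus d))) (h h' : H) :
    pairL h (tensor r h') = inner ℝ h h' • r := by
  refine Lp.ext ?_
  filter_upwards [coeFn_pairL h (tensor r h'), coeFn_tensor r h', Lp.coeFn_smul (inner ℝ h h') r]
    with x h1 h2 h3
  rw [h1, h2, h3, real_inner_smul_right, Pi.smul_apply, smul_eq_mul, mul_comm]

/-- Both sides are `∫ b b'`: the Riesz representative of `b` solves `-Δ φ = b`. -/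
theorem inner_testL2_testL2 {b b' : Space n → ℝ} (hb : IsTest b) (hb' : IsTest b') :
    inner ℝ (testL2 hb) (testL2 hb') = inner ℝ (HDot1.riesz hb) (HDot1.ofTest hb') := by
  rw [inner_testL2, HDot1.inner_riesz]
  refine integral_congr_ae ?_
  filter_upwards [(hb'.memLp 2).coeFn_toLp, (hb'.memLp (sobolevExponent n)).coeFn_toLp] with z h1 h2
  exact congrArg (· * b z) (h1.trans h2.symm)

theorem tensor_mem_agreeGraph (r : Lp ℝ 2 (volume : Measure (Torus d))) {b : Space n → ℝ}
    (hb : IsTest b) :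
    (WithLp.toLp 2 (tensor r (testL2 hb), tensor r (HDot1.ofTest hb)) : WaveSpace d n)
      ∈ agreeGraph d n := by
  rw [mem_agreeGraph]
  intro b' hb'
  change pairL (testL2 hb') (tensor r (testL2 hb)) = pairL (HDot1.riesz hb') (tensor r _)
  rw [pairL_tensor, pairL_tensor, inner_testL2_testL2]

/-- Agreement as distributions can be tested on tensor products. -/
theorem mem_agreeGraph_of_inner {w : WaveSpace d n}
    (h : ∀ (a : Torus d → ℝ) (ha : Torus.Smooth a) (b : Space n → ℝ) (hb : IsTest b),
      inner ℝ (tensor (smoothL2 ha) (testL2 hb)) w.fst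
        = inner ℝ (tensor (smoothL2 ha) (HDot1.riesz hb)) w.snd) : w ∈ agreeGraph d n := by
  rw [mem_agreeGraph]
  intro b hb
  rw [← sub_eq_zero, Lp.eq_zero_iff_ae_eq_zero]
  refine Torus.eq_zero_of_integral_smooth_mul fun a ha => ?_
  have e : ∫ x, a x * (pairL (testL2 hb) w.fst - pairL (HDot1.riesz hb) w.snd :
      Lp ℝ 2 (volume : Measure (Torus d))) x
      = ∫ x, a x * pairL (testL2 hb) w.fst x - a x * pairL (HDot1.riesz hb) w.snd x := by
    refine integral_congr_ae ?_
    filter_upwards [Lp.coeFn_sub (pairL (testL2 hb) w.fst) (pairL (HDot1.riesz hb) w.snd)] with x hx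
    rw [hx, Pi.sub_apply, mul_sub]
  have hint : ∀ r : Lp ℝ 2 (volume : Measure (Torus d)), Integrable fun x => a x * r x := fun r =>
    (Torus.memLp_of_continuous_real ha.continuous 2).integrable_mul (Lp.memLp r)
  rw [e, integral_sub (hint _) (hint _), integral_mul_pairL, integral_mul_pairL,
    ← inner_tensor_smoothL2 ha, ← inner_tensor_smoothL2 ha, h, sub_self]

/-- The index set of the tensor products `a(x) b(z)` of test functions. -/
abbrev TestPair (d n : ℕ) : Type :=
  {a : Torus d → ℝ // Torus.Smooth a} × {b : Space n → ℝ // IsTest b}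

/-- `a(x) b(z)` as a momentum. -/
def TestPair.momentum (i : TestPair d n) : Momentum d n := tensor (smoothL2 i.1.2) (testL2 i.2.2)

/-- `a(x) b(z)` as a field. -/
def TestPair.field (i : TestPair d n) : Field d n := tensor (smoothL2 i.1.2) (HDot1.ofTest i.2.2)

/-- The field representing the functional `Ψ ↦ ∬ a(x) b(z) Ψ(x, z)`. -/
def TestPair.riesz (i : TestPair d n) : Field d n := tensor (smoothL2 i.1.2) (HDot1.riesz i.2.2)

/-- The generator of the wave equation. -/
def wave (d n : ℕ) [Fact (3 ≤ n)] : Submodule ℝ (WaveSpace d n × WaveSpace d n) :=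
  waveGraph (agreeGraph d n)

/-- The generator of the wave equation is skew-adjoint. -/
theorem isSkewAdjointGraph_wave : IsSkewAdjointGraph (wave d n) := by
  refine isSkewAdjointGraph_waveGraph isClosed_agreeGraph (fun f hf => ?_) fun p hp => ?_
  · rw [mem_agreeGraph] at hf
    refine eq_zero_of_integral_smooth_mul_inner
      (B := {φ | ∃ (b : Space n → ℝ) (hb : IsTest b), φ = HDot1.riesz hb})
      (fun φ hφ => eq_zero_of_inner_riesz fun b hb => hφ _ ⟨b, hb, rfl⟩) ?_
    rintro a ha _ ⟨b, hb, rfl⟩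
    have h1 : pairL (HDot1.riesz hb) f = 0 := by
      rw [← show pairL (testL2 hb) (0 : Momentum d n) = pairL (HDot1.riesz hb) f from hf b hb,
        map_zero]
    rw [← integral_mul_pairL, h1]
    refine integral_eq_zero_of_ae ?_
    filter_upwards [Lp.coeFn_zero ℝ 2 (volume : Measure (Torus d))] with x _
    simp
  · refine eq_zero_of_integral_smooth_mul_inner
      (B := {φ | ∃ (b : Space n → ℝ) (hb : IsTest b), φ = testL2 hb})
      (fun φ hφ => eq_zero_of_inner_testL2 fun b hb => hφ _ ⟨b, hb, rfl⟩) ?_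
    rintro a ha _ ⟨b, hb, rfl⟩
    have h1 := (Submodule.mem_orthogonal _ _).1 hp _ (tensor_mem_agreeGraph (smoothL2 ha) hb)
    rw [toLp_inner_toLp, inner_zero_right, add_zero, inner_tensor_smoothL2] at h1
    exact h1

/-- A linear identity on the wave relation follows from its instances for test functions. -/
theorem inner_add_inner_eq_zero_of_wave {α β : WaveSpace d n}
    (h1 : ∀ i : TestPair d n, inner ℝ i.momentum α.fst - inner ℝ i.field β.snd = 0)
    (h2 : ∀ i : TestPair d n, inner ℝ i.riesz α.snd + inner ℝ i.momentum β.fst = 0)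
    {q : WaveSpace d n × WaveSpace d n} (hq : q ∈ wave d n) :
    inner ℝ q.1 α + inner ℝ q.2 β = 0 := by
  refine inner_add_inner_eq_zero_of_waveGraph (p := TestPair.momentum) (f := TestPair.field)
    (v := TestPair.riesz) isClosed_agreeGraph (fun i => tensor_mem_agreeGraph _ i.2.2)
    (fun w hw h => eq_zero_of_agreeGraph hw fun a ha b hb => h (⟨a, ha⟩, ⟨b, hb⟩))
    (fun w h => mem_agreeGraph_of_inner fun a ha b hb => ?_) h1 h2 hq
  have h3 := h (⟨a, ha⟩, ⟨b, hb⟩)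
  rw [WithLp.prod_inner_apply] at h3
  change inner ℝ (-tensor (smoothL2 ha) (testL2 hb)) w.fst
    + inner ℝ (tensor (smoothL2 ha) (HDot1.riesz hb)) w.snd = 0 at h3
  rw [inner_neg_left] at h3
  linarith

theorem momentum_mem_wave (i : TestPair d n) :
    ((WithLp.toLp 2 (i.momentum, 0), WithLp.toLp 2 (0, -i.field)) :
      WaveSpace d n × WaveSpace d n) ∈ wave d n := by
  refine mem_waveGraph.2 ⟨?_, ?_⟩
  · rw [neg_neg]
    exact tensor_mem_agreeGraph _ i.2.2
  · rw [neg_zero]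
    exact (agreeGraph d n)ᗮ.zero_mem

theorem tensor_riesz_mem_wave (r : Lp ℝ 2 (volume : Measure (Torus d))) {b : Space n → ℝ}
    (hb : IsTest b) : ((WithLp.toLp 2 (0, tensor r (HDot1.riesz hb)),
      WithLp.toLp 2 (tensor r (testL2 hb), 0)) : WaveSpace d n × WaveSpace d n) ∈ wave d n := by
  refine mem_waveGraph.2 ⟨?_, ?_⟩
  · rw [neg_zero]
    exact (agreeGraph d n).zero_mem
  · rw [Submodule.mem_orthogonal]
    intro w hw
    rw [mem_agreeGraph] at hw
    rw [WithLp.prod_inner_apply]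
    change inner ℝ w.fst (-tensor r (testL2 hb)) + inner ℝ w.snd (tensor r (HDot1.riesz hb)) = 0
    rw [inner_neg_right, real_inner_comm, real_inner_comm (tensor r (HDot1.riesz hb)),
      inner_tensor, inner_tensor, ← integral_mul_pairL, ← integral_mul_pairL, hw _ hb]
    ring

theorem riesz_mem_wave (i : TestPair d n) :
    ((WithLp.toLp 2 (0, i.riesz), WithLp.toLp 2 (i.momentum, 0)) :
      WaveSpace d n × WaveSpace d n) ∈ wave d n :=
  tensor_riesz_mem_wave _ i.2.2

end Wave

/-! ### Convolution on the torus -/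

section Convolution

variable {d : ℕ}

open Torus

theorem integrable_translate_mul {E : Type*} [NormedAddCommGroup E] [NormedSpace ℝ E]
    (k : C(Torus d, ℝ)) (x : Torus d) {g : Torus d → E} (hg : Integrable g) :
    Integrable fun y => k (x - y) • g y := by
  refine hg.bdd_smul ‖k‖ ?_ (Eventually.of_forall fun y => k.norm_coe_le_norm _)
  exact (k.continuous.comp (continuous_const.sub continuous_id)).aestronglyMeasurable

theorem integrable_translate_mul' {E : Type*} [NormedAddCommGroup E] [NormedSpace ℝ E]
    (k : C(Torus d, ℝ)) (y : Torus d) {w : Torus d → E} (hw : Integrable w) :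
    Integrable fun x => k (x - y) • w x := by
  refine hw.bdd_smul ‖k‖ ?_ (Eventually.of_forall fun x => k.norm_coe_le_norm _)
  exact (k.continuous.comp (continuous_id.sub continuous_const)).aestronglyMeasurable

/-- The convolution `x ↦ ∫ k(x - y) g(y) dy` of a continuous kernel with an integrable function. -/
def conv (k : C(Torus d, ℝ)) : Lp ℝ 1 (volume : Measure (Torus d)) →L[ℝ] C(Torus d, ℝ) :=
  LinearMap.mkContinuous
    { toFun := fun g => ⟨fun x => ∫ y, k (x - y) • g y, by
        refine continuous_of_dominated (bound := fun y => ‖k‖ * ‖g y‖)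
          (fun x => (integrable_translate_mul k x (L1.integrable_coeFn g)).1)
          (fun x => Eventually.of_forall fun y => ?_)
          ((L1.integrable_coeFn g).norm.const_mul _)
          (Eventually.of_forall fun y => ?_)
        · rw [norm_smul]
          gcongr
          exact k.norm_coe_le_norm _
        · exact (k.continuous.comp (continuous_id.sub continuous_const)).smul continuous_const⟩
      map_add' := fun f g => by
        ext x
        change ∫ y, k (x - y) • (f + g : Lp ℝ 1 volume) y
          = (∫ y, k (x - y) • f y) + ∫ y, k (x - y) • g y
        rw [← integral_add (integrable_translate_mul k x (L1.integrable_coeFn f))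
          (integrable_translate_mul k x (L1.integrable_coeFn g))]
        refine integral_congr_ae ?_
        filter_upwards [Lp.coeFn_add f g] with y hy
        rw [hy, Pi.add_apply, smul_add]
      map_smul' := fun r f => by
        ext x
        change ∫ y, k (x - y) • (r • f : Lp ℝ 1 volume) y = r * ∫ y, k (x - y) • f y
        rw [← integral_const_mul]
        refine integral_congr_ae ?_
        filter_upwards [Lp.coeFn_smul r f] with y hy
        rw [hy, Pi.smul_apply, smul_comm, smul_eq_mul] } ‖k‖ (fun g => by
      rw [ContinuousMap.norm_le _ (by positivity)]
      intro x
      refine (norm_integral_le_of_norm_le ((L1.integrable_coeFn g).norm.const_mul ‖k‖)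
        (Eventually.of_forall fun y => ?_)).trans_eq ?_
      · rw [norm_smul]
        gcongr
        exact k.norm_coe_le_norm _
      · rw [integral_const_mul, L1.norm_eq_integral_norm])

theorem conv_apply (k : C(Torus d, ℝ)) (g : Lp ℝ 1 (volume : Measure (Torus d))) (x : Torus d) :
    conv k g x = ∫ y, k (x - y) * g y := rfl

theorem integrable_translate_prod {E : Type*} [NormedAddCommGroup E] [NormedSpace ℝ E]
    (k : C(Torus d, ℝ)) {g : Torus d → ℝ} (hg : Integrable g)
    {w : Torus d → E} (hw : Integrable w) :
    Integrable (fun p : Torus d × Torus d => (k (p.1 - p.2) * g p.2) • w p.1)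
      ((volume : Measure (Torus d)).prod volume) := by
  have h : Integrable (fun p : Torus d × Torus d => g p.2 • w p.1)
      ((volume : Measure (Torus d)).prod volume) := (hg.smul_prod hw).swap
  have h2 := h.bdd_smul (φ := fun p : Torus d × Torus d => k (p.1 - p.2)) ‖k‖
    (k.continuous.comp (continuous_fst.sub continuous_snd)).aestronglyMeasurable
    (Eventually.of_forall fun p => k.norm_coe_le_norm _)
  refine h2.congr (Eventually.of_forall fun p => ?_)
  exact smul_smul _ _ _

/-- Fubini's theorem for the convolution. -/
theorem integral_conv_smul {E : Type*} [NormedAddCommGroup E] [NormedSpace ℝ E] [CompleteSpace E]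
    (k : C(Torus d, ℝ)) (g : Lp ℝ 1 (volume : Measure (Torus d)))
    {w : Torus d → E} (hw : Integrable w) :
    Integrable (fun y => g y • ∫ x, k (x - y) • w x) ∧
    ∫ x, conv k g x • w x = ∫ y, g y • ∫ x, k (x - y) • w x := by
  have e1 : ∀ x, conv k g x • w x = ∫ y, (k (x - y) * g y) • w x := by
    intro x
    rw [conv_apply, integral_smul_const]
  have e2 : ∀ y, ∫ x, (k (x - y) * g y) • w x = g y • ∫ x, k (x - y) • w x := by
    intro y
    rw [← integral_smul]
    refine integral_congr_ae (Eventually.of_forall fun x => ?_)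
    simp only [smul_smul, mul_comm]
  have hi := integrable_translate_prod k (L1.integrable_coeFn g) hw
  simp only [e1]
  rw [integral_integral_swap hi]
  simp only [e2]
  refine ⟨?_, trivial⟩
  simp only [← e2]
  exact hi.integral_prod_right

/-- Multiplication by a continuous function on `L²`. -/
def smulC (E : Type*) [NormedAddCommGroup E] [NormedSpace ℝ E] :
    C(Torus d, ℝ) →L[ℝ] Lp E 2 (volume : Measure (Torus d)) →L[ℝ]
      Lp E 2 (volume : Measure (Torus d)) :=
  ((ContinuousLinearMap.lsmul ℝ ℝ : ℝ →L[ℝ] E →L[ℝ] E).holderL volume ∞ 2 2).comp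
    (ContinuousMap.toLp ∞ volume ℝ)

theorem coeFn_smulC {E : Type*} [NormedAddCommGroup E] [NormedSpace ℝ E] (f : C(Torus d, ℝ))
    (g : Lp E 2 (volume : Measure (Torus d))) : smulC E f g =ᵐ[volume] fun x => f x • g x := by
  have h := (ContinuousLinearMap.lsmul ℝ ℝ : ℝ →L[ℝ] E →L[ℝ] E).coeFn_holder (r := 2)
    (ContinuousMap.toLp ∞ (volume : Measure (Torus d)) ℝ f) g
  filter_upwards [h, ContinuousMap.coeFn_toLp (p := ∞) (𝕜 := ℝ) (volume : Measure (Torus d)) f]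
    with x h1 h2
  refine h1.trans ?_
  rw [h2]
  rfl

end Convolution

section Multiplication

variable {d : ℕ}

open Torus

/-- The derivative of a smooth kernel. -/
def Torus.Smooth.derivC {σ : Torus d → ℝ} (hσ : Smooth σ) (j : Fin d) : C(Torus d, ℝ) :=
  ⟨partialDeriv j σ, hσ.continuous_partialDeriv j⟩

/-- A smooth kernel as a continuous function. -/
def Torus.Smooth.toC {σ : Torus d → ℝ} (hσ : Smooth σ) : C(Torus d, ℝ) := ⟨σ, hσ.continuous⟩

/-- The vector field `x ↦ u(x) e_j`. -/
def coordL (j : Fin d) : Lp ℂ 2 (volume : Measure (Torus d)) →L[ℂ]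
    Lp (EuclideanSpace ℂ (Fin d)) 2 (volume : Measure (Torus d)) :=
  (ContinuousLinearMap.toSpanSingleton ℂ (EuclideanSpace.single j (1 : ℂ))).compLpL 2 volume

theorem coeFn_coordL (j : Fin d) (u : Lp ℂ 2 (volume : Measure (Torus d))) :
    coordL j u =ᵐ[volume] fun x => u x • EuclideanSpace.single j (1 : ℂ) :=
  (ContinuousLinearMap.toSpanSingleton ℂ (EuclideanSpace.single j (1 : ℂ))).coeFn_compLpL u

/-- The product rule `∇(Φ u) = Φ ∇u + u ∇Φ`, for the potential `Φ = σ ⋆ g`. -/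
def gradMul {σ : Torus d → ℝ} (hσ : Smooth σ) (g : Lp ℝ 1 (volume : Measure (Torus d)))
    (u : H1 d) : Lp (EuclideanSpace ℂ (Fin d)) 2 (volume : Measure (Torus d)) :=
  smulC _ (conv hσ.toC g) u.grad + ∑ j, smulC _ (conv (hσ.derivC j) g) (coordL j u.fn)

theorem coeFn_gradMul {σ : Torus d → ℝ} (hσ : Smooth σ) (g : Lp ℝ 1 (volume : Measure (Torus d)))
    (u : H1 d) : ∀ᵐ x, ∀ j, gradMul hσ g u x j
      = conv hσ.toC g x * u.grad x j + conv (hσ.derivC j) g x * u.fn x := by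
  have h1 : ∀ᵐ x : Torus d, ∀ j, smulC _ (conv (hσ.derivC j) g) (coordL j u.fn) x
      = conv (hσ.derivC j) g x • u.fn x • EuclideanSpace.single j (1 : ℂ) := by
    rw [ae_all_iff]
    intro j
    filter_upwards [coeFn_smulC (conv (hσ.derivC j) g) (coordL j u.fn), coeFn_coordL j u.fn]
      with x h1 h2
    rw [h1, h2]
  filter_upwards [h1, Lp.coeFn_add (smulC _ (conv hσ.toC g) u.grad)
    (∑ j, smulC _ (conv (hσ.derivC j) g) (coordL j u.fn)),
    Lp.coeFn_finsetSum Finset.univ fun j => smulC _ (conv (hσ.derivC j) g) (coordL j u.fn),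
    coeFn_smulC (conv hσ.toC g) u.grad] with x h1 h2 h3 h4 i
  rw [gradMul, h2, Pi.add_apply, h3, h4, PiLp.add_apply]
  congr 1
  simp only [Finset.sum_apply, h1, WithLp.ofLp_sum]
  simp

theorem smooth_translate_mul {σ : Torus d → ℝ} (hσ : Smooth σ) (y : Torus d) {η : Torus d → ℂ}
    (hη : Smooth η) : Smooth fun x => (σ (x - y) : ℂ) * η x := by
  obtain ⟨y', rfl⟩ := isOpenQuotientMap_proj.surjective y
  refine ContDiff.mul (Complex.ofRealCLM.contDiff.comp ?_) hη
  have : (fun x : Fin d → ℝ => σ (proj x - proj y')) = fun x => σ (proj (x - y')) := rfl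
  rw [this]
  exact ContDiff.comp (g := fun x : Fin d → ℝ => σ (proj x)) hσ (contDiff_id.sub contDiff_const)

theorem partialDeriv_translate_mul {σ : Torus d → ℝ} (hσ : Smooth σ) (y : Torus d)
    {η : Torus d → ℂ} (hη : Smooth η) (j : Fin d) (x : Torus d) :
    partialDeriv j (fun x => (σ (x - y) : ℂ) * η x) x
      = partialDeriv j σ (x - y) * η x + σ (x - y) * partialDeriv j η x := by
  have h1 := (hσ.hasDerivAt j (x - y) 0).ofReal_comp
  have h2 := (h1.fun_mul (hη.hasDerivAt j x 0)).deriv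
  simpa [partialDeriv, sub_add_eq_add_sub] using h2

/-- The Leibniz rule `∇((σ ⋆ g) u) = (σ ⋆ g) ∇u + u ∇σ ⋆ g`. By Fubini it reduces to testing the
weak gradient of `u` against the products `σ (· - y) η`. -/
theorem isWeakGradient_mul {σ : Torus d → ℝ} (hσ : Smooth σ)
    (g : Lp ℝ 1 (volume : Measure (Torus d))) (u : H1 d) :
    IsWeakGradient (smulC ℂ (conv hσ.toC g) u.fn) (gradMul hσ g u) := by
  intro η hη j
  have hη' := hη.continuous_partialDeriv j
  have i1 : Integrable fun x => u.fn x * partialDeriv j η x := integrable_mul_continuous _ hη'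
  have i2 : Integrable fun x => u.fn x * η x := integrable_mul_continuous _ hη.continuous
  have i3 : Integrable fun x => u.grad x j * η x := integrable_coord_mul _ j hη.continuous
  have iC : ∀ (f : C(Torus d, ℝ)) {w : Torus d → ℂ}, Integrable w → Integrable fun x => f x • w x :=
    fun f w hw => hw.bdd_smul ‖f‖ f.continuous.aestronglyMeasurable
      (Eventually.of_forall fun y => f.norm_coe_le_norm _)
  have e1 : ∫ x, smulC ℂ (conv hσ.toC g) u.fn x * partialDeriv j η x
      = ∫ x, conv hσ.toC g x • (u.fn x * partialDeriv j η x) := by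
    refine integral_congr_ae ?_
    filter_upwards [coeFn_smulC (conv hσ.toC g) u.fn] with x hx
    rw [hx, smul_mul_assoc]
  have e2 : ∫ x, gradMul hσ g u x j * η x
      = ∫ x, conv hσ.toC g x • (u.grad x j * η x)
        + conv (hσ.derivC j) g x • (u.fn x * η x) := by
    refine integral_congr_ae ?_
    filter_upwards [coeFn_gradMul hσ g u] with x hx
    rw [hx]
    simp only [Complex.real_smul]
    ring
  obtain ⟨j1, f1⟩ := integral_conv_smul hσ.toC g i1
  obtain ⟨j2, f2⟩ := integral_conv_smul (hσ.derivC j) g i2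
  obtain ⟨j3, f3⟩ := integral_conv_smul hσ.toC g i3
  rw [e1, e2, integral_add (iC _ i3) (iC _ i2), f1, f2, f3, ← integral_add j3 j2, ← integral_neg]
  refine integral_congr_ae (Eventually.of_forall fun y => ?_)
  -- test the weak gradient of `u` against the translate of the kernel
  have hw := u.2 _ (smooth_translate_mul hσ y hη) j
  change ∫ x, u.fn x * _ = -∫ x, u.grad x j * _ at hw
  simp only [partialDeriv_translate_mul hσ y hη] at hw
  have k1 := integrable_translate_mul' hσ.toC y i1
  have k2 := integrable_translate_mul' (hσ.derivC j) y i2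
  have e3 : ∫ x, u.fn x * (partialDeriv j σ (x - y) * η x + σ (x - y) * partialDeriv j η x)
      = (∫ x, hσ.derivC j (x - y) • (u.fn x * η x))
        + ∫ x, hσ.toC (x - y) • (u.fn x * partialDeriv j η x) := by
    rw [← integral_add k2 k1]
    refine integral_congr_ae (Eventually.of_forall fun x => ?_)
    simp only [Complex.real_smul, Torus.Smooth.derivC, Torus.Smooth.toC, ContinuousMap.coe_mk]
    ring
  have e4 : ∫ x, u.grad x j * (σ (x - y) * η x) = ∫ x, hσ.toC (x - y) • (u.grad x j * η x) := by
    refine integral_congr_ae (Eventually.of_forall fun x => ?_)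
    simp only [Complex.real_smul, Torus.Smooth.toC, ContinuousMap.coe_mk]
    ring
  rw [e3, e4] at hw
  simp only
  rw [← smul_add, ← smul_neg]
  congr 1
  linear_combination hw

/-- The product `(σ ⋆ g) u`, as an element of `H¹`. -/
def mulH1 {σ : Torus d → ℝ} (hσ : Smooth σ) (g : Lp ℝ 1 (volume : Measure (Torus d)))
    (u : H1 d) : H1 d :=
  ⟨WithLp.toLp 2 (smulC ℂ (conv hσ.toC g) u.fn, gradMul hσ g u), isWeakGradient_mul hσ g u⟩

theorem H1.fn_smul (r : ℝ) (u : H1 d) : (r • u).fn = r • u.fn := rfl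
theorem H1.grad_smul (r : ℝ) (u : H1 d) : (r • u).grad = r • u.grad := rfl

theorem exists_norm_mulH1_le {σ : Torus d → ℝ} (hσ : Smooth σ) :
    ∃ C, ∀ (g : Lp ℝ 1 (volume : Measure (Torus d))) (u : H1 d),
      ‖mulH1 hσ g u‖ ≤ C * ‖g‖ * ‖u‖ := by
  have hb : ∀ (E : Type) [NormedAddCommGroup E] [NormedSpace ℝ E] (k : C(Torus d, ℝ))
      (g : Lp ℝ 1 (volume : Measure (Torus d))) (u : Lp E 2 (volume : Measure (Torus d))),
      ‖smulC E (conv k g) u‖ ≤ ‖(smulC E : C(Torus d, ℝ) →L[ℝ] _)‖ * (‖conv k‖ * ‖g‖) * ‖u‖ := by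
    intro E _ _ k g u
    refine ((smulC E).le_opNorm₂ _ _).trans ?_
    gcongr
    exact (conv k).le_opNorm g
  refine ⟨‖(smulC ℂ : C(Torus d, ℝ) →L[ℝ] _)‖ * ‖conv hσ.toC‖
    + (‖(smulC (EuclideanSpace ℂ (Fin d)) : C(Torus d, ℝ) →L[ℝ] _)‖ * ‖conv hσ.toC‖
      + ∑ j, ‖(smulC (EuclideanSpace ℂ (Fin d)) : C(Torus d, ℝ) →L[ℝ] _)‖ * ‖conv (hσ.derivC j)‖
        * ‖coordL (d := d) j‖), fun g u => ?_⟩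
  have h1 : ‖mulH1 hσ g u‖ ≤ ‖(mulH1 hσ g u).fn‖ + ‖(mulH1 hσ g u).grad‖ := by
    have := H1.norm_sq_eq (mulH1 hσ g u)
    refine le_of_sq_le_sq ?_ (by positivity)
    nlinarith [norm_nonneg (mulH1 hσ g u).fn, norm_nonneg (mulH1 hσ g u).grad]
  refine h1.trans ?_
  have hf := H1.norm_fn_le u
  have hg := H1.norm_grad_le u
  rw [add_mul, add_mul, add_mul, add_mul, Finset.sum_mul, Finset.sum_mul]
  refine add_le_add ?_ ((norm_add_le _ _).trans (add_le_add ?_ ((norm_sum_le _ _).trans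
    (Finset.sum_le_sum fun j _ => ?_))))
  · refine (hb ℂ hσ.toC g u.fn).trans ?_
    rw [← mul_assoc]
    gcongr
  · refine (hb _ hσ.toC g u.grad).trans ?_
    rw [← mul_assoc]
    gcongr
  · refine (hb _ (hσ.derivC j) g (coordL j u.fn)).trans ?_
    have : ‖coordL j u.fn‖ ≤ ‖coordL (d := d) j‖ * ‖u‖ :=
      ((coordL j).le_opNorm _).trans (by gcongr)
    calc _ ≤ ‖(smulC (EuclideanSpace ℂ (Fin d)) : C(Torus d, ℝ) →L[ℝ] _)‖
          * (‖conv (hσ.derivC j)‖ * ‖g‖) * (‖coordL (d := d) j‖ * ‖u‖) := by gcongr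
      _ = _ := by ring

/-- Multiplication by a potential `σ ⋆ g`, as a bounded bilinear map. -/
def mulL {σ : Torus d → ℝ} (hσ : Smooth σ) :
    Lp ℝ 1 (volume : Measure (Torus d)) →L[ℝ] H1 d →L[ℝ] H1 d :=
  LinearMap.mkContinuous₂
    (LinearMap.mk₂ ℝ (mulH1 hσ)
      (fun g g' u => H1.ext (by simp [mulH1, H1.fn]) (by
        simp only [mulH1, gradMul, H1.grad, map_add, add_apply, Finset.sum_add_distrib,
          Submodule.coe_add, WithLp.add_snd, WithLp.toLp_snd]
        abel))
      (fun r g u => H1.ext (by simp [mulH1, H1.fn]) (by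
        simp [mulH1, gradMul, H1.grad, Finset.smul_sum]))
      (fun g u u' => H1.ext (by simp [mulH1, H1.fn]) (by
        simp only [mulH1, gradMul, H1.grad, H1.fn, map_add, Finset.sum_add_distrib,
          Submodule.coe_add, WithLp.add_snd, WithLp.add_fst, WithLp.toLp_snd]
        abel))
      (fun r g u => H1.ext (by
        change smulC ℂ _ (r • u.fn) = r • smulC ℂ _ u.fn
        rw [map_smul]) (by
        change gradMul hσ g (r • u) = r • gradMul hσ g u
        simp only [gradMul, H1.fn_smul, H1.grad_smul, smul_add, Finset.smul_sum, map_smul]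
        congr 1
        refine Finset.sum_congr rfl fun j _ => ?_
        rw [← map_smul]
        congr 1
        exact ((coordL j).restrictScalars ℝ).map_smul r u.fn)))
    (exists_norm_mulH1_le hσ).choose (exists_norm_mulH1_le hσ).choose_spec

theorem coeFn_mulL {σ : Torus d → ℝ} (hσ : Smooth σ) (g : Lp ℝ 1 (volume : Measure (Torus d)))
    (u : H1 d) : (mulL hσ g u).fn =ᵐ[volume] fun x => (conv hσ.toC g x : ℂ) * u.fn x := by
  filter_upwards [coeFn_smulC (conv hσ.toC g) u.fn] with x hx
  exact hx

end Multiplication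

/-! ### The nonlinearity -/

section Nonlinear

open Torus

variable {d : ℕ}

/-- The inclusion of `L²(𝕋^d)` in `L¹(𝕋^d)`. -/
def toL1 (d : ℕ) : Lp ℝ 2 (volume : Measure (Torus d)) →L[ℝ] Lp ℝ 1 (volume : Measure (Torus d)) :=
  (ContinuousLinearMap.mul ℝ ℝ).holderL volume 2 2 1 (Lp.const 2 volume 1)

theorem coeFn_toL1 (f : Lp ℝ 2 (volume : Measure (Torus d))) : toL1 d f =ᵐ[volume] f := by
  filter_upwards [(ContinuousLinearMap.mul ℝ ℝ).coeFn_holder (r := 1)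
    (Lp.const 2 (volume : Measure (Torus d)) (1 : ℝ)) f,
    Lp.coeFn_const 2 (volume : Measure (Torus d)) (1 : ℝ)] with x h1 h2
  refine h1.trans ?_
  rw [h2]
  simp

/-- The bilinear map `(u, v) ↦ Re (ū v)`, from `L²` to `L¹`. -/
def reInner (d : ℕ) : Lp ℂ 2 (volume : Measure (Torus d)) →L[ℝ]
    Lp ℂ 2 (volume : Measure (Torus d)) →L[ℝ] Lp ℝ 1 (volume : Measure (Torus d)) :=
  (innerSL ℝ : ℂ →L[ℝ] ℂ →L[ℝ] ℝ).holderL volume 2 2 1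

theorem coeFn_reInner (u v : Lp ℂ 2 (volume : Measure (Torus d))) :
    reInner d u v =ᵐ[volume] fun x => inner ℝ (u x) (v x) :=
  (innerSL ℝ : ℂ →L[ℝ] ℂ →L[ℝ] ℝ).coeFn_holder u v

/-- The bilinear map `(u, v) ↦ σ ⋆ Re (ū v)`; its diagonal is the density. -/
def rho {σ : Torus d → ℝ} (hσ : Smooth σ) : Lp ℂ 2 (volume : Measure (Torus d)) →L[ℝ]
    Lp ℂ 2 (volume : Measure (Torus d)) →L[ℝ] C(Torus d, ℝ) :=
  ((ContinuousLinearMap.compL ℝ _ _ _) (conv hσ.toC)).comp (reInner d)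

theorem rho_apply {σ : Torus d → ℝ} (hσ : Smooth σ) (u v : Lp ℂ 2 (volume : Measure (Torus d))) :
    rho hσ u v = conv hσ.toC (reInner d u v) := rfl

theorem rho_comm {σ₁ : Torus d → ℝ} (h₁ : Smooth σ₁) (u v : Lp ℂ 2 (volume : Measure (Torus d))) :
    rho h₁ u v = rho h₁ v u := by
  rw [rho_apply, rho_apply]
  congr 1
  refine Lp.ext ?_
  filter_upwards [coeFn_reInner u v, coeFn_reInner v u] with x hx hx'
  rw [hx, hx', real_inner_comm]

theorem rho_self_apply {σ : Torus d → ℝ} (hσ : Smooth σ) (u : H1 d) (x : Torus d) :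
    rho hσ u.fn u.fn x = density σ u x := by
  rw [rho_apply, conv_apply, density]
  refine integral_congr_ae ?_
  filter_upwards [coeFn_reInner u.fn u.fn] with y hy
  rw [hy, real_inner_self_eq_norm_sq]
  rfl

/-- Continuous functions as elements of `L²`. -/
def contL2 (d : ℕ) : C(Torus d, ℝ) →L[ℝ] Lp ℝ 2 (volume : Measure (Torus d)) :=
  ContinuousMap.toLp 2 volume ℝ

theorem coeFn_contL2 (f : C(Torus d, ℝ)) : contL2 d f =ᵐ[volume] f :=
  ContinuousMap.coeFn_toLp (p := 2) (𝕜 := ℝ) volume f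

/-- The function `x ↦ r(x) h`, linearly in `r`. -/
def tensorL {H : Type*} [NormedAddCommGroup H] [InnerProductSpace ℝ H] (h : H) :
    Lp ℝ 2 (volume : Measure (Torus d)) →L[ℝ] Lp H 2 (volume : Measure (Torus d)) :=
  (ContinuousLinearMap.toSpanSingleton ℝ h).compLpL 2 volume

theorem tensorL_apply {H : Type*} [NormedAddCommGroup H] [InnerProductSpace ℝ H] (h : H)
    (r : Lp ℝ 2 (volume : Measure (Torus d))) : tensorL h r = tensor r h := rfl

variable {n : ℕ} [Fact (3 ≤ n)]

/-- The function `y ↦ ∫ σ₂(z) Ψ(y, z) dz`. -/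
def fieldMean {σ₂ : Space n → ℝ} (h₂ : IsTest σ₂) :
    Field d n →L[ℝ] Lp ℝ 2 (volume : Measure (Torus d)) := pairL (HDot1.riesz h₂)

theorem coeFn_fieldMean {σ₂ : Space n → ℝ} (h₂ : IsTest σ₂) (Ψ : Field d n) :
    fieldMean h₂ Ψ =ᵐ[volume] fun y => ∫ z, σ₂ z * (Ψ y).fn z := by
  filter_upwards [coeFn_pairL (HDot1.riesz h₂) Ψ] with y hy
  rw [fieldMean, hy, HDot1.inner_riesz]
  simp only [mul_comm]

theorem conv_fieldMean {σ₁ : Torus d → ℝ} (h₁ : Smooth σ₁) {σ₂ : Space n → ℝ} (h₂ : IsTest σ₂)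
    (Ψ : Field d n) (x : Torus d) :
    conv h₁.toC (toL1 d (fieldMean h₂ Ψ)) x = potential σ₁ σ₂ Ψ x := by
  rw [conv_apply, potential]
  refine integral_congr_ae ?_
  filter_upwards [coeFn_fieldMean h₂ Ψ, coeFn_toL1 (fieldMean h₂ Ψ)] with y h1 h2
  rw [h2, h1]
  rfl

/-- The states `(u, (π, Ψ))`, where `π = 2 c Π` is the momentum in the normalization for which the
free wave equation preserves `‖π‖² + ‖∇Ψ‖²`. -/
abbrev State (d n : ℕ) [Fact (3 ≤ n)] : Type := H1 d × WaveSpace d n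

/-- The nonlinear term of the Schrödinger equation, `-i γ Φ u`. -/
def schrodingerForce (γ : ℝ) {σ₁ : Torus d → ℝ} (h₁ : Smooth σ₁) {σ₂ : Space n → ℝ}
    (h₂ : IsTest σ₂) (X : State d n) : H1 d :=
  (-(Complex.I * γ)) • mulL h₁ (toL1 d (fieldMean h₂ X.2.snd)) X.1

/-- The source of the wave equation, `c γ ρ(u) σ₂`. -/
def waveForce (γ c : ℝ) {σ₁ : Torus d → ℝ} (h₁ : Smooth σ₁) {σ₂ : Space n → ℝ}
    (h₂ : IsTest σ₂) (X : State d n) : WaveSpace d n :=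
  WithLp.toLp 2 (tensorL (testL2 h₂) (contL2 d ((c * γ) • rho h₁ X.1.fn X.1.fn)), 0)

/-- The nonlinearity of the system. -/
def force (γ c : ℝ) {σ₁ : Torus d → ℝ} (h₁ : Smooth σ₁) {σ₂ : Space n → ℝ}
    (h₂ : IsTest σ₂) (X : State d n) : State d n :=
  (schrodingerForce γ h₁ h₂ X, waveForce γ c h₁ h₂ X)

/-- The inclusion of `H¹` in `L²`, as a real linear map. -/
def H1.fnLR (d : ℕ) : H1 d →L[ℝ] Lp ℂ 2 (volume : Measure (Torus d)) :=
  ContinuousLinearMap.restrictScalars ℝ (H1.fnL : H1 d →L[ℂ] Lp ℂ 2 (volume : Measure (Torus d)))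

/-- Multiplication by a complex number on `H¹`, as a real linear map. -/
def H1.smulL (d : ℕ) (z : ℂ) : H1 d →L[ℝ] H1 d :=
  ContinuousLinearMap.restrictScalars ℝ (z • ContinuousLinearMap.id ℂ (H1 d))

/-- The first component of a state. -/
def State.waveFnL (d n : ℕ) [Fact (3 ≤ n)] : State d n →L[ℝ] H1 d :=
  ContinuousLinearMap.fst ℝ (H1 d) (WaveSpace d n)

/-- The first component of a state, as an element of `L²`. -/
def State.waveFnL₂ (d n : ℕ) [Fact (3 ≤ n)] :
    State d n →L[ℝ] Lp ℂ 2 (volume : Measure (Torus d)) :=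
  (H1.fnLR d).comp (State.waveFnL d n)

/-- The field component of a state. -/
def State.fieldL (d n : ℕ) [Fact (3 ≤ n)] : State d n →L[ℝ] Field d n :=
  (WithLp.sndL 2 ℝ (Momentum d n) (Field d n)).comp
    (ContinuousLinearMap.snd ℝ (H1 d) (WaveSpace d n))

/-- A bounded bilinear map of a pair that depends boundedly linearly on the point is Lipschitz on
bounded sets. -/
theorem exists_norm_bilin_sub_le {E A B G : Type*} [SeminormedAddCommGroup E] [NormedSpace ℝ E]
    [SeminormedAddCommGroup A] [NormedSpace ℝ A] [SeminormedAddCommGroup B] [NormedSpace ℝ B]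
    [SeminormedAddCommGroup G] [NormedSpace ℝ G] (b : A →L[ℝ] B →L[ℝ] G) (f : E →L[ℝ] A)
    (g : E →L[ℝ] B) : ∃ C, 0 ≤ C ∧ ∀ x y : E,
      ‖b (f x) (g x) - b (f y) (g y)‖ ≤ C * (‖x‖ + ‖y‖) * ‖x - y‖ := by
  refine ⟨‖b‖ * ‖f‖ * ‖g‖, by positivity, fun x y => ?_⟩
  have e : b (f x) (g x) - b (f y) (g y) = b (f (x - y)) (g x) + b (f y) (g (x - y)) := by
    simp only [map_sub, sub_apply]
    abel
  have h : ∀ x y, ‖b (f x) (g y)‖ ≤ ‖b‖ * (‖f‖ * ‖x‖) * (‖g‖ * ‖y‖) := fun x y =>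
    (b.le_opNorm₂ _ _).trans (by gcongr <;> exact ContinuousLinearMap.le_opNorm _ _)
  rw [e]
  refine (norm_add_le _ _).trans ((add_le_add (h _ _) (h _ _)).trans_eq ?_)
  ring

theorem exists_norm_schrodingerForce_sub_le (γ : ℝ) {σ₁ : Torus d → ℝ} (h₁ : Smooth σ₁)
    {σ₂ : Space n → ℝ} (h₂ : IsTest σ₂) : ∃ C, 0 ≤ C ∧ ∀ X Y : State d n,
      ‖schrodingerForce γ h₁ h₂ X - schrodingerForce γ h₁ h₂ Y‖ ≤
        C * (‖X‖ + ‖Y‖) * ‖X - Y‖ :=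
  exists_norm_bilin_sub_le
    ((ContinuousLinearMap.compL ℝ _ _ _ (H1.smulL d (-(Complex.I * γ)))).comp (mulL h₁))
    ((toL1 d).comp ((fieldMean h₂).comp (State.fieldL d n))) (State.waveFnL d n)

theorem exists_norm_waveForce_sub_le (γ c : ℝ) {σ₁ : Torus d → ℝ} (h₁ : Smooth σ₁)
    {σ₂ : Space n → ℝ} (h₂ : IsTest σ₂) : ∃ C, 0 ≤ C ∧ ∀ X Y : State d n,
      ‖waveForce γ c h₁ h₂ X - waveForce γ c h₁ h₂ Y‖ ≤ C * (‖X‖ + ‖Y‖) * ‖X - Y‖ := by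
  obtain ⟨C2, h20, h2⟩ := exists_norm_bilin_sub_le (rho h₁) (State.waveFnL₂ d n)
    (State.waveFnL₂ d n)
  let L : C(Torus d, ℝ) →L[ℝ] Momentum d n := (tensorL (testL2 h₂)).comp (contL2 d)
  refine ⟨‖L‖ * (|c * γ| * C2), by positivity, fun X Y => ?_⟩
  have e : waveForce γ c h₁ h₂ X - waveForce γ c h₁ h₂ Y
      = WithLp.toLp 2 (L ((c * γ) • (rho h₁ X.1.fn X.1.fn - rho h₁ Y.1.fn Y.1.fn)), 0) := by
    rw [waveForce, waveForce, ← WithLp.toLp_sub, Prod.mk_sub_mk, sub_zero, smul_sub, map_sub]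
    rfl
  rw [e, WithLp.norm_toLp_fst]
  refine (L.le_opNorm _).trans ?_
  rw [norm_smul, Real.norm_eq_abs]
  calc ‖L‖ * (|c * γ| * ‖rho h₁ X.1.fn X.1.fn - rho h₁ Y.1.fn Y.1.fn‖)
      ≤ ‖L‖ * (|c * γ| * (C2 * (‖X‖ + ‖Y‖) * ‖X - Y‖)) :=
        mul_le_mul_of_nonneg_left (mul_le_mul_of_nonneg_left (h2 X Y) (abs_nonneg _))
          (norm_nonneg L)
    _ = _ := by ring

/-- The nonlinearity is locally Lipschitz, with a constant growing linearly with the norms. -/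
theorem exists_norm_force_sub_le (γ c : ℝ) {σ₁ : Torus d → ℝ} (h₁ : Smooth σ₁) {σ₂ : Space n → ℝ}
    (h₂ : IsTest σ₂) : ∃ C, 0 ≤ C ∧ ∀ X Y : State d n,
      ‖force γ c h₁ h₂ X - force γ c h₁ h₂ Y‖ ≤ C * (‖X‖ + ‖Y‖) * ‖X - Y‖ := by
  obtain ⟨C1, h10, h1⟩ := exists_norm_schrodingerForce_sub_le γ h₁ h₂ (d := d) (n := n)
  obtain ⟨C2, h20, h2⟩ := exists_norm_waveForce_sub_le γ c h₁ h₂ (d := d) (n := n)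
  refine ⟨max C1 C2, le_max_of_le_left h10, fun X Y => ?_⟩
  refine Prod.norm_def _ |>.trans_le (max_le ((h1 X Y).trans ?_) ((h2 X Y).trans ?_))
  · gcongr
    exact le_max_left _ _
  · gcongr
    exact le_max_right _ _

theorem force_zero (γ c : ℝ) {σ₁ : Torus d → ℝ} (h₁ : Smooth σ₁) {σ₂ : Space n → ℝ}
    (h₂ : IsTest σ₂) : force γ c h₁ h₂ (0 : State d n) = 0 := by
  refine Prod.ext ?_ ?_
  · change (-(Complex.I * γ)) • mulL h₁ _ (0 : H1 d) = 0
    rw [map_zero, smul_zero]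
  · change WithLp.toLp 2 (tensorL (testL2 h₂) (contL2 d ((c * γ) •
      rho h₁ (0 : Lp ℂ 2 (volume : Measure (Torus d))) 0)), 0) = 0
    simp

end Nonlinear

/-! ### Mild solutions of semilinear equations -/

/-- A nonlinearity that vanishes at the origin and is Lipschitz on bounded sets, with a constant
that grows linearly. -/
structure IsQuadratic {E : Type*} [NormedAddCommGroup E] (F : E → E) : Prop where
  map_zero : F 0 = 0
  exists_le : ∃ C, 0 ≤ C ∧ ∀ x y, ‖F x - F y‖ ≤ C * (‖x‖ + ‖y‖) * ‖x - y‖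

theorem IsQuadratic.continuous {E : Type*} [NormedAddCommGroup E] {F : E → E} (hF : IsQuadratic F) :
    Continuous F := by
  obtain ⟨C, hC, h⟩ := hF.exists_le
  rw [continuous_iff_continuousAt]
  intro X
  rw [ContinuousAt, tendsto_iff_norm_sub_tendsto_zero]
  have h0 : Tendsto (fun Y => C * (‖Y‖ + ‖X‖) * ‖Y - X‖) (𝓝 X) (𝓝 0) := by
    have : Continuous fun Y => C * (‖Y‖ + ‖X‖) * ‖Y - X‖ := by fun_prop
    simpa using this.tendsto X
  exact squeeze_zero (fun _ => norm_nonneg _) (fun Y => h Y X) h0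

section Semilinear

variable {E E' : Type*} [NormedAddCommGroup E] [NormedSpace ℝ E] [NormedAddCommGroup E']
  [NormedSpace ℝ E']

/-- The product of two flows. -/
def IsometricFlow.prod (S : IsometricFlow ℝ E) (S' : IsometricFlow ℝ E') :
    IsometricFlow ℝ (E × E') where
  toFun t := (S t).prodMap (S' t)
  map_zero' x := Prod.ext (S.map_zero _) (S'.map_zero _)
  map_add' s t x := Prod.ext (S.map_add _ _ _) (S'.map_add _ _ _)
  norm_map' t x := by simp [Prod.norm_def]
  continuous' x := (S.continuous' x.1).prodMk (S'.continuous' x.2)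

theorem continuous_radialRetraction {R : ℝ} (hR : 0 < R) :
    Continuous (radialRetraction R : E → E) :=
  (LipschitzWith.of_dist_le_mul (K := 2) fun x y => by
    rw [dist_eq_norm, dist_eq_norm]; exact norm_radialRetraction_sub_le hR x y).continuous

/-- The truncated nonlinearity is Lipschitz uniformly in time, also after conjugation with the flow.
-/
theorem exists_lipschitzWith_truncated (U : IsometricFlow ℝ E) {F : E → E} (hF : IsQuadratic F)
    {R : ℝ} (hR : 0 < R) : ∃ K : NNReal, ∀ t,
      LipschitzWith K fun x => U (-t) (F (radialRetraction R (U t x))) := by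
  obtain ⟨C, hC, h⟩ := hF.exists_le
  refine ⟨(C * (R + R) * 2).toNNReal, fun t => LipschitzWith.of_dist_le_mul fun x y => ?_⟩
  rw [dist_eq_norm, dist_eq_norm, ← map_sub, U.norm_map, Real.coe_toNNReal _ (by positivity)]
  refine (h _ _).trans ?_
  calc _ ≤ C * (R + R) * (2 * ‖U t x - U t y‖) := by
        gcongr
        · exact norm_radialRetraction_le hR.le _
        · exact norm_radialRetraction_le hR.le _
        · exact norm_radialRetraction_sub_le hR _ _
    _ = _ := by rw [← map_sub, U.norm_map]; ring

/-- The mild form of the equation with the truncated nonlinearity has global solutions. -/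
theorem exists_truncated_mild [CompleteSpace E] (U : IsometricFlow ℝ E) {F : E → E}
    (hF : IsQuadratic F) {R : ℝ} (hR : 0 < R) (x₀ : E) : ∃ Y : ℝ → E, Continuous Y ∧ Y 0 = x₀ ∧
      ∀ t, HasDerivAt (fun s => U (-s) (Y s)) (U (-t) (F (radialRetraction R (Y t)))) t := by
  obtain ⟨K, hK⟩ := exists_lipschitzWith_truncated U hF hR
  obtain ⟨C, hC, h⟩ := hF.exists_le
  obtain ⟨z, hz0, hz⟩ := exists_global_integralCurve
    (fun t x => U (-t) (F (radialRetraction R (U t x)))) hK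
    (fun x => U.continuous_comp continuous_neg (hF.continuous.comp
      ((continuous_radialRetraction hR).comp (U.continuous' x))))
    (M := (C * R * R).toNNReal)
    (fun t x => by
      rw [U.norm_map, Real.coe_toNNReal _ (by positivity)]
      have h1 := h (radialRetraction R (U t x)) 0
      rw [hF.map_zero, sub_zero, sub_zero, norm_zero, add_zero] at h1
      have h2 := norm_radialRetraction_le hR.le (U t x)
      exact h1.trans (by gcongr)) x₀
  refine ⟨fun t => U t (z t), U.continuous_comp continuous_id
    (continuous_iff_continuousAt.2 fun t => (hz t).continuousAt), by simp [hz0], fun t => ?_⟩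
  simp only [U.neg_apply_apply]
  exact hz t

/-- Uniqueness of mild solutions. -/
theorem eqOn_of_mild (U : IsometricFlow ℝ E) {F : E → E} (hF : IsQuadratic F) {Y₁ Y₂ : ℝ → E}
    (hY₁ : ContinuousOn Y₁ (Ici 0)) (hY₂ : ContinuousOn Y₂ (Ici 0)) (h0 : Y₁ 0 = Y₂ 0)
    (h₁ : ∀ t, 0 ≤ t →
      HasDerivWithinAt (fun s => U (-s) (Y₁ s)) (U (-t) (F (Y₁ t))) (Ici 0) t)
    (h₂ : ∀ t, 0 ≤ t →
      HasDerivWithinAt (fun s => U (-s) (Y₂ s)) (U (-t) (F (Y₂ t))) (Ici 0) t) :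
    EqOn Y₁ Y₂ (Ici 0) := by
  intro T hT
  have hb : ∀ Y : ℝ → E, ContinuousOn Y (Ici 0) → ∃ R, ∀ t ∈ Icc 0 T, ‖Y t‖ ≤ R := fun Y hY =>
    isCompact_Icc.exists_bound_of_continuousOn (hY.mono Icc_subset_Ici_self)
  obtain ⟨R₁, hR₁⟩ := hb Y₁ hY₁
  obtain ⟨R₂, hR₂⟩ := hb Y₂ hY₂
  set R := max (max R₁ R₂) 1
  have hR : 0 < R := lt_of_lt_of_le one_pos (le_max_right _ _)
  obtain ⟨K, hK⟩ := exists_lipschitzWith_truncated U hF hR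
  have hd : ∀ Y : ℝ → E, (∀ t ∈ Icc 0 T, ‖Y t‖ ≤ R) → (∀ t, 0 ≤ t →
      HasDerivWithinAt (fun s => U (-s) (Y s)) (U (-t) (F (Y t))) (Ici 0) t) →
      ∀ t ∈ Ico 0 T, HasDerivWithinAt (fun s => U (-s) (Y s))
        (U (-t) (F (radialRetraction R (U t (U (-t) (Y t)))))) (Ici t) t := by
    intro Y hY h t ht
    rw [U.apply_neg_apply, radialRetraction_of_norm_le (hY t ⟨ht.1, ht.2.le⟩)]
    exact (h t ht.1).mono (Ici_subset_Ici.2 ht.1)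
  have hc : ∀ Y : ℝ → E, ContinuousOn Y (Ici 0) →
      ContinuousOn (fun s => U (-s) (Y s)) (Icc 0 T) := fun Y hY =>
    U.continuousOn_comp continuous_neg (hY.mono Icc_subset_Ici_self)
  have key := ODE_solution_unique_of_mem_Icc_right
    (v := fun t x => U (-t) (F (radialRetraction R (U t x)))) (s := fun _ => univ) (K := K)
    (a := 0) (b := T)
    (fun t _ => (hK t).lipschitzOnWith) (hc _ hY₁)
    (hd Y₁ (fun t ht => (hR₁ t ht).trans ((le_max_left _ _).trans (le_max_left _ _))) h₁)
    (fun _ _ => mem_univ _) (hc _ hY₂)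
    (hd Y₂ (fun t ht => (hR₂ t ht).trans ((le_max_right _ _).trans (le_max_left _ _))) h₂)
    (fun _ _ => mem_univ _) (by simp [h0]) (right_mem_Icc.2 hT)
  have := congrArg (U T) key
  simpa using this

end Semilinear

/-! ### The flow of the linear system -/

section LinearFlow

variable {d n : ℕ} [Fact (3 ≤ n)]

theorem isQuadratic_force (γ c : ℝ) {σ₁ : Torus d → ℝ} (h₁ : Torus.Smooth σ₁) {σ₂ : Space n → ℝ}
    (h₂ : IsTest σ₂) : IsQuadratic (force γ c h₁ h₂ : State d n → State d n) :=
  ⟨force_zero γ c h₁ h₂, exists_norm_force_sub_le γ c h₁ h₂⟩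

/-- The free Schrödinger group, as a flow of real linear isometries. -/
def freeFlowReal (d : ℕ) : IsometricFlow ℝ (H1 d) where
  toFun t := (H1.freeFlow d t).restrictScalars ℝ
  map_zero' := (H1.freeFlow d).map_zero
  map_add' := (H1.freeFlow d).map_add
  norm_map' := (H1.freeFlow d).norm_map
  continuous' := (H1.freeFlow d).continuous'

variable (d n) in
/-- The flow of the free wave equation with unit speed. -/
def waveFlow : IsometricFlow ℝ (WaveSpace d n) := (isSkewAdjointGraph_wave.exists_flow).choose

theorem hasDerivAt_waveFlow {p : WaveSpace d n × WaveSpace d n} (hp : p ∈ wave d n) (t : ℝ) :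
    HasDerivAt (fun s => waveFlow d n s p.1) (waveFlow d n t p.2) t ∧
      (waveFlow d n t p.1, waveFlow d n t p.2) ∈ wave d n :=
  isSkewAdjointGraph_wave.exists_flow.choose_spec p.1 p.2 hp t

variable (d n) in
/-- The flow of the linear part of the system. -/
def linearFlow (c : ℝ) : IsometricFlow ℝ (State d n) :=
  (freeFlowReal d).prod ((waveFlow d n).rescale c)

end LinearFlow

/-! ### Weak and mild solutions of the linear equations -/

section Integral

variable {H F : Type*} [NormedAddCommGroup H] [NormedSpace ℝ H] [CompleteSpace H]
  [NormedAddCommGroup F] [NormedSpace ℝ F]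

/-- A linear differential equation on `[0, ∞)`, tested against continuous linear maps, in integral
form. The integral form is a relation between vectors that do not depend on the test. -/
theorem hasDerivWithinAt_iff_integral (l₀ l₁ l₂ : H →L[ℝ] F) {u f : ℝ → H} (hu : Continuous u)
    (hf : Continuous f) :
    (∀ t, 0 ≤ t → HasDerivWithinAt (fun s => l₀ (u s)) (l₁ (u t) + l₂ (f t)) (Ici 0) t) ↔
      ∀ t, 0 ≤ t → l₀ (u t - u 0) = l₁ (∫ s in (0 : ℝ)..t, u s) + l₂ (∫ s in (0 : ℝ)..t, f s) := by
  have hU : ∀ t, HasDerivAt (fun t => ∫ s in (0 : ℝ)..t, u s) (u t) t := fun t =>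
    hu.integral_hasStrictDerivAt 0 t |>.hasDerivAt
  have hG : ∀ t, HasDerivAt (fun t => ∫ s in (0 : ℝ)..t, f s) (f t) t := fun t =>
    hf.integral_hasStrictDerivAt 0 t |>.hasDerivAt
  have hR : ∀ t, HasDerivAt
      (fun t => l₁ (∫ s in (0 : ℝ)..t, u s) + l₂ (∫ s in (0 : ℝ)..t, f s))
      (l₁ (u t) + l₂ (f t)) t := fun t =>
    ((l₁.hasFDerivAt).comp_hasDerivAt t (hU t)).add ((l₂.hasFDerivAt).comp_hasDerivAt t (hG t))
  constructor
  · intro h t ht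
    have h1 := constant_of_has_deriv_right_zero (a := 0) (b := t)
      (f := fun t => l₀ (u t) -
        (l₁ (∫ s in (0 : ℝ)..t, u s) + l₂ (∫ s in (0 : ℝ)..t, f s)))
      (((l₀.continuous.comp hu).sub
        (continuous_iff_continuousAt.2 fun t => (hR t).continuousAt)).continuousOn)
      (fun s hs => by
        have h2 := ((h s hs.1).sub (hR s).hasDerivWithinAt).mono (Ici_subset_Ici.2 hs.1)
        rw [sub_self] at h2
        exact h2) t ⟨ht, le_rfl⟩
    simp only [intervalIntegral.integral_same, map_zero, add_zero, sub_zero] at h1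
    rw [map_sub, ← h1, sub_sub_cancel]
  · intro h t ht
    have h1 : ∀ s ∈ Ici (0 : ℝ), l₀ (u s) = l₀ (u 0) +
        (l₁ (∫ r in (0 : ℝ)..s, u r) + l₂ (∫ r in (0 : ℝ)..s, f r)) := by
      intro s hs
      rw [← h s hs, map_sub, add_sub_cancel]
    exact ((hR t).const_add _).hasDerivWithinAt.congr h1 (h1 t ht)

/-- The same on the whole line. -/
theorem hasDerivAt_iff_integral (l₀ l₁ l₂ : H →L[ℝ] F) {u f : ℝ → H} (hu : Continuous u)
    (hf : Continuous f) : (∀ t, HasDerivAt (fun s => l₀ (u s)) (l₁ (u t) + l₂ (f t)) t) ↔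
      ∀ t, l₀ (u t - u 0) = l₁ (∫ s in (0 : ℝ)..t, u s) + l₂ (∫ s in (0 : ℝ)..t, f s) := by
  have hU : ∀ t, HasDerivAt (fun t => ∫ s in (0 : ℝ)..t, u s) (u t) t := fun t =>
    hu.integral_hasStrictDerivAt 0 t |>.hasDerivAt
  have hG : ∀ t, HasDerivAt (fun t => ∫ s in (0 : ℝ)..t, f s) (f t) t := fun t =>
    hf.integral_hasStrictDerivAt 0 t |>.hasDerivAt
  have hR : ∀ t, HasDerivAt
      (fun t => l₁ (∫ s in (0 : ℝ)..t, u s) + l₂ (∫ s in (0 : ℝ)..t, f s))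
      (l₁ (u t) + l₂ (f t)) t := fun t =>
    ((l₁.hasFDerivAt).comp_hasDerivAt t (hU t)).add ((l₂.hasFDerivAt).comp_hasDerivAt t (hG t))
  constructor
  · intro h t
    have h0 : ∀ s, HasDerivAt (fun t => l₀ (u t) -
        (l₁ (∫ s in (0 : ℝ)..t, u s) + l₂ (∫ s in (0 : ℝ)..t, f s))) 0 s := fun s => by
      have := (h s).sub (hR s)
      rwa [sub_self] at this
    have h1 := is_const_of_deriv_eq_zero (fun s => (h0 s).differentiableAt)
      (fun s => (h0 s).deriv) t 0
    simp only [intervalIntegral.integral_same, map_zero, add_zero, sub_zero] at h1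
    rw [map_sub, ← h1, sub_sub_cancel]
  · intro h t
    have h1 : ∀ s, l₀ (u s) = l₀ (u 0) +
        (l₁ (∫ r in (0 : ℝ)..s, u r) + l₂ (∫ r in (0 : ℝ)..s, f r)) := by
      intro s
      rw [← h s, map_sub, add_sub_cancel]
    exact ((hR t).const_add _).congr_of_eventuallyEq (Eventually.of_forall h1)

end Integral

section Schrodinger

open Torus

variable {d : ℕ}

namespace H1

/-- The weak form of a linear relation holds for all test functions if it holds for the
characters. -/
theorem inner_fn_eq_of_charL2 {v a b : H1 d}
    (h : ∀ k, inner ℂ (charL2 k) v.fn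
      = -(Complex.I / 2) * (freqSq k * inner ℂ (charL2 k) a.fn) + inner ℂ (charL2 k) b.fn)
    (w : H1 d) : inner ℂ w.fn v.fn
      = -(Complex.I / 2) * inner ℂ w.grad a.grad + inner ℂ w.fn b.fn := by
  -- the element of `H¹` that represents the difference of the two sides
  set Z : H1 d := ContinuousLinearMap.adjoint fnL (v.fn - b.fn)
    + (Complex.I / 2) • ContinuousLinearMap.adjoint gradL a.grad with hZ
  have hin : ∀ w : H1 d, inner ℂ w Z
      = inner ℂ w.fn v.fn - inner ℂ w.fn b.fn + Complex.I / 2 * inner ℂ w.grad a.grad := by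
    intro w
    rw [hZ, inner_add_right, inner_smul_right', ContinuousLinearMap.adjoint_inner_right,
      ContinuousLinearMap.adjoint_inner_right, inner_sub_right]
    rfl
  have h0 : Z = 0 := by
    refine hilbertBasis_ext (basis d) fun k => ?_
    rw [basis_apply, inner_smul_left', inner_smul_left', inner_zero_right, mul_zero, hin, fn_char,
      inner_grad_char, h]
    ring
  have h1 := hin w
  rw [h0, inner_zero_right] at h1
  linear_combination -h1

/-- The functional `u ↦ ⟨w, u⟩` of `L²`. -/
def pairFn (w : H1 d) : H1 d →L[ℝ] ℂ :=
  ContinuousLinearMap.restrictScalars ℝ ((innerSL ℂ w.fn).comp fnL)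

/-- The functional `u ↦ ⟨∇w, ∇u⟩` of `L²`, times `-i / 2`. -/
def pairGrad (w : H1 d) : H1 d →L[ℝ] ℂ :=
  ContinuousLinearMap.restrictScalars ℝ ((-(Complex.I / 2)) • (innerSL ℂ w.grad).comp gradL)

theorem pairGrad_apply (w u : H1 d) :
    pairGrad w u = -(Complex.I / 2) * inner ℂ w.grad u.grad := rfl

/-- The identity `⟪b, u⟫_{H¹} = const * ⟪b, u⟫_{L²}` for the elements of the Fourier basis of `H¹`.
-/
theorem inner_basis_eq (k : Fin d → ℤ) (u : H1 d) : inner ℂ (basis d k) u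
    = (((charNorm k)⁻¹ * (1 + freqSq k) : ℝ) : ℂ) * inner ℂ (charL2 k) u.fn := by
  rw [basis_apply, inner_smul_left', inner_char]
  simp [mul_assoc]

/-- A mild solution of `u' = (i / 2) Δ u + f` solves the equation in the dual of `H¹`. -/
theorem hasDerivAt_inner_fn_of_mild {u f : ℝ → H1 d} (hu : Continuous u) (hf : Continuous f)
    (h : ∀ t, HasDerivAt (fun s => freeFlow d (-s) (u s)) (freeFlow d (-t) (f t)) t) (w : H1 d)
    (t : ℝ) : HasDerivAt (fun s => inner ℂ w.fn (u s).fn)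
      (-(Complex.I / 2) * inner ℂ w.grad (u t).grad + inner ℂ w.fn (f t).fn) t := by
  have key : ∀ k t, HasDerivAt (fun s => inner ℂ (charL2 k) (u s).fn)
      (-(Complex.I / 2) * (freqSq k * inner ℂ (charL2 k) (u t).fn)
        + inner ℂ (charL2 k) (f t).fn) t := by
    intro k t
    have h1 := hasDerivAt_inner_of_mild (freeFlow d)
      (fun t => IsometricFlow.hasDerivAt_diagonal_basis (basis d) (fun k => -(freqSq k / 2)) k t)
      (h t)
    simp only [IsometricFlow.apply_neg_apply, inner_smul_left', inner_basis_eq] at h1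
    have hN : charNorm k ≠ 0 := (charNorm_pos k).ne'
    have hF : 1 + freqSq k ≠ 0 := by linarith [freqSq_nonneg k]
    set N : ℝ := (charNorm k)⁻¹ * (1 + freqSq k) with hNdef
    have hN0 : (N : ℂ) ≠ 0 := by
      rw [hNdef]
      exact_mod_cast mul_ne_zero (inv_ne_zero hN) hF
    have h2 := h1.const_mul ((N : ℂ)⁻¹)
    refine (h2.congr_deriv ?_).congr_of_eventuallyEq (Eventually.of_forall fun s => ?_)
    · simp only [map_mul, Complex.conj_I, Complex.conj_ofReal]
      field_simp
      push_cast
      ring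
    · simp only
      field_simp
  refine (hasDerivAt_iff_integral (pairFn w) (pairGrad w) (pairFn w) hu hf).2 (fun t => ?_) t
  refine inner_fn_eq_of_charL2 (v := u t - u 0) (a := ∫ s in (0 : ℝ)..t, u s)
    (b := ∫ s in (0 : ℝ)..t, f s) (fun k => ?_) w
  have := (hasDerivAt_iff_integral (pairFn (char k)) (pairGrad (char k)) (pairFn (char k))
    hu hf).1 (fun t => by
      rw [pairGrad_apply, inner_grad_char]
      exact key k t) t
  rw [pairGrad_apply, inner_grad_char] at this
  exact this

/-- A solution of `u' = (i / 2) Δ u + f` in the dual of `H¹` is a mild solution. -/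
theorem hasDerivWithinAt_freeFlow_of_weak {u f : ℝ → H1 d} (hu : Continuous u) (hf : Continuous f)
    (h : ∀ w : H1 d, ∀ t, 0 ≤ t → HasDerivWithinAt (fun s => inner ℂ w.fn (u s).fn)
      (-(Complex.I / 2) * inner ℂ w.grad (u t).grad + inner ℂ w.fn (f t).fn) (Ici 0) t)
    {t : ℝ} (ht : 0 ≤ t) :
    HasDerivWithinAt (fun s => freeFlow d (-s) (u s)) (freeFlow d (-t) (f t)) (Ici 0) t := by
  refine hasDerivWithinAt_of_weak (freeFlow d)
    (range fun p : ℂ × (Fin d → ℤ) => (p.1 • basis d p.2,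
      p.1 • ((Complex.I * (-(freqSq p.2 / 2) : ℝ)) • basis d p.2)))
    ?_ ?_ hu hf ?_ ht
  · rintro _ ⟨⟨a, k⟩, rfl⟩ t
    refine ⟨?_, ⟨(Complex.exp (Complex.I * (t * (-(freqSq k / 2)) : ℝ)) * a, k), ?_⟩⟩
    · have := (IsometricFlow.hasDerivAt_diagonal_basis (basis d) (fun k => -(freqSq k / 2)) k
        t).const_smul a
      simp only [map_smul] at this ⊢
      exact this
    · have := IsometricFlow.diagonal_basis (basis d) (fun k => -(freqSq k / 2)) k t
      simp only [map_smul, freeFlow, this, smul_smul]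
      refine Prod.ext ?_ ?_
      · simp only [mul_comm a]
      · dsimp only
        congr 1
        ring
  · intro x hx
    refine hilbertBasis_ext (basis d) fun k => ?_
    rw [inner_zero_right]
    simpa using hx _ ⟨(1, k), rfl⟩
  · rintro _ ⟨⟨a, k⟩, rfl⟩ t ht
    have h1 := (h (char k) t ht).const_mul
      (starRingEnd ℂ a * (((charNorm k)⁻¹ * (1 + freqSq k) : ℝ) : ℂ))
    simp only [inner_smul_left', inner_basis_eq]
    refine (h1.congr_deriv ?_).congr_of_mem (fun s _ => ?_) ht
    · rw [inner_grad_char, fn_char]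
      simp only [map_mul, Complex.conj_I, Complex.conj_ofReal]
      push_cast
      ring
    · rw [fn_char]
      ring

end H1

end Schrodinger

/-! ### The weak form of the wave equation -/

section WaveWeak

variable {d n : ℕ} [Fact (3 ≤ n)]

/-- The test `(a b, 0)` for the momentum and its image under the adjoint of the generator. -/
def TestPair.momentumTest (i : TestPair d n) : WaveSpace d n × WaveSpace d n :=
  (WithLp.toLp 2 (i.momentum, 0), WithLp.toLp 2 (0, -i.field))

/-- The test for the field and its image under the adjoint of the generator. -/
def TestPair.rieszTest (i : TestPair d n) : WaveSpace d n × WaveSpace d n :=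
  (WithLp.toLp 2 (0, i.riesz), WithLp.toLp 2 (i.momentum, 0))

theorem TestPair.inner_momentumTest_fst (i : TestPair d n) (w : WaveSpace d n) :
    inner ℝ i.momentumTest.1 w = inner ℝ i.momentum w.fst := by
  rw [WithLp.prod_inner_apply]
  change inner ℝ i.momentum w.fst + inner ℝ (0 : Field d n) w.snd = _
  rw [inner_zero_left, add_zero]

theorem TestPair.inner_momentumTest_snd (i : TestPair d n) (w : WaveSpace d n) :
    inner ℝ i.momentumTest.2 w = -inner ℝ i.field w.snd := by
  rw [WithLp.prod_inner_apply]
  change inner ℝ (0 : Momentum d n) w.fst + inner ℝ (-i.field) w.snd = _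
  rw [inner_zero_left, zero_add, inner_neg_left]

theorem TestPair.inner_rieszTest_fst (i : TestPair d n) (w : WaveSpace d n) :
    inner ℝ i.rieszTest.1 w = inner ℝ i.riesz w.snd := by
  rw [WithLp.prod_inner_apply]
  change inner ℝ (0 : Momentum d n) w.fst + inner ℝ i.riesz w.snd = _
  rw [inner_zero_left, zero_add]

theorem TestPair.inner_rieszTest_snd (i : TestPair d n) (w : WaveSpace d n) :
    inner ℝ i.rieszTest.2 w = inner ℝ i.momentum w.fst := by
  rw [WithLp.prod_inner_apply]
  change inner ℝ i.momentum w.fst + inner ℝ (0 : Field d n) w.snd = _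
  rw [inner_zero_left, add_zero]

/-- `y` solves `y' = c A y + f`, where `A` is the generator of the wave equation, tested against
the pair `p` of the wave relation. -/
def IsWaveWeakAt (c : ℝ) (y f : ℝ → WaveSpace d n) (t : ℝ)
    (p : WaveSpace d n × WaveSpace d n) : Prop :=
  HasDerivWithinAt (fun s => inner ℝ p.1 (y s))
    (-inner ℝ (c • p.2) (y t) + inner ℝ p.1 (f t)) (Ici 0) t

theorem isWaveWeakAt_of_mild {c : ℝ} {y f : ℝ → WaveSpace d n} {t : ℝ}
    (h : HasDerivAt (fun s => (waveFlow d n).rescale c (-s) (y s))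
      ((waveFlow d n).rescale c (-t) (f t)) t) {p : WaveSpace d n × WaveSpace d n}
    (hp : p ∈ wave d n) : IsWaveWeakAt c y f t p := by
  have h1 := hasDerivAt_inner_of_mild (𝕜 := ℝ) ((waveFlow d n).rescale c)
    (IsometricFlow.hasDerivAt_rescale _ c fun t => (hasDerivAt_waveFlow hp t).1) h
  simp only [IsometricFlow.apply_neg_apply] at h1
  exact h1.hasDerivWithinAt

/-- The weak equations against test functions for momentum and field imply the weak equation against
the whole domain of the generator. -/
theorem isWaveWeakAt_of_test {c : ℝ} {y f : ℝ → WaveSpace d n} (hy : Continuous y)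
    (hf : Continuous f) (h1 : ∀ (i : TestPair d n) t, 0 ≤ t → IsWaveWeakAt c y f t i.momentumTest)
    (h2 : ∀ (i : TestPair d n) t, 0 ≤ t → IsWaveWeakAt c y f t i.rieszTest)
    {p : WaveSpace d n × WaveSpace d n} (hp : p ∈ wave d n) {t : ℝ} (ht : 0 ≤ t) :
    IsWaveWeakAt c y f t p := by
  have hiff : ∀ p : WaveSpace d n × WaveSpace d n, (∀ t, 0 ≤ t → IsWaveWeakAt c y f t p) ↔
      ∀ t, 0 ≤ t → inner ℝ p.1 (y t - y 0 - ∫ s in (0 : ℝ)..t, f s)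
        + inner ℝ p.2 (c • ∫ s in (0 : ℝ)..t, y s) = 0 := by
    intro p
    refine (hasDerivWithinAt_iff_integral (innerSL ℝ p.1) (-(innerSL ℝ (c • p.2))) (innerSL ℝ p.1)
      hy hf).trans (forall_congr' fun t => forall_congr' fun _ => ?_)
    simp only [neg_apply, innerSL_apply_apply]
    rw [inner_sub_right p.1 (y t - y 0), real_inner_smul_left, real_inner_smul_right]
    constructor <;> intro h <;> linarith
  refine (hiff p).2 (fun t ht => inner_add_inner_eq_zero_of_wave (fun i => ?_) (fun i => ?_) hp)
    t ht
  · have := (hiff _).1 (h1 i) t ht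
    rwa [i.inner_momentumTest_fst, i.inner_momentumTest_snd, ← sub_eq_add_neg] at this
  · have := (hiff _).1 (h2 i) t ht
    rwa [i.inner_rieszTest_fst, i.inner_rieszTest_snd] at this

/-- A weak solution of the inhomogeneous wave equation is a mild solution. -/
theorem hasDerivWithinAt_waveFlow_of_weak {c : ℝ} {y f : ℝ → WaveSpace d n} (hy : Continuous y)
    (hf : Continuous f) (h1 : ∀ (i : TestPair d n) t, 0 ≤ t → IsWaveWeakAt c y f t i.momentumTest)
    (h2 : ∀ (i : TestPair d n) t, 0 ≤ t → IsWaveWeakAt c y f t i.rieszTest) {t : ℝ} (ht : 0 ≤ t) :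
    HasDerivWithinAt (fun s => (waveFlow d n).rescale c (-s) (y s))
      ((waveFlow d n).rescale c (-t) (f t)) (Ici 0) t := by
  refine hasDerivWithinAt_of_weak (𝕜 := ℝ) ((waveFlow d n).rescale c)
    {p | ∃ q ∈ wave d n, p = (q.1, c • q.2)} ?_ ?_ hy hf ?_ ht
  · rintro _ ⟨q, hq, rfl⟩ t
    refine ⟨IsometricFlow.hasDerivAt_rescale _ c (fun t => (hasDerivAt_waveFlow hq t).1) t,
      _, (hasDerivAt_waveFlow hq (c * t)).2, Prod.ext rfl ?_⟩
    exact map_smul _ _ _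
  · intro x hx
    refine WithLp.ofLp_injective 2 (Prod.ext ?_ ?_)
    · refine eq_zero_of_integral_smooth_mul_inner
        (B := {φ | ∃ (b : Space n → ℝ) (hb : IsTest b), φ = testL2 hb})
        (fun φ hφ => eq_zero_of_inner_testL2 fun b hb => hφ _ ⟨b, hb, rfl⟩) ?_
      rintro a ha _ ⟨b, hb, rfl⟩
      have h := hx _ ⟨_, momentum_mem_wave (⟨a, ha⟩, ⟨b, hb⟩), rfl⟩
      have h' := TestPair.inner_momentumTest_fst (n := n) (⟨a, ha⟩, ⟨b, hb⟩) x
      rw [← inner_tensor_smoothL2]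
      exact h'.symm.trans h
    · refine eq_zero_of_integral_smooth_mul_inner
        (B := {φ | ∃ (b : Space n → ℝ) (hb : IsTest b), φ = HDot1.riesz hb})
        (fun φ hφ => eq_zero_of_inner_riesz fun b hb => hφ _ ⟨b, hb, rfl⟩) ?_
      rintro a ha _ ⟨b, hb, rfl⟩
      have h := hx _ ⟨_, riesz_mem_wave (⟨a, ha⟩, ⟨b, hb⟩), rfl⟩
      have h' := TestPair.inner_rieszTest_fst (n := n) (⟨a, ha⟩, ⟨b, hb⟩) x
      rw [← inner_tensor_smoothL2]
      exact h'.symm.trans h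
  · rintro _ ⟨q, hq, rfl⟩ t ht
    exact isWaveWeakAt_of_test hy hf h1 h2 hq ht

end WaveWeak

/-! ### Solutions of the Schrödinger–wave system as mild solutions -/

section Solutions

theorem TestPair.integral_momentum {d n : ℕ} (i : TestPair d n) (p : Momentum d n) :
    inner ℝ i.momentum p = ∫ x, i.1.1 x * ∫ z, p x z * i.2.1 z := by
  rw [TestPair.momentum, inner_tensor_smoothL2]
  simp only [inner_testL2]

theorem integral_testL2 {n : ℕ} {b b' : Space n → ℝ} (hb : IsTest b) (hb' : IsTest b') :
    inner ℝ (testL2 hb) (testL2 hb') = ∫ z, b' z * b z := by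
  rw [inner_testL2]
  refine integral_congr_ae ?_
  filter_upwards [(hb'.memLp 2).coeFn_toLp] with z h
  exact congrArg (· * b z) h

variable {d n : ℕ} [Fact (3 ≤ n)]

/-- The state `(u, (2 c Π, Ψ))` that corresponds to `(u, Ψ, Π)`. -/
def toState (c : ℝ) (X : EnergySpace d n) : State d n :=
  (X.1, WithLp.toLp 2 ((2 * c) • X.2.2, X.2.1))

/-- The inverse of `toState`. -/
def ofState (c : ℝ) (Y : State d n) : EnergySpace d n := (Y.1, Y.2.snd, (2 * c)⁻¹ • Y.2.fst)

theorem toState_ofState {c : ℝ} (hc : 0 < c) (Y : State d n) : toState c (ofState c Y) = Y := by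
  refine Prod.ext rfl (WithLp.ofLp_injective 2 (Prod.ext ?_ rfl))
  exact smul_inv_smul₀ (by positivity) _

theorem ofState_toState {c : ℝ} (hc : 0 < c) (X : EnergySpace d n) :
    ofState c (toState c X) = X := by
  refine Prod.ext rfl (Prod.ext rfl ?_)
  exact inv_smul_smul₀ (by positivity) _

theorem continuous_toState (c : ℝ) : Continuous (toState c : EnergySpace d n → State d n) :=
  continuous_fst.prodMk ((WithLp.prod_continuous_toLp 2 _ _).comp
    (((continuous_const_smul (2 * c)).comp continuous_snd.snd).prodMk continuous_snd.fst))

theorem continuous_ofState (c : ℝ) : Continuous (ofState c : State d n → EnergySpace d n) := by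
  have h1 : Continuous fun Y : State d n => Y.2.snd :=
    (WithLp.sndL 2 ℝ (Momentum d n) (Field d n)).continuous.comp continuous_snd
  have h2 : Continuous fun Y : State d n => Y.2.fst :=
    (WithLp.fstL 2 ℝ (Momentum d n) (Field d n)).continuous.comp continuous_snd
  exact continuous_fst.prodMk (h1.prodMk ((continuous_const_smul (2 * c)⁻¹).comp h2))

variable {γ c : ℝ} {σ₁ : Torus d → ℝ} (h₁ : Torus.Smooth σ₁) {σ₂ : Space n → ℝ} (h₂ : IsTest σ₂)

theorem inner_schrodingerForce (γ : ℝ) (w : H1 d) (Y : State d n) :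
    inner ℂ w.fn (schrodingerForce γ h₁ h₂ Y).fn = -Complex.I * (γ *
      ∫ x, starRingEnd ℂ (w.fn x) * (potential σ₁ σ₂ Y.2.snd x * Y.1.fn x)) := by
  have e : (schrodingerForce γ h₁ h₂ Y).fn
      = (-(Complex.I * γ)) • (mulL h₁ (toL1 d (fieldMean h₂ Y.2.snd)) Y.1).fn := rfl
  rw [e, inner_smul_right, L2.inner_def]
  have : ∫ x, inner ℂ (w.fn x) ((mulL h₁ (toL1 d (fieldMean h₂ Y.2.snd)) Y.1).fn x)
      = ∫ x, starRingEnd ℂ (w.fn x) * (potential σ₁ σ₂ Y.2.snd x * Y.1.fn x) := by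
    refine integral_congr_ae ?_
    filter_upwards [coeFn_mulL h₁ (toL1 d (fieldMean h₂ Y.2.snd)) Y.1] with x hx
    rw [hx, conv_fieldMean, RCLike.inner_apply, mul_comm]
  rw [this]
  ring

theorem TestPair.integral_riesz (i : TestPair d n) (Ψ : Field d n) :
    inner ℝ i.riesz Ψ = ∫ x, i.1.1 x * ∫ z, (Ψ x).fn z * i.2.1 z := by
  rw [TestPair.riesz, inner_tensor_smoothL2]
  simp only [HDot1.inner_riesz]

theorem TestPair.integral_field (i : TestPair d n) (Ψ : Field d n) :
    inner ℝ i.field Ψ = ∫ x, i.1.1 x * ∫ z, inner ℝ ((Ψ x).grad z) (gradient i.2.1 z) := by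
  rw [TestPair.field, inner_tensor_smoothL2]
  simp only [HDot1.inner_ofTest]

theorem TestPair.inner_waveForce (γ c : ℝ) (i : TestPair d n) (Y : State d n) :
    inner ℝ i.momentum (waveForce γ c h₁ h₂ Y).fst
      = c * γ * ∫ x, i.1.1 x * (density σ₁ Y.1 x * ∫ z, σ₂ z * i.2.1 z) := by
  change inner ℝ i.momentum (tensor (contL2 d ((c * γ) • rho h₁ Y.1.fn Y.1.fn)) (testL2 h₂)) = _
  rw [TestPair.momentum, inner_tensor_smoothL2, ← integral_const_mul]
  refine integral_congr_ae ?_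
  filter_upwards [coeFn_tensor (contL2 d ((c * γ) • rho h₁ Y.1.fn Y.1.fn)) (testL2 h₂),
    coeFn_contL2 ((c * γ) • rho h₁ Y.1.fn Y.1.fn)] with x hx hx'
  rw [hx, hx', inner_smul_right, integral_testL2, ContinuousMap.smul_apply, rho_self_apply]
  simp only [smul_eq_mul]
  ring

/-- The weak form of the system for curves of states. -/
structure IsWeakSolution (γ c : ℝ) (Y : ℝ → State d n) : Prop where
  continuousOn : ContinuousOn Y (Ici 0)
  schrodinger : ∀ w : H1 d, ∀ t, 0 ≤ t → HasDerivWithinAt (fun s => inner ℂ w.fn (Y s).1.fn)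
    (-(Complex.I / 2) * inner ℂ w.grad (Y t).1.grad
      + inner ℂ w.fn (force γ c h₁ h₂ (Y t)).1.fn) (Ici 0) t
  momentum : ∀ (i : TestPair d n) t, 0 ≤ t →
    IsWaveWeakAt c (fun s => (Y s).2) (fun s => (force γ c h₁ h₂ (Y s)).2) t i.momentumTest
  field : ∀ (i : TestPair d n) t, 0 ≤ t →
    IsWaveWeakAt c (fun s => (Y s).2) (fun s => (force γ c h₁ h₂ (Y s)).2) t i.rieszTest

/-- The notion of solution, in terms of the rescaled states. -/
theorem isSolution_iff (hc : 0 < c) {X : ℝ → EnergySpace d n} {X₀ : EnergySpace d n} :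
    IsSolution γ c σ₁ σ₂ X X₀ ↔
      X 0 = X₀ ∧ IsWeakSolution h₁ h₂ γ c (fun t => toState c (X t)) := by
  have hcont : ContinuousOn X (Ici 0) ↔ ContinuousOn (fun t => toState c (X t)) (Ici 0) := by
    refine ⟨fun h => (continuous_toState c).comp_continuousOn h, fun h => ?_⟩
    have := (continuous_ofState c).comp_continuousOn h
    simpa only [Function.comp_def, ofState_toState hc] using this
  have hschr : ∀ (w : H1 d) t,
      (-Complex.I * ((1 / 2) * inner ℂ w.grad (X t).1.grad
        + γ * ∫ x, starRingEnd ℂ (w.fn x) * (potential σ₁ σ₂ (X t).2.1 x * (X t).1.fn x)))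
      = -(Complex.I / 2) * inner ℂ w.grad (toState c (X t)).1.grad
        + inner ℂ w.fn (force γ c h₁ h₂ (toState c (X t))).1.fn := by
    intro w t
    have := inner_schrodingerForce h₁ h₂ γ w (toState c (X t))
    change _ = _ + inner ℂ w.fn (schrodingerForce γ h₁ h₂ (toState c (X t))).fn
    rw [this]
    change _ = -(Complex.I / 2) * inner ℂ w.grad (X t).1.grad + -Complex.I * (γ *
      ∫ x, starRingEnd ℂ (w.fn x) * (potential σ₁ σ₂ (X t).2.1 x * (X t).1.fn x))
    ring
  have hfield : ∀ (i : TestPair d n) t,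
      IsWaveWeakAt c (fun s => (toState c (X s)).2)
        (fun s => (force γ c h₁ h₂ (toState c (X s))).2) t i.rieszTest ↔
      HasDerivWithinAt (fun s => ∫ x, i.1.1 x * ∫ z, ((X s).2.1 x).fn z * i.2.1 z)
        (-2 * c ^ 2 * ∫ x, i.1.1 x * ∫ z, (X t).2.2 x z * i.2.1 z) (Ici 0) t := by
    intro i t
    rw [IsWaveWeakAt]
    simp only [real_inner_smul_left, i.inner_rieszTest_fst, i.inner_rieszTest_snd]
    have e1 : ∀ s, inner ℝ i.riesz (toState c (X s)).2.snd
        = ∫ x, i.1.1 x * ∫ z, ((X s).2.1 x).fn z * i.2.1 z := fun s => i.integral_riesz _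
    have e2 : inner ℝ i.momentum (toState c (X t)).2.fst
        = 2 * c * ∫ x, i.1.1 x * ∫ z, (X t).2.2 x z * i.2.1 z := by
      rw [← i.integral_momentum]
      exact real_inner_smul_right _ _ _
    have e3 : inner ℝ i.riesz (force γ c h₁ h₂ (toState c (X t))).2.snd = 0 :=
      inner_zero_right _
    simp only [e1, e2, e3]
    rw [show -(c * (2 * c * ∫ x, i.1.1 x * ∫ z, (X t).2.2 x z * i.2.1 z)) + 0
      = -2 * c ^ 2 * ∫ x, i.1.1 x * ∫ z, (X t).2.2 x z * i.2.1 z by ring]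
  have hmom : ∀ (i : TestPair d n) t,
      IsWaveWeakAt c (fun s => (toState c (X s)).2)
        (fun s => (force γ c h₁ h₂ (toState c (X s))).2) t i.momentumTest ↔
      HasDerivWithinAt (fun s => ∫ x, i.1.1 x * ∫ z, (X s).2.2 x z * i.2.1 z)
        (1 / 2 * (∫ x, i.1.1 x * ∫ z, inner ℝ (((X t).2.1 x).grad z) (gradient i.2.1 z))
        + γ / 2 * ∫ x, i.1.1 x * (density σ₁ (X t).1 x * ∫ z, σ₂ z * i.2.1 z)) (Ici 0) t := by
    intro i t
    rw [IsWaveWeakAt]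
    simp only [real_inner_smul_left, i.inner_momentumTest_fst, i.inner_momentumTest_snd]
    have e1 : ∀ s, inner ℝ i.momentum (toState c (X s)).2.fst
        = 2 * c * ∫ x, i.1.1 x * ∫ z, (X s).2.2 x z * i.2.1 z := by
      intro s
      rw [← i.integral_momentum]
      exact real_inner_smul_right _ _ _
    have e2 : inner ℝ i.field (toState c (X t)).2.snd
        = ∫ x, i.1.1 x * ∫ z, inner ℝ (((X t).2.1 x).grad z) (gradient i.2.1 z) :=
      i.integral_field _
    have e3 : inner ℝ i.momentum (force γ c h₁ h₂ (toState c (X t))).2.fst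
        = c * γ * ∫ x, i.1.1 x * (density σ₁ (X t).1 x * ∫ z, σ₂ z * i.2.1 z) :=
      i.inner_waveForce h₁ h₂ γ c (toState c (X t))
    simp only [e1, e2, e3]
    generalize (∫ x, i.1.1 x * ∫ z, inner ℝ (((X t).2.1 x).grad z) (gradient i.2.1 z)) = I₁
    generalize (∫ x, i.1.1 x * (density σ₁ (X t).1 x * ∫ z, σ₂ z * i.2.1 z)) = I₂
    have h2c : 2 * c ≠ 0 := by positivity
    constructor
    · intro h
      refine ((h.const_mul (2 * c)⁻¹).congr_deriv ?_).congr_of_eventuallyEq ?_ ?_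
      · field_simp
      · exact Eventually.of_forall fun s => by simp only; field_simp
      · field_simp
    · intro h
      refine (h.const_mul (2 * c)).congr_deriv ?_
      ring
  constructor
  · rintro ⟨h0, hc', hs, hf, hm⟩
    exact ⟨h0, hcont.1 hc', fun w t ht => (hs w t ht).congr_deriv (hschr w t),
      fun i t ht => (hmom i t).2 (hm _ i.1.2 _ i.2.2.1 i.2.2.2 t ht),
      fun i t ht => (hfield i t).2 (hf _ i.1.2 _ i.2.2.1 i.2.2.2 t ht)⟩
  · rintro ⟨h0, hc', hs, hm, hf⟩
    exact ⟨h0, hcont.2 hc', fun w t ht => (hs w t ht).congr_deriv (hschr w t).symm,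
      fun a ha b hb hbs t ht => (hfield (⟨a, ha⟩, ⟨b, hb, hbs⟩) t).1 (hf _ t ht),
      fun a ha b hb hbs t ht => (hmom (⟨a, ha⟩, ⟨b, hb, hbs⟩) t).1 (hm _ t ht)⟩

end Solutions

/-! ### Existence and uniqueness -/

section MildSolutions

variable {d n : ℕ} [Fact (3 ≤ n)] {γ c : ℝ} {σ₁ : Torus d → ℝ} (h₁ : Torus.Smooth σ₁)
  {σ₂ : Space n → ℝ} (h₂ : IsTest σ₂)

/-- A global solution of the mild form of the system with the truncated nonlinearity. -/
structure IsTruncatedSolution (γ c R : ℝ) (Y : ℝ → State d n) : Prop where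
  continuous : Continuous Y
  hasDerivAt : ∀ t, HasDerivAt (fun s => linearFlow d n c (-s) (Y s))
    (linearFlow d n c (-t) (force γ c h₁ h₂ (radialRetraction R (Y t)))) t

/-- The truncated nonlinearity is globally Lipschitz, hence the truncated system has global
solutions. -/
theorem exists_isTruncatedSolution (γ c : ℝ) {R : ℝ} (hR : 0 < R) (Y₀ : State d n) :
    ∃ Y, IsTruncatedSolution h₁ h₂ γ c R Y ∧ Y 0 = Y₀ := by
  obtain ⟨Y, hY, h0, h⟩ := exists_truncated_mild (linearFlow d n c) (isQuadratic_force γ c h₁ h₂)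
    hR Y₀
  exact ⟨Y, ⟨hY, h⟩, h0⟩

namespace IsTruncatedSolution

variable {h₁ h₂} {R : ℝ} {Y : ℝ → State d n}

theorem hasDerivAt_fst (h : IsTruncatedSolution h₁ h₂ γ c R Y) (t : ℝ) :
    HasDerivAt (fun s => H1.freeFlow d (-s) (Y s).1)
      (H1.freeFlow d (-t) (force γ c h₁ h₂ (radialRetraction R (Y t))).1) t :=
  ((ContinuousLinearMap.fst ℝ (H1 d) (WaveSpace d n)).hasFDerivAt).comp_hasDerivAt t
    (h.hasDerivAt t)

theorem hasDerivAt_snd (h : IsTruncatedSolution h₁ h₂ γ c R Y) (t : ℝ) :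
    HasDerivAt (fun s => (waveFlow d n).rescale c (-s) (Y s).2)
      ((waveFlow d n).rescale c (-t) (force γ c h₁ h₂ (radialRetraction R (Y t))).2) t :=
  ((ContinuousLinearMap.snd ℝ (H1 d) (WaveSpace d n)).hasFDerivAt).comp_hasDerivAt t
    (h.hasDerivAt t)

theorem continuous_force_retraction (h : IsTruncatedSolution h₁ h₂ γ c R Y) (hR : 0 < R) :
    Continuous fun t => force γ c h₁ h₂ (radialRetraction R (Y t)) :=
  (isQuadratic_force γ c h₁ h₂).continuous.comp
    ((continuous_radialRetraction hR).comp h.continuous)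

/-- The Schrödinger equation in weak form, for the truncated system. -/
theorem hasDerivAt_inner_fn (h : IsTruncatedSolution h₁ h₂ γ c R Y) (hR : 0 < R) (w : H1 d)
    (t : ℝ) : HasDerivAt (fun s => inner ℂ w.fn (Y s).1.fn)
      (-(Complex.I / 2) * inner ℂ w.grad (Y t).1.grad
        + inner ℂ w.fn (force γ c h₁ h₂ (radialRetraction R (Y t))).1.fn) t :=
  H1.hasDerivAt_inner_fn_of_mild (u := fun s => (Y s).1)
    (f := fun s => (force γ c h₁ h₂ (radialRetraction R (Y s))).1)
    (continuous_fst.comp h.continuous)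
    (continuous_fst.comp (h.continuous_force_retraction hR)) h.hasDerivAt_fst w t

/-- As long as the truncation is not active, a solution of the truncated system is a solution. -/
theorem isWeakSolution (h : IsTruncatedSolution h₁ h₂ γ c R Y) (hR : 0 < R)
    (hY : ∀ t, 0 ≤ t → ‖Y t‖ ≤ R) : IsWeakSolution h₁ h₂ γ c Y := by
  have hf := h.continuous_force_retraction hR
  have hwave : ∀ p ∈ wave d n, ∀ t, 0 ≤ t →
      IsWaveWeakAt c (fun s => (Y s).2) (fun s => (force γ c h₁ h₂ (Y s)).2) t p := by
    intro p hp t ht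
    have h1 := isWaveWeakAt_of_mild (y := fun s => (Y s).2)
      (f := fun s => (force γ c h₁ h₂ (radialRetraction R (Y s))).2) (h.hasDerivAt_snd t) hp
    rw [IsWaveWeakAt, radialRetraction_of_norm_le (hY t ht)] at h1
    exact h1
  refine ⟨h.continuous.continuousOn, fun w t ht => ?_,
    fun i => hwave _ (momentum_mem_wave i), fun i => hwave _ (riesz_mem_wave i)⟩
  have h1 := (h.hasDerivAt_inner_fn hR w t).hasDerivWithinAt (s := Ici 0)
  rw [radialRetraction_of_norm_le (hY t ht)] at h1
  exact h1

end IsTruncatedSolution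

variable {h₁ h₂}

/-- A solution of the system satisfies its mild form. -/
theorem IsWeakSolution.hasDerivWithinAt {Y : ℝ → State d n} (h : IsWeakSolution h₁ h₂ γ c Y)
    {t : ℝ} (ht : 0 ≤ t) : HasDerivWithinAt (fun s => linearFlow d n c (-s) (Y s))
      (linearFlow d n c (-t) (force γ c h₁ h₂ (Y t))) (Ici 0) t := by
  -- extension by a constant to negative times
  set y : ℝ → State d n := fun s => Y (max s 0) with hy
  have hyY : ∀ s ∈ Ici (0 : ℝ), Y s = y s := fun s hs => by rw [hy]; simp only [max_eq_left hs.out]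
  have hyc : Continuous y := by
    rw [← continuousOn_univ]
    exact h.continuousOn.comp (by fun_prop) fun s _ => le_max_right s 0
  have hfc : Continuous fun t => force γ c h₁ h₂ (y t) :=
    (isQuadratic_force γ c h₁ h₂).continuous.comp hyc
  have h1 := H1.hasDerivWithinAt_freeFlow_of_weak (u := fun s => (y s).1)
    (f := fun s => (force γ c h₁ h₂ (y s)).1)
    (continuous_fst.comp hyc) (continuous_fst.comp hfc) (fun w t ht => by
      have := h.schrodinger w t ht
      rw [hyY t ht] at this
      exact this.congr (fun s hs => by rw [hyY s hs]) (by rw [hyY t ht])) ht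
  have hw : ∀ p, (∀ t, 0 ≤ t → IsWaveWeakAt c (fun s => (Y s).2)
      (fun s => (force γ c h₁ h₂ (Y s)).2) t p) → ∀ t, 0 ≤ t → IsWaveWeakAt c (fun s => (y s).2)
      (fun s => (force γ c h₁ h₂ (y s)).2) t p := by
    intro p hp t ht
    have := hp t ht
    rw [IsWaveWeakAt, hyY t ht] at this
    exact this.congr (fun s hs => by rw [hyY s hs]) (by rw [hyY t ht])
  have h2 := hasDerivWithinAt_waveFlow_of_weak (y := fun s => (y s).2)
    (f := fun s => (force γ c h₁ h₂ (y s)).2)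
    (continuous_snd.comp hyc) (continuous_snd.comp hfc) (fun i => hw _ (h.momentum i))
    (fun i => hw _ (h.field i)) ht
  have h3 := h1.prodMk h2
  rw [hyY t ht]
  exact h3.congr (fun s hs => by rw [hyY s hs]; rfl) (by rw [hyY t ht]; rfl)

/-- Solutions are determined by their initial data. -/
theorem IsWeakSolution.eqOn {Y Y' : ℝ → State d n} (h : IsWeakSolution h₁ h₂ γ c Y)
    (h' : IsWeakSolution h₁ h₂ γ c Y') (h0 : Y 0 = Y' 0) : EqOn Y Y' (Ici 0) :=
  eqOn_of_mild (linearFlow d n c) (isQuadratic_force γ c h₁ h₂) h.continuousOn h'.continuousOn h0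
    (fun _ ht => h.hasDerivWithinAt ht) fun _ ht => h'.hasDerivWithinAt ht

end MildSolutions

/-! ### Conservation of mass and energy -/

/-- In the derivative of `‖y‖²` only the force contributes, as the linear flow is isometric. -/
theorem hasDerivAt_norm_sq_of_mild {𝕜 H : Type*} [RCLike 𝕜] [NormedAddCommGroup H]
    [InnerProductSpace 𝕜 H] [NormedSpace ℝ H] [IsScalarTower ℝ 𝕜 H] (S : IsometricFlow 𝕜 H)
    {y : ℝ → H} {f : H} {t : ℝ} (h : HasDerivAt (fun s => S (-s) (y s)) (S (-t) f) t) :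
    HasDerivAt (fun s => ‖y s‖ ^ 2) (2 * RCLike.re (inner 𝕜 (y t) f)) t := by
  have h1 := h.inner 𝕜 h
  have h2 := (RCLike.reCLM (K := 𝕜)).hasFDerivAt.comp_hasDerivAt t h1
  refine (h2.congr_deriv ?_).congr_of_eventuallyEq (Eventually.of_forall fun s => ?_)
  · simp only [S.inner_map_map, RCLike.reCLM_apply, map_add]
    rw [inner_re_symm f]
    ring
  · simp only [Function.comp, S.inner_map_map, RCLike.reCLM_apply, inner_self_eq_norm_sq]

namespace H1

open Torus

variable {d : ℕ}

theorem inner_charL2_freeFlow (k : Fin d → ℤ) (t : ℝ) (u : H1 d) :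
    inner ℂ (charL2 k) (freeFlow d t u).fn
      = Complex.exp (Complex.I * (t * (-(freqSq k / 2)) : ℝ)) * inner ℂ (charL2 k) u.fn := by
  have h := IsometricFlow.inner_diagonal (basis d) (fun k => -(freqSq k / 2)) k t u
  change inner ℂ (basis d k) (freeFlow d t u) = _ at h
  rw [inner_basis_eq, inner_basis_eq] at h
  have hN : (((charNorm k)⁻¹ * (1 + freqSq k) : ℝ) : ℂ) ≠ 0 := by
    have hF : 1 + freqSq k ≠ 0 := by linarith [freqSq_nonneg k]
    exact_mod_cast mul_ne_zero (inv_ne_zero (charNorm_pos k).ne') hF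
  refine mul_left_cancel₀ hN (h.trans ?_)
  ring

/-- The free Schrödinger group is also isometric for the norm of `L²`. -/
theorem inner_fn_freeFlow (t : ℝ) (u v : H1 d) :
    inner ℂ (freeFlow d t u).fn (freeFlow d t v).fn = inner ℂ u.fn v.fn := by
  refine ((basisL2 d).hasSum_inner_mul_inner _ _).unique
    (((basisL2 d).hasSum_inner_mul_inner u.fn v.fn).congr_fun fun k => ?_)
  rw [basisL2_apply, ← inner_conj_symm, ← inner_conj_symm u.fn]
  simp only [inner_smul_left, inner_charL2_freeFlow, map_mul, ← Complex.exp_conj, Complex.conj_I,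
    Complex.conj_ofReal]
  have : Complex.exp (-Complex.I * (t * (-(freqSq k / 2)) : ℝ))
      * Complex.exp (Complex.I * (t * (-(freqSq k / 2)) : ℝ)) = 1 := by
    rw [← Complex.exp_add]
    simp
  linear_combination (starRingEnd ℂ) ((starRingEnd ℂ) ((Real.sqrt (vol d))⁻¹ : ℂ))
    * (starRingEnd ℂ) (inner ℂ (charL2 k) u.fn) * ((starRingEnd ℂ) ((Real.sqrt (vol d))⁻¹ : ℂ))
    * (inner ℂ (charL2 k) v.fn) * this

theorem hasDerivAt_norm_fn_sq_of_mild {u : ℝ → H1 d} {f : H1 d} {t : ℝ}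
    (h : HasDerivAt (fun s => freeFlow d (-s) (u s)) (freeFlow d (-t) f) t) :
    HasDerivAt (fun s => ‖(u s).fn‖ ^ 2) (2 * (inner ℂ (u t).fn f.fn).re) t := by
  have h0 : HasDerivAt (fun s => (freeFlow d (-s) (u s)).fn) (freeFlow d (-t) f).fn t :=
    (fnLR d).hasFDerivAt.comp_hasDerivAt t h
  have h1 := h0.inner ℂ h0
  have h2 := (RCLike.reCLM (K := ℂ)).hasFDerivAt.comp_hasDerivAt t h1
  refine (h2.congr_deriv ?_).congr_of_eventuallyEq (Eventually.of_forall fun s => ?_)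
  · simp only [inner_fn_freeFlow, RCLike.reCLM_apply, map_add]
    rw [inner_re_symm f.fn]
    simp only [RCLike.re_to_complex]
    ring
  · simp only [Function.comp, inner_fn_freeFlow, RCLike.reCLM_apply, inner_self_eq_norm_sq]

end H1

/-- For an even kernel the convolution with `σ₁` is self-adjoint. -/
theorem integral_conv_reInner {d : ℕ} {σ₁ : Torus d → ℝ} (h₁ : Torus.Smooth σ₁)
    (heven : ∀ x, σ₁ (-x) = σ₁ x) (P : Lp ℝ 2 (volume : Measure (Torus d)))
    (u v : Lp ℂ 2 (volume : Measure (Torus d))) {m : Lp ℂ 2 (volume : Measure (Torus d))}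
    (hm : m =ᵐ[volume] fun x => (conv h₁.toC (toL1 d P) x : ℂ) * u x) :
    ∫ x, conv h₁.toC (reInner d u v) x • P x = (inner ℂ m v).re := by
  have hP : Integrable (P : Torus d → ℝ) := (Lp.memLp P).integrable (by norm_num)
  have hi : Integrable fun x => inner ℂ (m x) (v x) := L2.integrable_inner _ _
  rw [(integral_conv_smul h₁.toC (reInner d u v) hP).2, L2.inner_def]
  refine Eq.trans (integral_congr_ae ?_) (integral_re hi)
  filter_upwards [coeFn_reInner u v, hm] with x hx hx'
  have e : ∫ y, h₁.toC (y - x) • P y = conv h₁.toC (toL1 d P) x := by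
    rw [conv_apply]
    refine integral_congr_ae ?_
    filter_upwards [coeFn_toL1 P] with y hy
    rw [hy, smul_eq_mul]
    congr 1
    change σ₁ _ = σ₁ _
    rw [← heven, neg_sub]
  rw [e, hx, hx']
  generalize conv h₁.toC (toL1 d P) x = a
  simp only [Complex.inner, smul_eq_mul, RCLike.inner_apply, map_mul, Complex.conj_ofReal,
    RCLike.re_to_complex, Complex.mul_re, Complex.mul_im, Complex.conj_re, Complex.conj_im,
    Complex.ofReal_re, Complex.ofReal_im]
  ring

section Interaction

variable {d n : ℕ} [Fact (3 ≤ n)] {σ₁ : Torus d → ℝ} (h₁ : Torus.Smooth σ₁)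
  {σ₂ : Space n → ℝ} (h₂ : IsTest σ₂)

/-- The form `∫ (σ₁ ⋆ Re (ū v)) (∫ σ₂ Ψ dz) dx`; on the diagonal `u = v` it is `∫ Φ |u|² dx`. -/
def interaction (u v : Lp ℂ 2 (volume : Measure (Torus d))) (Ψ : Field d n) : ℝ :=
  inner ℝ (tensor (contL2 d (rho h₁ u v)) (HDot1.riesz h₂)) Ψ

theorem interaction_comm (u v : Lp ℂ 2 (volume : Measure (Torus d))) (Ψ : Field d n) :
    interaction h₁ h₂ u v Ψ = interaction h₁ h₂ v u Ψ := by
  rw [interaction, interaction, rho_comm]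

theorem interaction_eq_integral (u v : Lp ℂ 2 (volume : Measure (Torus d))) (Ψ : Field d n) :
    interaction h₁ h₂ u v Ψ = ∫ x, conv h₁.toC (reInner d u v) x • fieldMean h₂ Ψ x := by
  rw [interaction, inner_tensor]
  refine integral_congr_ae ?_
  filter_upwards [coeFn_contL2 (rho h₁ u v), coeFn_pairL (HDot1.riesz h₂) Ψ] with x hx hx'
  rw [hx, fieldMean, hx']
  rfl

/-- The potential generated by `Ψ` is adjoint to the density, because `σ₁` is even. -/
theorem interaction_eq (heven : ∀ x, σ₁ (-x) = σ₁ x) (u v : H1 d) (Ψ : Field d n) :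
    interaction h₁ h₂ u.fn v.fn Ψ
      = (inner ℂ (mulL h₁ (toL1 d (fieldMean h₂ Ψ)) u).fn v.fn).re :=
  (interaction_eq_integral h₁ h₂ _ _ _).trans
    (integral_conv_reInner h₁ heven _ _ _ (coeFn_mulL h₁ _ u))

end Interaction

/-! ### The weak equations along truncated solutions -/

section Energy

variable {d n : ℕ} [Fact (3 ≤ n)] {γ c R : ℝ} {σ₁ : Torus d → ℝ} {h₁ : Torus.Smooth σ₁}
  {σ₂ : Space n → ℝ} {h₂ : IsTest σ₂} {Y : ℝ → State d n}

theorem inner_toLp_zero_left (x : Field d n) (w : WaveSpace d n) :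
    inner ℝ (WithLp.toLp 2 ((0 : Momentum d n), x) : WaveSpace d n) w = inner ℝ x w.snd := by
  rw [WithLp.prod_inner_apply]
  change inner ℝ (0 : Momentum d n) w.fst + inner ℝ x w.snd = _
  rw [inner_zero_left, zero_add]

theorem inner_toLp_zero_right (x : Momentum d n) (w : WaveSpace d n) :
    inner ℝ (WithLp.toLp 2 (x, (0 : Field d n)) : WaveSpace d n) w = inner ℝ x w.fst := by
  rw [WithLp.prod_inner_apply]
  change inner ℝ x w.fst + inner ℝ (0 : Field d n) w.snd = _
  rw [inner_zero_left, add_zero]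

theorem norm_snd_fst_le (Y : State d n) : ‖Y.2.fst‖ ≤ ‖Y‖ :=
  (WithLp.norm_fst_le _ Y.2).trans (norm_snd_le Y)

namespace IsTruncatedSolution

/-- The derivative of `⟪w, u⟫` in `u` along a solution. As the force is only paired with `w (t)`,
the map `w` need only be continuous. -/
theorem hasDerivAt_re_inner_sub (h : IsTruncatedSolution h₁ h₂ γ c R Y) (hR : 0 < R)
    {w : ℝ → H1 d} {t : ℝ} (hw : ContinuousAt w t) :
    HasDerivAt (fun s => (inner ℂ (w s).fn (Y s).1.fn).re - (inner ℂ (w s).fn (Y t).1.fn).re)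
      (-(Complex.I / 2) * inner ℂ (w t).grad (Y t).1.grad
        + inner ℂ (w t).fn (force γ c h₁ h₂ (radialRetraction R (Y t))).1.fn).re t := by
  set f : ℝ → State d n := fun s => force γ c h₁ h₂ (radialRetraction R (Y s)) with hf
  have hfc : Continuous f := h.continuous_force_retraction hR
  have hD : ∀ (w : H1 d) s, HasDerivAt
      (fun r => (Complex.reCLM.comp (H1.pairFn (Y r).1)).toLinearMap w)
      (-(Complex.I / 2) * inner ℂ w.grad (Y s).1.grad + inner ℂ w.fn (f s).1.fn).re s := by
    intro w s
    refine ((Complex.reCLM.hasFDerivAt).comp_hasDerivAt s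
      (h.hasDerivAt_inner_fn hR w s)).congr_of_eventuallyEq (Eventually.of_forall fun r => ?_)
    exact inner_re_symm (𝕜 := ℂ) (Y r).1.fn w.fn
  have hC : ∀ᶠ s in 𝓝 t, ∀ w : H1 d,
      |(-(Complex.I / 2) * inner ℂ w.grad (Y s).1.grad + inner ℂ w.fn (f s).1.fn).re|
        ≤ (1 / 2 * (‖Y t‖ + 1) + (‖f t‖ + 1)) * ‖w‖ := by
    filter_upwards [(h.continuous.norm.tendsto t).eventually_le_const (lt_add_one ‖Y t‖),
      (hfc.norm.tendsto t).eventually_le_const (lt_add_one ‖f t‖)] with s hs hs' w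
    refine (Complex.abs_re_le_norm _).trans ((norm_add_le _ _).trans ?_)
    rw [add_mul]
    have e1 : ‖inner ℂ w.grad (Y s).1.grad‖ ≤ ‖w‖ * (‖Y t‖ + 1) :=
      (norm_inner_le_norm _ _).trans (mul_le_mul (H1.norm_grad_le w)
        ((H1.norm_grad_le _).trans ((norm_fst_le (Y s)).trans hs)) (norm_nonneg _) (norm_nonneg _))
    have e2 : ‖inner ℂ w.fn (f s).1.fn‖ ≤ ‖w‖ * (‖f t‖ + 1) :=
      (norm_inner_le_norm _ _).trans (mul_le_mul (H1.norm_fn_le w)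
        ((H1.norm_fn_le _).trans ((norm_fst_le (f s)).trans hs')) (norm_nonneg _) (norm_nonneg _))
    have e3 : ‖-(Complex.I / 2)‖ = 1 / 2 := by simp
    rw [norm_mul, e3]
    linarith
  have key := hasDerivAt_sub_of_weak hD hC hw
  refine key.congr_of_eventuallyEq (Eventually.of_forall fun s => ?_)
  exact congrArg₂ (· - ·) (inner_re_symm (𝕜 := ℂ) _ _) (inner_re_symm (𝕜 := ℂ) _ _)

/-- The derivative of `∫ r σ₂ Ψ` along a solution. -/
theorem hasDerivAt_inner_tensor (h : IsTruncatedSolution h₁ h₂ γ c R Y)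
    (r : Lp ℝ 2 (volume : Measure (Torus d))) (s : ℝ) :
    HasDerivAt (fun τ => inner ℝ (tensor r (HDot1.riesz h₂)) (Y τ).2.snd)
      (-c * inner ℝ (tensor r (testL2 h₂)) (Y s).2.fst) s := by
  have h1 := hasDerivAt_inner_of_mild (𝕜 := ℝ) ((waveFlow d n).rescale c)
    (IsometricFlow.hasDerivAt_rescale _ c
      fun t => (hasDerivAt_waveFlow (tensor_riesz_mem_wave r h₂) t).1) (h.hasDerivAt_snd s)
  simp only [IsometricFlow.apply_neg_apply, inner_toLp_zero_left, real_inner_smul_left,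
    inner_toLp_zero_right] at h1
  refine h1.congr_deriv ?_
  have : inner ℝ (tensor r (HDot1.riesz h₂))
      (force γ c h₁ h₂ (radialRetraction R (Y s))).2.snd = 0 := inner_zero_right _
  rw [this]
  ring

/-- The variant of `hasDerivAt_inner_tensor` for an `r` depending continuously on time, where only
the increment of the field is differentiated. -/
theorem hasDerivAt_inner_tensor_sub (h : IsTruncatedSolution h₁ h₂ γ c R Y)
    {r : ℝ → Lp ℝ 2 (volume : Measure (Torus d))} {t : ℝ} (hr : ContinuousAt r t) :
    HasDerivAt (fun s => inner ℝ (tensor (r s) (HDot1.riesz h₂)) (Y s).2.snd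
        - inner ℝ (tensor (r s) (HDot1.riesz h₂)) (Y t).2.snd)
      (-c * inner ℝ (tensor (r t) (testL2 h₂)) (Y t).2.fst) t := by
  have hD : ∀ (r : Lp ℝ 2 (volume : Measure (Torus d))) s, HasDerivAt
      (fun τ => ((innerSL ℝ (Y τ).2.snd).comp (tensorL (HDot1.riesz h₂))).toLinearMap r)
      (-c * inner ℝ (tensor r (testL2 h₂)) (Y s).2.fst) s := fun r s =>
    (h.hasDerivAt_inner_tensor r s).congr_of_eventuallyEq
      (Eventually.of_forall fun τ => real_inner_comm (tensor r (HDot1.riesz h₂)) (Y τ).2.snd)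
  have hC : ∀ᶠ s in 𝓝 t, ∀ r : Lp ℝ 2 (volume : Measure (Torus d)),
      |-c * inner ℝ (tensor r (testL2 h₂)) (Y s).2.fst|
        ≤ (|c| * (‖testL2 h₂‖ * (‖Y t‖ + 1))) * ‖r‖ := by
    filter_upwards [(h.continuous.norm.tendsto t).eventually_le_const (lt_add_one ‖Y t‖)]
      with s hs r
    rw [abs_mul, abs_neg]
    have e1 := (abs_real_inner_le_norm (tensor r (testL2 h₂)) (Y s).2.fst).trans
      (mul_le_mul_of_nonneg_left ((norm_snd_fst_le (Y s)).trans hs) (norm_nonneg _))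
    rw [norm_tensor] at e1
    calc _ ≤ |c| * (‖r‖ * ‖testL2 h₂‖ * (‖Y t‖ + 1)) :=
          mul_le_mul_of_nonneg_left e1 (abs_nonneg c)
      _ = _ := by ring
  have key := hasDerivAt_sub_of_weak hD hC hr
  refine key.congr_of_eventuallyEq (Eventually.of_forall fun s => ?_)
  exact congrArg₂ (· - ·) (real_inner_comm _ _) (real_inner_comm _ _)

end IsTruncatedSolution

end Energy

/-! ### The conservation laws along truncated solutions -/

section Energy

variable {d n : ℕ} [Fact (3 ≤ n)] {γ c R : ℝ} {σ₁ : Torus d → ℝ} {h₁ : Torus.Smooth σ₁}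
  {σ₂ : Space n → ℝ} {h₂ : IsTest σ₂} {Y : ℝ → State d n}

variable (h₁ h₂) in
/-- The energy `½ ‖∇u‖² + ½ (‖π‖² + ‖∇Ψ‖²) + γ ∫ Φ |u|²`. -/
def energy (γ : ℝ) (Y : State d n) : ℝ :=
  (‖Y.1.grad‖ ^ 2 + ‖Y.2‖ ^ 2) / 2 + γ * interaction h₁ h₂ Y.1.fn Y.1.fn Y.2.snd

variable (h₁ h₂) in
/-- The product `Φ u`. -/
def potentialMul (Y : State d n) : H1 d := mulL h₁ (toL1 d (fieldMean h₂ Y.2.snd)) Y.1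

/-- The force `-i γ Φ u` is orthogonal to `u`. -/
theorem re_inner_fn_force (γ : ℝ) (Y : State d n) :
    (inner ℂ Y.1.fn (force γ c h₁ h₂ Y).1.fn).re = 0 := by
  have h := inner_schrodingerForce h₁ h₂ γ Y.1 Y
  have e : ∫ x, starRingEnd ℂ (Y.1.fn x) * (potential σ₁ σ₂ Y.2.snd x * Y.1.fn x)
      = ((∫ x, potential σ₁ σ₂ Y.2.snd x * ‖Y.1.fn x‖ ^ 2 : ℝ) : ℂ) := by
    rw [← integral_complex_ofReal]
    refine integral_congr_ae (Eventually.of_forall fun x => ?_)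
    simp only [Complex.ofReal_mul, Complex.ofReal_pow, ← Complex.conj_mul']
    ring
  rw [e] at h
  change (inner ℂ Y.1.fn (schrodingerForce γ h₁ h₂ Y).fn).re = 0
  rw [h]
  simp

theorem re_inner_potentialMul_force (γ : ℝ) (Y : State d n) :
    (inner ℂ (potentialMul h₁ h₂ Y).fn (force γ c h₁ h₂ Y).1.fn).re = 0 := by
  have e : (force γ c h₁ h₂ Y).1.fn = (-(Complex.I * γ)) • (potentialMul h₁ h₂ Y).fn := rfl
  rw [e, inner_smul_right, inner_self_eq_norm_sq_to_K]
  simp [← Complex.ofReal_pow]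

/-- The work of the force on the kinetic energy; it is balanced by `hasDerivAt_interaction_fst`. -/
theorem re_inner_grad_force (γ : ℝ) (Y : State d n) :
    (inner ℂ Y.1.grad (force γ c h₁ h₂ Y).1.grad).re
      = -(γ * (2 * (-(Complex.I / 2) * inner ℂ (potentialMul h₁ h₂ Y).grad Y.1.grad).re)) := by
  have e : (force γ c h₁ h₂ Y).1.grad = (-(Complex.I * γ)) • (potentialMul h₁ h₂ Y).grad := rfl
  rw [e, inner_smul_right, ← inner_conj_symm]
  generalize inner ℂ (potentialMul h₁ h₂ Y).grad Y.1.grad = z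
  simp

/-- The work of the force on the energy of the wave field; it is balanced by
`hasDerivAt_interaction_snd`. -/
theorem inner_snd_force (γ : ℝ) (Y : State d n) :
    inner ℝ Y.2 (force γ c h₁ h₂ Y).2 = γ * (c *
      inner ℝ (tensor (contL2 d (rho h₁ Y.1.fn Y.1.fn)) (testL2 h₂)) Y.2.fst) := by
  have e : (force γ c h₁ h₂ Y).2 = WithLp.toLp 2 ((c * γ) •
      tensorL (testL2 h₂) (contL2 d (rho h₁ Y.1.fn Y.1.fn)), (0 : Field d n)) := by
    rw [← (tensorL (testL2 h₂)).map_smul, ← (contL2 d).map_smul]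
    rfl
  rw [e, real_inner_comm, inner_toLp_zero_right, real_inner_smul_left, tensorL_apply]
  ring

namespace IsTruncatedSolution

/-- The derivative of `∫ Φ |u|²` with the field frozen: only the Laplacian contributes, and its
pairing with `Φ u ∈ H¹` makes sense. -/
theorem hasDerivAt_interaction_fst (h : IsTruncatedSolution h₁ h₂ γ c R Y) (hR : 0 < R)
    (heven : ∀ x, σ₁ (-x) = σ₁ x) {t : ℝ} (ht : ‖Y t‖ ≤ R) :
    HasDerivAt (fun s => interaction h₁ h₂ (Y s).1.fn (Y s).1.fn (Y t).2.snd)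
      (2 * (-(Complex.I / 2) * inner ℂ (potentialMul h₁ h₂ (Y t)).grad (Y t).1.grad).re) t := by
  set M : H1 d →L[ℝ] H1 d := mulL h₁ (toL1 d (fieldMean h₂ (Y t).2.snd)) with hM
  have hMt : M (Y t).1 = potentialMul h₁ h₂ (Y t) := rfl
  have hw : Continuous fun s => M (Y s).1 :=
    M.continuous.comp (continuous_fst.comp h.continuous)
  have k2 := h.hasDerivAt_re_inner_sub hR hw.continuousAt (t := t)
  have k3 := h.hasDerivAt_re_inner_sub hR (w := fun _ => M (Y t).1) continuousAt_const (t := t)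
  have hI : ∀ s s', interaction h₁ h₂ (Y s).1.fn (Y s').1.fn (Y t).2.snd
      = (inner ℂ (M (Y s).1).fn (Y s').1.fn).re :=
    fun s s' => interaction_eq h₁ h₂ heven _ _ _
  clear_value M
  simp only [hMt, radialRetraction_of_norm_le ht, Complex.add_re, re_inner_potentialMul_force,
    add_zero] at k2 k3
  have k := (k2.add k3).add_const (interaction h₁ h₂ (Y t).1.fn (Y t).1.fn (Y t).2.snd)
  refine (k.congr_deriv (two_mul _).symm).congr_of_eventuallyEq
    (Eventually.of_forall fun s => ?_)
  have e := interaction_comm h₁ h₂ (Y t).1.fn (Y s).1.fn (Y t).2.snd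
  rw [hI, hI] at e
  simp only [Pi.add_apply, hI, ← hMt, e]
  ring

/-- The derivative of the part of `∫ Φ |u|²` due to the motion of the field. -/
theorem hasDerivAt_interaction_snd (h : IsTruncatedSolution h₁ h₂ γ c R Y) (t : ℝ) :
    HasDerivAt (fun s => interaction h₁ h₂ (Y s).1.fn (Y s).1.fn (Y s).2.snd
        - interaction h₁ h₂ (Y s).1.fn (Y s).1.fn (Y t).2.snd)
      (-c * inner ℝ (tensor (contL2 d (rho h₁ (Y t).1.fn (Y t).1.fn)) (testL2 h₂)) (Y t).2.fst)
      t := by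
  have hufn : Continuous fun s => (Y s).1.fn :=
    (H1.fnLR d).continuous.comp (continuous_fst.comp h.continuous)
  have hr : Continuous fun s => contL2 d (rho h₁ (Y s).1.fn (Y s).1.fn) :=
    (contL2 d).continuous.comp (((rho h₁).continuous.comp hufn).clm_apply hufn)
  exact h.hasDerivAt_inner_tensor_sub hr.continuousAt (t := t)

theorem hasDerivAt_interaction (h : IsTruncatedSolution h₁ h₂ γ c R Y) (hR : 0 < R)
    (heven : ∀ x, σ₁ (-x) = σ₁ x) {t : ℝ} (ht : ‖Y t‖ ≤ R) :
    HasDerivAt (fun s => interaction h₁ h₂ (Y s).1.fn (Y s).1.fn (Y s).2.snd)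
      (-c * inner ℝ (tensor (contL2 d (rho h₁ (Y t).1.fn (Y t).1.fn)) (testL2 h₂)) (Y t).2.fst
        + 2 * (-(Complex.I / 2) *
          inner ℂ (potentialMul h₁ h₂ (Y t)).grad (Y t).1.grad).re) t := by
  refine ((h.hasDerivAt_interaction_snd t).add
    (h.hasDerivAt_interaction_fst hR heven ht)).congr_of_eventuallyEq
    (Eventually.of_forall fun s => ?_)
  simp only [Pi.add_apply, sub_add_cancel]

theorem hasDerivAt_mass (h : IsTruncatedSolution h₁ h₂ γ c R Y) {t : ℝ} (ht : ‖Y t‖ ≤ R) :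
    HasDerivAt (fun s => ‖(Y s).1.fn‖ ^ 2) 0 t := by
  have k := H1.hasDerivAt_norm_fn_sq_of_mild (u := fun s => (Y s).1) (h.hasDerivAt_fst t)
  rw [radialRetraction_of_norm_le ht, re_inner_fn_force, mul_zero] at k
  exact k

theorem hasDerivAt_energy (h : IsTruncatedSolution h₁ h₂ γ c R Y) (hR : 0 < R)
    (heven : ∀ x, σ₁ (-x) = σ₁ x) {t : ℝ} (ht : ‖Y t‖ ≤ R) :
    HasDerivAt (fun s => energy h₁ h₂ γ (Y s)) 0 t := by
  have k1 := hasDerivAt_norm_sq_of_mild (H1.freeFlow d) (y := fun s => (Y s).1) (h.hasDerivAt_fst t)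
  have k2 := h.hasDerivAt_mass ht
  have k3 := hasDerivAt_norm_sq_of_mild (𝕜 := ℝ) ((waveFlow d n).rescale c)
    (y := fun s => (Y s).2) (h.hasDerivAt_snd t)
  have k4 := h.hasDerivAt_interaction hR heven ht
  rw [radialRetraction_of_norm_le ht] at k1 k3
  rw [H1.inner_eq, map_add, RCLike.re_to_complex, RCLike.re_to_complex, re_inner_fn_force,
    re_inner_grad_force] at k1
  rw [RCLike.re_to_real, inner_snd_force] at k3
  have k := (((k1.sub k2).add k3).div_const 2).add (k4.const_mul γ)
  refine (k.congr_deriv ?_).congr_of_eventuallyEq (Eventually.of_forall fun s => ?_)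
  · ring
  · simp only [Pi.add_apply, Pi.sub_apply, energy, H1.norm_sq_eq (Y s).1]
    ring

theorem eq_of_hasDerivAt_zero {g : ℝ → ℝ} {T : ℝ} (hT : 0 ≤ T)
    (hg : ∀ t ∈ Icc 0 T, HasDerivAt g 0 t) : g T = g 0 :=
  constant_of_has_deriv_right_zero (fun t ht => (hg t ht).continuousAt.continuousWithinAt)
    (fun t ht => (hg t (Ico_subset_Icc_self ht)).hasDerivWithinAt) T ⟨hT, le_rfl⟩

/-- Conservation of the mass, as long as the truncation is not active. -/
theorem mass_eq (h : IsTruncatedSolution h₁ h₂ γ c R Y) {T : ℝ} (hT : 0 ≤ T)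
    (hY : ∀ t ∈ Icc 0 T, ‖Y t‖ ≤ R) : ‖(Y T).1.fn‖ ^ 2 = ‖(Y 0).1.fn‖ ^ 2 :=
  eq_of_hasDerivAt_zero (g := fun s => ‖(Y s).1.fn‖ ^ 2) hT fun t ht => h.hasDerivAt_mass (hY t ht)

/-- Conservation of the energy, as long as the truncation is not active. -/
theorem energy_eq (h : IsTruncatedSolution h₁ h₂ γ c R Y) (hR : 0 < R)
    (heven : ∀ x, σ₁ (-x) = σ₁ x) {T : ℝ} (hT : 0 ≤ T) (hY : ∀ t ∈ Icc 0 T, ‖Y t‖ ≤ R) :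
    energy h₁ h₂ γ (Y T) = energy h₁ h₂ γ (Y 0) :=
  eq_of_hasDerivAt_zero (g := fun s => energy h₁ h₂ γ (Y s)) hT
    fun t ht => h.hasDerivAt_energy hR heven (hY t ht)

end IsTruncatedSolution

end Energy

/-! ### Coercivity of the energy -/

section Density

variable {d : ℕ} {σ₁ : Torus d → ℝ} (h₁ : Torus.Smooth σ₁)

theorem rho_self_eq_integral (u : Lp ℂ 2 (volume : Measure (Torus d))) (x : Torus d) :
    rho h₁ u u x = ∫ y, σ₁ (x - y) * ‖u y‖ ^ 2 := by
  rw [rho_apply, conv_apply]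
  refine integral_congr_ae ?_
  filter_upwards [coeFn_reInner u u] with y hy
  rw [hy, real_inner_self_eq_norm_sq]
  rfl

theorem rho_self_nonneg (hσ : ∀ x, 0 ≤ σ₁ x) (u : Lp ℂ 2 (volume : Measure (Torus d)))
    (x : Torus d) : 0 ≤ rho h₁ u u x := by
  rw [rho_self_eq_integral]
  exact integral_nonneg fun y => mul_nonneg (hσ _) (sq_nonneg _)

/-- The Cauchy–Schwarz inequality for the nonnegative weight `σ₁ (x - ·)`. -/
theorem rho_sq_le (hσ : ∀ x, 0 ≤ σ₁ x) (u v : Lp ℂ 2 (volume : Measure (Torus d)))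
    (x : Torus d) : rho h₁ u v x ^ 2 ≤ rho h₁ u u x * rho h₁ v v x := by
  have h : ∀ s : ℝ, 0 ≤ rho h₁ u u x * (s * s) + 2 * rho h₁ u v x * s + rho h₁ v v x := by
    intro s
    have := rho_self_nonneg h₁ hσ (s • u + v) x
    simp only [map_add, map_smul, add_apply, smul_apply, ContinuousMap.add_apply,
      ContinuousMap.smul_apply, smul_eq_mul, rho_comm h₁ v u] at this
    linarith
  have := discrim_le_zero h
  rw [discrim] at this
  linarith

theorem integral_sub_eq_average (heven : ∀ x, σ₁ (-x) = σ₁ x) (x : Torus d) :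
    ∫ y, σ₁ (x - y) = average σ₁ := by
  rw [average, ← integral_sub_right_eq_self σ₁ x]
  simp only [← heven (x - _), neg_sub]

theorem rho_const_self (heven : ∀ x, σ₁ (-x) = σ₁ x) (α : ℂ) (x : Torus d) :
    rho h₁ (Lp.const 2 volume α) (Lp.const 2 volume α) x = ‖α‖ ^ 2 * average σ₁ := by
  rw [rho_self_eq_integral, ← integral_sub_eq_average heven x, ← integral_const_mul]
  refine integral_congr_ae ?_
  filter_upwards [Lp.coeFn_const 2 (volume : Measure (Torus d)) α] with y hy
  rw [hy, Function.const_apply, mul_comm]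

theorem integral_rho_self (u : Lp ℂ 2 (volume : Measure (Torus d))) :
    ∫ x, rho h₁ u u x = average σ₁ * ‖u‖ ^ 2 := by
  have h := (integral_conv_smul h₁.toC (reInner d u u) (w := fun _ => (1 : ℝ))
    (integrable_const _)).2
  have e : ∀ y : Torus d, ∫ x, h₁.toC (x - y) = average σ₁ := fun y =>
    integral_sub_right_eq_self (fun x => σ₁ x) y
  simp only [smul_eq_mul, mul_one, e] at h
  rw [rho_apply, h, integral_mul_const, mul_comm]
  congr 1
  have h2 : ‖u‖ ^ 2 = ∫ y, ‖u y‖ ^ 2 := by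
    rw [← inner_self_eq_norm_sq (𝕜 := ℂ), L2.inner_def, ← integral_re (L2.integrable_inner u u)]
    simp only [inner_self_eq_norm_sq]
  rw [h2]
  refine integral_congr_ae ?_
  filter_upwards [coeFn_reInner u u] with y hy
  rw [hy, real_inner_self_eq_norm_sq]

theorem norm_contL2_sq (f : C(Torus d, ℝ)) : ‖contL2 d f‖ ^ 2 = ∫ x, f x ^ 2 := by
  rw [← real_inner_self_eq_norm_sq, L2.inner_def]
  refine integral_congr_ae ?_
  filter_upwards [coeFn_contL2 f] with x hx
  rw [hx, real_inner_self_eq_norm_sq, Real.norm_eq_abs, sq_abs]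

/-- Young's inequality for `σ₁ ⋆ Re (ᾱ v)`. -/
theorem norm_rho_const_le (hσ : ∀ x, 0 ≤ σ₁ x) (heven : ∀ x, σ₁ (-x) = σ₁ x) (α : ℂ)
    (v : Lp ℂ 2 (volume : Measure (Torus d))) :
    ‖contL2 d (rho h₁ (Lp.const 2 volume α) v)‖ ≤ average σ₁ * ‖α‖ * ‖v‖ := by
  have hA : 0 ≤ average σ₁ := integral_nonneg hσ
  refine le_of_sq_le_sq ?_ (by positivity)
  rw [norm_contL2_sq]
  have hi : ∀ f : C(Torus d, ℝ), Integrable fun x => f x := fun f =>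
    f.continuous.integrable_of_hasCompactSupport (HasCompactSupport.of_compactSpace _)
  calc ∫ x, rho h₁ (Lp.const 2 volume α) v x ^ 2
      ≤ ∫ x, ‖α‖ ^ 2 * average σ₁ * rho h₁ v v x := by
        refine integral_mono (hi (rho h₁ (Lp.const 2 volume α) v ^ 2)) ((hi _).const_mul _)
          fun x => ?_
        have := rho_sq_le h₁ hσ (Lp.const 2 volume α) v x
        rwa [rho_const_self h₁ heven] at this
    _ = _ := by
        rw [integral_const_mul, integral_rho_self]
        ring

end Density

/-! ### Mean values and fluctuations -/

section Fluctuation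

open Torus

variable {d : ℕ}

/-- Subtraction of the mean value. -/
def removeMean (d : ℕ) : Lp ℝ 2 (volume : Measure (Torus d)) →L[ℝ]
    Lp ℝ 2 (volume : Measure (Torus d)) :=
  ContinuousLinearMap.id ℝ _ - (vol d)⁻¹ • (innerSL ℝ (Lp.const 2 volume (1 : ℝ))).smulRight
    (Lp.const 2 (volume : Measure (Torus d)) (1 : ℝ))

theorem removeMean_apply (f : Lp ℝ 2 (volume : Measure (Torus d))) : removeMean d f
    = f - (vol d)⁻¹ • inner ℝ (Lp.const 2 volume (1 : ℝ)) f • Lp.const 2 volume (1 : ℝ) := rfl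

theorem inner_const_one (f : Lp ℝ 2 (volume : Measure (Torus d))) :
    inner ℝ (Lp.const 2 volume (1 : ℝ)) f = ∫ x, f x := by
  rw [L2.inner_def]
  refine integral_congr_ae ?_
  filter_upwards [Lp.coeFn_const 2 (volume : Measure (Torus d)) (1 : ℝ)] with x hx
  rw [hx]
  simp

theorem inner_const_one_self :
    inner ℝ (Lp.const 2 (volume : Measure (Torus d)) (1 : ℝ)) (Lp.const 2 volume (1 : ℝ))
      = vol d := by
  rw [inner_const_one, integral_congr_ae (Lp.coeFn_const 2 (volume : Measure (Torus d)) (1 : ℝ))]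
  simp [vol]

theorem norm_sq_eq_removeMean (f : Lp ℝ 2 (volume : Measure (Torus d))) :
    ‖f‖ ^ 2 = (∫ x, f x) ^ 2 / vol d + ‖removeMean d f‖ ^ 2 := by
  have hV := (vol_pos (d := d)).ne'
  have h1 := inner_const_one_self (d := d)
  have h2 := (real_inner_comm _ _).trans (inner_const_one f)
  rw [removeMean_apply, smul_smul, norm_sub_sq_real, real_inner_smul_right, norm_smul, mul_pow,
    ← real_inner_self_eq_norm_sq (Lp.const 2 (volume : Measure (Torus d)) (1 : ℝ)),
    h1, real_inner_comm, h2, Real.norm_eq_abs, sq_abs]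
  field_simp
  ring

theorem norm_removeMean_le (f : Lp ℝ 2 (volume : Measure (Torus d))) : ‖removeMean d f‖ ≤ ‖f‖ := by
  refine le_of_sq_le_sq ?_ (norm_nonneg f)
  have h := norm_sq_eq_removeMean f
  have : 0 ≤ (∫ x, f x) ^ 2 / vol d := div_nonneg (sq_nonneg _) vol_pos.le
  linarith

theorem removeMean_smul_const (a : ℝ) :
    removeMean d (a • Lp.const 2 volume (1 : ℝ)) = 0 := by
  have hV := (vol_pos (d := d)).ne'
  rw [removeMean_apply, real_inner_smul_right, inner_const_one_self, smul_smul,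
    inv_mul_eq_div, mul_div_cancel_right₀ _ hV, sub_self]

/-- Distance to a constant, through the mean value. -/
theorem norm_sub_const_le (f : Lp ℝ 2 (volume : Measure (Torus d))) (a : ℝ) :
    ‖f - a • Lp.const 2 volume (1 : ℝ)‖
      ≤ ‖removeMean d f‖ + |(∫ x, f x) / vol d - a| * √(vol d) := by
  have e : f - a • Lp.const 2 volume (1 : ℝ) = removeMean d f
      + ((∫ x, f x) / vol d - a) • Lp.const 2 volume (1 : ℝ) := by
    rw [removeMean_apply, inner_const_one, smul_smul, inv_mul_eq_div, sub_smul]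
    abel
  have hn : ‖Lp.const 2 (volume : Measure (Torus d)) (1 : ℝ)‖ = √(vol d) := by
    rw [norm_eq_sqrt_real_inner, inner_const_one_self]
  rw [e]
  refine (norm_add_le _ _).trans_eq ?_
  rw [norm_smul, hn, Real.norm_eq_abs]

end Fluctuation

theorem exists_norm_bilin_le {A B G : Type*} [SeminormedAddCommGroup A] [NormedSpace ℝ A]
    [SeminormedAddCommGroup B] [NormedSpace ℝ B] [SeminormedAddCommGroup G] [NormedSpace ℝ G]
    (b : A →L[ℝ] B →L[ℝ] G) : ∃ C, 0 ≤ C ∧ ∀ x y, ‖b x y‖ ≤ C * ‖x‖ * ‖y‖ :=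
  ⟨‖b‖, norm_nonneg b, b.le_opNorm₂⟩

section Mean

open Torus

variable {d : ℕ}

theorem H1.fn_const (α : ℂ) : (H1.const d α).fn = Lp.const 2 volume α := rfl

theorem H1.grad_const (α : ℂ) : (H1.const d α).grad = 0 := rfl

theorem const_eq_smul_charL2 (α : ℂ) :
    Lp.const 2 (volume : Measure (Torus d)) α = α • charL2 0 := by
  refine Lp.ext ?_
  filter_upwards [Lp.coeFn_const 2 (volume : Measure (Torus d)) α,
    Lp.coeFn_smul α (charL2 (0 : Fin d → ℤ)), coeFn_charL2 (0 : Fin d → ℤ)] with x h1 h2 h3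
  rw [h1, h2, Pi.smul_apply, h3, char_zero]
  simp

theorem norm_sq_const_add {α : ℂ} {v : Lp ℂ 2 (volume : Measure (Torus d))}
    (hv : inner ℂ (charL2 0) v = 0) :
    ‖Lp.const 2 volume α + v‖ ^ 2 = ‖α‖ ^ 2 * vol d + ‖v‖ ^ 2 := by
  classical
  have h1 : inner ℂ (charL2 (0 : Fin d → ℤ)) (charL2 0) = (vol d : ℂ) := by
    rw [inner_charL2_charL2, if_pos rfl]
  have h2 : ‖charL2 (0 : Fin d → ℤ)‖ ^ 2 = vol d := by
    rw [← inner_self_eq_norm_sq (𝕜 := ℂ), h1]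
    simp
  rw [const_eq_smul_charL2, norm_add_sq (𝕜 := ℂ), inner_smul_left, hv, norm_smul, mul_pow, h2]
  simp

/-- Decomposition into mean value and fluctuation. -/
theorem H1.exists_const_add (u : H1 d) : ∃ (α : ℂ) (v : H1 d), u = H1.const d α + v ∧
    v.grad = u.grad ∧ ‖v.fn‖ ≤ ‖u.grad‖ ∧ ‖u.fn‖ ^ 2 = ‖α‖ ^ 2 * vol d + ‖v.fn‖ ^ 2 := by
  classical
  have hV : (vol d : ℂ) ≠ 0 := by exact_mod_cast (vol_pos (d := d)).ne'
  set α : ℂ := inner ℂ (charL2 0) u.fn / vol d with hα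
  set v : H1 d := u - H1.const d α with hv
  have hg : v.grad = u.grad := by
    change u.grad - (H1.const d α).grad = u.grad
    rw [H1.grad_const, sub_zero]
  have hfn : v.fn = u.fn - Lp.const 2 volume α := rfl
  have h0 : inner ℂ (charL2 0) v.fn = 0 := by
    rw [hfn, inner_sub_right, const_eq_smul_charL2, inner_smul_right, inner_charL2_charL2,
      if_pos rfl, hα]
    field_simp
    ring
  refine ⟨α, v, by rw [hv]; abel, hg, hg ▸ H1.norm_fn_le_norm_grad h0, ?_⟩
  rw [← norm_sq_const_add h0, hfn]
  congr 2
  abel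

variable {σ₁ : Torus d → ℝ} (h₁ : Torus.Smooth σ₁)

/-- The fluctuation of the density is controlled, at first order with the sharp constant, by the
fluctuation of the wave function. -/
theorem exists_norm_removeMean_rho_le (hσ : ∀ x, 0 ≤ σ₁ x) (heven : ∀ x, σ₁ (-x) = σ₁ x) :
    ∃ C, 0 ≤ C ∧ ∀ (α : ℂ) (v : Lp ℂ 2 (volume : Measure (Torus d))),
      ‖removeMean d (contL2 d (rho h₁ (Lp.const 2 volume α + v) (Lp.const 2 volume α + v)))‖
        ≤ (2 * average σ₁ * ‖α‖ + C * ‖v‖) * ‖v‖ := by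
  set L : C(Torus d, ℝ) →L[ℝ] Lp ℝ 2 (volume : Measure (Torus d)) := contL2 d with hL
  obtain ⟨C, hC, hCb⟩ := exists_norm_bilin_le (rho h₁)
  refine ⟨‖L‖ * C, by positivity, fun α v => ?_⟩
  set w : Lp ℂ 2 (volume : Measure (Torus d)) := Lp.const 2 volume α with hw
  have hc : removeMean d (L (rho h₁ w w)) = 0 := by
    have : L (rho h₁ w w) = (‖α‖ ^ 2 * average σ₁) • Lp.const 2 volume (1 : ℝ) := by
      refine Lp.ext ?_
      filter_upwards [coeFn_contL2 (rho h₁ w w), Lp.coeFn_smul (‖α‖ ^ 2 * average σ₁)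
        (Lp.const 2 (volume : Measure (Torus d)) (1 : ℝ)),
        Lp.coeFn_const 2 (volume : Measure (Torus d)) (1 : ℝ)] with x hx hx' hx''
      rw [hL, hx, hx', Pi.smul_apply, hx'', rho_const_self h₁ heven]
      simp
    rw [this, removeMean_smul_const]
  have e : removeMean d (L (rho h₁ (w + v) (w + v)))
      = (2 : ℝ) • removeMean d (L (rho h₁ w v)) + removeMean d (L (rho h₁ v v)) := by
    simp only [map_add, add_apply, rho_comm h₁ v w, hc, two_smul]
    abel
  have h1 : ‖removeMean d (L (rho h₁ w v))‖ ≤ average σ₁ * ‖α‖ * ‖v‖ :=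
    (norm_removeMean_le _).trans (norm_rho_const_le h₁ hσ heven α v)
  have h2 : ‖removeMean d (L (rho h₁ v v))‖ ≤ ‖L‖ * C * ‖v‖ * ‖v‖ := by
    refine (norm_removeMean_le _).trans ((L.le_opNorm _).trans ?_)
    rw [mul_assoc, mul_assoc, ← mul_assoc C]
    exact mul_le_mul_of_nonneg_left (hCb v v) (norm_nonneg L)
  rw [e]
  refine (norm_add_le _ _).trans ?_
  rw [norm_smul, Real.norm_ofNat]
  linarith

end Mean

/-! ### Coercivity near the plane wave -/

section Coercivity

open Torus

/-- The constant `2 ⟨σ₁⟩ ‖α‖` of `exists_norm_removeMean_rho_le` is close to `2 ⟨σ₁⟩` when `u` is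
close to the plane wave, and the fluctuation of `u` is at most `‖∇u‖` by the Poincaré inequality;
this is where the smallness condition enters. -/
theorem exists_norm_removeMean_le_grad {d : ℕ} {σ₁ : Torus d → ℝ} (h₁ : Torus.Smooth σ₁)
    (hσ : ∀ x, 0 ≤ σ₁ x) (heven : ∀ x, σ₁ (-x) = σ₁ x) {k : ℝ}
    (hsmall : 4 * k * average σ₁ ^ 2 < 1) :
    ∃ η b β : ℝ, 0 < η ∧ 0 ≤ b ∧ 0 < β ∧ k * b ^ 2 ≤ 1 - β ∧ ∀ u : H1 d, ‖u.grad‖ ≤ η →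
      |‖u.fn‖ ^ 2 - vol d| ≤ η → ‖removeMean d (contL2 d (rho h₁ u.fn u.fn))‖ ≤ b * ‖u.grad‖ := by
  obtain ⟨C, hC, hCb⟩ := exists_norm_removeMean_rho_le h₁ hσ heven
  have hV := vol_pos (d := d)
  have hA : 0 ≤ average σ₁ := integral_nonneg hσ
  have hdec := H1.exists_const_add (d := d)
  generalize average σ₁ = A at *
  generalize vol d = V at *
  set β := (1 - 4 * k * A ^ 2) / 2 with hβ
  have hβ0 : 0 < β := by rw [hβ]; linarith
  -- `η` is so small that the fluctuation of the density is still absorbed by the gradient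
  obtain ⟨η, hη, hη0⟩ : ∃ η, k * (2 * A * (1 + η / V) + C * η) ^ 2 < 1 - β ∧ 0 < η := by
    have hcont : Continuous fun η : ℝ => k * (2 * A * (1 + η / V) + C * η) ^ 2 := by fun_prop
    have h0 : k * (2 * A * (1 + 0 / V) + C * 0) ^ 2 < 1 - β := by
      rw [zero_div, mul_zero, add_zero, add_zero, mul_one]
      nlinarith
    have h1 := (hcont.tendsto 0).eventually_lt_const h0
    exact ((h1.filter_mono nhdsWithin_le_nhds).and (self_mem_nhdsWithin (s := Ioi 0))).exists
  refine ⟨η, 2 * A * (1 + η / V) + C * η, β, hη0, by positivity, hβ0, hη.le, fun u hgη hDη => ?_⟩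
  obtain ⟨α, v, hu, hvg, hvn, hm⟩ := hdec u
  have hα : ‖α‖ ≤ 1 + η / V := by
    have h1 : ‖α‖ ^ 2 * V ≤ V + η := by
      have := (abs_le.1 hDη).2
      nlinarith [sq_nonneg ‖v.fn‖]
    have h2 : ‖α‖ ^ 2 ≤ 1 + η / V := by
      rw [← le_div_iff₀ hV, add_div, div_self hV.ne'] at h1
      exact h1
    have h3 : 0 ≤ η / V := by positivity
    refine le_of_sq_le_sq (h2.trans ?_) (by positivity)
    nlinarith
  have h1 := hCb α v.fn
  have h2 : u.fn = Lp.const 2 volume α + v.fn := by rw [hu]; rfl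
  rw [← h2] at h1
  have h3 : ‖v.fn‖ ≤ η := hvn.trans hgη
  refine h1.trans (mul_le_mul ?_ hvn (norm_nonneg _) (by positivity))
  gcongr

/-- The elementary inequality behind `exists_deviation_le`: `g`, `p`, `F` and `D` stand for the
gradient, the momentum, the distance of the field to the equilibrium, and the defect of mass. -/
theorem deviation_le_of_sq_le {β b g p Z D G a F E : ℝ} (hβ : 0 < β) (hb : 0 ≤ b)
    (hD : 0 ≤ D) (hG : 0 ≤ G) (ha : 0 ≤ a)
    (hE : (β * g ^ 2 + p ^ 2 + Z ^ 2) / 2 ≤ E) (hF : F ≤ Z + G * (b * g + a * D)) :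
    g + D + F + p ≤ (√(2 / β) + 5 + G * (b * √(2 / β)) + G * a) * (√E + D) := by
  have hP2 : √(2 / β) ^ 2 = 2 / β := Real.sq_sqrt (by positivity)
  have hP0 : 0 ≤ √(2 / β) := Real.sqrt_nonneg _
  generalize √(2 / β) = P at *
  have hs2 : √E ^ 2 = E := Real.sq_sqrt (le_trans (by positivity) hE)
  have hs0 : 0 ≤ √E := Real.sqrt_nonneg _
  generalize √E = s at *
  subst hs2
  have hgs : g ≤ P * s := by
    refine le_of_sq_le_sq ?_ (by positivity)
    rw [mul_pow, hP2, div_mul_eq_mul_div, le_div_iff₀ hβ]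
    nlinarith [sq_nonneg p, sq_nonneg Z]
  have hps : p ≤ 2 * s := by
    refine le_of_sq_le_sq ?_ (by positivity)
    nlinarith [mul_nonneg hβ.le (sq_nonneg g), sq_nonneg Z, sq_nonneg s]
  have hZs : Z ≤ 2 * s := by
    refine le_of_sq_le_sq ?_ (by positivity)
    nlinarith [mul_nonneg hβ.le (sq_nonneg g), sq_nonneg p, sq_nonneg s]
  have hbg : G * (b * g) ≤ G * (b * (P * s)) := by gcongr
  have t1 : 0 ≤ G * (b * P) * D := by positivity
  have t2 : 0 ≤ G * a * s := by positivity
  have t3 : 0 ≤ P * D := by positivity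
  linarith

variable {d n : ℕ} [Fact (3 ≤ n)] {σ₁ : Torus d → ℝ} (h₁ : Torus.Smooth σ₁) {σ₂ : Space n → ℝ}
  (h₂ : IsTest σ₂)

/-- The density of a state as an element of `L²`. -/
def densityL2 (Y : State d n) : Lp ℝ 2 (volume : Measure (Torus d)) :=
  contL2 d (rho h₁ Y.1.fn Y.1.fn)

/-- The energy, renormalized by a function of the mass so as to vanish at the plane wave. -/
def excess (γ : ℝ) (Y : State d n) : ℝ :=
  energy h₁ h₂ γ Y
    + γ ^ 2 * ‖HDot1.riesz h₂‖ ^ 2 * average σ₁ ^ 2 / (2 * vol d) * (‖Y.1.fn‖ ^ 2) ^ 2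

theorem integral_densityL2 (Y : State d n) :
    ∫ x, densityL2 h₁ Y x = average σ₁ * ‖Y.1.fn‖ ^ 2 := by
  rw [← integral_rho_self h₁]
  exact integral_congr_ae (coeFn_contL2 _)

theorem tensor_add (r s : Lp ℝ 2 (volume : Measure (Torus d))) (h : HDot1 n) :
    tensor (r + s) h = tensor r h + tensor s h := (tensorL h).map_add r s

/-- The renormalized energy is a sum of squares, up to the fluctuation of the density. -/
theorem excess_eq (γ : ℝ) (Y : State d n) : excess h₁ h₂ γ Y =
    (‖Y.1.grad‖ ^ 2 + ‖Y.2.fst‖ ^ 2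
      + ‖Y.2.snd + γ • tensor (densityL2 h₁ Y) (HDot1.riesz h₂)‖ ^ 2
      - γ ^ 2 * ‖HDot1.riesz h₂‖ ^ 2 * ‖removeMean d (densityL2 h₁ Y)‖ ^ 2) / 2 := by
  have hV := (vol_pos (d := d)).ne'
  have h1 := norm_sq_eq_removeMean (densityL2 h₁ Y)
  rw [integral_densityL2] at h1
  have h2 : ‖Y.2‖ ^ 2 = ‖Y.2.fst‖ ^ 2 + ‖Y.2.snd‖ ^ 2 := WithLp.prod_norm_sq_eq_of_L2 _
  have h3 : interaction h₁ h₂ Y.1.fn Y.1.fn Y.2.snd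
      = inner ℝ Y.2.snd (tensor (densityL2 h₁ Y) (HDot1.riesz h₂)) := real_inner_comm _ _
  rw [excess, energy, h2, h3, norm_add_sq_real, real_inner_smul_right, norm_smul, norm_tensor,
    mul_pow, mul_pow, h1, Real.norm_eq_abs, sq_abs]
  field_simp
  ring

/-- The distance of a state to the plane wave, modulo phase rotations, in terms of the quantities
that are controlled by the conservation laws. -/
def deviation (γ : ℝ) (Y : State d n) : ℝ :=
  ‖Y.1.grad‖ + |‖Y.1.fn‖ ^ 2 - vol d|
    + ‖Y.2.snd - equilibriumField γ σ₁ (HDot1.riesz h₂)‖ + ‖Y.2.fst‖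

theorem equilibriumField_eq (γ : ℝ) (σ₁ : Torus d → ℝ) (Γ : HDot1 n) : equilibriumField γ σ₁ Γ
    = -(γ • tensor (average σ₁ • Lp.const 2 volume (1 : ℝ)) Γ) := by
  refine Lp.ext ?_
  filter_upwards [Lp.coeFn_const 2 (volume : Measure (Torus d)) (-(γ * average σ₁) • Γ),
    Lp.coeFn_neg (γ • tensor (average σ₁ • Lp.const 2 volume (1 : ℝ)) Γ),
    Lp.coeFn_smul γ (tensor (average σ₁ • Lp.const 2 (volume : Measure (Torus d)) (1 : ℝ)) Γ),
    coeFn_tensor (average σ₁ • Lp.const 2 (volume : Measure (Torus d)) (1 : ℝ)) Γ,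
    Lp.coeFn_smul (average σ₁) (Lp.const 2 (volume : Measure (Torus d)) (1 : ℝ)),
    Lp.coeFn_const 2 (volume : Measure (Torus d)) (1 : ℝ)] with x e1 e2 e3 e4 e5 e6
  rw [equilibriumField, e1, e2, Pi.neg_apply, e3, Pi.smul_apply, e4, e5, Pi.smul_apply, e6]
  simp [smul_smul, neg_smul]

/-- The field is compared with its equilibrium given the density, and the density with its constant
value at the plane wave. -/
theorem norm_sub_equilibriumField_le {γ : ℝ} (hγ : 0 ≤ γ) (Y : State d n) :
    ‖Y.2.snd - equilibriumField γ σ₁ (HDot1.riesz h₂)‖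
      ≤ ‖Y.2.snd + γ • tensor (densityL2 h₁ Y) (HDot1.riesz h₂)‖
        + γ * ‖HDot1.riesz h₂‖ *
          ‖densityL2 h₁ Y - average σ₁ • Lp.const 2 volume (1 : ℝ)‖ := by
  set r := densityL2 h₁ Y
  set r₀ := average σ₁ • Lp.const 2 (volume : Measure (Torus d)) (1 : ℝ)
  have e : tensor r (HDot1.riesz h₂) = tensor (r - r₀) (HDot1.riesz h₂)
      + tensor r₀ (HDot1.riesz h₂) := by
    rw [← tensor_add, sub_add_cancel]
  have e2 : Y.2.snd - equilibriumField γ σ₁ (HDot1.riesz h₂)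
      = (Y.2.snd + γ • tensor r (HDot1.riesz h₂)) - γ • tensor (r - r₀) (HDot1.riesz h₂) := by
    rw [equilibriumField_eq, e, smul_add]
    abel
  rw [e2]
  refine (norm_sub_le _ _).trans_eq ?_
  rw [norm_smul, norm_tensor, Real.norm_of_nonneg hγ]
  ring

/-- Under the smallness condition, near the plane wave the renormalized energy bounds the gradient
of the wave function, the momentum, and the distance of the field to its value at equilibrium given
the density. -/
theorem exists_sq_le_excess (γ : ℝ) (hσ : ∀ x, 0 ≤ σ₁ x) (heven : ∀ x, σ₁ (-x) = σ₁ x)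
    (hsmall : 4 * (γ ^ 2 * ‖HDot1.riesz h₂‖ ^ 2) * average σ₁ ^ 2 < 1) :
    ∃ η b β : ℝ, 0 < η ∧ 0 ≤ b ∧ 0 < β ∧ ∀ Y : State d n, ‖Y.1.grad‖ ≤ η →
      |‖Y.1.fn‖ ^ 2 - vol d| ≤ η → ‖removeMean d (densityL2 h₁ Y)‖ ≤ b * ‖Y.1.grad‖ ∧
      (β * ‖Y.1.grad‖ ^ 2 + ‖Y.2.fst‖ ^ 2
        + ‖Y.2.snd + γ • tensor (densityL2 h₁ Y) (HDot1.riesz h₂)‖ ^ 2) / 2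
        ≤ excess h₁ h₂ γ Y := by
  obtain ⟨η, b, β, hη, hb, hβ, hk, h⟩ := exists_norm_removeMean_le_grad h₁ hσ heven
    (k := γ ^ 2 * ‖HDot1.riesz h₂‖ ^ 2) hsmall
  refine ⟨η, b, β, hη, hb, hβ, fun Y hg hm => ⟨h Y.1 hg hm, ?_⟩⟩
  have h1 := h Y.1 hg hm
  change ‖removeMean d (densityL2 h₁ Y)‖ ≤ _ at h1
  rw [excess_eq]
  have h2 : γ ^ 2 * ‖HDot1.riesz h₂‖ ^ 2 * ‖removeMean d (densityL2 h₁ Y)‖ ^ 2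
      ≤ (1 - β) * ‖Y.1.grad‖ ^ 2 := by
    calc _ ≤ γ ^ 2 * ‖HDot1.riesz h₂‖ ^ 2 * (b * ‖Y.1.grad‖) ^ 2 := by gcongr
      _ = γ ^ 2 * ‖HDot1.riesz h₂‖ ^ 2 * b ^ 2 * ‖Y.1.grad‖ ^ 2 := by ring
      _ ≤ _ := by gcongr
  linarith

theorem norm_densityL2_sub_le (hA : 0 ≤ average σ₁) (Y : State d n) :
    ‖densityL2 h₁ Y - average σ₁ • Lp.const 2 volume (1 : ℝ)‖
      ≤ ‖removeMean d (densityL2 h₁ Y)‖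
        + average σ₁ / vol d * √(vol d) * |‖Y.1.fn‖ ^ 2 - vol d| := by
  have hV := vol_pos (d := d)
  refine (norm_sub_const_le _ _).trans_eq ?_
  rw [integral_densityL2]
  have : average σ₁ * ‖Y.1.fn‖ ^ 2 / vol d - average σ₁
      = average σ₁ / vol d * (‖Y.1.fn‖ ^ 2 - vol d) := by field_simp
  rw [this, abs_mul, abs_of_nonneg (by positivity : 0 ≤ average σ₁ / vol d)]
  ring

/-- Under the smallness condition, near the plane wave the conserved quantities control the
distance to it. -/
theorem exists_deviation_le {γ : ℝ} (hγ : 0 ≤ γ) (hσ : ∀ x, 0 ≤ σ₁ x)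
    (heven : ∀ x, σ₁ (-x) = σ₁ x)
    (hsmall : 4 * (γ ^ 2 * ‖HDot1.riesz h₂‖ ^ 2) * average σ₁ ^ 2 < 1) :
    ∃ η L : ℝ, 0 < η ∧ 0 ≤ L ∧ ∀ Y : State d n, deviation h₂ (σ₁ := σ₁) γ Y ≤ η →
      deviation h₂ (σ₁ := σ₁) γ Y
        ≤ L * (√(excess h₁ h₂ γ Y) + |‖Y.1.fn‖ ^ 2 - vol d|) := by
  obtain ⟨η, b, β, hη, hb, hβ, h⟩ := exists_sq_le_excess h₁ h₂ γ hσ heven hsmall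
  have hV := vol_pos (d := d)
  have hA : 0 ≤ average σ₁ := integral_nonneg hσ
  have hN := norm_nonneg (HDot1.riesz h₂)
  refine ⟨η, √(2 / β) + 5 + γ * ‖HDot1.riesz h₂‖ * (b * √(2 / β))
    + γ * ‖HDot1.riesz h₂‖ * (average σ₁ / vol d * √(vol d)), hη, by positivity, fun Y hY => ?_⟩
  have hfield := norm_sub_equilibriumField_le h₁ h₂ hγ Y
  have hdens := norm_densityL2_sub_le h₁ hA Y
  have hp := norm_nonneg Y.2.fst
  have hd := norm_nonneg (Y.2.snd - equilibriumField γ σ₁ (HDot1.riesz h₂))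
  have hg := norm_nonneg Y.1.grad
  have hD := abs_nonneg (‖Y.1.fn‖ ^ 2 - vol d)
  rw [deviation] at hY ⊢
  obtain ⟨hq, hE⟩ := h Y (by linarith) (by linarith)
  exact deviation_le_of_sq_le hβ hb hD (by positivity) (by positivity) hE
    (hfield.trans (add_le_add_right (mul_le_mul_of_nonneg_left (hdens.trans
      (add_le_add_left hq _)) (by positivity)) _))

end Coercivity

/-! ### The plane wave and its orbit -/

section Orbit

open Torus

variable {d n : ℕ} [Fact (3 ≤ n)] {σ₁ : Torus d → ℝ} {σ₂ : Space n → ℝ}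

theorem norm_const_sq {d : ℕ} (z : ℂ) :
    ‖Lp.const 2 (volume : Measure (Torus d)) z‖ ^ 2 = ‖z‖ ^ 2 * vol d := by
  have := norm_sq_const_add (d := d) (α := z) (v := 0) (inner_zero_right _)
  simpa using this

theorem H1.norm_const {d : ℕ} (z : ℂ) : ‖H1.const d z‖ = ‖z‖ * √(vol d) := by
  have h := H1.norm_sq_eq (H1.const d z)
  rw [H1.fn_const, norm_const_sq, H1.grad_const, norm_zero] at h
  rw [← Real.sqrt_sq (norm_nonneg (H1.const d z)), h, zero_pow two_ne_zero, add_zero,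
    Real.sqrt_mul (sq_nonneg _), Real.sqrt_sq (norm_nonneg z)]

theorem H1.const_eq_smul {d : ℕ} (z : ℂ) : H1.const d z = z • H1.const d 1 := by
  refine H1.ext ?_ ?_
  · change Lp.const 2 volume z = z • Lp.const 2 volume (1 : ℂ)
    rw [const_eq_smul_charL2, const_eq_smul_charL2 1, one_smul]
  · exact (smul_zero z).symm

theorem H1.const_sub {d : ℕ} (z z' : ℂ) : H1.const d z - H1.const d z' = H1.const d (z - z') := by
  rw [H1.const_eq_smul, H1.const_eq_smul z', H1.const_eq_smul (z - z'), sub_smul]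

/-- The phase of a complex number, in `[0, 2π)`. -/
theorem exists_phase (α : ℂ) : ∃ θ ∈ Ico (0 : ℝ) (2 * π),
    α = ‖α‖ * Complex.exp (Complex.I * θ) := by
  have h := Complex.norm_mul_exp_arg_mul_I α
  rcases le_or_gt 0 (Complex.arg α) with h0 | h0
  · refine ⟨Complex.arg α, ⟨h0, ?_⟩, ?_⟩
    · linarith [Complex.arg_le_pi α, Real.pi_pos]
    · rw [mul_comm Complex.I, h]
  · refine ⟨Complex.arg α + 2 * π, ⟨?_, by linarith⟩, ?_⟩
    · linarith [Complex.neg_pi_lt_arg α, Real.pi_pos]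
    · have : Complex.I * ((Complex.arg α + 2 * π : ℝ) : ℂ)
          = Complex.arg α * Complex.I + 2 * π * Complex.I := by
        push_cast
        ring
      rw [this, Complex.exp_add, Complex.exp_two_pi_mul_I, mul_one, h]

/-- The distance to the constants of modulus one is controlled by the gradient and the mass. -/
theorem H1.exists_norm_sub_const_le {d : ℕ} (u : H1 d) (hg : ‖u.grad‖ ≤ 1) :
    ∃ θ ∈ Ico (0 : ℝ) (2 * π), ‖u - H1.const d (Complex.exp (Complex.I * θ))‖
      ≤ (2 + √(vol d) / vol d) * (‖u.grad‖ + |‖u.fn‖ ^ 2 - vol d|) := by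
  have hV := vol_pos (d := d)
  obtain ⟨α, v, hu, hvg, hvn, hm⟩ := H1.exists_const_add u
  obtain ⟨θ, hθ, hα⟩ := exists_phase α
  refine ⟨θ, hθ, ?_⟩
  set z := Complex.exp (Complex.I * θ) with hz
  have hz1 : ‖z‖ = 1 := by rw [hz, mul_comm]; exact Complex.norm_exp_ofReal_mul_I θ
  have e : u - H1.const d z = H1.const d (α - z) + v := by
    rw [← H1.const_sub]
    nth_rw 1 [hu]
    abel
  have e1 : ‖α - z‖ = |‖α‖ - 1| := by
    have : α - z = ((‖α‖ - 1 : ℝ) : ℂ) * z := by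
      nth_rw 1 [hα]
      push_cast
      ring
    rw [this, norm_mul, hz1, mul_one, Complex.norm_real, Real.norm_eq_abs]
  have hg0 := norm_nonneg u.grad
  have e2 : |‖α‖ - 1| ≤ (‖u.grad‖ + |‖u.fn‖ ^ 2 - vol d|) / vol d := by
    have h1 : |‖α‖ - 1| ≤ |‖α‖ ^ 2 - 1| := by
      have : ‖α‖ ^ 2 - 1 = (‖α‖ - 1) * (‖α‖ + 1) := by ring
      rw [this, abs_mul, abs_of_pos (by positivity : 0 < ‖α‖ + 1)]
      exact le_mul_of_one_le_right (abs_nonneg _) (by linarith [norm_nonneg α])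
    refine h1.trans ((le_div_iff₀ hV).2 ?_)
    have h2 : |‖α‖ ^ 2 - 1| * vol d = |(‖u.fn‖ ^ 2 - vol d) - ‖v.fn‖ ^ 2| := by
      rw [← abs_of_pos hV, ← abs_mul, abs_of_pos hV]
      congr 1
      linarith
    rw [h2]
    have h3 := abs_sub (‖u.fn‖ ^ 2 - vol d) (‖v.fn‖ ^ 2)
    have h4 : |‖v.fn‖ ^ 2| ≤ ‖u.grad‖ := by
      rw [abs_of_nonneg (sq_nonneg _)]
      nlinarith [norm_nonneg v.fn]
    linarith
  have e3 : ‖v‖ ≤ 2 * ‖u.grad‖ := by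
    refine le_of_sq_le_sq ?_ (by positivity)
    rw [H1.norm_sq_eq, hvg]
    nlinarith [norm_nonneg v.fn]
  rw [e]
  refine (norm_add_le _ _).trans ?_
  rw [H1.norm_const, e1]
  have e4 := mul_le_mul_of_nonneg_right e2 (Real.sqrt_nonneg (vol d))
  have e5 : (‖u.grad‖ + |‖u.fn‖ ^ 2 - vol d|) / vol d * √(vol d)
      = √(vol d) / vol d * (‖u.grad‖ + |‖u.fn‖ ^ 2 - vol d|) := by ring
  have := abs_nonneg (‖u.fn‖ ^ 2 - vol d)
  linarith

/-- The distance to the orbit in the energy space is controlled by the deviation. -/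
theorem exists_orbitDist_le (γ : ℝ) {c : ℝ} (hc : 0 < c) (h₂ : IsTest σ₂) :
    ∃ M : ℝ, 0 ≤ M ∧ ∀ Y : State d n, deviation (σ₁ := σ₁) h₂ γ Y ≤ 1 →
      orbitDist γ σ₁ (HDot1.riesz h₂) (ofState c Y) ≤ M * deviation (σ₁ := σ₁) h₂ γ Y := by
  have hV := vol_pos (d := d)
  refine ⟨2 + √(vol d) / vol d + 1 + (2 * c)⁻¹, by positivity, fun Y hY => ?_⟩
  have hp := norm_nonneg Y.2.fst
  have hd := norm_nonneg (Y.2.snd - equilibriumField γ σ₁ (HDot1.riesz h₂))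
  have hg := norm_nonneg Y.1.grad
  have hD := abs_nonneg (‖Y.1.fn‖ ^ 2 - vol d)
  rw [deviation] at hY ⊢
  obtain ⟨θ, hθ, h⟩ := H1.exists_norm_sub_const_le Y.1 (by linarith)
  have h1 : (⨅ θ : Ico (0 : ℝ) (2 * π),
      ‖(ofState c Y).1 - H1.const d (Complex.exp (Complex.I * (θ : ℝ)))‖)
      ≤ ‖Y.1 - H1.const d (Complex.exp (Complex.I * θ))‖ :=
    ciInf_le ⟨0, by rintro _ ⟨x, rfl⟩; exact norm_nonneg _⟩ (⟨θ, hθ⟩ : Ico (0 : ℝ) (2 * π))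
  have h2 : ‖(ofState c Y).2.2‖ = (2 * c)⁻¹ * ‖Y.2.fst‖ := by
    change ‖(2 * c)⁻¹ • Y.2.fst‖ = _
    rw [norm_smul, Real.norm_of_nonneg (by positivity)]
  have h3 : ‖(ofState c Y).2.1 - equilibriumField γ σ₁ (HDot1.riesz h₂)‖
      = ‖Y.2.snd - equilibriumField γ σ₁ (HDot1.riesz h₂)‖ := rfl
  rw [orbitDist, h2, h3]
  have hW : 0 ≤ √(vol d) / vol d := by positivity
  have hc' : 0 ≤ (2 * c)⁻¹ := by positivity
  generalize ‖Y.2.snd - equilibriumField γ σ₁ (HDot1.riesz h₂)‖ = x at *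
  generalize ‖Y.2.fst‖ = p at *
  generalize ‖Y.1.grad‖ = g at *
  generalize |‖Y.1.fn‖ ^ 2 - vol d| = D at *
  generalize √(vol d) / vol d = W at *
  generalize (2 * c)⁻¹ = e at *
  have t1 := mul_nonneg hW hp
  have t2 := mul_nonneg hW hd
  have t3 := mul_nonneg hc' hd
  have t4 := mul_nonneg hc' hg
  have t5 := mul_nonneg hc' hD
  have := h1.trans h
  linarith

/-- A radius within which the states of small deviation lie; the nonlinearity is truncated there. -/
theorem norm_le_of_deviation (γ : ℝ) (h₂ : IsTest σ₂) {Y : State d n}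
    (hY : deviation (σ₁ := σ₁) h₂ γ Y ≤ 1) :
    ‖Y‖ ≤ vol d + 3 + ‖equilibriumField (d := d) γ σ₁ (HDot1.riesz h₂)‖ := by
  have hV := vol_pos (d := d)
  have hp := norm_nonneg Y.2.fst
  have hd := norm_nonneg (Y.2.snd - equilibriumField γ σ₁ (HDot1.riesz h₂))
  have hg := norm_nonneg Y.1.grad
  have he := norm_nonneg (equilibriumField (d := d) γ σ₁ (HDot1.riesz h₂))
  have hD := abs_nonneg (‖Y.1.fn‖ ^ 2 - vol d)
  rw [deviation] at hY
  refine max_le ?_ ?_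
  · have h1 : ‖Y.1‖ ≤ vol d + 3 := by
      refine le_of_sq_le_sq ?_ (by positivity)
      rw [H1.norm_sq_eq]
      have := (abs_le.1 (show |‖Y.1.fn‖ ^ 2 - vol d| ≤ 1 by linarith)).2
      nlinarith
    linarith
  · have h1 : ‖Y.2‖ ≤ ‖Y.2.fst‖ + ‖Y.2.snd‖ := by
      refine le_of_sq_le_sq ?_ (by positivity)
      rw [show ‖Y.2‖ ^ 2 = ‖Y.2.fst‖ ^ 2 + ‖Y.2.snd‖ ^ 2 from WithLp.prod_norm_sq_eq_of_L2 _]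
      nlinarith [norm_nonneg Y.2.snd]
    have h2 := norm_le_norm_sub_add Y.2.snd (equilibriumField γ σ₁ (HDot1.riesz h₂))
    linarith

end Orbit

/-! ### The plane wave is a solution -/

section PlaneWave

open Torus

variable {d n : ℕ} [Fact (3 ≤ n)] {σ₁ : Torus d → ℝ} {σ₂ : Space n → ℝ} (h₂ : IsTest σ₂)

/-- The field of the plane wave creates a constant potential. -/
theorem potential_equilibriumField (heven : ∀ x, σ₁ (-x) = σ₁ x) (γ : ℝ) (x : Torus d) :
    potential σ₁ σ₂ (equilibriumField γ σ₁ (HDot1.riesz h₂)) x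
      = -(γ * ‖HDot1.riesz h₂‖ ^ 2 * average σ₁ ^ 2) := by
  have e : potential σ₁ σ₂ (equilibriumField γ σ₁ (HDot1.riesz h₂)) x
      = ∫ y, σ₁ (x - y) * -(γ * average σ₁ * ‖HDot1.riesz h₂‖ ^ 2) := by
    refine integral_congr_ae ?_
    filter_upwards [coeFn_fieldMean h₂ (equilibriumField γ σ₁ (HDot1.riesz h₂)),
      coeFn_pairL (HDot1.riesz h₂) (equilibriumField γ σ₁ (HDot1.riesz h₂)),
      Lp.coeFn_const 2 (volume : Measure (Torus d)) (-(γ * average σ₁) • HDot1.riesz h₂)]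
      with y e1 e2 e3
    have e4 : equilibriumField (d := d) γ σ₁ (HDot1.riesz h₂) y
        = -(γ * average σ₁) • HDot1.riesz h₂ := e3
    rw [← e1, fieldMean, e2, e4, real_inner_smul_right, real_inner_self_eq_norm_sq]
    ring
  rw [e, integral_mul_const, integral_sub_eq_average heven]
  ring

theorem inner_field_equilibriumField (γ : ℝ) (i : TestPair d n) :
    inner ℝ i.field (equilibriumField γ σ₁ (HDot1.riesz h₂))
      = -(γ * average σ₁) * ((∫ x, i.1.1 x) * ∫ z, σ₂ z * i.2.1 z) := by
  have e : inner ℝ (HDot1.ofTest i.2.2) (HDot1.riesz h₂) = ∫ z, σ₂ z * i.2.1 z := by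
    rw [real_inner_comm, ← inner_testL2_testL2, real_inner_comm, integral_testL2]
  rw [TestPair.field, inner_tensor_smoothL2, ← e, ← integral_mul_const, ← integral_const_mul]
  refine integral_congr_ae ?_
  filter_upwards [Lp.coeFn_const 2 (volume : Measure (Torus d))
    (-(γ * average σ₁) • HDot1.riesz h₂)] with x hx
  rw [equilibriumField, hx, Function.const_apply, real_inner_smul_right]
  ring

theorem density_const (h₁ : Torus.Smooth σ₁) (heven : ∀ x, σ₁ (-x) = σ₁ x) {z : ℂ}
    (hz : ‖z‖ = 1) (x : Torus d) :
    density σ₁ (H1.const d z) x = average σ₁ := by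
  rw [← rho_self_apply h₁, H1.fn_const, rho_const_self h₁ heven, hz]
  ring

theorem norm_exp_phase (freq t : ℝ) : ‖Complex.exp (Complex.I * freq * t)‖ = 1 := by
  rw [show Complex.I * freq * t = ((freq * t : ℝ) : ℂ) * Complex.I by push_cast; ring]
  exact Complex.norm_exp_ofReal_mul_I _

theorem planeWave_fst_fn (γ freq : ℝ) (Γ : HDot1 n) (t : ℝ) :
    (planeWave γ freq σ₁ Γ t).1.fn
      = Complex.exp (Complex.I * freq * t) • Lp.const 2 (volume : Measure (Torus d)) (1 : ℂ) := by
  have := congrArg H1.fn (H1.const_eq_smul (d := d) (Complex.exp (Complex.I * freq * t)))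
  exact this

theorem continuous_planeWave (γ freq : ℝ) (Γ : HDot1 n) :
    Continuous (planeWave γ freq σ₁ Γ : ℝ → EnergySpace d n) := by
  refine Continuous.prodMk ?_ continuous_const
  simp only [H1.const_eq_smul (d := d) (Complex.exp _)]
  have : Continuous fun t : ℝ => Complex.exp (Complex.I * freq * t) := by fun_prop
  exact this.smul continuous_const

theorem hasDerivAt_exp_phase (freq t : ℝ) : HasDerivAt
    (fun s : ℝ => Complex.exp (Complex.I * freq * s))
    (Complex.I * freq * Complex.exp (Complex.I * freq * t)) t := by
  have h := (((hasDerivAt_id (t : ℂ)).const_mul (Complex.I * freq)).cexp).comp_ofReal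
  simpa [mul_comm] using h

theorem hasDerivWithinAt_of_forall_eq {f : ℝ → ℝ} {f' t : ℝ} {s : Set ℝ} (hf : ∀ r, f r = f t)
    (h : f' = 0) : HasDerivWithinAt f f' s t := by
  rw [h, show f = fun _ => f t from funext hf]
  exact hasDerivWithinAt_const _ _ _

/-- With a constant potential the Schrödinger equation reduces to the dispersion relation, while the
wave equation reduces to `-Δ Γ = σ₂`. -/
theorem isSolution_planeWave (h₁ : Torus.Smooth σ₁) (heven : ∀ x, σ₁ (-x) = σ₁ x)
    (γ c : ℝ) {freq : ℝ}
    (hfreq : freq = γ ^ 2 * ‖HDot1.riesz h₂‖ ^ 2 * average σ₁ ^ 2) :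
    IsSolution γ c σ₁ σ₂ (planeWave γ freq σ₁ (HDot1.riesz h₂))
      (H1.const d 1, equilibriumField γ σ₁ (HDot1.riesz h₂), 0) where
  initial := by simp [planeWave]
  continuousOn := (continuous_planeWave γ freq _).continuousOn
  schrodinger := by
    intro w t ht
    have hg : (planeWave γ freq σ₁ (HDot1.riesz h₂) t).1.grad = 0 :=
      H1.grad_const (d := d) (Complex.exp (Complex.I * freq * t))
    have hp : ∀ x, potential σ₁ σ₂ (planeWave γ freq σ₁ (HDot1.riesz h₂) t).2.1 x
        = -(γ * ‖HDot1.riesz h₂‖ ^ 2 * average σ₁ ^ 2) :=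
      potential_equilibriumField h₂ heven γ
    have hi : ∫ x, starRingEnd ℂ (w.fn x) * ((-(γ * ‖HDot1.riesz h₂‖ ^ 2 * average σ₁ ^ 2) : ℝ)
          * (planeWave γ freq σ₁ (HDot1.riesz h₂) t).1.fn x)
        = (-(γ * ‖HDot1.riesz h₂‖ ^ 2 * average σ₁ ^ 2) : ℝ)
          * inner ℂ w.fn (planeWave γ freq σ₁ (HDot1.riesz h₂) t).1.fn := by
      rw [L2.inner_def, ← integral_const_mul]
      refine integral_congr_ae (Eventually.of_forall fun x => ?_)
      simp only [RCLike.inner_apply]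
      ring
    simp only [hp, hg]
    rw [hi]
    simp only [inner_zero_right, planeWave_fst_fn, inner_smul_right]
    refine (((hasDerivAt_exp_phase freq t).mul_const _).congr_deriv ?_).hasDerivWithinAt
    rw [hfreq]
    push_cast
    ring
  field := by
    intro a ha b hb hbs t ht
    have h := TestPair.integral_momentum (d := d) (n := n) (⟨a, ha⟩, ⟨b, hb, hbs⟩) 0
    rw [inner_zero_right] at h
    refine hasDerivWithinAt_of_forall_eq (fun _ => rfl) (Eq.symm ?_)
    change 0 = -2 * c ^ 2 * ∫ x, a x * ∫ z, (0 : Momentum d n) x z * b z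
    rw [← h, mul_zero]
  momentum := by
    intro a ha b hb hbs t ht
    have h := TestPair.integral_field (d := d) (n := n) (⟨a, ha⟩, ⟨b, hb, hbs⟩)
      (equilibriumField γ σ₁ (HDot1.riesz h₂))
    rw [inner_field_equilibriumField] at h
    refine hasDerivWithinAt_of_forall_eq (fun _ => rfl) (Eq.symm ?_)
    change 0 = 1 / 2 * (∫ x, a x * ∫ z, inner ℝ
        ((equilibriumField γ σ₁ (HDot1.riesz h₂) x).grad z) (gradient b z))
      + γ / 2 * ∫ x, a x * (density σ₁ (H1.const d (Complex.exp (Complex.I * freq * t))) x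
        * ∫ z, σ₂ z * b z)
    rw [← h]
    simp only [density_const h₁ heven (norm_exp_phase freq t), integral_mul_const]
    ring

end PlaneWave

/-! ### Orbital stability -/

section Stability

open Torus

variable {d n : ℕ} [Fact (3 ≤ n)] {σ₁ : Torus d → ℝ} (h₁ : Torus.Smooth σ₁) {σ₂ : Space n → ℝ}
  (h₂ : IsTest σ₂)

theorem continuous_state_fn : Continuous fun Y : State d n => Y.1.fn :=
  (State.waveFnL₂ d n).continuous

theorem continuous_state_field : Continuous fun Y : State d n => Y.2.snd :=
  (State.fieldL d n).continuous

theorem continuous_state_momentum : Continuous fun Y : State d n => Y.2.fst :=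
  (WithLp.fstL 2 ℝ (Momentum d n) (Field d n)).continuous.comp continuous_snd

theorem continuous_state_grad : Continuous fun Y : State d n => Y.1.grad :=
  (H1.gradL : H1 d →L[ℂ] _).continuous.comp continuous_fst

theorem continuous_deviation (γ : ℝ) :
    Continuous (deviation (d := d) (n := n) h₂ (σ₁ := σ₁) γ) :=
  ((continuous_state_grad.norm.add
    ((continuous_state_fn.norm.pow 2).sub continuous_const).abs).add
    (continuous_state_field.sub continuous_const).norm).add continuous_state_momentum.norm

theorem continuous_densityL2 :
    Continuous (densityL2 (d := d) (n := n) h₁) :=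
  (contL2 d).continuous.comp
    (((rho h₁).continuous.comp continuous_state_fn).clm_apply continuous_state_fn)

theorem continuous_excess (γ : ℝ) : Continuous (excess (d := d) (n := n) h₁ h₂ γ) := by
  have h := (tensorL (d := d) (HDot1.riesz h₂)).continuous.comp
    (continuous_densityL2 (n := n) h₁)
  have h' : Continuous fun Y : State d n => tensor (densityL2 h₁ Y) (HDot1.riesz h₂) := h
  have h3 : Continuous fun Y : State d n => removeMean d (densityL2 h₁ Y) :=
    (removeMean d).continuous.comp (continuous_densityL2 h₁)
  refine Continuous.congr ?_ fun Y => (excess_eq h₁ h₂ γ Y).symm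
  exact ((((continuous_state_grad.norm.pow 2).add (continuous_state_momentum.norm.pow 2)).add
    ((continuous_state_field.add ((continuous_const_smul γ).comp h')).norm.pow 2)).sub
    ((h3.norm.pow 2).const_mul _)).div_const 2

/-- The plane wave at time zero. -/
def equilibrium (d : ℕ) (γ : ℝ) (σ₁ : Torus d → ℝ) (Γ : HDot1 n) : EnergySpace d n :=
  (H1.const d 1, equilibriumField γ σ₁ Γ, 0)

theorem toState_equilibrium_fst (γ c : ℝ) (Γ : HDot1 n) :
    (toState c (equilibrium d γ σ₁ Γ)).2.fst = 0 := smul_zero (2 * c)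

theorem deviation_equilibrium (γ c : ℝ) :
    deviation (σ₁ := σ₁) h₂ γ (toState c (equilibrium d γ σ₁ (HDot1.riesz h₂))) = 0 := by
  have h1 : (toState c (equilibrium d γ σ₁ (HDot1.riesz h₂))).1.grad = 0 := H1.grad_const 1
  have h2 : ‖(toState c (equilibrium d γ σ₁ (HDot1.riesz h₂))).1.fn‖ ^ 2 = vol d := by
    have := norm_const_sq (d := d) 1
    rw [norm_one, one_pow, one_mul] at this
    exact this
  have h3 : (toState c (equilibrium d γ σ₁ (HDot1.riesz h₂))).2.snd
      = equilibriumField γ σ₁ (HDot1.riesz h₂) := rfl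
  rw [deviation, h1, h2, h3, toState_equilibrium_fst]
  simp

theorem excess_equilibrium (heven : ∀ x, σ₁ (-x) = σ₁ x) (γ c : ℝ) :
    excess h₁ h₂ γ (toState c (equilibrium d γ σ₁ (HDot1.riesz h₂))) = 0 := by
  have h1 : (toState c (equilibrium d γ σ₁ (HDot1.riesz h₂))).1.grad = 0 := H1.grad_const 1
  have h2 : densityL2 h₁ (toState c (equilibrium d γ σ₁ (HDot1.riesz h₂)))
      = average σ₁ • Lp.const 2 volume (1 : ℝ) := by
    refine Lp.ext ?_
    filter_upwards [coeFn_contL2 (rho h₁ (Lp.const 2 volume (1 : ℂ)) (Lp.const 2 volume 1)),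
      Lp.coeFn_smul (average σ₁) (Lp.const 2 (volume : Measure (Torus d)) (1 : ℝ)),
      Lp.coeFn_const 2 (volume : Measure (Torus d)) (1 : ℝ)] with x e1 e2 e3
    rw [e2, Pi.smul_apply, e3]
    refine e1.trans ?_
    rw [rho_const_self h₁ heven]
    simp
  have h3 : (toState c (equilibrium d γ σ₁ (HDot1.riesz h₂))).2.snd
      = equilibriumField γ σ₁ (HDot1.riesz h₂) := rfl
  rw [excess_eq, h1, h2, h3, toState_equilibrium_fst, removeMean_smul_const, equilibriumField_eq,
    neg_add_cancel]
  simp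

/-- Near the plane wave both the deviation and the bound on it by conserved quantities are small. -/
theorem exists_delta (heven : ∀ x, σ₁ (-x) = σ₁ x) (γ c L : ℝ) {r : ℝ} (hr : 0 < r) :
    ∃ δ : ℝ, 0 < δ ∧ ∀ X₀ : EnergySpace d n,
      ‖X₀.1 - H1.const d 1‖ + ‖X₀.2.1 - equilibriumField γ σ₁ (HDot1.riesz h₂)‖ + ‖X₀.2.2‖ < δ →
      deviation (σ₁ := σ₁) h₂ γ (toState c X₀) < r ∧
      L * (√(excess h₁ h₂ γ (toState c X₀)) + |‖(toState c X₀).1.fn‖ ^ 2 - vol d|) < r := by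
  have hc1 : Continuous fun X₀ : EnergySpace d n => deviation (σ₁ := σ₁) h₂ γ (toState c X₀) :=
    (continuous_deviation h₂ γ).comp (continuous_toState c)
  have hc2 : Continuous fun X₀ : EnergySpace d n =>
      L * (√(excess h₁ h₂ γ (toState c X₀)) + |‖(toState c X₀).1.fn‖ ^ 2 - vol d|) :=
    continuous_const.mul (((continuous_excess h₁ h₂ γ).comp (continuous_toState c)).sqrt.add
      ((((continuous_state_fn.comp (continuous_toState c)).norm).pow 2).sub continuous_const).abs)
  have hm : ‖(toState c (equilibrium d γ σ₁ (HDot1.riesz h₂))).1.fn‖ ^ 2 - vol d = 0 := by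
    have := norm_const_sq (d := d) 1
    rw [norm_one, one_pow, one_mul] at this
    exact sub_eq_zero.2 this
  have e1 : ∀ᶠ X₀ in 𝓝 (equilibrium d γ σ₁ (HDot1.riesz h₂)),
      deviation (σ₁ := σ₁) h₂ γ (toState c X₀) < r :=
    hc1.continuousAt.eventually_lt continuousAt_const
      (by rw [deviation_equilibrium]; exact hr)
  have e2 : ∀ᶠ X₀ in 𝓝 (equilibrium d γ σ₁ (HDot1.riesz h₂)),
      L * (√(excess h₁ h₂ γ (toState c X₀)) + |‖(toState c X₀).1.fn‖ ^ 2 - vol d|) < r :=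
    hc2.continuousAt.eventually_lt continuousAt_const
      (by rw [excess_equilibrium h₁ h₂ heven, hm]; simpa using hr)
  obtain ⟨δ, hδ, h⟩ := Metric.eventually_nhds_iff.1 (e1.and e2)
  refine ⟨δ, hδ, fun X₀ hX₀ => h ?_⟩
  have n1 := norm_nonneg (X₀.1 - H1.const d 1)
  have n2 := norm_nonneg (X₀.2.1 - equilibriumField γ σ₁ (HDot1.riesz h₂))
  have n3 := norm_nonneg X₀.2.2
  have d1 : dist X₀.1 (H1.const d 1) < δ := by rw [dist_eq_norm]; linarith
  have d2 : dist X₀.2.1 (equilibriumField γ σ₁ (HDot1.riesz h₂)) < δ := by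
    rw [dist_eq_norm]; linarith
  have d3 : dist X₀.2.2 0 < δ := by rw [dist_zero_right]; linarith
  exact max_lt d1 (max_lt d2 d3)

/-- The bootstrap argument: the deviation of a truncated solution stays small, hence the truncation
is never active. -/
theorem IsTruncatedSolution.deviation_lt {γ c R η L r : ℝ} (hR : 0 < R)
    (heven : ∀ x, σ₁ (-x) = σ₁ x) {Y : ℝ → State d n} (h : IsTruncatedSolution h₁ h₂ γ c R Y)
    (hrη : r ≤ η) (hr1 : r ≤ 1)
    (hRle : vol d + 3 + ‖equilibriumField (d := d) γ σ₁ (HDot1.riesz h₂)‖ ≤ R)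
    (hL : ∀ Y : State d n, deviation h₂ (σ₁ := σ₁) γ Y ≤ η → deviation h₂ (σ₁ := σ₁) γ Y
        ≤ L * (√(excess h₁ h₂ γ Y) + |‖Y.1.fn‖ ^ 2 - vol d|))
    (h0 : deviation (σ₁ := σ₁) h₂ γ (Y 0) < r)
    (hG : L * (√(excess h₁ h₂ γ (Y 0)) + |‖(Y 0).1.fn‖ ^ 2 - vol d|) < r) {t : ℝ} (ht : 0 ≤ t) :
    deviation (σ₁ := σ₁) h₂ γ (Y t) < r := by
  refine lt_of_continuity (f := fun t => deviation (σ₁ := σ₁) h₂ γ (Y t))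
    ((continuous_deviation h₂ γ).comp h.continuous).continuousOn h0 (fun T hT hle => ?_) ht
  have hY : ∀ t ∈ Icc 0 T, ‖Y t‖ ≤ R := fun t ht =>
    (norm_le_of_deviation γ h₂ ((hle t ht).trans hr1)).trans hRle
  have hm := h.mass_eq hT hY
  have he := h.energy_eq hR heven hT hY
  have hex : excess h₁ h₂ γ (Y T) = excess h₁ h₂ γ (Y 0) := by rw [excess, excess, hm, he]
  have := hL (Y T) ((hle T ⟨hT, le_rfl⟩).trans hrη)
  rw [hex, hm] at this
  exact this.trans_lt hG

/-- Orbital stability, with `Γ` replaced by the Riesz representative of `σ₂` and `κ` by its squared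
norm. -/
theorem orbital_stability (h₁ : Torus.Smooth σ₁) (heven : ∀ x, σ₁ (-x) = σ₁ x)
    (hσ : ∀ x, 0 ≤ σ₁ x) {γ c : ℝ}
    (hγ : 0 ≤ γ) (hc : 0 < c)
    (hsmall : 4 * (γ ^ 2 * ‖HDot1.riesz h₂‖ ^ 2) * average σ₁ ^ 2 < 1) {ε : ℝ} (hε : 0 < ε) :
    ∃ δ : ℝ, 0 < δ ∧ ∀ X₀ : EnergySpace d n,
      ‖X₀.1 - H1.const d 1‖ + ‖X₀.2.1 - equilibriumField γ σ₁ (HDot1.riesz h₂)‖ + ‖X₀.2.2‖ < δ →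
      ∃ X : ℝ → EnergySpace d n, IsSolution γ c σ₁ σ₂ X X₀ ∧
        (∀ Y : ℝ → EnergySpace d n, IsSolution γ c σ₁ σ₂ Y X₀ → EqOn Y X (Ici 0)) ∧
        (⨆ t ∈ Ici (0 : ℝ), ENNReal.ofReal (orbitDist γ σ₁ (HDot1.riesz h₂) (X t)))
          < ENNReal.ofReal ε := by
  obtain ⟨η, L, hη, -, hL⟩ := exists_deviation_le (n := n) h₁ h₂ hγ hσ heven hsmall
  obtain ⟨M, hM, horbit⟩ := exists_orbitDist_le (d := d) (σ₁ := σ₁) γ hc h₂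
  -- `r` is such that `M * r < ε`
  set r : ℝ := min η (min 1 (ε / (2 * (M + 1)))) with hr_def
  have hr : 0 < r := lt_min hη (lt_min one_pos (by positivity))
  have hrη : r ≤ η := min_le_left _ _
  have hr1 : r ≤ 1 := (min_le_right _ _).trans (min_le_left _ _)
  have hMr : M * r ≤ ε / 2 := by
    have h1 : r ≤ ε / (2 * (M + 1)) := (min_le_right _ _).trans (min_le_right _ _)
    rw [le_div_iff₀ (by positivity)] at h1
    linarith
  obtain ⟨δ, hδ, hδX⟩ := exists_delta h₁ h₂ heven γ c L hr
  refine ⟨δ, hδ, fun X₀ hX₀ => ?_⟩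
  obtain ⟨h0, hG⟩ := hδX X₀ hX₀
  set R : ℝ := vol d + 3 + ‖equilibriumField (d := d) γ σ₁ (HDot1.riesz h₂)‖ with hR_def
  have hR : 0 < R := by
    have := vol_pos (d := d)
    positivity
  obtain ⟨Y, hY, hY0⟩ := exists_isTruncatedSolution h₁ h₂ γ c hR (toState c X₀)
  rw [← hY0] at h0 hG
  have hdev : ∀ t, 0 ≤ t → deviation (σ₁ := σ₁) h₂ γ (Y t) < r := fun t ht =>
    hY.deviation_lt h₁ h₂ hR heven hrη hr1 le_rfl hL h0 hG ht
  have hweak : IsWeakSolution h₁ h₂ γ c Y := hY.isWeakSolution hR fun t ht =>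
    norm_le_of_deviation γ h₂ ((hdev t ht).le.trans hr1)
  have hto : (fun t => toState c (ofState c (Y t))) = Y := funext fun t => toState_ofState hc _
  refine ⟨fun t => ofState c (Y t), (isSolution_iff h₁ h₂ hc).2 ⟨?_, ?_⟩, fun Z hZ t ht => ?_, ?_⟩
  · rw [hY0, ofState_toState hc]
  · rw [hto]
    exact hweak
  · obtain ⟨hZ0, hZw⟩ := (isSolution_iff h₁ h₂ hc).1 hZ
    have := hZw.eqOn hweak (by rw [hY0, hZ0]) ht
    simp only at this
    change Z t = ofState c (Y t)
    rw [← this, ofState_toState hc]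
  · refine (iSup₂_le fun t ht => ENNReal.ofReal_le_ofReal ?_).trans_lt
      ((ENNReal.ofReal_lt_ofReal_iff hε).2 (half_lt_self hε))
    exact ((horbit _ ((hdev t ht).le.trans hr1)).trans
      (mul_le_mul_of_nonneg_left (hdev t ht).le hM)).trans hMr

end Stability

end SchrodingerWave

open SchrodingerWave in
theorem mainTheorem5 (d n : ℕ) [Fact (3 ≤ n)] (hd : 1 ≤ d)
    (γ c freq : ℝ) (hγ : 0 < γ) (hc : 0 < c)
    (σ₁ : Torus d → ℝ) (hσ₁_nonneg : ∀ x, 0 ≤ σ₁ x) (hσ₁_smooth : Torus.Smooth σ₁)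
    (hσ₁_even : ∀ x, σ₁ (-x) = σ₁ x) (hσ₁_avg : average σ₁ ≠ 0)
    (σ₂ : Space n → ℝ) (hσ₂_nonneg : ∀ z, 0 ≤ σ₂ z) (hσ₂_smooth : ContDiff ℝ ∞ σ₂)
    (hσ₂_supp : HasCompactSupport σ₂) (hσ₂_radial : ∀ z z', ‖z‖ = ‖z'‖ → σ₂ z = σ₂ z')
    (hσ₂_fourier : ∀ ξ : Space n,
      ∫ z, Complex.exp (-Complex.I * (inner ℝ ξ z : ℝ)) * (σ₂ z : ℂ) ≠ 0)
    (Γ : HDot1 n) (hΓ : IsInverseLaplacian σ₂ Γ)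
    (hdispersion : freq - γ ^ 2 * kappa σ₂ Γ * average σ₁ ^ 2 = 0)
    (hsmall : 4 * γ ^ 2 * kappa σ₂ Γ * (∫ x, ‖σ₁ x‖) ^ 2 < 1) :
    IsSolution γ c σ₁ σ₂ (planeWave γ freq σ₁ Γ) (H1.const d 1, equilibriumField γ σ₁ Γ, 0) ∧
    ∀ ε : ℝ, 0 < ε → ∃ δ : ℝ, 0 < δ ∧ ∀ X₀ : EnergySpace d n,
      ‖X₀.1 - H1.const d 1‖ + ‖X₀.2.1 - equilibriumField γ σ₁ Γ‖ + ‖X₀.2.2‖ < δ →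
      ∃ X : ℝ → EnergySpace d n, IsSolution γ c σ₁ σ₂ X X₀ ∧
        (∀ Y : ℝ → EnergySpace d n, IsSolution γ c σ₁ σ₂ Y X₀ → Set.EqOn Y X (Set.Ici 0)) ∧
        (⨆ t ∈ Set.Ici (0 : ℝ), ENNReal.ofReal (orbitDist γ σ₁ Γ (X t))) < ENNReal.ofReal ε := by
  have h₂ : IsTest σ₂ := ⟨hσ₂_smooth, hσ₂_supp⟩
  rw [HDot1.kappa_eq h₂ hΓ] at hdispersion hsmall
  obtain rfl := HDot1.eq_riesz_of_isInverseLaplacian h₂ hΓ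
  have hA : ∫ x, ‖σ₁ x‖ = average σ₁ :=
    integral_congr_ae (Filter.Eventually.of_forall fun x => Real.norm_of_nonneg (hσ₁_nonneg x))
  rw [hA, mul_assoc 4] at hsmall
  exact ⟨isSolution_planeWave h₂ hσ₁_smooth hσ₁_even γ c (sub_eq_zero.1 hdispersion),
    fun ε hε => orbital_stability h₂ hσ₁_smooth hσ₁_even hσ₁_nonneg hγ.le hc hsmall hε⟩

end
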